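/- Let $M$ be a compact connected manifold (without boundary) of dimension $2n+1$ with a Sasakian structure $(\eta,\xi,\Phi,g)$: $\eta$ is a contact form, $\xi$ its Reeb field, which is Killing for the Riemannian metric $g$, and $\eta(\xi)=1$, $\iota_\xi d\eta=0$, $\Phi^2=-\mathrm{id}+\xi\otimes\eta$, $g(\Phi\cdot,\Phi\cdot)=g-\eta\otimes\eta$, $d\eta=g(\Phi\cdot,\cdot)$, $N_\Phi+\xi\otimes d\eta=0$ (with $d\eta(X,Y)=X\eta(Y)-Y\eta(X)-\eta([X,Y])$). For a smooth basic function $\phi$ (that is, $\xi\phi=0$) put $d^c\phi=\frac i2(\bar\partial-\partial)\phi=-\frac12\,d\phi\circ\Phi$ and $$\eta_\phi=\eta+d^c\phi,\qquad \Phi_\phi=\Phi-(\xi\otimes d^c\phi)\circ\Phi,\qquad g_\phi=d\eta_\phi\circ(\mathrm{id}\otimes\Phi_\phi)+\eta_\phi\otimes\eta_\phi,\qquad d\mu_\phi=\tfrac1{n!}\,\eta_\phi\wedge(d\eta_\phi)^n .$$ Let $\mathcal H_S$ be the set of smooth basic functions $\phi$ such that $\eta_\phi\wedge(d\eta_\phi)^n$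 vanishes nowhere and $I(\phi)=0$, where $I(\phi)=\int_0^1\int_M\phi\,d\mu_{t\phi}\,dt$ is the functional with $I(0)=0$ whose derivative at $\phi$ is $\psi\mapsto\int_M\psi\,d\mu_\phi$. At $\phi\in\mathcal H_S$ consider the Calabi metric $g_C(\psi,\psi)=\int_M(\Delta_\phi\psi)^2\,d\mu_\phi$, where $\Delta_\phi\psi=(dd^c\psi,d\eta_\phi)_{g_\phi}$ is the basic ($\bar\partial$-)Laplacian and $(\cdot,\cdot)_{g_\phi}$ the inner product of $2$-forms, the gradient metric $g_G(\psi,\psi)=\int_M g_\phi(d\psi,d\psi)\,d\mu_\phi$, and the pullback $\Gamma^*g_E$, under $\Gamma(\phi)=g_\phi$, of the Ebin metric $g_E(a,a)_h=\int_M|a|_h^2\,dv_h$ on the space of Riemannian metrics $h$ on $M$ ($a$ a symmetric $2$-tensor with its tensor norm). Let $d_C$, $d_G$ and $d$ be the corresponding length distances: the infima of the lengths of the smooth curves in $\mathcal H_S$ that join two given points. Then $(\mathcal H_S,d)$ is a metric space (in particular $d$ is finite, and $d(p,q)=0$ only for $p=q$), $d_C\le d$, and more precisely $$d_C\;\le\;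 d_C+\tfrac12\,d_G\;\le\; d .$$ -/

import Mathlib

open scoped Manifold ContDiff ENNReal Topology

noncomputable section

namespace Sasaki

/-- The model space of a manifold of dimension `2n + 1`. -/
abbrev Model (n : ℕ) : Type := EuclideanSpace ℝ (Fin (2 * n + 1))

section Tensors

variable {n : ℕ} {M : Type*} [TopologicalSpace M] [ChartedSpace (Model n) M]

/-- The tangent space of `M` at `x`. -/
abbrev Tan (n : ℕ) {M : Type*} [TopologicalSpace M] [ChartedSpace (Model n) M] (x : M) : Type :=
  TangentSpace (𝓡 (2 * n + 1)) x

/-- The `i`-th vector of a basis of the tangent space at `x` (the coordinate basis of the preferred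
chart at `x`). -/
def tanBasis (n : ℕ) {M : Type*} [TopologicalSpace M] [ChartedSpace (Model n) M] (x : M)
    (i : Fin (2 * n + 1)) : Tan n x :=
  (EuclideanSpace.single i (1 : ℝ) : Model n)

/-- The exterior derivative of a `1`-form `α` at `x`, computed in the preferred chart at `x`, with
the convention `dα(X, Y) = X(α(Y)) - Y(α(X)) - α([X, Y])`. -/
def extD (α : ∀ x : M, Tan n x →L[ℝ] ℝ) (x : M) (v w : Tan n x) : ℝ :=
  let c := extChartAt (𝓡 (2 * n + 1)) x
  let a : Model n → (Model n →L[ℝ] ℝ) := fun y =>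
    (α (c.symm y)).comp (mfderiv 𝓘(ℝ, Model n) (𝓡 (2 * n + 1)) c.symm y)
  let v' : Model n := mfderiv (𝓡 (2 * n + 1)) 𝓘(ℝ, Model n) c x v
  let w' : Model n := mfderiv (𝓡 (2 * n + 1)) 𝓘(ℝ, Model n) c x w
  fderiv ℝ a (c x) v' w' - fderiv ℝ a (c x) w' v'

/-- The differential of a function, as a `1`-form. -/
def diff (n : ℕ) {M : Type*} [TopologicalSpace M] [ChartedSpace (Model n) M]
    (f : M → ℝ) (x : M) : Tan n x →L[ℝ] ℝ :=
  mfderiv (𝓡 (2 * n + 1)) 𝓘(ℝ, ℝ) f x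

/-- The value of the `(2n+1)`-form `α ∧ τ ∧ ... ∧ τ` (`n` factors `τ`) on `2n + 1` vectors,
where `α` is a `1`-form and `τ` a `2`-form. -/
def wedgeTop {x : M} (α : Tan n x → ℝ) (τ : Tan n x → Tan n x → ℝ)
    (v : Fin (2 * n + 1) → Tan n x) : ℝ :=
  (1 / 2 ^ n : ℝ) * ∑ σ : Equiv.Perm (Fin (2 * n + 1)),
    ((Equiv.Perm.sign σ : ℤ) : ℝ) * α (v (σ ⟨0, by omega⟩)) *
      ∏ k : Fin n, τ (v (σ ⟨2 * (k : ℕ) + 1, by omega⟩)) (v (σ ⟨2 * (k : ℕ) + 2, by omega⟩))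

/-- The components of a covariant `2`-tensor at `x`. -/
def gram (g : ∀ x : M, Tan n x → Tan n x → ℝ) (x : M) :
    Matrix (Fin (2 * n + 1)) (Fin (2 * n + 1)) ℝ :=
  Matrix.of fun i j => g x (tanBasis n x i) (tanBasis n x j)

/-- The inner product `g^{ij} α_i β_j` induced by a Riemannian metric `g` on `1`-forms. -/
def inner1 (g : ∀ x : M, Tan n x → Tan n x → ℝ) (α β : ∀ x : M, Tan n x →L[ℝ] ℝ) (x : M) : ℝ :=
  ∑ i, ∑ j, (gram g x)⁻¹ i j * α x (tanBasis n x i) * β x (tanBasis n x j)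

/-- The inner product `g^{ik} g^{jl} a_{ij} b_{kl}` induced by a Riemannian metric `g` on covariant
`2`-tensors. -/
def inner2 (g a b : ∀ x : M, Tan n x → Tan n x → ℝ) (x : M) : ℝ :=
  ∑ i, ∑ j, ∑ k, ∑ l, (gram g x)⁻¹ i k * (gram g x)⁻¹ j l *
    a x (tanBasis n x i) (tanBasis n x j) * b x (tanBasis n x k) (tanBasis n x l)

end Tensors

section Integration

variable {n : ℕ} {M : Type*} [TopologicalSpace M] [ChartedSpace (Model n) M]

/-- The measure `|δ(∂₀, ..., ∂₂ₙ)| dy` carried by the preferred chart at `c`, moved to `M`. Here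
`δ` is a top-degree form, or a density, on `M`. -/
def chartMeasure [MeasurableSpace M] (δ : ∀ x : M, (Fin (2 * n + 1) → Tan n x) → ℝ) (c : M) :
    MeasureTheory.Measure M :=
  let e := extChartAt (𝓡 (2 * n + 1)) c
  (((MeasureTheory.volume : MeasureTheory.Measure (Model n)).restrict e.target).withDensity
    (fun y => ENNReal.ofReal |δ (e.symm y) (fun i =>
      mfderiv 𝓘(ℝ, Model n) (𝓡 (2 * n + 1)) e.symm y (EuclideanSpace.single i (1 : ℝ)))|)).map e.symm

variable (n M) in
/-- A smooth partition of unity subordinate to the domains of the preferred charts. -/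
def chartPartition [IsManifold (𝓡 (2 * n + 1)) ∞ M] [T2Space M] [SigmaCompactSpace M] :
    SmoothPartitionOfUnity M (𝓡 (2 * n + 1)) M Set.univ :=
  Classical.choose
    (SmoothPartitionOfUnity.exists_isSubordinate_chartAt_source (I := 𝓡 (2 * n + 1)) M)

/-- The measure `|δ|` on `M` defined by a top-degree form or a density `δ`: the chart measures are
glued by a partition of unity. -/
def densityMeasure [IsManifold (𝓡 (2 * n + 1)) ∞ M] [T2Space M] [SigmaCompactSpace M]
    [MeasurableSpace M] (δ : ∀ x : M, (Fin (2 * n + 1) → Tan n x) → ℝ) :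
    MeasureTheory.Measure M :=
  MeasureTheory.Measure.sum fun c : M =>
    (chartMeasure δ c).withDensity fun x => ENNReal.ofReal (chartPartition n M c x)

/-- The Riemannian volume measure `dv_g` of a Riemannian metric `g`. -/
def riemannianVolume [IsManifold (𝓡 (2 * n + 1)) ∞ M] [T2Space M] [SigmaCompactSpace M]
    [MeasurableSpace M] (g : ∀ x : M, Tan n x → Tan n x → ℝ) : MeasureTheory.Measure M :=
  densityMeasure fun x v => √(Matrix.det (Matrix.of fun i j => g x (v i) (v j)))

/-- The Ebin metric at the Riemannian metric `g`: the `L²` inner product of two covariant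
`2`-tensor fields. -/
def ebinMetric [IsManifold (𝓡 (2 * n + 1)) ∞ M] [T2Space M] [SigmaCompactSpace M]
    [MeasurableSpace M] (g a b : ∀ x : M, Tan n x → Tan n x → ℝ) : ℝ :=
  ∫ x, inner2 g a b x ∂(riemannianVolume g)

end Integration

/-- A Sasakian structure `(η, ξ, Φ, g)` on a manifold `M` of dimension `2n + 1`. -/
structure SasakianStructure (n : ℕ) (M : Type*) [TopologicalSpace M] [ChartedSpace (Model n) M]
    [IsManifold (𝓡 (2 * n + 1)) ∞ M] where
  /-- the contact form `η` -/
  eta : ∀ x : M, Tan n x →L[ℝ] ℝ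
  eta_smooth : ContMDiff (𝓡 (2 * n + 1))
    ((𝓡 (2 * n + 1)).prod 𝓘(ℝ, Model n →L[ℝ] ℝ)) ∞
    (fun x : M => Bundle.TotalSpace.mk' (Model n →L[ℝ] ℝ)
      (E := fun x : M => Tan n x →L[ℝ] Bundle.Trivial M ℝ x) x (eta x))
  /-- the Reeb field `ξ` -/
  xi : ∀ x : M, Tan n x
  xi_smooth : ContMDiff (𝓡 (2 * n + 1)) (𝓡 (2 * n + 1)).tangent ∞
    (fun x : M => (⟨x, xi x⟩ : TangentBundle (𝓡 (2 * n + 1)) M))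
  /-- the `(1,1)`-tensor field `Φ` -/
  Phi : ∀ x : M, Tan n x →L[ℝ] Tan n x
  Phi_smooth : ContMDiff (𝓡 (2 * n + 1))
    ((𝓡 (2 * n + 1)).prod 𝓘(ℝ, Model n →L[ℝ] Model n)) ∞
    (fun x : M => Bundle.TotalSpace.mk' (Model n →L[ℝ] Model n)
      (E := fun x : M => Tan n x →L[ℝ] Tan n x) x (Phi x))
  /-- the Riemannian metric `g` -/
  g : Bundle.ContMDiffRiemannianMetric (𝓡 (2 * n + 1)) ∞ (Model n) (fun x : M => Tan n x)
  /-- `η ∧ (dη)ⁿ` vanishes nowhere -/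
  contact : ∀ x : M, ∃ v, wedgeTop (eta x) (extD eta x) v ≠ 0
  eta_xi : ∀ x, eta x (xi x) = 1
  xi_extD : ∀ x v, extD eta x (xi x) v = 0
  Phi_sq : ∀ x v, Phi x (Phi x v) = -v + eta x v • xi x
  g_Phi : ∀ x v w, g.inner x (Phi x v) (Phi x w) = g.inner x v w - eta x v * eta x w
  extD_eta : ∀ x v w, extD eta x v w = g.inner x (Phi x v) w
  /-- `ξ` is a Killing field: `ξ(g(X, Y)) = g([ξ, X], Y) + g(X, [ξ, Y])` -/
  killing : ∀ X Y : (∀ x : M, Tan n x),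
    ContMDiff (𝓡 (2 * n + 1)) (𝓡 (2 * n + 1)).tangent ∞
      (fun x : M => (⟨x, X x⟩ : TangentBundle (𝓡 (2 * n + 1)) M)) →
    ContMDiff (𝓡 (2 * n + 1)) (𝓡 (2 * n + 1)).tangent ∞
      (fun x : M => (⟨x, Y x⟩ : TangentBundle (𝓡 (2 * n + 1)) M)) →
    ∀ x, diff n (fun z => g.inner z (X z) (Y z)) x (xi x) =
      g.inner x (VectorField.mlieBracket (𝓡 (2 * n + 1)) xi X x) (Y x) +
      g.inner x (X x) (VectorField.mlieBracket (𝓡 (2 * n + 1)) xi Y x)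
  /-- normality: `N_Φ + dη ⊗ ξ = 0`, with `N_Φ` the Nijenhuis torsion of `Φ` -/
  normal : ∀ X Y : (∀ x : M, Tan n x),
    ContMDiff (𝓡 (2 * n + 1)) (𝓡 (2 * n + 1)).tangent ∞
      (fun x : M => (⟨x, X x⟩ : TangentBundle (𝓡 (2 * n + 1)) M)) →
    ContMDiff (𝓡 (2 * n + 1)) (𝓡 (2 * n + 1)).tangent ∞
      (fun x : M => (⟨x, Y x⟩ : TangentBundle (𝓡 (2 * n + 1)) M)) →
    ∀ x, Phi x (Phi x (VectorField.mlieBracket (𝓡 (2 * n + 1)) X Y x)) +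
      VectorField.mlieBracket (𝓡 (2 * n + 1)) (fun z => Phi z (X z)) (fun z => Phi z (Y z)) x -
      Phi x (VectorField.mlieBracket (𝓡 (2 * n + 1)) (fun z => Phi z (X z)) Y x) -
      Phi x (VectorField.mlieBracket (𝓡 (2 * n + 1)) X (fun z => Phi z (Y z)) x) +
      extD eta x (X x) (Y x) • xi x = 0

namespace SasakianStructure

variable {n : ℕ} {M : Type*} [TopologicalSpace M] [ChartedSpace (Model n) M]
  [IsManifold (𝓡 (2 * n + 1)) ∞ M] (S : SasakianStructure n M)

/-- Smooth basic functions: smooth functions that are constant along the Reeb field. -/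
def IsBasic (f : M → ℝ) : Prop :=
  ContMDiff (𝓡 (2 * n + 1)) 𝓘(ℝ, ℝ) ∞ f ∧ ∀ x, diff n f x (S.xi x) = 0

/-- The transverse operator `d^c = (i/2)(∂̄ - ∂)` on basic functions; for the transverse complex
structure `J` induced by `Φ` this is `d^c f = -(1/2) df ∘ J`. -/
def dc (f : M → ℝ) (x : M) : Tan n x →L[ℝ] ℝ :=
  (-(1 / 2 : ℝ)) • (diff n f x).comp (S.Phi x)

/-- The `2`-form `dd^c f = i∂∂̄f` of a basic function. -/
def ddc (f : M → ℝ) (x : M) (v w : Tan n x) : ℝ := extD (S.dc f) x v w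

/-- The deformed contact form `η_φ = η + d^c φ`. -/
def etaDef (φ : M → ℝ) (x : M) : Tan n x →L[ℝ] ℝ := S.eta x + S.dc φ x

/-- The transverse Kähler form `dη_φ`. -/
def dEtaDef (φ : M → ℝ) (x : M) (v w : Tan n x) : ℝ := extD (S.etaDef φ) x v w

/-- The deformed `(1,1)`-tensor `Φ_φ = Φ - (ξ ⊗ d^c φ) ∘ Φ`. -/
def PhiDef (φ : M → ℝ) (x : M) (v : Tan n x) : Tan n x :=
  S.Phi x v - S.dc φ x (S.Phi x v) • S.xi x

/-- The deformed metric `g_φ = dη_φ ∘ (id ⊗ Φ_φ) + η_φ ⊗ η_φ`. -/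
def gDef (φ : M → ℝ) (x : M) (v w : Tan n x) : ℝ :=
  S.dEtaDef φ x v (S.PhiDef φ x w) + S.etaDef φ x v * S.etaDef φ x w

/-- The basic functions `φ` such that `η_φ ∧ (dη_φ)ⁿ` vanishes nowhere. -/
def IsPotential (φ : M → ℝ) : Prop :=
  S.IsBasic φ ∧ ∀ x, ∃ v, wedgeTop (S.etaDef φ x) (S.dEtaDef φ x) v ≠ 0

/-- The basic Laplacian `Δ_φ f = (i∂∂̄f, dη_φ)_φ`. The inner product of `2`-forms is half of the
one of `2`-tensors. -/
def laplacian (φ f : M → ℝ) (x : M) : ℝ :=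
  (1 / 2 : ℝ) * inner2 (S.gDef φ) (S.ddc f) (S.dEtaDef φ) x

variable [T2Space M] [SigmaCompactSpace M] [MeasurableSpace M]

/-- The measure of the volume form `(1/n!) η_φ ∧ (dη_φ)ⁿ`. -/
def vol (φ : M → ℝ) : MeasureTheory.Measure M :=
  densityMeasure fun x v =>
    (1 / (n.factorial : ℝ)) * wedgeTop (S.etaDef φ x) (S.dEtaDef φ x) v

/-- The functional `I`, with `I(0) = 0` and derivative `ψ ↦ ∫ ψ dμ_φ` at `φ`; it is the integral of
this closed `1`-form along the segment from `0` to `φ`. -/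
def functionalI (φ : M → ℝ) : ℝ :=
  ∫ t in (0 : ℝ)..1, ∫ x, φ x ∂(S.vol (fun z => t * φ z))

/-- The space of normalized potentials. -/
def Potential : Type _ := {φ : M → ℝ // S.IsPotential φ ∧ S.functionalI φ = 0}

/-- The Calabi metric at `φ`. -/
def calabiMetric (φ ψ₁ ψ₂ : M → ℝ) : ℝ :=
  ∫ x, S.laplacian φ ψ₁ x * S.laplacian φ ψ₂ x ∂(S.vol φ)

/-- The gradient (Dirichlet) metric at `φ`. -/
def gradientMetric (φ ψ₁ ψ₂ : M → ℝ) : ℝ :=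
  ∫ x, inner1 (S.gDef φ) (diff n ψ₁) (diff n ψ₂) x ∂(S.vol φ)

/-- A smooth curve of normalized potentials from `p` to `q`, parametrized by `[0, 1]`. -/
structure Curve (p q : S.Potential) where
  toFun : ℝ → M → ℝ
  smooth : ContMDiff (𝓘(ℝ, ℝ).prod (𝓡 (2 * n + 1))) 𝓘(ℝ, ℝ) ∞ (fun z : ℝ × M => toFun z.1 z.2)
  mem : ∀ t ∈ Set.Icc (0 : ℝ) 1, S.IsPotential (toFun t) ∧ S.functionalI (toFun t) = 0
  start : toFun 0 = p.1
  finish : toFun 1 = q.1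

variable {S}

/-- The velocity of a curve of potentials. -/
def Curve.velocity {p q : S.Potential} (γ : S.Curve p q) (t : ℝ) (x : M) : ℝ :=
  deriv (fun s => γ.toFun s x) t

/-- The velocity of the curve of Riemannian metrics `t ↦ g_{γ(t)}`, that is, the image of the
velocity of `γ` under the differential of `φ ↦ g_φ`. -/
def Curve.metricVelocity {p q : S.Potential} (γ : S.Curve p q) (t : ℝ) (x : M)
    (v w : Tan n x) : ℝ :=
  deriv (fun s => S.gDef (γ.toFun s) x v w) t

/-- The length of a curve for the pullback of the Ebin metric under `φ ↦ g_φ`. -/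
def Curve.ebinLength {p q : S.Potential} (γ : S.Curve p q) : ℝ≥0∞ :=
  ∫⁻ t in Set.Icc (0 : ℝ) 1, ENNReal.ofReal
    √(ebinMetric (S.gDef (γ.toFun t)) (γ.metricVelocity t) (γ.metricVelocity t))

/-- The length of a curve for the Calabi metric. -/
def Curve.calabiLength {p q : S.Potential} (γ : S.Curve p q) : ℝ≥0∞ :=
  ∫⁻ t in Set.Icc (0 : ℝ) 1, ENNReal.ofReal
    √(S.calabiMetric (γ.toFun t) (γ.velocity t) (γ.velocity t))

/-- The length of a curve for the gradient metric. -/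
def Curve.gradientLength {p q : S.Potential} (γ : S.Curve p q) : ℝ≥0∞ :=
  ∫⁻ t in Set.Icc (0 : ℝ) 1, ENNReal.ofReal
    √(S.gradientMetric (γ.toFun t) (γ.velocity t) (γ.velocity t))

/-- The distance `d` of the restricted Ebin metric. -/
def ebinDist (p q : S.Potential) : ℝ≥0∞ := ⨅ γ : S.Curve p q, γ.ebinLength

/-- The Calabi distance `d_C`. -/
def calabiDist (p q : S.Potential) : ℝ≥0∞ := ⨅ γ : S.Curve p q, γ.calabiLength

/-- The distance `d_G` of the gradient metric. -/
def gradientDist (p q : S.Potential) : ℝ≥0∞ := ⨅ γ : S.Curve p q, γ.gradientLength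

end SasakianStructure

end Sasaki

end

/-! Everything rests on one pointwise computation and one application of Stokes' theorem. Fix a
potential `φ` and a basic direction `ψ`. At each point there is a basis `ξ, e₁, Je₁, e₂, Je₂, ...`,
orthonormal for `g_φ`, in which `dd^c ψ` is diagonal relative to `dη_φ`, with eigenvalues `c₁, ...,
cₙ` (`exists_adapted_basis`). In this basis `Δ_φ ψ = ∑ c_k`, the velocity of `g_φ` has squared norm
`2 ∑ c_k² + |dψ|²/2` (`IsAdapted.contract_velocity`), and the volume density along `φ + sψ` is
multiplied by `∏ (1 + s c_k)` (`IsBasic.rho_add_smul`).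

The second derivative of that product at `s = 0` is `(∑ c_k)² - ∑ c_k²`. By Stokes the total volume
is the same for all basic functions (`integral_linForm`), so the integral of this second derivative
vanishes and `∫ ∑ c_k² = ∫ (Δ_φ ψ)²`. Hence the pulled-back Ebin metric is `2 g_C + g_G / 2`, up to
the constant `(volRatio n)⁻¹ ≥ 1` comparing the two volume measures (`ebin_eq`). From `(a + b)² ≤
2a² + 2b²` with `a = √g_C`, `b = √g_G / 2` one gets `√g_C + √g_G / 2 ≤ √g_E`; integrating along
curves and taking infima gives `d_C + d_G / 2 ≤ d` (`calabiDist_add_le`).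

The diagonalization needs `g_φ` to be positive definite, while a potential is only assumed to have a
nowhere vanishing volume form. At a minimum of `φ` the form `dd^c φ` is nonnegative, so the
transverse form is positive there. Positivity is open, and it is closed because a semidefinite form
with nonzero determinant is definite; connectedness spreads it to all of `M` (`IsPotential.posAt`).
That `dd^c` of a basic function is `Φ`-invariant comes from normality (`IsBasic.extDE_Phi_Phi`).

For the metric space axioms, symmetry and the triangle inequality follow from reversing and smoothly
concatenating curves. Finiteness uses the straight segment shifted by constants so that `I = 0`; the
shift is smooth because `I` is polynomial along a segment. If `d(p, q) = 0` then `d_C(p, q) = 0`,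
and Cauchy-Schwarz shows that the volume densities of `p` and `q` agree
(`rho_eq_of_calabiDist_eq_zero`). Rolle's theorem along the segment and Green's formula then give
`d(q - p) = 0`, and `I = 0` removes the remaining constant (`eq_of_calabiDist_eq_zero`). -/

noncomputable section

set_option linter.unusedSectionVars false

section

namespace Sasaki

/-! ### Linear algebra of `α ∧ τⁿ` on an adapted basis. -/

section Wedge

/-- The index of the first vector of the `k`-th pair. -/
def fstIdx {n : ℕ} (k : Fin n) : Fin (2 * n + 1) := ⟨2 * (k : ℕ) + 1, by omega⟩

/-- The index of the second vector of the `k`-th pair. -/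
def sndIdx {n : ℕ} (k : Fin n) : Fin (2 * n + 1) := ⟨2 * (k : ℕ) + 2, by omega⟩

/-- The index of the Reeb direction. -/
def reebIdx (n : ℕ) : Fin (2 * n + 1) := ⟨0, by omega⟩

variable {n : ℕ}

lemma idx_cases (i : Fin (2 * n + 1)) :
    i = reebIdx n ∨ (∃ k, i = fstIdx k) ∨ ∃ k, i = sndIdx k := by
  obtain ⟨i, hi⟩ := i
  rcases Nat.eq_zero_or_pos i with h | h
  · left; simp [reebIdx, h]
  · right
    rcases Nat.even_or_odd' i with ⟨m, hm | hm⟩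
    · right; exact ⟨⟨m - 1, by omega⟩, by ext; simp only [sndIdx]; omega⟩
    · left; exact ⟨⟨m, by omega⟩, by ext; simp only [fstIdx]; omega⟩

@[simp] lemma fstIdx_ne_reebIdx (k : Fin n) : fstIdx k ≠ reebIdx n := by
  simp [fstIdx, reebIdx, Fin.ext_iff]
@[simp] lemma sndIdx_ne_reebIdx (k : Fin n) : sndIdx k ≠ reebIdx n := by
  simp [sndIdx, reebIdx, Fin.ext_iff]
@[simp] lemma reebIdx_ne_fstIdx (k : Fin n) : reebIdx n ≠ fstIdx k := (fstIdx_ne_reebIdx k).symm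
@[simp] lemma reebIdx_ne_sndIdx (k : Fin n) : reebIdx n ≠ sndIdx k := (sndIdx_ne_reebIdx k).symm
@[simp] lemma fstIdx_ne_sndIdx (k l : Fin n) : fstIdx k ≠ sndIdx l := by
  simp only [fstIdx, sndIdx, ne_eq, Fin.ext_iff]; omega
@[simp] lemma sndIdx_ne_fstIdx (k l : Fin n) : sndIdx k ≠ fstIdx l :=
  (fstIdx_ne_sndIdx l k).symm
@[simp] lemma fstIdx_inj {k l : Fin n} : fstIdx k = fstIdx l ↔ k = l := by
  simp [fstIdx, Fin.ext_iff]
@[simp] lemma sndIdx_inj {k l : Fin n} : sndIdx k = sndIdx l ↔ k = l := by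
  simp [sndIdx, Fin.ext_iff]

lemma sum_idx {A : Type*} [AddCommMonoid A] (f : Fin (2 * n + 1) → A) :
    ∑ i, f i = f (reebIdx n) + ∑ k, (f (fstIdx k) + f (sndIdx k)) := by
  rw [Finset.sum_add_distrib]
  have hu : (Finset.univ : Finset (Fin (2 * n + 1))) =
      insert (reebIdx n) ((Finset.univ.image fstIdx) ∪ (Finset.univ.image sndIdx)) := by
    ext i
    rcases idx_cases i with h | ⟨k, h⟩ | ⟨k, h⟩ <;> simp [h]
  rw [hu, Finset.sum_insert, Finset.sum_union, Finset.sum_image, Finset.sum_image]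
  · intro a _ b _ h; exact sndIdx_inj.1 h
  · intro a _ b _ h; exact fstIdx_inj.1 h
  · rw [Finset.disjoint_left]; simp
  · simp

variable {V : Type*}

/-- The value of `α ∧ τ ∧ ... ∧ τ` on vectors of an arbitrary space. -/
def wedge (α : V → ℝ) (τ : V → V → ℝ) (v : Fin (2 * n + 1) → V) : ℝ :=
  (1 / 2 ^ n : ℝ) * ∑ σ : Equiv.Perm (Fin (2 * n + 1)),
    ((Equiv.Perm.sign σ : ℤ) : ℝ) * α (v (σ (reebIdx n))) *
      ∏ k : Fin n, τ (v (σ (fstIdx k))) (v (σ (sndIdx k)))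

variable [AddCommGroup V] [Module ℝ V]

/-- The multilinear map whose alternatization is `α ∧ τ ∧ ... ∧ τ` up to a constant. -/
def wedgeMulti (n : ℕ) (α : V →ₗ[ℝ] ℝ) (τ : V →ₗ[ℝ] V →ₗ[ℝ] ℝ) :
    MultilinearMap ℝ (fun _ : Fin (2 * n + 1) => V) ℝ where
  toFun v := α (v (reebIdx n)) * ∏ k : Fin n, τ (v (fstIdx k)) (v (sndIdx k))
  map_update_add' := by
    intro inst v i x y
    -- The field quantifies over all decidability instances; fixing the standard one lets the
    -- `Function.update` simp lemmas fire.
    obtain rfl : inst = instDecidableEqFin _ := Subsingleton.elim _ _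
    rcases idx_cases i with rfl | ⟨k, rfl⟩ | ⟨k, rfl⟩
    · simp [add_mul]
    · rw [Fintype.prod_eq_mul_prod_compl k, Fintype.prod_eq_mul_prod_compl k,
        Fintype.prod_eq_mul_prod_compl k]
      have h : ∀ z : V, ∏ l ∈ {k}ᶜ, τ (Function.update v (fstIdx k) z (fstIdx l))
          (Function.update v (fstIdx k) z (sndIdx l)) =
          ∏ l ∈ {k}ᶜ, τ (v (fstIdx l)) (v (sndIdx l)) := fun z =>
        Finset.prod_congr rfl fun l hl => by
          have : l ≠ k := by simpa using hl
          simp [this]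
      rw [h, h, h]
      simp
      ring
    · rw [Fintype.prod_eq_mul_prod_compl k, Fintype.prod_eq_mul_prod_compl k,
        Fintype.prod_eq_mul_prod_compl k]
      have h : ∀ z : V, ∏ l ∈ {k}ᶜ, τ (Function.update v (sndIdx k) z (fstIdx l))
          (Function.update v (sndIdx k) z (sndIdx l)) =
          ∏ l ∈ {k}ᶜ, τ (v (fstIdx l)) (v (sndIdx l)) := fun z =>
        Finset.prod_congr rfl fun l hl => by
          have : l ≠ k := by simpa using hl
          simp [this]
      rw [h, h, h]
      simp
      ring
  map_update_smul' := by
    intro inst v i c x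
    obtain rfl : inst = instDecidableEqFin _ := Subsingleton.elim _ _
    rcases idx_cases i with rfl | ⟨k, rfl⟩ | ⟨k, rfl⟩
    · simp [mul_assoc]
    · rw [Fintype.prod_eq_mul_prod_compl k, Fintype.prod_eq_mul_prod_compl k]
      have h : ∀ z : V, ∏ l ∈ {k}ᶜ, τ (Function.update v (fstIdx k) z (fstIdx l))
          (Function.update v (fstIdx k) z (sndIdx l)) =
          ∏ l ∈ {k}ᶜ, τ (v (fstIdx l)) (v (sndIdx l)) := fun z =>
        Finset.prod_congr rfl fun l hl => by
          have : l ≠ k := by simpa using hl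
          simp [this]
      rw [h, h]
      simp
      ring
    · rw [Fintype.prod_eq_mul_prod_compl k, Fintype.prod_eq_mul_prod_compl k]
      have h : ∀ z : V, ∏ l ∈ {k}ᶜ, τ (Function.update v (sndIdx k) z (fstIdx l))
          (Function.update v (sndIdx k) z (sndIdx l)) =
          ∏ l ∈ {k}ᶜ, τ (v (fstIdx l)) (v (sndIdx l)) := fun z =>
        Finset.prod_congr rfl fun l hl => by
          have : l ≠ k := by simpa using hl
          simp [this]
      rw [h, h]
      simp
      ring

/-- `α ∧ τ ∧ ... ∧ τ` as an alternating map. -/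
def wedgeAlt (n : ℕ) (α : V →ₗ[ℝ] ℝ) (τ : V →ₗ[ℝ] V →ₗ[ℝ] ℝ) :
    V [⋀^Fin (2 * n + 1)]→ₗ[ℝ] ℝ :=
  (1 / 2 ^ n : ℝ) • MultilinearMap.alternatization (wedgeMulti n α τ)

lemma wedgeAlt_apply (α : V →ₗ[ℝ] ℝ) (τ : V →ₗ[ℝ] V →ₗ[ℝ] ℝ) (v : Fin (2 * n + 1) → V) :
    wedgeAlt n α τ v = wedge (fun x => α x) (fun x y => τ x y) v := by
  simp only [wedgeAlt, wedge, AlternatingMap.smul_apply, MultilinearMap.alternatization_apply,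
    smul_eq_mul]
  congr 1
  refine Finset.sum_congr rfl fun σ _ => ?_
  simp [wedgeMulti, MultilinearMap.domDomCongr_apply, Units.smul_def, mul_assoc]

/-- An alternating form of top degree is determined by its value on one basis. -/
lemma wedge_eq_det_mul (b : Module.Basis (Fin (2 * n + 1)) ℝ V)
    (α : V →ₗ[ℝ] ℝ) (τ : V →ₗ[ℝ] V →ₗ[ℝ] ℝ) (v : Fin (2 * n + 1) → V) :
    wedge (fun x => α x) (fun x y => τ x y) v =
      b.det v * wedge (fun x => α x) (fun x y => τ x y) b := by
  rw [← wedgeAlt_apply, ← wedgeAlt_apply]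
  conv_lhs => rw [AlternatingMap.eq_smul_basis_det b (wedgeAlt n α τ)]
  simp [mul_comm]

/-- `α ∧ τ ∧ ... ∧ τ` vanishes if both `α` and `τ` are annihilated by a basis vector. -/
lemma wedge_eq_zero_of_kernel (b : Module.Basis (Fin (2 * n + 1)) ℝ V)
    (α : V →ₗ[ℝ] ℝ) (τ : V →ₗ[ℝ] V →ₗ[ℝ] ℝ) {i : Fin (2 * n + 1)} (h0 : α (b i) = 0)
    (h1 : ∀ y, τ (b i) y = 0) (h2 : ∀ y, τ y (b i) = 0) (v : Fin (2 * n + 1) → V) :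
    wedge (fun x => α x) (fun x y => τ x y) v = 0 := by
  rw [wedge_eq_det_mul b]
  refine mul_eq_zero_of_right _ (mul_eq_zero_of_right _ (Finset.sum_eq_zero fun σ _ => ?_))
  obtain ⟨j, rfl⟩ := σ.surjective i
  rcases idx_cases j with rfl | ⟨k, rfl⟩ | ⟨k, rfl⟩
  · simp [h0]
  · exact mul_eq_zero_of_right _ (Finset.prod_eq_zero (Finset.mem_univ k) (h1 _))
  · exact mul_eq_zero_of_right _ (Finset.prod_eq_zero (Finset.mem_univ k) (h2 _))

lemma wedge_add_left {V : Type*} (α β : V → ℝ) (τ : V → V → ℝ) (v : Fin (2 * n + 1) → V) :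
    wedge (fun x => α x + β x) τ v = wedge α τ v + wedge β τ v := by
  simp only [wedge, ← mul_add, ← Finset.sum_add_distrib]
  congr 1
  refine Finset.sum_congr rfl fun σ _ => ?_
  ring

/-- The components, in an adapted basis, of the `2`-form with values `μ k` on the `k`-th pair. -/
def stdForm (μ : Fin n → ℝ) (i j : Fin (2 * n + 1)) : ℝ :=
  ∑ k, μ k * ((if i = fstIdx k ∧ j = sndIdx k then 1 else 0) -
    (if i = sndIdx k ∧ j = fstIdx k then 1 else 0))

lemma stdForm_fst_snd (μ : Fin n → ℝ) (k l : Fin n) :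
    stdForm μ (fstIdx k) (sndIdx l) = if k = l then μ k else 0 := by
  simp only [stdForm, fstIdx_inj, sndIdx_inj, fstIdx_ne_sndIdx, false_and, if_false, sub_zero]
  rw [Finset.sum_eq_single k]
  · simp [eq_comm]
  · intro b _ hb; simp [hb.symm]
  · simp

lemma stdForm_snd_fst (μ : Fin n → ℝ) (k l : Fin n) :
    stdForm μ (sndIdx k) (fstIdx l) = if k = l then -μ k else 0 := by
  simp only [stdForm, fstIdx_inj, sndIdx_inj, sndIdx_ne_fstIdx, false_and, if_false, zero_sub]
  rw [Finset.sum_eq_single k]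
  · by_cases h : k = l
    · simp [h]
    · simp [h, Ne.symm h]
  · intro b _ hb; simp [hb.symm]
  · simp

lemma stdForm_fst_fst (μ : Fin n → ℝ) (k l : Fin n) : stdForm μ (fstIdx k) (fstIdx l) = 0 := by
  simp [stdForm]

lemma stdForm_snd_snd (μ : Fin n → ℝ) (k l : Fin n) : stdForm μ (sndIdx k) (sndIdx l) = 0 := by
  simp [stdForm]

lemma stdForm_reeb_left (μ : Fin n → ℝ) (i) : stdForm μ (reebIdx n) i = 0 := by
  simp [stdForm]

lemma stdForm_reeb_right (μ : Fin n → ℝ) (i) : stdForm μ i (reebIdx n) = 0 := by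
  simp [stdForm]

/-- A nonzero entry joins the two vectors of a single pair, so it depends on `μ` only through the
value at that pair; the sign is kept in the form with all values one. -/
lemma stdForm_cases (i j : Fin (2 * n + 1)) :
    (∃ k, (i = fstIdx k ∧ j = sndIdx k ∨ i = sndIdx k ∧ j = fstIdx k) ∧
      ∀ μ : Fin n → ℝ, stdForm μ i j = μ k * stdForm (fun _ => 1) i j) ∨
    ∀ μ : Fin n → ℝ, stdForm μ i j = 0 := by
  rcases idx_cases i with rfl | ⟨k, rfl⟩ | ⟨k, rfl⟩
  · right; intro μ; exact stdForm_reeb_left μ _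
  · rcases idx_cases j with rfl | ⟨l, rfl⟩ | ⟨l, rfl⟩
    · right; intro μ; exact stdForm_reeb_right μ _
    · right; intro μ; exact stdForm_fst_fst μ _ _
    · by_cases h : k = l
      · subst h; left; exact ⟨k, Or.inl ⟨rfl, rfl⟩, fun μ => by simp [stdForm_fst_snd]⟩
      · right; intro μ; simp [stdForm_fst_snd, h]
  · rcases idx_cases j with rfl | ⟨l, rfl⟩ | ⟨l, rfl⟩
    · right; intro μ; exact stdForm_reeb_right μ _
    · by_cases h : k = l
      · subst h; left; exact ⟨k, Or.inr ⟨rfl, rfl⟩, fun μ => by simp [stdForm_snd_fst]⟩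
      · right; intro μ; simp [stdForm_snd_fst, h]
    · right; intro μ; exact stdForm_snd_snd μ _ _

/-- The value of `η ∧ ωⁿ` on an adapted basis. -/
def wedgeConst (n : ℕ) : ℝ :=
  wedge (n := n) (fun i => if i = reebIdx n then 1 else 0) (stdForm fun _ => 1) id

/-- A permutation that contributes to `η ∧ ωⁿ` maps pairs to pairs, possibly flipping them, and so
induces a permutation of the pairs. -/
lemma exists_pairing {σ : Equiv.Perm (Fin (2 * n + 1))}
    (h : ∏ k : Fin n, stdForm (fun _ => 1) (σ (fstIdx k)) (σ (sndIdx k)) ≠ 0) :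
    ∃ j : Equiv.Perm (Fin n), ∀ k,
      (σ (fstIdx k) = fstIdx (j k) ∧ σ (sndIdx k) = sndIdx (j k) ∨
        σ (fstIdx k) = sndIdx (j k) ∧ σ (sndIdx k) = fstIdx (j k)) ∧
      ∀ μ : Fin n → ℝ, stdForm μ (σ (fstIdx k)) (σ (sndIdx k)) =
        μ (j k) * stdForm (fun _ => 1) (σ (fstIdx k)) (σ (sndIdx k)) := by
  have h1 : ∀ k, ∃ l, (σ (fstIdx k) = fstIdx l ∧ σ (sndIdx k) = sndIdx l ∨
        σ (fstIdx k) = sndIdx l ∧ σ (sndIdx k) = fstIdx l) ∧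
      ∀ μ : Fin n → ℝ, stdForm μ (σ (fstIdx k)) (σ (sndIdx k)) =
        μ l * stdForm (fun _ => 1) (σ (fstIdx k)) (σ (sndIdx k)) := fun k => by
    rcases stdForm_cases (σ (fstIdx k)) (σ (sndIdx k)) with h' | h'
    · exact h'
    · exact absurd (h' _) ((Finset.prod_ne_zero_iff.1 h) k (Finset.mem_univ k))
  choose j hj using h1
  have inj : Function.Injective j := fun k l hkl => by
    have hk := (hj k).1
    have hl := (hj l).1
    rw [← hkl] at hl
    rcases hk with hk | hk <;> rcases hl with hl | hl
    · exact fstIdx_inj.1 (σ.injective (hk.1.trans hl.1.symm))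
    · exact absurd (σ.injective (hk.1.trans hl.2.symm)) (by simp)
    · exact absurd (σ.injective (hk.1.trans hl.2.symm)) (by simp)
    · exact fstIdx_inj.1 (σ.injective (hk.1.trans hl.1.symm))
  exact ⟨Equiv.ofBijective j (Finite.injective_iff_bijective.1 inj), hj⟩

/-- The identity holds for each permutation separately: a contributing one only reorders the factors
`μ k`. -/
lemma wedge_stdForm (μ : Fin n → ℝ) :
    wedge (n := n) (fun i => if i = reebIdx n then 1 else 0) (stdForm μ) id =
      wedgeConst n * ∏ k, μ k := by
  unfold wedgeConst wedge
  rw [mul_assoc, Finset.sum_mul]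
  congr 1
  refine Finset.sum_congr rfl fun σ _ => ?_
  rw [mul_assoc _ _ (∏ k, μ k)]
  congr 1
  simp only [id]
  by_cases h : ∏ k : Fin n, stdForm (fun _ => 1) (σ (fstIdx k)) (σ (sndIdx k)) = 0
  · rw [h, zero_mul]
    obtain ⟨k, _, hk⟩ := Finset.prod_eq_zero_iff.1 h
    refine Finset.prod_eq_zero (Finset.mem_univ k) ?_
    rcases stdForm_cases (σ (fstIdx k)) (σ (sndIdx k)) with ⟨l, _, hl⟩ | h'
    · rw [hl, hk, mul_zero]
    · exact h' _
  · obtain ⟨j, hj⟩ := exists_pairing h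
    rw [← Equiv.prod_comp j μ, ← Finset.prod_mul_distrib]
    exact Finset.prod_congr rfl fun k _ => by rw [(hj k).2 μ, mul_comm]

lemma abs_stdForm_one_le (i j : Fin (2 * n + 1)) : |stdForm (fun _ => 1) i j| ≤ 1 := by
  rcases stdForm_cases i j with ⟨k, ⟨rfl, rfl⟩ | ⟨rfl, rfl⟩, _⟩ | h
  · simp [stdForm_fst_snd]
  · simp [stdForm_snd_fst]
  · simp [h]

/-- At most `n! 2ⁿ` permutations contribute, each by at most one in absolute value, and `2ⁿ` cancels
the normalization. This upper bound is all that the comparison of the contact volume with the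
Riemannian one needs. -/
lemma abs_wedgeConst_le (n : ℕ) : |wedgeConst n| ≤ n.factorial := by
  classical
  unfold wedgeConst wedge
  set P : Equiv.Perm (Fin (2 * n + 1)) → Prop := fun σ => σ (reebIdx n) = reebIdx n ∧
    ∏ k : Fin n, stdForm (fun _ => 1) (σ (fstIdx k)) (σ (sndIdx k)) ≠ 0 with hP
  have key : (Finset.univ.filter P).card ≤ n.factorial * 2 ^ n := by
    have hc : n.factorial * 2 ^ n =
        (Finset.univ : Finset (Equiv.Perm (Fin n) × (Fin n → Bool))).card := by
      simp [Fintype.card_perm]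
    rw [hc]
    have hex : ∀ σ, ∃ j : Equiv.Perm (Fin n), P σ → ∀ k,
        (σ (fstIdx k) = fstIdx (j k) ∧ σ (sndIdx k) = sndIdx (j k) ∨
        σ (fstIdx k) = sndIdx (j k) ∧ σ (sndIdx k) = fstIdx (j k)) := fun σ => by
      by_cases h : P σ
      · obtain ⟨j, hj⟩ := exists_pairing h.2
        exact ⟨j, fun _ k => (hj k).1⟩
      · exact ⟨1, fun h' => absurd h' h⟩
    choose J hJ using hex
    -- A contributing permutation is recovered from its action on the pairs and from the bits that
    -- tell which pairs keep their order.
    refine Finset.card_le_card_of_injOn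
      (fun σ => (J σ, fun k => decide (σ (fstIdx k) = fstIdx (J σ k)))) (by simp) ?_
    intro σ hσ τ hτ hστ
    simp only [Finset.coe_filter, Finset.mem_univ, true_and, Set.mem_ofPred_eq] at hσ hτ
    simp only [Prod.mk.injEq, funext_iff, decide_eq_decide] at hστ
    obtain ⟨hJJ, hb⟩ := hστ
    have hs := hJ σ hσ
    have ht := hJ τ hτ
    rw [← hJJ] at ht
    ext1 i
    rcases idx_cases i with rfl | ⟨k, rfl⟩ | ⟨k, rfl⟩
    · rw [hσ.1, hτ.1]
    all_goals
      have hb' := hb k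
      rw [← hJJ] at hb'
      rcases hs k with h1 | h1 <;> rcases ht k with h2 | h2 <;>
        simp [h1.1, h2.1, h1.2, h2.2] at hb' ⊢
  rw [abs_mul, abs_of_pos (by positivity : (0 : ℝ) < 1 / 2 ^ n), one_div, inv_mul_le_iff₀
    (by positivity)]
  refine (Finset.abs_sum_le_sum_abs _ _).trans ?_
  have : ∀ σ : Equiv.Perm (Fin (2 * n + 1)), |((Equiv.Perm.sign σ : ℤ) : ℝ) *
      (if id (σ (reebIdx n)) = reebIdx n then (1 : ℝ) else 0) *
      ∏ k : Fin n, stdForm (fun _ => 1) (id (σ (fstIdx k))) (id (σ (sndIdx k)))| ≤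
      if P σ then 1 else 0 := fun σ => by
    simp only [id]
    have hsg : |((Equiv.Perm.sign σ : ℤ) : ℝ)| = 1 := by
      rcases Int.units_eq_one_or (Equiv.Perm.sign σ) with h | h <;> simp [h]
    rw [abs_mul, abs_mul, hsg, one_mul]
    by_cases h1 : σ (reebIdx n) = reebIdx n
    · by_cases h2 : ∏ k : Fin n, stdForm (fun _ => 1) (σ (fstIdx k)) (σ (sndIdx k)) = 0
      · simp [h2, P]
      · rw [if_pos (show P σ from ⟨h1, h2⟩), if_pos h1, abs_one, one_mul, Finset.abs_prod]
        exact Finset.prod_le_one (fun _ _ => abs_nonneg _) fun _ _ => abs_stdForm_one_le _ _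
    · simp [h1, P]
  refine (Finset.sum_le_sum fun σ _ => this σ).trans ?_
  rw [Finset.sum_ite, Finset.sum_const_zero, add_zero, Finset.sum_const, nsmul_eq_mul, mul_one]
  rw [mul_comm (2 ^ n : ℝ)]
  exact_mod_cast key

end Wedge
end Sasaki

end

section

namespace Sasaki

/-! ### Simultaneous diagonalization of two transverse forms. -/

section AdaptedBasis

variable {V : Type*} [AddCommGroup V] [Module ℝ V]

/-- A maximum point of the Rayleigh quotient `q(v, v) / g(v, v)` on `W` is an eigenvector. The norm
pulled back from coordinates serves only to have a compact unit sphere. -/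
lemma exists_relative_eigenvector [FiniteDimensional ℝ V] (W : Submodule ℝ V) (hW : W ≠ ⊥)
    (q g : V →ₗ[ℝ] V →ₗ[ℝ] ℝ) (hq : ∀ v w, q v w = q w v) (hg : ∀ v w, g v w = g w v)
    (hpos : ∀ v, v ≠ 0 → 0 < g v v) :
    ∃ v ∈ W, v ≠ 0 ∧ ∃ c : ℝ, ∀ w ∈ W, q v w = c * g v w := by
  let e := (Module.finBasis ℝ V).equivFun
  let _ : NormedAddCommGroup V := NormedAddCommGroup.induced V _ e.toLinearMap e.injective
  let _ : NormedSpace ℝ V := NormedSpace.induced ℝ V _ e.toLinearMap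
  have hcont : ∀ f : V →ₗ[ℝ] V →ₗ[ℝ] ℝ, Continuous fun v => f v v := fun f => by
    have h1 : Continuous fun v => LinearMap.toContinuousLinearMap (f v) :=
      ((LinearMap.toContinuousLinearMap : (V →ₗ[ℝ] ℝ) ≃ₗ[ℝ] (V →L[ℝ] ℝ)).toLinearMap.comp
        f).continuous_of_finiteDimensional
    exact h1.clm_apply continuous_id
  have : ProperSpace V := FiniteDimensional.proper ℝ V
  have hS : IsCompact (Metric.sphere (0 : V) 1 ∩ W) :=
    (isCompact_sphere _ _).inter_right W.closed_of_finiteDimensional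
  have hne : ∀ w ∈ W, w ≠ 0 → ‖w‖⁻¹ • w ∈ Metric.sphere (0 : V) 1 ∩ W := fun w hw h0 =>
    ⟨by simp [norm_smul, h0], W.smul_mem _ hw⟩
  obtain ⟨w₀, hw₀, hw₀0⟩ := W.ne_bot_iff.1 hW
  have hgne : ∀ v ∈ Metric.sphere (0 : V) 1 ∩ W, g v v ≠ 0 := fun v hv =>
    (hpos v (by rintro rfl; simp at hv)).ne'
  obtain ⟨v, hv, hmax⟩ := hS.exists_isMaxOn ⟨_, hne w₀ hw₀ hw₀0⟩
    ((hcont q).continuousOn.div (hcont g).continuousOn hgne)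
  set c := q v v / g v v with hc
  have hle : ∀ w ∈ W, q w w ≤ c * g w w := fun w hw => by
    by_cases h0 : w = 0
    · simp [h0]
    have h1 := hmax (hne w hw h0)
    have hr : 0 < ‖w‖⁻¹ := by positivity
    simp only [Set.mem_ofPred_eq, Pi.div_apply, map_smul, LinearMap.smul_apply, smul_eq_mul] at h1
    rw [mul_div_mul_left _ _ hr.ne', mul_div_mul_left _ _ hr.ne', div_le_iff₀ (hpos w h0)] at h1
    exact h1
  have hv0 : v ≠ 0 := by rintro rfl; simp at hv
  refine ⟨v, hv.2, hv0, c, fun w hw => ?_⟩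
  -- The inequality at `v + t w` has zero constant term because `v` attains the maximum; a
  -- nonnegative quadratic of this kind has no linear term.
  have hquad : ∀ t : ℝ, 0 ≤ (c * g w w - q w w) * (t * t) + (2 * (c * g v w - q v w)) * t + 0 :=
    fun t => by
      have h1 := hle (v + t • w) (W.add_mem hv.2 (W.smul_mem _ hw))
      have h2 : q v v = c * g v v := by rw [hc, div_mul_cancel₀ _ (hpos v hv0).ne']
      simp only [map_add, map_smul, LinearMap.add_apply, LinearMap.smul_apply, smul_eq_mul,
        hq w v, hg w v] at h1
      nlinarith
  have := discrim_le_zero hquad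
  simp only [discrim, mul_zero, sub_zero] at this
  have h3 := pow_eq_zero_iff (two_ne_zero) |>.1 (le_antisymm this (sq_nonneg _))
  linarith

/-- A linear almost contact structure: `η(ξ) = 1` and `J² = -id + η ⊗ ξ`. -/
structure AlmostContact (η : V →ₗ[ℝ] ℝ) (ξ : V) (J : V →ₗ[ℝ] V) : Prop where
  eta_xi : η ξ = 1
  J_sq : ∀ v, J (J v) = -v + η v • ξ

/-- Skew forms which are annihilated by `ξ` and invariant under `J`. -/
structure IsTransverse (ξ : V) (J : V →ₗ[ℝ] V) (τ : V →ₗ[ℝ] V →ₗ[ℝ] ℝ) : Prop where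
  skew : ∀ v w, τ v w = -τ w v
  xi_left : ∀ v, τ ξ v = 0
  inv : ∀ v w, τ (J v) (J w) = τ v w

variable {η : V →ₗ[ℝ] ℝ} {ξ : V} {J : V →ₗ[ℝ] V}

namespace AlmostContact

lemma xi_ne_zero (h : AlmostContact η ξ J) : ξ ≠ 0 := by
  rintro rfl; simpa using h.eta_xi

/-- From `J²ξ = 0` the axiom gives `Jξ = η(Jξ) ξ`, and applying `J` once more kills the factor. -/
lemma J_xi (h : AlmostContact η ξ J) : J ξ = 0 := by
  have h1 : J (J ξ) = 0 := by simp [h.J_sq, h.eta_xi]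
  have h2 : J ξ = η (J ξ) • ξ := by
    have := h.J_sq (J ξ)
    rw [h1, map_zero] at this
    exact (neg_add_eq_zero.1 this.symm)
  have h3 : η (J ξ) = 0 := by
    rw [h2, map_smul, h2, smul_smul] at h1
    rcases smul_eq_zero.1 h1 with h' | h'
    · simpa [h.eta_xi] using h'
    · exact absurd h' h.xi_ne_zero
  rw [h2, h3, zero_smul]

lemma eta_J (h : AlmostContact η ξ J) (v : V) : η (J v) = 0 := by
  have h1 := h.J_sq (J v)
  rw [h.J_sq v, map_add, map_neg, map_smul, h.J_xi, smul_zero, add_zero] at h1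
  rcases smul_eq_zero.1 (left_eq_add.1 h1) with h' | h'
  · exact h'
  · exact absurd h' h.xi_ne_zero

end AlmostContact

namespace IsTransverse

variable {τ : V →ₗ[ℝ] V →ₗ[ℝ] ℝ}

lemma xi_right (h : IsTransverse ξ J τ) (v : V) : τ v ξ = 0 := by
  rw [h.skew, h.xi_left, neg_zero]

lemma self (h : IsTransverse ξ J τ) (v : V) : τ v v = 0 := by
  linarith [h.skew v v]

lemma symm (h : IsTransverse ξ J τ) (hJ : AlmostContact η ξ J) (v w : V) :
    τ v (J w) = τ w (J v) := by
  rw [← h.inv v (J w), hJ.J_sq, map_add, map_neg, map_smul, h.xi_right, h.skew (J v) w]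
  simp

lemma J_left (h : IsTransverse ξ J τ) (hJ : AlmostContact η ξ J) (v w : V) :
    τ (J v) w = -τ v (J w) := by
  rw [h.skew, h.symm hJ]

lemma J_J (h : IsTransverse ξ J τ) (hJ : AlmostContact η ξ J) (v w : V) :
    τ v (J (J w)) = -τ v w := by
  rw [hJ.J_sq, map_add, map_neg, map_smul, h.xi_right]; simp

end IsTransverse

/-- The metric `Ω(·, J ·) + η ⊗ η`. -/
def contactMetric (η : V →ₗ[ℝ] ℝ) (J : V →ₗ[ℝ] V) (Ω : V →ₗ[ℝ] V →ₗ[ℝ] ℝ) :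
    V →ₗ[ℝ] V →ₗ[ℝ] ℝ :=
  Ω.compl₂ J + η.smulRight η

lemma contactMetric_apply (Ω : V →ₗ[ℝ] V →ₗ[ℝ] ℝ) (v w : V) :
    contactMetric η J Ω v w = Ω v (J w) + η v * η w := by
  simp [contactMetric]

variable {Ω θ : V →ₗ[ℝ] V →ₗ[ℝ] ℝ} {n : ℕ}

/-- Induction on the number of vectors: the next one is an eigenvector of `θ(·, J ·)` relative to
the metric, inside the common kernel of `η`, `Ω(e_i, ·)` and `Ω(e_i, J ·)`. These are `2k + 1`
conditions, so the kernel is nonzero as long as `k < n`. -/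
lemma exists_adapted_frame [FiniteDimensional ℝ V] (hd : Module.finrank ℝ V = 2 * n + 1)
    (hJ : AlmostContact η ξ J)
    (hΩ : IsTransverse ξ J Ω) (hθ : IsTransverse ξ J θ)
    (hpos : ∀ v, v ≠ 0 → 0 < contactMetric η J Ω v v) (k : ℕ) (hk : k ≤ n) :
    ∃ (e : Fin k → V) (c : Fin k → ℝ), (∀ i, η (e i) = 0) ∧
      (∀ i j, Ω (e i) (J (e j)) = if i = j then 1 else 0) ∧ (∀ i j, Ω (e i) (e j) = 0) ∧
      ∀ i w, θ (e i) w = c i * Ω (e i) w := by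
  induction k with
  | zero => exact ⟨Fin.elim0, Fin.elim0, fun i => i.elim0, fun i => i.elim0, fun i => i.elim0,
      fun i => i.elim0⟩
  | succ k ih =>
    obtain ⟨e, c, he, h1, h2, h3⟩ := ih (by omega)
    let L : V →ₗ[ℝ] ℝ × (Fin k → ℝ) × (Fin k → ℝ) :=
      η.prod ((LinearMap.pi fun i => Ω (e i)).prod (LinearMap.pi fun i => (Ω (e i)).comp J))
    have hL : LinearMap.ker L ≠ ⊥ := by
      apply LinearMap.ker_ne_bot_of_finrank_lt
      simp [hd]; omega
    have memL : ∀ w, w ∈ LinearMap.ker L ↔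
        η w = 0 ∧ (∀ i, Ω (e i) w = 0) ∧ ∀ i, Ω (e i) (J w) = 0 := fun w => by
      simp [L, LinearMap.mem_ker, funext_iff]
    obtain ⟨v, hv, hv0, a, ha⟩ := exists_relative_eigenvector (LinearMap.ker L) hL (θ.compl₂ J)
      (contactMetric η J Ω) (fun v w => by simpa using hθ.symm hJ v w)
      (fun v w => by
        rw [contactMetric_apply, contactMetric_apply, hΩ.symm hJ, mul_comm]) hpos
    obtain ⟨v1, v2, v3⟩ := (memL v).1 hv
    -- The eigenvalue equation is known on the kernel only. An arbitrary `w` differs from its kernel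
    -- component `z` by multiples of `ξ`, `e_i` and `J e_i`, on which both `θ v` and `Ω v` vanish.
    have key : ∀ w, θ v w = a * Ω v w := by
      intro w
      set z := w - η w • ξ - ∑ i, (Ω (e i) (J w) • e i + Ω (e i) w • J (e i)) with hz
      have zeta : η z = 0 := by simp [hz, hJ.eta_xi, he, hJ.eta_J]
      have z1 : ∀ j, Ω (e j) z = 0 := fun j => by
        simp [hz, hΩ.xi_right, h2, h1, Finset.sum_add_distrib]
      have z2 : ∀ j, Ω (e j) (J z) = 0 := fun j => by
        simp [hz, hJ.J_xi, hJ.J_sq, he, h2, h1, Finset.sum_add_distrib]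
      -- The eigenvector equation involves `θ(·, J ·)`; testing it on `J z` gives back `θ(v, z)`
      -- because `J² = -1` modulo `ξ`.
      have hJz : J z ∈ LinearMap.ker L := (memL _).2 ⟨hJ.eta_J _, z2, fun i => by
        rw [hΩ.J_J hJ, z1, neg_zero]⟩
      have h4 : θ v z = a * Ω v z := by
        have := ha _ hJz
        rw [contactMetric_apply, v1, LinearMap.compl₂_apply, hθ.J_J hJ, hΩ.J_J hJ] at this
        linarith
      have hw : w = z + η w • ξ + ∑ i, (Ω (e i) (J w) • e i + Ω (e i) w • J (e i)) := by
        rw [hz]; abel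
      have h5 : ∀ i, Ω v (e i) = 0 := fun i => by rw [hΩ.skew, v2, neg_zero]
      have h6 : ∀ i, Ω v (J (e i)) = 0 := fun i => by rw [hΩ.symm hJ, v3]
      have h7 : ∀ i, θ v (e i) = 0 := fun i => by rw [hθ.skew, h3, v2, mul_zero, neg_zero]
      have h8 : ∀ i, θ v (J (e i)) = 0 := fun i => by rw [hθ.symm hJ, h3, v3, mul_zero]
      rw [hw]
      simp [h5, h6, h7, h8, hΩ.xi_right, hθ.xi_right, h4]
    have hgv : 0 < Ω v (J v) := by
      have := hpos v hv0
      rwa [contactMetric_apply, v1, mul_zero, add_zero] at this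
    set r := (√(Ω v (J v)))⁻¹ with hr
    have hrr : r * (r * Ω v (J v)) = 1 := by
      rw [← mul_assoc, ← mul_inv, Real.mul_self_sqrt hgv.le, inv_mul_cancel₀ hgv.ne']
    refine ⟨Fin.snoc e (r • v), Fin.snoc c a, ?_, ?_, ?_, ?_⟩
    · intro i
      refine Fin.lastCases ?_ (fun i => ?_) i
      · simp [v1]
      · simp [he]
    · intro i j
      refine Fin.lastCases ?_ (fun i => ?_) i <;> refine Fin.lastCases ?_ (fun j => ?_) j
      · simp [hrr]
      · simp [hΩ.symm hJ v, v3, (Fin.castSucc_lt_last j).ne']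
      · simp [v3, (Fin.castSucc_lt_last i).ne]
      · simp [h1]
    · intro i j
      refine Fin.lastCases ?_ (fun i => ?_) i <;> refine Fin.lastCases ?_ (fun j => ?_) j
      · simp [hΩ.self]
      · simp [hΩ.skew v, v2]
      · simp [v2]
      · simp [h2]
    · intro i w
      refine Fin.lastCases ?_ (fun i => ?_) i
      · simp [key]; ring
      · simp [h3]

/-- A basis `ξ, e₁, J e₁, e₂, J e₂, ...` which is orthonormal for `Ω(·, J ·) + η ⊗ η` and in which
the form `θ` is diagonal. -/
structure IsAdapted (b : Module.Basis (Fin (2 * n + 1)) ℝ V) (η : V →ₗ[ℝ] ℝ) (ξ : V)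
    (J : V →ₗ[ℝ] V) (Ω θ : V →ₗ[ℝ] V →ₗ[ℝ] ℝ) (c : Fin n → ℝ) : Prop where
  reeb : b (reebIdx n) = ξ
  snd : ∀ k, b (sndIdx k) = J (b (fstIdx k))
  eta : ∀ i, η (b i) = if i = reebIdx n then 1 else 0
  form : ∀ i j, Ω (b i) (b j) = stdForm (fun _ => 1) i j
  form' : ∀ i j, θ (b i) (b j) = stdForm c i j
  orthonormal : ∀ i j, contactMetric η J Ω (b i) (b j) = if i = j then 1 else 0

lemma exists_adapted_basis [FiniteDimensional ℝ V] (hd : Module.finrank ℝ V = 2 * n + 1)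
    (hJ : AlmostContact η ξ J)
    (hΩ : IsTransverse ξ J Ω) (hθ : IsTransverse ξ J θ)
    (hpos : ∀ v, v ≠ 0 → 0 < contactMetric η J Ω v v) :
    ∃ (b : Module.Basis (Fin (2 * n + 1)) ℝ V) (c : Fin n → ℝ), IsAdapted b η ξ J Ω θ c := by
  obtain ⟨e, c, he, h1, h2, h3⟩ := exists_adapted_frame hd hJ hΩ hθ hpos n le_rfl
  -- Position `0` holds `ξ`, the odd position `2k + 1` holds `e_k` and the even position `2k + 2`
  -- holds `J e_k`, in agreement with `fstIdx` and `sndIdx`.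
  let B : Fin (2 * n + 1) → V := fun i =>
    if hi : (i : ℕ) = 0 then ξ else if (i : ℕ) % 2 = 1 then e ⟨((i : ℕ) - 1) / 2, by omega⟩
      else J (e ⟨((i : ℕ) - 2) / 2, by omega⟩)
  have B0 : B (reebIdx n) = ξ := by simp [B, reebIdx]
  have B1 : ∀ k, B (fstIdx k) = e k := fun k => by
    have : (2 * (k : ℕ) + 1) % 2 = 1 := by omega
    simp [B, fstIdx, this]
  have B2 : ∀ k, B (sndIdx k) = J (e k) := fun k => by
    have : ¬ (2 * (k : ℕ) + 2) % 2 = 1 := by omega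
    simp [B, sndIdx]
  have hη : ∀ i, η (B i) = if i = reebIdx n then 1 else 0 := fun i => by
    rcases idx_cases i with rfl | ⟨k, rfl⟩ | ⟨k, rfl⟩ <;> simp [B0, B1, B2, hJ.eta_xi, he, hJ.eta_J]
  have hform : ∀ i j, Ω (B i) (B j) = stdForm (fun _ => 1) i j := fun i j => by
    rcases idx_cases i with rfl | ⟨k, rfl⟩ | ⟨k, rfl⟩
    · rw [B0, hΩ.xi_left, stdForm_reeb_left]
    all_goals rcases idx_cases j with rfl | ⟨l, rfl⟩ | ⟨l, rfl⟩
    · rw [B0, hΩ.xi_right, stdForm_reeb_right]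
    · rw [B1, B1, h2, stdForm_fst_fst]
    · rw [B1, B2, h1, stdForm_fst_snd]
    · rw [B0, hΩ.xi_right, stdForm_reeb_right]
    · rw [B2, B1, hΩ.J_left hJ, h1, stdForm_snd_fst]
      split_ifs <;> simp
    · rw [B2, B2, hΩ.inv, h2, stdForm_snd_snd]
  have hform' : ∀ i j, θ (B i) (B j) = stdForm c i j := fun i j => by
    rcases idx_cases i with rfl | ⟨k, rfl⟩ | ⟨k, rfl⟩
    · rw [B0, hθ.xi_left, stdForm_reeb_left]
    all_goals rcases idx_cases j with rfl | ⟨l, rfl⟩ | ⟨l, rfl⟩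
    · rw [B0, hθ.xi_right, stdForm_reeb_right]
    · rw [B1, B1, h3, h2, stdForm_fst_fst, mul_zero]
    · rw [B1, B2, h3, h1, stdForm_fst_snd]
      split_ifs <;> simp
    · rw [B0, hθ.xi_right, stdForm_reeb_right]
    · rw [B2, B1, hθ.J_left hJ, h3, h1, stdForm_snd_fst]
      split_ifs <;> simp
    · rw [B2, B2, hθ.inv, h3, h2, stdForm_snd_snd, mul_zero]
  have hon : ∀ i j, contactMetric η J Ω (B i) (B j) = if i = j then 1 else 0 := fun i j => by
    rw [contactMetric_apply, hη, hη]
    rcases idx_cases i with rfl | ⟨k, rfl⟩ | ⟨k, rfl⟩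
    · rw [B0, hΩ.xi_left]; simp [eq_comm]
    all_goals rcases idx_cases j with rfl | ⟨l, rfl⟩ | ⟨l, rfl⟩
    · simp [B0, hJ.J_xi]
    · simp [B1, h1]
    · simp [B1, B2, hΩ.J_J hJ, h2]
    · simp [B0, hJ.J_xi]
    · simp [B1, B2, hΩ.inv, h2]
    · simp [B2, hΩ.inv, h1]
  have hli : LinearIndependent ℝ B := by
    rw [Fintype.linearIndependent_iff]
    intro x hx i
    have := congrArg (contactMetric η J Ω (B i)) hx
    simpa [hon] using this
  let b := basisOfLinearIndependentOfCardEqFinrank hli (by simp [hd])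
  have hb : ⇑b = B := coe_basisOfLinearIndependentOfCardEqFinrank _ _
  exact ⟨b, c, by rw [hb, B0], fun k => by rw [hb, B1, B2], by rwa [hb], by rwa [hb], by rwa [hb],
    by rwa [hb]⟩

end AdaptedBasis

/-! ### Contractions with a metric, computed in an orthonormal basis. -/

section Contraction

variable {V : Type*} [AddCommGroup V] [Module ℝ V] {ι : Type*} [Fintype ι] [DecidableEq ι]

lemma gram_eq_transpose_mul (g : V →ₗ[ℝ] V →ₗ[ℝ] ℝ) (b : Module.Basis ι ℝ V)
    (hb : ∀ i j, g (b i) (b j) = if i = j then 1 else 0) (v : ι → V) :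
    (Matrix.of fun i j => g (v i) (v j)) = (b.toMatrix v).transpose * b.toMatrix v := by
  ext i j
  have hv : ∀ i, v i = ∑ a, b.toMatrix v a i • b a := fun i => by
    simp [Module.Basis.toMatrix_apply, b.sum_repr]
  rw [Matrix.of_apply, hv i, hv j]
  simp only [map_sum, map_smul, LinearMap.sum_apply, LinearMap.smul_apply, hb, smul_eq_mul,
    Matrix.mul_apply, Matrix.transpose_apply, mul_ite, mul_one, mul_zero, Finset.sum_ite_eq',
    Finset.mem_univ, if_true]
  exact Finset.sum_congr rfl fun a _ => mul_comm _ _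

lemma sqrt_det_gram (g : V →ₗ[ℝ] V →ₗ[ℝ] ℝ) (b : Module.Basis ι ℝ V)
    (hb : ∀ i j, g (b i) (b j) = if i = j then 1 else 0) (v : ι → V) :
    √(Matrix.det (Matrix.of fun i j => g (v i) (v j))) = |b.det v| := by
  rw [gram_eq_transpose_mul g b hb, Matrix.det_mul, Matrix.det_transpose, Real.sqrt_mul_self_eq_abs,
    Module.Basis.det_apply]

/-- If `P` is the change of basis to an orthonormal one, the inverse Gram matrix is `P Pᵀ`, so the
contraction becomes a plain sum of squares type expression there. -/
lemma contract_vectors (g : V →ₗ[ℝ] V →ₗ[ℝ] ℝ) (b e : Module.Basis ι ℝ V)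
    (hb : ∀ i j, g (b i) (b j) = if i = j then 1 else 0) (α β : V →ₗ[ℝ] ℝ) :
    ∑ i, ∑ k, (Matrix.of fun i j => g (e i) (e j))⁻¹ i k * α (e i) * β (e k) =
      ∑ a, α (b a) * β (b a) := by
  have hinv : (Matrix.of fun i j => g (e i) (e j))⁻¹ =
      e.toMatrix b * (e.toMatrix b).transpose := by
    rw [gram_eq_transpose_mul g b hb]
    refine Matrix.inv_eq_right_inv ?_
    rw [Matrix.mul_assoc, ← Matrix.mul_assoc (b.toMatrix e), b.toMatrix_mul_toMatrix_flip e,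
      Matrix.one_mul, ← Matrix.transpose_mul, e.toMatrix_mul_toMatrix_flip b, Matrix.transpose_one]
  have hv : ∀ (f : V →ₗ[ℝ] ℝ) a, f (b a) = ∑ i, e.toMatrix b i a * f (e i) := fun f a => by
    conv_lhs => rw [← e.sum_repr (b a), map_sum]
    simp only [map_smul, smul_eq_mul, Module.Basis.toMatrix_apply]
  simp only [hinv, hv, Matrix.mul_apply, Matrix.transpose_apply, Finset.sum_mul_sum]
  simp only [Finset.sum_mul]
  rw [Finset.sum_congr rfl fun i _ => Finset.sum_comm, Finset.sum_comm]
  refine Finset.sum_congr rfl fun a _ => Finset.sum_congr rfl fun i _ =>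
    Finset.sum_congr rfl fun k _ => ?_
  ring

lemma contract_tensors (g : V →ₗ[ℝ] V →ₗ[ℝ] ℝ) (b e : Module.Basis ι ℝ V)
    (hb : ∀ i j, g (b i) (b j) = if i = j then 1 else 0) (α β : V →ₗ[ℝ] V →ₗ[ℝ] ℝ) :
    ∑ i, ∑ j, ∑ k, ∑ l, (Matrix.of fun i j => g (e i) (e j))⁻¹ i k *
      (Matrix.of fun i j => g (e i) (e j))⁻¹ j l * α (e i) (e j) * β (e k) (e l) =
      ∑ a, ∑ c, α (b a) (b c) * β (b a) (b c) := by
  set G := (Matrix.of fun i j => g (e i) (e j))⁻¹ with hG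
  have h1 : ∀ j l, ∑ i, ∑ k, G i k * α (e i) (e j) * β (e k) (e l) =
      ∑ a, α (b a) (e j) * β (b a) (e l) := fun j l =>
    contract_vectors g b e hb (α.flip (e j)) (β.flip (e l))
  have h2 : ∀ a, ∑ j, ∑ l, G j l * α (b a) (e j) * β (b a) (e l) =
      ∑ c, α (b a) (b c) * β (b a) (b c) := fun a =>
    contract_vectors g b e hb (α (b a)) (β (b a))
  calc _ = ∑ j, ∑ l, G j l * ∑ i, ∑ k, G i k * α (e i) (e j) * β (e k) (e l) := by
        rw [Finset.sum_comm]
        refine Finset.sum_congr rfl fun j _ => ?_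
        simp only [Finset.mul_sum]
        rw [Finset.sum_congr rfl fun i _ => Finset.sum_comm, Finset.sum_comm]
        refine Finset.sum_congr rfl fun l _ => Finset.sum_congr rfl fun i _ =>
          Finset.sum_congr rfl fun k _ => ?_
        ring
    _ = ∑ j, ∑ l, ∑ a, G j l * α (b a) (e j) * β (b a) (e l) := by
        simp only [h1]
        simp only [Finset.mul_sum, mul_assoc]
    _ = ∑ a, ∑ j, ∑ l, G j l * α (b a) (e j) * β (b a) (e l) := by
        rw [Finset.sum_congr rfl fun j _ => Finset.sum_comm]
        exact Finset.sum_comm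
    _ = _ := by simp only [h2]

end Contraction
end Sasaki

end

section

namespace Sasaki

/-! ### Laplacian, gradient and metric velocity in terms of the eigenvalues. -/

section AdaptedSums

variable {V : Type*} [AddCommGroup V] [Module ℝ V] {η : V →ₗ[ℝ] ℝ} {ξ : V} {J : V →ₗ[ℝ] V}
  {Ω θ : V →ₗ[ℝ] V →ₗ[ℝ] ℝ} {n : ℕ} {b : Module.Basis (Fin (2 * n + 1)) ℝ V} {c : Fin n → ℝ}

namespace IsAdapted

lemma J_snd (h : IsAdapted b η ξ J Ω θ c) (hJ : AlmostContact η ξ J) (k : Fin n) :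
    J (b (sndIdx k)) = -b (fstIdx k) := by
  rw [h.snd, hJ.J_sq, h.eta]; simp

/-- Each pair is counted in both orders, whence the factor `2`; the factor one half in `laplacian`
removes it. -/
lemma contract_forms (h : IsAdapted b η ξ J Ω θ c) (e : Module.Basis (Fin (2 * n + 1)) ℝ V) :
    ∑ i, ∑ j, ∑ k, ∑ l, (Matrix.of fun i j => contactMetric η J Ω (e i) (e j))⁻¹ i k *
      (Matrix.of fun i j => contactMetric η J Ω (e i) (e j))⁻¹ j l * θ (e i) (e j) *
        Ω (e k) (e l) = 2 * ∑ k, c k := by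
  rw [contract_tensors _ b e h.orthonormal θ Ω]
  simp only [h.form, h.form', sum_idx, stdForm_reeb_left, stdForm_reeb_right, stdForm_fst_fst,
    stdForm_snd_snd, stdForm_fst_snd, stdForm_snd_fst]
  simp [Finset.mul_sum, ← two_mul]

lemma contract_covector (h : IsAdapted b η ξ J Ω θ c) (e : Module.Basis (Fin (2 * n + 1)) ℝ V)
    (d : V →ₗ[ℝ] ℝ) (hd : d ξ = 0) :
    ∑ i, ∑ j, (Matrix.of fun i j => contactMetric η J Ω (e i) (e j))⁻¹ i j * d (e i) * d (e j) =
      ∑ k, (d (b (fstIdx k)) ^ 2 + d (b (sndIdx k)) ^ 2) := by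
  rw [contract_vectors _ b e h.orthonormal d d, sum_idx, h.reeb, hd]
  simp [sq]

/-- Here `τ` is `dψ ∧ d^c ψ`, the term by which `dd^c(ψ²)` differs from `2ψ dd^c ψ` up to a factor;
its trace is the squared gradient. -/
lemma contract_wedge (h : IsAdapted b η ξ J Ω θ c) (hJ : AlmostContact η ξ J)
    (e : Module.Basis (Fin (2 * n + 1)) ℝ V)
    (d : V →ₗ[ℝ] ℝ) (hd : d ξ = 0) (τ : V →ₗ[ℝ] V →ₗ[ℝ] ℝ)
    (hτ : ∀ v w, τ v w = -(1 / 2 : ℝ) * (d v * d (J w) - d w * d (J v))) :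
    ∑ i, ∑ j, ∑ k, ∑ l, (Matrix.of fun i j => contactMetric η J Ω (e i) (e j))⁻¹ i k *
      (Matrix.of fun i j => contactMetric η J Ω (e i) (e j))⁻¹ j l * τ (e i) (e j) *
        Ω (e k) (e l) = ∑ k, (d (b (fstIdx k)) ^ 2 + d (b (sndIdx k)) ^ 2) := by
  rw [contract_tensors _ b e h.orthonormal τ Ω]
  simp only [h.form, sum_idx, stdForm_reeb_left, stdForm_reeb_right, stdForm_fst_fst,
    stdForm_snd_snd, stdForm_fst_snd, stdForm_snd_fst, hτ, h.reeb, hd, hJ.J_xi, h.J_snd hJ, ← h.snd]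
  simp only [map_neg, mul_zero, zero_add, add_zero, mul_ite, mul_one, mul_neg,
    Finset.sum_ite_eq, Finset.mem_univ, if_true]
  simp only [Finset.sum_const_zero, zero_add]
  refine Finset.sum_congr rfl fun k _ => ?_
  ring

/-- The transverse block is diagonal with every `c_k` occurring twice. The mixed entries `-(1/2) d(J
·)` occur in both orders and contribute `2 · (1/4) |d|²`. -/
lemma contract_velocity (h : IsAdapted b η ξ J Ω θ c) (hJ : AlmostContact η ξ J)
    (e : Module.Basis (Fin (2 * n + 1)) ℝ V)
    (d : V →ₗ[ℝ] ℝ) (a : V →ₗ[ℝ] V →ₗ[ℝ] ℝ)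
    (ha : ∀ v w, a v w = θ v (J w) - (1 / 2 : ℝ) * (η v * d (J w) + d (J v) * η w)) :
    ∑ i, ∑ j, ∑ k, ∑ l, (Matrix.of fun i j => contactMetric η J Ω (e i) (e j))⁻¹ i k *
      (Matrix.of fun i j => contactMetric η J Ω (e i) (e j))⁻¹ j l * a (e i) (e j) *
        a (e k) (e l) = 2 * ∑ k, c k ^ 2 +
          1 / 2 * ∑ k, (d (b (fstIdx k)) ^ 2 + d (b (sndIdx k)) ^ 2) := by
  rw [contract_tensors _ b e h.orthonormal a a]
  simp only [h.form', sum_idx, stdForm_reeb_left, stdForm_fst_fst, h.eta,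
    stdForm_snd_snd, stdForm_fst_snd, stdForm_snd_fst, ha, hJ.J_xi, h.J_snd hJ, ← h.snd,
    map_zero, map_neg, fstIdx_ne_reebIdx, sndIdx_ne_reebIdx, if_true, if_false, h.reeb]
  simp only [mul_zero, zero_mul, add_zero, zero_add, sub_zero, mul_one, one_mul, zero_sub, neg_zero]
  simp only [mul_neg, neg_mul, neg_neg, ite_mul_ite, mul_zero,
    Finset.sum_add_distrib, Finset.sum_ite_eq, Finset.mem_univ, if_true]
  simp only [Finset.mul_sum, ← Finset.sum_add_distrib]
  refine Finset.sum_congr rfl fun k _ => ?_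
  ring

lemma wedge_eq (h : IsAdapted b η ξ J Ω θ c) (s r : ℝ) (v : Fin (2 * n + 1) → V) :
    wedge (fun x => η x) (fun x y => (s • Ω + r • θ) x y) v =
      b.det v * (wedgeConst n * ∏ k, (s + r * c k)) := by
  rw [wedge_eq_det_mul b, ← wedge_stdForm]
  congr 1
  have h1 : ∀ i j, (s • Ω + r • θ) (b i) (b j) = stdForm (fun k => s + r * c k) i j := fun i j => by
    simp only [LinearMap.add_apply, LinearMap.smul_apply, h.form, h.form', smul_eq_mul, stdForm,
      Finset.mul_sum, ← Finset.sum_add_distrib]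
    exact Finset.sum_congr rfl fun k _ => by ring
  unfold wedge
  simp only [h1, h.eta, id]

lemma covector_eq_zero (h : IsAdapted b η ξ J Ω θ c) (d : V →ₗ[ℝ] ℝ) (hd : d ξ = 0)
    (h0 : ∑ k, (d (b (fstIdx k)) ^ 2 + d (b (sndIdx k)) ^ 2) = 0) : d = 0 := by
  rw [Finset.sum_eq_zero_iff_of_nonneg fun k _ => by positivity] at h0
  refine b.ext fun i => ?_
  rcases idx_cases i with rfl | ⟨k, rfl⟩ | ⟨k, rfl⟩
  · rw [h.reeb, hd]; rfl
  · have := h0 k (Finset.mem_univ k)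
    simpa using (pow_eq_zero_iff two_ne_zero).1 (le_antisymm (by nlinarith [sq_nonneg (d (b (sndIdx k)))]) (sq_nonneg (d (b (fstIdx k)))))
  · have := h0 k (Finset.mem_univ k)
    simpa using (pow_eq_zero_iff two_ne_zero).1 (le_antisymm (by nlinarith [sq_nonneg (d (b (fstIdx k)))]) (sq_nonneg (d (b (sndIdx k)))))

end IsAdapted
end AdaptedSums
end Sasaki

end

section

namespace Sasaki

/-! ### Coordinate expressions in the preferred charts. -/

section Charts

variable {n : ℕ} {M : Type*} [TopologicalSpace M] [ChartedSpace (Model n) M]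

/-- The derivative of the inverse of the preferred chart at `c`. -/
def chartInv (c : M) (y : Model n) : Model n →L[ℝ] Model n :=
  mfderiv 𝓘(ℝ, Model n) (𝓡 (2 * n + 1)) (extChartAt (𝓡 (2 * n + 1)) c).symm y

/-- The derivative of the preferred chart at `c`. -/
def chartFwd (c x : M) : Model n →L[ℝ] Model n :=
  mfderiv (𝓡 (2 * n + 1)) 𝓘(ℝ, Model n) (extChartAt (𝓡 (2 * n + 1)) c) x

/-- The coordinate expression of a `1`-form in the preferred chart at `c`. -/
def rep1 (α : ∀ x : M, Tan n x →L[ℝ] ℝ) (c : M) (y : Model n) : Model n →L[ℝ] ℝ :=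
  (α ((extChartAt (𝓡 (2 * n + 1)) c).symm y)).comp
    (mfderiv 𝓘(ℝ, Model n) (𝓡 (2 * n + 1)) (extChartAt (𝓡 (2 * n + 1)) c).symm y)

/-- The exterior derivative of a `1`-form on the model space. -/
def locD (a : Model n → (Model n →L[ℝ] ℝ)) (y : Model n) : Model n →L[ℝ] Model n →L[ℝ] ℝ :=
  fderiv ℝ a y - (fderiv ℝ a y).flip

lemma locD_apply (a : Model n → (Model n →L[ℝ] ℝ)) (y v w : Model n) :
    locD a y v w = fderiv ℝ a y v w - fderiv ℝ a y w v := rfl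

lemma extD_eq (α : ∀ x : M, Tan n x →L[ℝ] ℝ) (x : M) (v w : Model n) :
    extD α x v w = locD (rep1 α x) (extChartAt (𝓡 (2 * n + 1)) x x) (chartFwd x x v)
      (chartFwd x x w) := rfl

lemma rep1_apply (α : ∀ x : M, Tan n x →L[ℝ] ℝ) (c : M) (y v : Model n) :
    rep1 α c y v = α ((extChartAt (𝓡 (2 * n + 1)) c).symm y) (chartInv c y v) := rfl

lemma isOpen_target (c : M) : IsOpen (extChartAt (𝓡 (2 * n + 1)) c).target :=
  isOpen_extChartAt_target c

variable [IsManifold (𝓡 (2 * n + 1)) ∞ M]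

lemma isManifold_one : IsManifold (𝓡 (2 * n + 1)) 1 M := IsManifold.of_le (n := ∞) (by simp)

lemma chartFwd_chartInv {c : M} {y : Model n} (hy : y ∈ (extChartAt (𝓡 (2 * n + 1)) c).target)
    (v : Model n) :
    chartFwd c ((extChartAt (𝓡 (2 * n + 1)) c).symm y) (chartInv c y v) = v := by
  have := isManifold_one (n := n) (M := M)
  have h := mfderiv_extChartAt_comp_mfderivWithin_extChartAt_symm (I := 𝓡 (2 * n + 1)) hy
  rw [ModelWithCorners.range_eq_univ, mfderivWithin_univ] at h
  exact congrArg (fun f : Model n →L[ℝ] Model n => f v) h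

lemma chartInv_chartFwd {c : M} {y : Model n} (hy : y ∈ (extChartAt (𝓡 (2 * n + 1)) c).target)
    (v : Model n) :
    chartInv c y (chartFwd c ((extChartAt (𝓡 (2 * n + 1)) c).symm y) v) = v := by
  have := isManifold_one (n := n) (M := M)
  have h := mfderivWithin_extChartAt_symm_comp_mfderiv_extChartAt (I := 𝓡 (2 * n + 1)) hy
  rw [ModelWithCorners.range_eq_univ, mfderivWithin_univ] at h
  exact congrArg (fun f : Model n →L[ℝ] Model n => f v) h

lemma chartInv_chartFwd' {c x : M} (hx : x ∈ (extChartAt (𝓡 (2 * n + 1)) c).source)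
    (v : Model n) :
    chartInv c (extChartAt (𝓡 (2 * n + 1)) c x) (chartFwd c x v) = v := by
  have h := chartInv_chartFwd ((extChartAt (𝓡 (2 * n + 1)) c).map_source hx) v
  rwa [(extChartAt (𝓡 (2 * n + 1)) c).left_inv hx] at h

/-- The tangent space at `x` is identified with the model space through this very chart. This is why
tensors at `x` can be handled as tensors on the model space. -/
lemma chartFwd_self (x : M) (v : Model n) : chartFwd x x v = v := by
  have := isManifold_one (n := n) (M := M)
  exact congrArg (fun f : Model n →L[ℝ] Model n => f v)
    (mfderiv_extChartAt_self (I := 𝓡 (2 * n + 1)) (x := x))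

lemma mdifferentiableAt_chart_symm {c : M} {y : Model n}
    (hy : y ∈ (extChartAt (𝓡 (2 * n + 1)) c).target) :
    MDifferentiableAt 𝓘(ℝ, Model n) (𝓡 (2 * n + 1)) (extChartAt (𝓡 (2 * n + 1)) c).symm y := by
  have := isManifold_one (n := n) (M := M)
  have h := mdifferentiableWithinAt_extChartAt_symm (I := 𝓡 (2 * n + 1)) hy
  rwa [ModelWithCorners.range_eq_univ, mdifferentiableWithinAt_univ] at h

/-- A `1`-form whose coordinate expressions are smooth. -/
def Smooth1 (α : ∀ x : M, Tan n x →L[ℝ] ℝ) : Prop :=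
  ∀ c, ContDiffOn ℝ ∞ (rep1 α c) (extChartAt (𝓡 (2 * n + 1)) c).target

/-- The transition map between two charts. -/
def transition (c c' : M) (y : Model n) : Model n :=
  extChartAt (𝓡 (2 * n + 1)) c' ((extChartAt (𝓡 (2 * n + 1)) c).symm y)

/-- The domain of the transition map between two charts. -/
def overlap (c c' : M) : Set (Model n) :=
  (extChartAt (𝓡 (2 * n + 1)) c).target ∩
    (extChartAt (𝓡 (2 * n + 1)) c).symm ⁻¹' (extChartAt (𝓡 (2 * n + 1)) c').source

lemma isOpen_overlap (c c' : M) : IsOpen (overlap (n := n) c c') :=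
  (continuousOn_extChartAt_symm c).isOpen_inter_preimage (isOpen_target c)
    (isOpen_extChartAt_source c')

lemma contDiffOn_transition (c c' : M) : ContDiffOn ℝ ∞ (transition (n := n) c c')
    (overlap c c') := by
  exact contDiffOn_ext_coord_change (I := 𝓡 (2 * n + 1)) (n := ∞) c' c

lemma fderiv_transition {c c' : M} {y : Model n} (hy : y ∈ overlap c c') (v : Model n) :
    fderiv ℝ (transition c c') y v =
      chartFwd c' ((extChartAt (𝓡 (2 * n + 1)) c).symm y) (chartInv c y v) := by
  have := isManifold_one (n := n) (M := M)
  have h1 := mdifferentiableAt_chart_symm hy.1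
  have h2 : MDifferentiableAt (𝓡 (2 * n + 1)) 𝓘(ℝ, Model n) (extChartAt (𝓡 (2 * n + 1)) c')
      ((extChartAt (𝓡 (2 * n + 1)) c).symm y) := mdifferentiableAt_extChartAt (by simpa using hy.2)
  have h3 := mfderiv_comp y h2 h1
  rw [mfderiv_eq_fderiv] at h3
  exact congrArg (fun f : Model n →L[ℝ] Model n => f v) h3

end Charts
end Sasaki

end

section

namespace Sasaki

lemma two_le_infty : (1 + 1 : ℕ∞ω) ≤ (∞ : ℕ∞ω) := by
  rw [one_add_one_eq_two]; exact WithTop.coe_le_coe.2 le_top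

/-! ### Independence of the exterior derivative of the chart. -/

section Naturality

variable {n : ℕ} {M : Type*} [TopologicalSpace M] [ChartedSpace (Model n) M]
  [IsManifold (𝓡 (2 * n + 1)) ∞ M]

lemma rep1_eq_comp_transition (α : ∀ x : M, Tan n x →L[ℝ] ℝ) {c c' : M} {y : Model n}
    (hy : y ∈ overlap c c') :
    rep1 α c y = (rep1 α c' (transition c c' y)).comp (fderiv ℝ (transition c c') y) := by
  ext v
  rw [ContinuousLinearMap.comp_apply, fderiv_transition hy, rep1_apply, rep1_apply]
  have h : (extChartAt (𝓡 (2 * n + 1)) c').symm (transition c c' y) =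
      (extChartAt (𝓡 (2 * n + 1)) c).symm y := (extChartAt (𝓡 (2 * n + 1)) c').left_inv hy.2
  have h2 := chartInv_chartFwd' hy.2 (chartInv c y v)
  rw [transition] at h ⊢
  rw [h2, h]

lemma mem_overlap {c c' x : M} (hx : x ∈ (extChartAt (𝓡 (2 * n + 1)) c).source)
    (hx' : x ∈ (extChartAt (𝓡 (2 * n + 1)) c').source) :
    extChartAt (𝓡 (2 * n + 1)) c x ∈ overlap (n := n) c c' :=
  ⟨(extChartAt (𝓡 (2 * n + 1)) c).map_source hx, by
    rwa [Set.mem_preimage, (extChartAt (𝓡 (2 * n + 1)) c).left_inv hx]⟩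

/-- The exterior derivative can be computed in any chart. -/
lemma extD_eq_of_mem {α : ∀ x : M, Tan n x →L[ℝ] ℝ} {c x : M}
    (hx : x ∈ (extChartAt (𝓡 (2 * n + 1)) c).source)
    (hα : DifferentiableAt ℝ (rep1 α c) (extChartAt (𝓡 (2 * n + 1)) c x)) (v w : Model n) :
    extD α x v w = locD (rep1 α c) (extChartAt (𝓡 (2 * n + 1)) c x) (chartFwd c x v)
      (chartFwd c x w) := by
  rw [extD_eq]
  have hy := mem_overlap (mem_extChartAt_source (I := 𝓡 (2 * n + 1)) x) hx
  set y := extChartAt (𝓡 (2 * n + 1)) x x with hydef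
  set τ := transition (n := n) x c with hτ
  have hτy : τ y = extChartAt (𝓡 (2 * n + 1)) c x := by
    rw [hτ, transition, hydef, extChartAt_to_inv]
  have hev : rep1 α x =ᶠ[𝓝 y] fun z => (rep1 α c (τ z)).comp (fderiv ℝ τ z) := by
    filter_upwards [(isOpen_overlap x c).mem_nhds hy] with z hz
    exact rep1_eq_comp_transition α hz
  have hτs : ContDiffAt ℝ ∞ τ y := (contDiffOn_transition x c).contDiffAt
    ((isOpen_overlap x c).mem_nhds hy)
  have hd1 : DifferentiableAt ℝ τ y := hτs.differentiableAt (by simp)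
  have hd2 : DifferentiableAt ℝ (fderiv ℝ τ) y :=
    (hτs.fderiv_right (m := 1) two_le_infty).differentiableAt (by simp)
  have hd3 : DifferentiableAt ℝ (fun z => rep1 α c (τ z)) y :=
    DifferentiableAt.comp (g := rep1 α c) y (by rwa [hτy]) hd1
  have hfd : ∀ v, fderiv ℝ τ y v = chartFwd c x (chartFwd x x v) := fun v => by
    rw [fderiv_transition hy]
    have h2 := chartInv_chartFwd' (mem_extChartAt_source (I := 𝓡 (2 * n + 1)) x) v
    rw [chartFwd_self] at h2
    rw [h2, hydef, extChartAt_to_inv, chartFwd_self]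
  have hder : ∀ v w, fderiv ℝ (rep1 α x) y v w =
      fderiv ℝ (rep1 α c) (τ y) (fderiv ℝ τ y v) (fderiv ℝ τ y w) +
        rep1 α c (τ y) (fderiv ℝ (fderiv ℝ τ) y v w) := fun v w => by
    rw [hev.fderiv_eq, fderiv_clm_comp hd3 hd2]
    have h4 : fderiv ℝ (fun z => rep1 α c (τ z)) y =
        (fderiv ℝ (rep1 α c) (τ y)).comp (fderiv ℝ τ y) :=
      fderiv_comp (g := rep1 α c) y (by rwa [hτy]) hd1
    rw [h4]
    simp [add_comm]
  -- Second derivatives of the transition map enter symmetrically, so they drop out of the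
  -- antisymmetrization.
  have hsymm : IsSymmSndFDerivAt ℝ τ y := hτs.isSymmSndFDerivAt (by simpa [one_add_one_eq_two] using two_le_infty)
  rw [locD_apply, locD_apply, hder, hder, hsymm.eq (chartFwd x x v) (chartFwd x x w), hfd, hfd,
    chartFwd_self, chartFwd_self, chartFwd_self, chartFwd_self, hτy]
  abel

lemma Smooth1.differentiableAt {α : ∀ x : M, Tan n x →L[ℝ] ℝ} (hα : Smooth1 α) {c : M}
    {y : Model n} (hy : y ∈ (extChartAt (𝓡 (2 * n + 1)) c).target) :
    DifferentiableAt ℝ (rep1 α c) y :=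
  ((hα c).contDiffAt ((isOpen_target c).mem_nhds hy)).differentiableAt (by simp)

lemma Smooth1.extD_eq {α : ∀ x : M, Tan n x →L[ℝ] ℝ} (hα : Smooth1 α) {c : M}
    {y : Model n} (hy : y ∈ (extChartAt (𝓡 (2 * n + 1)) c).target) (v w : Model n) :
    extD α ((extChartAt (𝓡 (2 * n + 1)) c).symm y) (chartInv c y v) (chartInv c y w) =
      locD (rep1 α c) y v w := by
  have hr := (extChartAt (𝓡 (2 * n + 1)) c).right_inv hy
  rw [extD_eq_of_mem ((extChartAt (𝓡 (2 * n + 1)) c).map_target hy)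
    (by rw [hr]; exact hα.differentiableAt hy), hr, chartFwd_chartInv hy, chartFwd_chartInv hy]

end Naturality

/-! ### Smooth sections of bundles have smooth coordinate expressions. -/

section Fields

variable {n : ℕ} {M : Type*} [TopologicalSpace M] [ChartedSpace (Model n) M]
  [IsManifold (𝓡 (2 * n + 1)) ∞ M]

lemma contDiffOn_of_contMDiffOn {F : Type*} [NormedAddCommGroup F] [NormedSpace ℝ F] {f : M → F}
    {c : M} (hf : ContMDiffOn (𝓡 (2 * n + 1)) 𝓘(ℝ, F) ∞ f (chartAt (Model n) c).source) :
    ContDiffOn ℝ ∞ (fun y => f ((extChartAt (𝓡 (2 * n + 1)) c).symm y))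
      (extChartAt (𝓡 (2 * n + 1)) c).target := by
  rw [← contMDiffOn_iff_contDiffOn]
  refine hf.comp (contMDiffOn_extChartAt_symm c) fun y hy => ?_
  have := (extChartAt (𝓡 (2 * n + 1)) c).map_target hy
  rwa [extChartAt_source] at this

/-- The coordinate expression of a vector field. -/
def repVec (X : ∀ x : M, Tan n x) (c : M) (y : Model n) : Model n :=
  chartFwd c ((extChartAt (𝓡 (2 * n + 1)) c).symm y) (X ((extChartAt (𝓡 (2 * n + 1)) c).symm y))

/-- The coordinate expression of a field of endomorphisms. -/
def repEnd (A : ∀ x : M, Tan n x →L[ℝ] Tan n x) (c : M) (y : Model n) : Model n →L[ℝ] Model n :=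
  (chartFwd c ((extChartAt (𝓡 (2 * n + 1)) c).symm y)).comp
    ((A ((extChartAt (𝓡 (2 * n + 1)) c).symm y)).comp (mfderiv 𝓘(ℝ, Model n) (𝓡 (2 * n + 1))
      (extChartAt (𝓡 (2 * n + 1)) c).symm y) : Model n →L[ℝ] Model n)

lemma repEnd_apply (A : ∀ x : M, Tan n x →L[ℝ] Tan n x) (c : M) (y v : Model n) :
    repEnd A c y v = chartFwd c ((extChartAt (𝓡 (2 * n + 1)) c).symm y)
      (A ((extChartAt (𝓡 (2 * n + 1)) c).symm y) (chartInv c y v)) := rfl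

/-- The trivialization of the tangent bundle at `c` is the derivative of the chart at `c`, so the
section read in the trivialization is exactly `rep1`. -/
lemma smooth1_of_contMDiff {α : ∀ x : M, Tan n x →L[ℝ] ℝ}
    (hα : ContMDiff (𝓡 (2 * n + 1)) ((𝓡 (2 * n + 1)).prod 𝓘(ℝ, Model n →L[ℝ] ℝ)) ∞
    (fun x : M => Bundle.TotalSpace.mk' (Model n →L[ℝ] ℝ)
      (E := fun x : M => Tan n x →L[ℝ] Bundle.Trivial M ℝ x) x (α x))) : Smooth1 α := by
  intro c
  have := isManifold_one (n := n) (M := M)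
  let e := trivializationAt (Model n →L[ℝ] ℝ)
      (fun x : M => Tan n x →L[ℝ] Bundle.Trivial M ℝ x) c
  have hbase : e.baseSet = (chartAt (Model n) c).source := by
    simp [e]
  have h1 := (e.contMDiffOn_section_baseSet_iff (IB := 𝓡 (2 * n + 1)) (n := ∞)
    (s := fun x => α x)).1 hα.contMDiffOn
  rw [hbase] at h1
  refine (contDiffOn_of_contMDiffOn h1).congr fun y hy => ?_
  have hys : (extChartAt (𝓡 (2 * n + 1)) c).symm y ∈ (chartAt (Model n) c).source := by
    simpa using (extChartAt (𝓡 (2 * n + 1)) c).map_target hy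
  have hL := TangentBundle.symmL_trivializationAt (I := 𝓡 (2 * n + 1)) hys
  rw [ModelWithCorners.range_eq_univ, mfderivWithin_univ,
    (extChartAt (𝓡 (2 * n + 1)) c).right_inv hy] at hL
  ext v
  have hv := congrArg (fun f : Model n →L[ℝ] Model n => f v) hL
  simp only [e, hom_trivializationAt_apply, ContinuousLinearMap.inCoordinates]
  rw [rep1_apply, ContinuousLinearMap.comp_apply, ContinuousLinearMap.comp_apply]
  have ht : ∀ t : ℝ, (Bundle.Trivialization.continuousLinearMapAt ℝ
      (trivializationAt ℝ (Bundle.Trivial M ℝ) c) ((extChartAt (𝓡 (2 * n + 1)) c).symm y)) t = t :=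
    fun t => by simp
  refine Eq.trans ?_ (ht _).symm
  exact congrArg (α ((extChartAt (𝓡 (2 * n + 1)) c).symm y)) hv.symm

lemma contDiffOn_repEnd {A : ∀ x : M, Tan n x →L[ℝ] Tan n x}
    (hA : ContMDiff (𝓡 (2 * n + 1))
    ((𝓡 (2 * n + 1)).prod 𝓘(ℝ, Model n →L[ℝ] Model n)) ∞
    (fun x : M => Bundle.TotalSpace.mk' (Model n →L[ℝ] Model n)
      (E := fun x : M => Tan n x →L[ℝ] Tan n x) x (A x))) (c : M) :
    ContDiffOn ℝ ∞ (repEnd A c) (extChartAt (𝓡 (2 * n + 1)) c).target := by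
  have := isManifold_one (n := n) (M := M)
  let e := trivializationAt (Model n →L[ℝ] Model n) (fun x : M => Tan n x →L[ℝ] Tan n x) c
  have hbase : e.baseSet = (chartAt (Model n) c).source := by
    simp [e]
  have h1 := (e.contMDiffOn_section_baseSet_iff (IB := 𝓡 (2 * n + 1)) (n := ∞)
    (s := fun x => A x)).1 hA.contMDiffOn
  rw [hbase] at h1
  refine (contDiffOn_of_contMDiffOn h1).congr fun y hy => ?_
  have hys : (extChartAt (𝓡 (2 * n + 1)) c).symm y ∈ (chartAt (Model n) c).source := by
    simpa using (extChartAt (𝓡 (2 * n + 1)) c).map_target hy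
  have hL := TangentBundle.symmL_trivializationAt (I := 𝓡 (2 * n + 1)) hys
  rw [ModelWithCorners.range_eq_univ, mfderivWithin_univ,
    (extChartAt (𝓡 (2 * n + 1)) c).right_inv hy] at hL
  have hR := TangentBundle.continuousLinearMapAt_trivializationAt (I := 𝓡 (2 * n + 1)) hys
  ext1 v
  have hv := congrArg (fun f : Model n →L[ℝ] Model n => f v) hL
  simp only [e, hom_trivializationAt_apply, ContinuousLinearMap.inCoordinates]
  rw [repEnd_apply, ContinuousLinearMap.comp_apply, ContinuousLinearMap.comp_apply]
  have hR' := congrArg (fun f : Model n →L[ℝ] Model n =>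
    f (A ((extChartAt (𝓡 (2 * n + 1)) c).symm y) (chartInv c y v))) hR
  refine hR'.symm.trans ?_
  exact congrArg (fun u : Model n => Bundle.Trivialization.continuousLinearMapAt ℝ
    (trivializationAt (Model n) (Tan n) c) ((extChartAt (𝓡 (2 * n + 1)) c).symm y)
    (A ((extChartAt (𝓡 (2 * n + 1)) c).symm y) u)) hv.symm

end Fields
end Sasaki

end

section

namespace Sasaki

/-! ### Globally defined test fields and the Lie bracket in a chart. -/

section Extension

variable {n : ℕ} {M : Type*} [TopologicalSpace M] [ChartedSpace (Model n) M]
  [IsManifold (𝓡 (2 * n + 1)) ∞ M]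

/-- A globally smooth vector field which is constant near `x` in the preferred chart at `x`. -/
lemma exists_constant_field [T2Space M] (x : M) (v : Model n) :
    ∃ X : ∀ z : M, Tan n z, ContMDiff (𝓡 (2 * n + 1)) (𝓡 (2 * n + 1)).tangent ∞
      (fun z : M => (⟨z, X z⟩ : TangentBundle (𝓡 (2 * n + 1)) M)) ∧
      ∀ᶠ y in 𝓝 (extChartAt (𝓡 (2 * n + 1)) x x), repVec X x y = v := by
  have := isManifold_one (n := n) (M := M)
  let e := trivializationAt (Model n) (TangentSpace (𝓡 (2 * n + 1)) (M := M)) x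
  have hbase : e.baseSet = (chartAt (Model n) x).source := by simp [e]
  -- The field with constant coordinates is cut off by a bump function, which equals one near `x`.
  let f : SmoothBumpFunction (𝓡 (2 * n + 1)) x := Classical.arbitrary _
  let s : ∀ z : M, Tan n z := fun z => e.symmL ℝ z v
  have hs : ContMDiffOn (𝓡 (2 * n + 1)) (𝓡 (2 * n + 1)).tangent ∞
      (fun z : M => (⟨z, s z⟩ : TangentBundle (𝓡 (2 * n + 1)) M)) e.baseSet := by
    refine (e.contMDiffOn_section_baseSet_iff (IB := 𝓡 (2 * n + 1)) (n := ∞) (s := s)).2 ?_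
    refine (contMDiffOn_const (c := v)).congr fun z hz => ?_
    have h1 := e.continuousLinearMapAt_symmL (R := ℝ) hz v
    have h2 := Bundle.Trivialization.coe_linearMapAt_of_mem (R := ℝ) e hz
    exact (congrFun h2 _).symm.trans h1
  refine ⟨fun z => f z • s z, ?_, ?_⟩
  · exact ContMDiffOn.smul_section_of_tsupport f.contMDiff.contMDiffOn e.open_baseSet
      (by rw [hbase]; exact f.tsupport_subset_chartAt_source) hs
  · have h1 : ∀ᶠ y in 𝓝 (extChartAt (𝓡 (2 * n + 1)) x x),
        f ((extChartAt (𝓡 (2 * n + 1)) x).symm y) = 1 := by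
      have hc : Filter.Tendsto (extChartAt (𝓡 (2 * n + 1)) x).symm
          (𝓝 (extChartAt (𝓡 (2 * n + 1)) x x)) (𝓝 x) := by
        have := continuousAt_extChartAt_symm (I := 𝓡 (2 * n + 1)) x
        rwa [ContinuousAt, extChartAt_to_inv] at this
      exact hc.eventually f.eventuallyEq_one
    filter_upwards [h1, (isOpen_target x).mem_nhds (mem_extChartAt_target (I := 𝓡 (2 * n + 1)) x)]
      with y hy1 hy
    have hys : (extChartAt (𝓡 (2 * n + 1)) x).symm y ∈ (chartAt (Model n) x).source := by
      simpa using (extChartAt (𝓡 (2 * n + 1)) x).map_target hy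
    have hL := TangentBundle.symmL_trivializationAt (I := 𝓡 (2 * n + 1)) hys
    rw [ModelWithCorners.range_eq_univ, mfderivWithin_univ,
      (extChartAt (𝓡 (2 * n + 1)) x).right_inv hy] at hL
    have hv : s ((extChartAt (𝓡 (2 * n + 1)) x).symm y) = chartInv x y v :=
      congrArg (fun f : Model n →L[ℝ] Model n => f v) hL
    rw [repVec, hy1, one_smul, hv]
    exact chartFwd_chartInv hy v

/-- The Lie bracket of two vector fields as an element of the model space. -/
def lieE (V W : ∀ z : M, Tan n z) (x : M) : Model n :=
  VectorField.mlieBracket (𝓡 (2 * n + 1)) V W x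

/-- `mlieBracket` pulls the fields back to the preferred chart at `x` and pushes the result forward
by a derivative that is the identity at `x`. -/
lemma lieE_eq (V W : ∀ z : M, Tan n z) (x : M) :
    lieE V W x =
      fderiv ℝ (repVec W x) (extChartAt (𝓡 (2 * n + 1)) x x)
        (repVec V x (extChartAt (𝓡 (2 * n + 1)) x x)) -
      fderiv ℝ (repVec V x) (extChartAt (𝓡 (2 * n + 1)) x x)
        (repVec W x (extChartAt (𝓡 (2 * n + 1)) x x)) := by
  have := isManifold_one (n := n) (M := M)
  have key : ∀ V : ∀ z : M, Tan n z, (VectorField.mpullbackWithin 𝓘(ℝ, Model n) (𝓡 (2 * n + 1))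
      (extChartAt (𝓡 (2 * n + 1)) x).symm V (Set.range (𝓡 (2 * n + 1)))) =ᶠ[𝓝
        (extChartAt (𝓡 (2 * n + 1)) x x)] repVec V x := fun V => by
    filter_upwards [(isOpen_target x).mem_nhds (mem_extChartAt_target (I := 𝓡 (2 * n + 1)) x)]
      with y hy
    rw [VectorField.mpullbackWithin_apply, ModelWithCorners.range_eq_univ, mfderivWithin_univ]
    have hinv : (chartInv x y).inverse = chartFwd x ((extChartAt (𝓡 (2 * n + 1)) x).symm y) :=
      ContinuousLinearMap.inverse_eq (by ext1 v; exact chartInv_chartFwd hy v)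
        (by ext1 v; exact chartFwd_chartInv hy v)
    exact congrArg (fun f : Model n →L[ℝ] Model n =>
      f (V ((extChartAt (𝓡 (2 * n + 1)) x).symm y))) hinv
  rw [lieE, VectorField.mlieBracket, VectorField.mlieBracketWithin_apply]
  have hid : (chartFwd x x : Model n →L[ℝ] Model n) = ContinuousLinearMap.id ℝ (Model n) := by
    ext1 v; exact chartFwd_self x v
  have hinv : (chartFwd x x).inverse = ContinuousLinearMap.id ℝ (Model n) := by
    rw [hid]; exact ContinuousLinearMap.inverse_id
  have h2 := congrArg (fun f : Model n →L[ℝ] Model n => f (VectorField.lieBracketWithin ℝ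
    (VectorField.mpullbackWithin 𝓘(ℝ, Model n) (𝓡 (2 * n + 1))
      (extChartAt (𝓡 (2 * n + 1)) x).symm V (Set.range (𝓡 (2 * n + 1))))
    (VectorField.mpullbackWithin 𝓘(ℝ, Model n) (𝓡 (2 * n + 1))
      (extChartAt (𝓡 (2 * n + 1)) x).symm W (Set.range (𝓡 (2 * n + 1))))
    ((extChartAt (𝓡 (2 * n + 1)) x).symm ⁻¹' Set.univ ∩ Set.range (𝓡 (2 * n + 1)))
    (extChartAt (𝓡 (2 * n + 1)) x x))) hinv
  refine h2.trans ?_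
  have h3 : (extChartAt (𝓡 (2 * n + 1)) x).symm ⁻¹' Set.univ ∩ Set.range (𝓡 (2 * n + 1)) =
      Set.univ := by
    rw [ModelWithCorners.range_eq_univ, Set.preimage_univ, Set.univ_inter]
  simp only [h3]
  have h4 := (key V).lieBracket_vectorField_eq (𝕜 := ℝ) (key W)
  exact (congrFun VectorField.lieBracketWithin_univ _).trans h4

lemma repVec_end (A : ∀ x : M, Tan n x →L[ℝ] Tan n x) (X : ∀ x : M, Tan n x) {c : M} {y : Model n}
    (hy : y ∈ (extChartAt (𝓡 (2 * n + 1)) c).target) :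
    repVec (fun z => A z (X z)) c y = repEnd A c y (repVec X c y) := by
  rw [repEnd_apply, repVec, repVec]
  exact (congrArg (fun u : Model n => chartFwd c ((extChartAt (𝓡 (2 * n + 1)) c).symm y)
    (A ((extChartAt (𝓡 (2 * n + 1)) c).symm y) u)) (chartInv_chartFwd hy _)).symm

end Extension

/-! ### The operator `d^c` and the normality condition in coordinates. -/

section Basic

variable {n : ℕ} {M : Type*} [TopologicalSpace M] [ChartedSpace (Model n) M]
  [IsManifold (𝓡 (2 * n + 1)) ∞ M]

/-- The coordinate expression of a function. -/
def rep0 (n : ℕ) {M : Type*} [TopologicalSpace M] [ChartedSpace (Model n) M]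
    (f : M → ℝ) (c : M) (y : Model n) : ℝ := f ((extChartAt (𝓡 (2 * n + 1)) c).symm y)

lemma contDiffOn_rep0 {f : M → ℝ} (hf : ContMDiff (𝓡 (2 * n + 1)) 𝓘(ℝ, ℝ) ∞ f) (c : M) :
    ContDiffOn ℝ ∞ (rep0 n f c) (extChartAt (𝓡 (2 * n + 1)) c).target :=
  contDiffOn_of_contMDiffOn hf.contMDiffOn

lemma rep1_diff {f : M → ℝ} (hf : ContMDiff (𝓡 (2 * n + 1)) 𝓘(ℝ, ℝ) ∞ f) {c : M} {y : Model n}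
    (hy : y ∈ (extChartAt (𝓡 (2 * n + 1)) c).target) :
    rep1 (diff n f) c y = fderiv ℝ (rep0 n f c) y := by
  have h1 := mdifferentiableAt_chart_symm hy
  have h2 : MDifferentiableAt (𝓡 (2 * n + 1)) 𝓘(ℝ, ℝ) f
      ((extChartAt (𝓡 (2 * n + 1)) c).symm y) := hf.mdifferentiableAt (by simp)
  have h3 := mfderiv_comp y h2 h1
  rw [mfderiv_eq_fderiv] at h3
  exact h3.symm

namespace SasakianStructure

variable (S : SasakianStructure n M)

lemma rep1_dc {f : M → ℝ} (hf : ContMDiff (𝓡 (2 * n + 1)) 𝓘(ℝ, ℝ) ∞ f) {c : M} {y : Model n}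
    (hy : y ∈ (extChartAt (𝓡 (2 * n + 1)) c).target) :
    rep1 (S.dc f) c y =
      (-(1 / 2 : ℝ)) • (fderiv ℝ (rep0 n f c) y).comp (repEnd S.Phi c y) := by
  ext v
  rw [rep1_apply, ← rep1_diff hf hy, smul_apply, ContinuousLinearMap.comp_apply, rep1_apply,
    repEnd_apply]
  exact (congrArg (fun u : Model n => (-(1 / 2 : ℝ)) •
    diff n f ((extChartAt (𝓡 (2 * n + 1)) c).symm y) u) (chartInv_chartFwd hy _)).symm

lemma smooth1_dc {f : M → ℝ} (hf : ContMDiff (𝓡 (2 * n + 1)) 𝓘(ℝ, ℝ) ∞ f) : Smooth1 (S.dc f) := by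
  intro c
  have h1 : ContDiffOn ℝ ∞ (fderiv ℝ (rep0 n f c)) (extChartAt (𝓡 (2 * n + 1)) c).target :=
    (contDiffOn_rep0 hf c).fderiv_of_isOpen (isOpen_target c) (by simp)
  refine ContDiffOn.congr ?_ fun y hy => S.rep1_dc hf hy
  exact (h1.clm_comp (contDiffOn_repEnd S.Phi_smooth c)).const_smul _

lemma smooth1_eta : Smooth1 S.eta := smooth1_of_contMDiff S.eta_smooth

/-- The tensor `Φ` at `x` on the model space. -/
def PhiE (x : M) : Model n →L[ℝ] Model n := S.Phi x

/-- The form `η` at `x` on the model space. -/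
def etaE (x : M) : Model n →L[ℝ] ℝ := S.eta x

/-- The Reeb field at `x` as an element of the model space. -/
def xiE (x : M) : Model n := S.xi x

/-- The exterior derivative of a `1`-form at `x` as a bilinear map on the model space. -/
def _root_.Sasaki.extDE (α : ∀ x : M, Tan n x →L[ℝ] ℝ) (x : M) : Model n →L[ℝ] Model n →L[ℝ] ℝ :=
  locD (rep1 α x) (extChartAt (𝓡 (2 * n + 1)) x x)

lemma _root_.Sasaki.extDE_apply (α : ∀ x : M, Tan n x →L[ℝ] ℝ) (x : M) (v w : Model n) :
    extDE α x v w = extD α x v w := by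
  rw [extD_eq, chartFwd_self, chartFwd_self]; rfl

variable {S}

lemma Phi_field_apply (x : M) (v : Model n) :
    repEnd S.Phi x (extChartAt (𝓡 (2 * n + 1)) x x) v = S.PhiE x v := by
  rw [repEnd_apply]
  have h : (extChartAt (𝓡 (2 * n + 1)) x).symm (extChartAt (𝓡 (2 * n + 1)) x x) = x :=
    extChartAt_to_inv x
  have h2 := chartInv_chartFwd' (mem_extChartAt_source (I := 𝓡 (2 * n + 1)) x) v
  rw [chartFwd_self] at h2
  rw [h2, h]
  exact chartFwd_self x _

/-- The normality condition in the preferred chart at `x`. -/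
lemma normal_chart [T2Space M] (S : SasakianStructure n M) (x : M) (v w : Model n) :
    fderiv ℝ (repEnd S.Phi x) (extChartAt (𝓡 (2 * n + 1)) x x) (S.PhiE x v) w -
      fderiv ℝ (repEnd S.Phi x) (extChartAt (𝓡 (2 * n + 1)) x x) (S.PhiE x w) v +
      S.PhiE x (fderiv ℝ (repEnd S.Phi x) (extChartAt (𝓡 (2 * n + 1)) x x) w v) -
      S.PhiE x (fderiv ℝ (repEnd S.Phi x) (extChartAt (𝓡 (2 * n + 1)) x x) v w) +
      extDE S.eta x v w • S.xiE x = 0 := by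
  set y := extChartAt (𝓡 (2 * n + 1)) x x with hy
  have hyt : y ∈ (extChartAt (𝓡 (2 * n + 1)) x).target :=
    mem_extChartAt_target (I := 𝓡 (2 * n + 1)) x
  -- For fields with constant coordinates near `x` the bracket `[X, Y]` vanishes, and only first
  -- derivatives of `Φ` survive in the remaining brackets.
  obtain ⟨X, hX, hXv⟩ := exists_constant_field x v
  obtain ⟨Y, hY, hYw⟩ := exists_constant_field x w
  have hval : ∀ {X : ∀ z : M, Tan n z} {v : Model n}, repVec X x y = v → X x = v := fun {X v} h => by
    rw [← h, repVec, hy, extChartAt_to_inv]; exact (chartFwd_self x _).symm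
  have hXx : X x = v := hval hXv.self_of_nhds
  have hYx : Y x = w := hval hYw.self_of_nhds
  have hPd : DifferentiableAt ℝ (repEnd S.Phi x) y :=
    ((contDiffOn_repEnd S.Phi_smooth x).contDiffAt ((isOpen_target x).mem_nhds hyt)).differentiableAt
      (by simp)
  have hcst : ∀ {X : ∀ z : M, Tan n z} {v : Model n}, (∀ᶠ y in 𝓝 y, repVec X x y = v) →
      fderiv ℝ (repVec X x) y = 0 := fun {X v} h => by
    have : repVec X x =ᶠ[𝓝 y] fun _ => v := h
    rw [this.fderiv_eq]; simp
  have hPhi : ∀ {X : ∀ z : M, Tan n z} {v : Model n}, (∀ᶠ y in 𝓝 y, repVec X x y = v) →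
      (∀ u, fderiv ℝ (repVec (fun z => S.Phi z (X z)) x) y u = fderiv ℝ (repEnd S.Phi x) y u v) ∧
      repVec (fun z => S.Phi z (X z)) x y = S.PhiE x v := fun {X v} h => by
    have : repVec (fun z => S.Phi z (X z)) x =ᶠ[𝓝 y] fun z => repEnd S.Phi x z v := by
      filter_upwards [h, (isOpen_target x).mem_nhds hyt] with z hz hzt
      rw [repVec_end _ _ hzt, hz]
    refine ⟨fun u => ?_, ?_⟩
    · rw [this.fderiv_eq, fderiv_clm_apply hPd (differentiableAt_const v)]
      simp
    · rw [this.self_of_nhds]; exact Phi_field_apply x v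
  have key : S.PhiE x (S.PhiE x (lieE X Y x)) +
      (lieE (fun z => S.Phi z (X z)) (fun z => S.Phi z (Y z)) x) -
      S.PhiE x (lieE (fun z => S.Phi z (X z)) Y x) -
      S.PhiE x (lieE X (fun z => S.Phi z (Y z)) x) +
      extD S.eta x (X x) (Y x) • S.xiE x = (0 : Model n) := S.normal X Y hX hY x
  have e1 := lieE_eq X Y x
  have e2 := lieE_eq (fun z => S.Phi z (X z)) (fun z => S.Phi z (Y z)) x
  have e3 := lieE_eq (fun z => S.Phi z (X z)) Y x
  have e4 := lieE_eq X (fun z => S.Phi z (Y z)) x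
  rw [← hy, hcst hXv, hcst hYw] at e1
  rw [← hy, (hPhi hXv).1, (hPhi hYw).1, (hPhi hXv).2, (hPhi hYw).2] at e2
  rw [← hy, (hPhi hXv).1, hcst hYw, hYw.self_of_nhds] at e3
  rw [← hy, (hPhi hYw).1, hcst hXv, hXv.self_of_nhds] at e4
  rw [e1, e2, e3, e4, hXx, hYx, ← extDE_apply] at key
  rw [← key]
  simp only [zero_apply, sub_zero, zero_sub, map_zero, zero_add, map_neg, sub_neg_eq_add]

end SasakianStructure
end Basic
end Sasaki

end

section

/-! ### Second order identities for basic functions. -/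

namespace Sasaki

/-- If the second derivative along a line were negative, the minimum would also be a local maximum;
the function would be constant along the line and its second derivative zero. -/
lemma second_deriv_nonneg_of_isLocalMin {E : Type*} [NormedAddCommGroup E] [NormedSpace ℝ E]
    {f : E → ℝ} {y : E} (hf : ContDiffAt ℝ 2 f y) (hmin : IsLocalMin f y) (v : E) :
    0 ≤ fderiv ℝ (fderiv ℝ f) y v v := by
  by_contra hneg
  push Not at hneg
  have hline : ∀ t : ℝ, HasDerivAt (fun s : ℝ => y + s • v) v t := fun t => by
    simpa using ((hasDerivAt_id t).smul_const v).const_add y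
  have hcont : Filter.Tendsto (fun s : ℝ => y + s • v) (𝓝 0) (𝓝 y) := by
    have : Continuous (fun s : ℝ => y + s • v) := by fun_prop
    simpa using this.tendsto 0
  set g : ℝ → ℝ := fun s => f (y + s • v) with hg
  have hd : ∀ᶠ z in 𝓝 y, DifferentiableAt ℝ f z := by
    filter_upwards [hf.eventually (by simp)] with z hz
    exact hz.differentiableAt (by simp)
  have hg1 : deriv g =ᶠ[𝓝 0] fun s => fderiv ℝ f (y + s • v) v := by
    filter_upwards [hcont.eventually hd] with s hs
    exact (hs.hasFDerivAt.comp_hasDerivAt s (hline s)).deriv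
  have hf2 : DifferentiableAt ℝ (fderiv ℝ f) y :=
    (hf.fderiv_right (m := 1) (by rw [one_add_one_eq_two])).differentiableAt (by simp)
  have hg2 : deriv (deriv g) 0 = fderiv ℝ (fderiv ℝ f) y v v := by
    rw [hg1.deriv_eq]
    have h0 : y + (0 : ℝ) • v = y := by simp
    have h1 : HasDerivAt (fun s : ℝ => fderiv ℝ f (y + s • v)) (fderiv ℝ (fderiv ℝ f) y v) 0 := by
      have h3 : DifferentiableAt ℝ (fderiv ℝ f) (y + (0 : ℝ) • v) := by rwa [h0]
      have := h3.hasFDerivAt.comp_hasDerivAt (0 : ℝ) (hline 0)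
      rwa [h0] at this
    have h2 := h1.clm_apply (hasDerivAt_const (0 : ℝ) v)
    simpa using h2.deriv
  have hgmin : IsLocalMin g 0 := by
    have := hcont.eventually hmin
    simpa [IsLocalMin, IsMinFilter, hg] using this
  have hgc : ContinuousAt g 0 := by
    have h0 : y + (0 : ℝ) • v = y := by simp
    exact ContinuousAt.comp (g := f) (by rw [h0]; exact hf.continuousAt)
      (by fun_prop)
  have hgmax : IsLocalMax g 0 :=
    isLocalMax_of_deriv_deriv_neg (by rw [hg2]; exact hneg) hgmin.deriv_eq_zero hgc
  have hgconst : g =ᶠ[𝓝 0] fun _ => g 0 := by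
    filter_upwards [hgmin, hgmax] with s h1 h2 using le_antisymm h2 h1
  have h3 : deriv g =ᶠ[𝓝 0] fun _ => 0 := by
    have := hgconst.deriv
    simpa using this
  have h4 : deriv (deriv g) 0 = 0 := by rw [h3.deriv_eq]; simp
  linarith [hg2 ▸ h4]

namespace SasakianStructure

variable {n : ℕ} {M : Type*} [TopologicalSpace M] [ChartedSpace (Model n) M]
  [IsManifold (𝓡 (2 * n + 1)) ∞ M] (S : SasakianStructure n M)

/-- The differential of a function at `x` on the model space. -/
def _root_.Sasaki.diffE (n : ℕ) {M : Type*} [TopologicalSpace M] [ChartedSpace (Model n) M]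
    (f : M → ℝ) (x : M) : Model n →L[ℝ] ℝ := diff n f x

/-- The form `d^c f` at `x` on the model space. -/
def dcE (f : M → ℝ) (x : M) : Model n →L[ℝ] ℝ := S.dc f x

lemma dcE_apply (f : M → ℝ) (x : M) (v : Model n) :
    S.dcE f x v = -(1 / 2 : ℝ) * diffE n f x (S.PhiE x v) := rfl

lemma etaE_xiE (x : M) : S.etaE x (S.xiE x) = 1 := S.eta_xi x

lemma PhiE_sq (x : M) (v : Model n) :
    S.PhiE x (S.PhiE x v) = -v + S.etaE x v • S.xiE x := S.Phi_sq x v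

lemma IsBasic.diffE_xiE {S : SasakianStructure n M} {f : M → ℝ} (hf : S.IsBasic f) (x : M) :
    diffE n f x (S.xiE x) = 0 := hf.2 x

lemma IsBasic.diffE_Phi_Phi {S : SasakianStructure n M} {f : M → ℝ} (hf : S.IsBasic f) (x : M)
    (v : Model n) : diffE n f x (S.PhiE x (S.PhiE x v)) = -diffE n f x v := by
  rw [PhiE_sq, map_add, map_neg, map_smul, hf.diffE_xiE, smul_zero, add_zero]

lemma fderiv_rep0_self {f : M → ℝ} (hf : ContMDiff (𝓡 (2 * n + 1)) 𝓘(ℝ, ℝ) ∞ f) (x : M)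
    (v : Model n) : fderiv ℝ (rep0 n f x) (extChartAt (𝓡 (2 * n + 1)) x x) v = diffE n f x v := by
  have hyt := mem_extChartAt_target (I := 𝓡 (2 * n + 1)) x
  rw [← rep1_diff hf hyt, rep1_apply]
  have h : (extChartAt (𝓡 (2 * n + 1)) x).symm (extChartAt (𝓡 (2 * n + 1)) x x) = x :=
    extChartAt_to_inv x
  have h2 := chartInv_chartFwd' (mem_extChartAt_source (I := 𝓡 (2 * n + 1)) x) v
  rw [chartFwd_self] at h2
  rw [h2, h]; rfl

lemma contDiffAt_rep0 {f : M → ℝ} (hf : ContMDiff (𝓡 (2 * n + 1)) 𝓘(ℝ, ℝ) ∞ f) {c : M}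
    {y : Model n} (hy : y ∈ (extChartAt (𝓡 (2 * n + 1)) c).target) :
    ContDiffAt ℝ ∞ (rep0 n f c) y := (contDiffOn_rep0 hf c).contDiffAt ((isOpen_target c).mem_nhds hy)

lemma contDiffAt_repPhi {c : M} {y : Model n} (hy : y ∈ (extChartAt (𝓡 (2 * n + 1)) c).target) :
    ContDiffAt ℝ ∞ (repEnd S.Phi c) y :=
  (contDiffOn_repEnd S.Phi_smooth c).contDiffAt ((isOpen_target c).mem_nhds hy)

lemma differentiableAt_fderiv_rep0 {f : M → ℝ} (hf : ContMDiff (𝓡 (2 * n + 1)) 𝓘(ℝ, ℝ) ∞ f) {c : M}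
    {y : Model n} (hy : y ∈ (extChartAt (𝓡 (2 * n + 1)) c).target) :
    DifferentiableAt ℝ (fderiv ℝ (rep0 n f c)) y :=
  ((contDiffAt_rep0 hf hy).fderiv_right (m := 1) two_le_infty).differentiableAt (by simp)

/-- The form `dd^c f` in the preferred chart at `x`. -/
lemma extDE_dc {f : M → ℝ} (hf : ContMDiff (𝓡 (2 * n + 1)) 𝓘(ℝ, ℝ) ∞ f) (x : M) (v w : Model n) :
    extDE (S.dc f) x v w = -(1 / 2 : ℝ) *
      (fderiv ℝ (fderiv ℝ (rep0 n f x)) (extChartAt (𝓡 (2 * n + 1)) x x) v (S.PhiE x w) +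
        diffE n f x (fderiv ℝ (repEnd S.Phi x) (extChartAt (𝓡 (2 * n + 1)) x x) v w) -
      (fderiv ℝ (fderiv ℝ (rep0 n f x)) (extChartAt (𝓡 (2 * n + 1)) x x) w (S.PhiE x v) +
        diffE n f x (fderiv ℝ (repEnd S.Phi x) (extChartAt (𝓡 (2 * n + 1)) x x) w v))) := by
  set y := extChartAt (𝓡 (2 * n + 1)) x x with hy
  have hyt : y ∈ (extChartAt (𝓡 (2 * n + 1)) x).target :=
    mem_extChartAt_target (I := 𝓡 (2 * n + 1)) x
  have hev : rep1 (S.dc f) x =ᶠ[𝓝 y] fun z =>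
      (-(1 / 2 : ℝ)) • (fderiv ℝ (rep0 n f x) z).comp (repEnd S.Phi x z) := by
    filter_upwards [(isOpen_target x).mem_nhds hyt] with z hz using S.rep1_dc hf hz
  have hd1 := differentiableAt_fderiv_rep0 hf hyt
  have hd2 : DifferentiableAt ℝ (repEnd S.Phi x) y := (S.contDiffAt_repPhi hyt).differentiableAt
    (by simp)
  have key : ∀ v w, fderiv ℝ (rep1 (S.dc f) x) y v w = -(1 / 2 : ℝ) *
      (fderiv ℝ (fderiv ℝ (rep0 n f x)) y v (S.PhiE x w) +
        diffE n f x (fderiv ℝ (repEnd S.Phi x) y v w)) := fun v w => by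
    have hd3 : DifferentiableAt ℝ
      (fun z => (fderiv ℝ (rep0 n f x) z).comp (repEnd S.Phi x z)) y := hd1.clm_comp hd2
    have h5 := fderiv_const_smul hd3 (-(1 / 2 : ℝ))
    have h6 : (fun z => (-(1 / 2 : ℝ)) • (fderiv ℝ (rep0 n f x) z).comp (repEnd S.Phi x z)) =
      (-(1 / 2 : ℝ)) • (fun z => (fderiv ℝ (rep0 n f x) z).comp (repEnd S.Phi x z)) := rfl
    rw [hev.fderiv_eq, h6, h5, fderiv_clm_comp hd1 hd2]
    simp only [smul_apply, add_apply, ContinuousLinearMap.comp_apply,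
      ContinuousLinearMap.compL_apply, ContinuousLinearMap.flip_apply, smul_eq_mul]
    rw [Phi_field_apply, fderiv_rep0_self hf]
    ring
  rw [extDE, ← hy, locD_apply, key, key]
  ring

/-- For basic `f` one has `df ∘ Φ² = -df` on a whole neighbourhood; this is its derivative in the
direction `u`. -/
lemma IsBasic.hessian_identity {S : SasakianStructure n M} {f : M → ℝ} (hf : S.IsBasic f) (x : M)
    (u w : Model n) :
    fderiv ℝ (fderiv ℝ (rep0 n f x)) (extChartAt (𝓡 (2 * n + 1)) x x) u
        (S.PhiE x (S.PhiE x w)) +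
      diffE n f x (fderiv ℝ (repEnd S.Phi x) (extChartAt (𝓡 (2 * n + 1)) x x) u (S.PhiE x w)) +
      diffE n f x (S.PhiE x (fderiv ℝ (repEnd S.Phi x) (extChartAt (𝓡 (2 * n + 1)) x x) u w)) =
      -fderiv ℝ (fderiv ℝ (rep0 n f x)) (extChartAt (𝓡 (2 * n + 1)) x x) u w := by
  set y := extChartAt (𝓡 (2 * n + 1)) x x with hy
  have hyt : y ∈ (extChartAt (𝓡 (2 * n + 1)) x).target :=
    mem_extChartAt_target (I := 𝓡 (2 * n + 1)) x
  have hd1 := differentiableAt_fderiv_rep0 hf.1 hyt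
  have hd2 : DifferentiableAt ℝ (repEnd S.Phi x) y := (S.contDiffAt_repPhi hyt).differentiableAt
    (by simp)
  have hev : (fun z => fderiv ℝ (rep0 n f x) z (repEnd S.Phi x z (repEnd S.Phi x z w))) =ᶠ[𝓝 y]
      fun z => -(fderiv ℝ (rep0 n f x) z w) := by
    filter_upwards [(isOpen_target x).mem_nhds hyt] with z hz
    rw [← rep1_diff hf.1 hz, rep1_apply, rep1_apply, repEnd_apply, repEnd_apply]
    have h1 := chartInv_chartFwd hz
      (S.PhiE ((extChartAt (𝓡 (2 * n + 1)) x).symm z) (chartInv x z w))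
    have h2 := chartInv_chartFwd hz (S.PhiE ((extChartAt (𝓡 (2 * n + 1)) x).symm z)
      (S.PhiE ((extChartAt (𝓡 (2 * n + 1)) x).symm z) (chartInv x z w)))
    have h3 := hf.diffE_Phi_Phi ((extChartAt (𝓡 (2 * n + 1)) x).symm z) (chartInv x z w)
    refine Eq.trans ?_ h3
    refine congrArg (diffE n f ((extChartAt (𝓡 (2 * n + 1)) x).symm z)) ?_
    refine Eq.trans ?_ h2
    exact congrArg (fun t : Model n => chartInv x z (chartFwd x
      ((extChartAt (𝓡 (2 * n + 1)) x).symm z)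
        (S.PhiE ((extChartAt (𝓡 (2 * n + 1)) x).symm z) t))) h1
  have hd3 : DifferentiableAt ℝ (fun z => repEnd S.Phi x z w) y :=
    hd2.clm_apply (differentiableAt_const w)
  have hd4 : DifferentiableAt ℝ (fun z => repEnd S.Phi x z (repEnd S.Phi x z w)) y :=
    hd2.clm_apply hd3
  have hP : ∀ v, repEnd S.Phi x y v = S.PhiE x v := Phi_field_apply x
  have hF : ∀ v, fderiv ℝ (rep0 n f x) y v = diffE n f x v := fderiv_rep0_self hf.1 x
  have h7 := congrArg (fun L : Model n →L[ℝ] ℝ => L u) (hev.fderiv_eq (𝕜 := ℝ))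
  rw [fderiv_clm_apply hd1 hd4, fderiv_clm_apply hd2 hd3,
    fderiv_clm_apply hd2 (differentiableAt_const w), fderiv_fun_neg,
    fderiv_clm_apply hd1 (differentiableAt_const w)] at h7
  simp only [add_apply, ContinuousLinearMap.comp_apply, neg_apply,
    ContinuousLinearMap.flip_apply, fderiv_fun_const, Pi.zero_apply, zero_apply, map_zero,
    zero_add, map_add, hP, hF] at h7
  linarith

lemma hessian_symm {f : M → ℝ} (hf : ContMDiff (𝓡 (2 * n + 1)) 𝓘(ℝ, ℝ) ∞ f) (x : M)
    (u w : Model n) :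
    fderiv ℝ (fderiv ℝ (rep0 n f x)) (extChartAt (𝓡 (2 * n + 1)) x x) u w =
      fderiv ℝ (fderiv ℝ (rep0 n f x)) (extChartAt (𝓡 (2 * n + 1)) x x) w u :=
  ((contDiffAt_rep0 hf (mem_extChartAt_target (I := 𝓡 (2 * n + 1)) x)).isSymmSndFDerivAt
    (by simpa [one_add_one_eq_two] using two_le_infty)).eq u w

/-- `dd^c f` is `Φ`-invariant. -/
lemma IsBasic.extDE_Phi_Phi [T2Space M] {S : SasakianStructure n M} {f : M → ℝ} (hf : S.IsBasic f)
    (x : M) (v w : Model n) :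
    extDE (S.dc f) x (S.PhiE x v) (S.PhiE x w) = extDE (S.dc f) x v w := by
  rw [S.extDE_dc hf.1, S.extDE_dc hf.1]
  have h1 := hf.hessian_identity x (S.PhiE x v) w
  have h2 := hf.hessian_identity x (S.PhiE x w) v
  -- The Hessian terms are exchanged by the two identities above. The first derivatives of `Φ` that
  -- are left over form `df ∘ Φ` applied to the normality condition, whose `ξ` part is killed.
  have h3 := congrArg (fun u => diffE n f x (S.PhiE x u)) (S.normal_chart x v w)
  simp only [map_add, map_sub, hf.diffE_Phi_Phi, map_smul, map_zero] at h3
  have h4 : diffE n f x (S.PhiE x (S.xiE x)) = 0 := by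
    have h5 := hf.diffE_Phi_Phi x (S.PhiE x (S.xiE x))
    rw [S.PhiE_sq x (S.xiE x), etaE_xiE, one_smul, neg_add_cancel, map_zero, map_zero] at h5
    linarith
  rw [h4] at h3
  have h5 := hessian_symm hf.1 x v (S.PhiE x w)
  have h6 := hessian_symm hf.1 x w (S.PhiE x v)
  simp only [smul_zero, add_zero] at h3
  linarith

lemma _root_.Sasaki.extDE_skew (α : ∀ x : M, Tan n x →L[ℝ] ℝ) (x : M) (v w : Model n) :
    extDE α x v w = -extDE α x w v := by
  rw [extDE, locD_apply, locD_apply]; ring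

/-- At a minimum point `dd^c f` is nonnegative. -/
lemma IsBasic.extDE_dc_nonneg {S : SasakianStructure n M} {f : M → ℝ} (hf : S.IsBasic f)
    {x : M} (hmin : ∀ z, f x ≤ f z) (v : Model n) : 0 ≤ extDE (S.dc f) x v (S.PhiE x v) := by
  have hyt := mem_extChartAt_target (I := 𝓡 (2 * n + 1)) x
  have hloc : IsLocalMin (rep0 n f x) (extChartAt (𝓡 (2 * n + 1)) x x) := by
    refine Filter.Eventually.of_forall fun z => ?_
    rw [rep0, extChartAt_to_inv]
    exact hmin _
  have hs : ContDiffAt ℝ 2 (rep0 n f x) (extChartAt (𝓡 (2 * n + 1)) x x) :=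
    (contDiffAt_rep0 hf.1 hyt).of_le (by simpa [one_add_one_eq_two] using two_le_infty)
  have h0 : ∀ u, diffE n f x u = 0 := fun u => by
    rw [← fderiv_rep0_self hf.1, hloc.fderiv_eq_zero]; rfl
  have h1 := second_deriv_nonneg_of_isLocalMin hs hloc v
  have h2 := second_deriv_nonneg_of_isLocalMin hs hloc (S.PhiE x v)
  -- Where `df = 0`, this turns `dd^c f(v, Φv)` into half of `Hess(v, v) + Hess(Φv, Φv)`.
  have h3 := hf.hessian_identity x v v
  rw [S.extDE_dc hf.1]
  simp only [h0, add_zero] at h3 ⊢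
  linarith

end SasakianStructure
end Sasaki

end

section

/-! ### The deformed Sasakian structure at a point. -/

namespace Sasaki

lemma IsAdapted.quadratic {V : Type*} [AddCommGroup V] [Module ℝ V] {η : V →ₗ[ℝ] ℝ} {ξ : V}
    {J : V →ₗ[ℝ] V} {Ω θ : V →ₗ[ℝ] V →ₗ[ℝ] ℝ} {n : ℕ} {b : Module.Basis (Fin (2 * n + 1)) ℝ V}
    {c : Fin n → ℝ} (h : IsAdapted b η ξ J Ω θ c) (hJ : AlmostContact η ξ J) (s r : ℝ) (v : V) :
    (s • Ω + r • θ) v (J v) =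
      ∑ k, (s + r * c k) * (b.repr v (fstIdx k) ^ 2 + b.repr v (sndIdx k) ^ 2) := by
  have h1 : ∀ i j, (s • Ω + r • θ) (b i) (b j) = stdForm (fun k => s + r * c k) i j := fun i j => by
    simp only [LinearMap.add_apply, LinearMap.smul_apply, h.form, h.form', smul_eq_mul, stdForm,
      Finset.mul_sum, ← Finset.sum_add_distrib]
    exact Finset.sum_congr rfl fun k _ => by ring
  set τ := s • Ω + r • θ
  set x := b.repr v with hx
  have hv : v = x (reebIdx n) • b (reebIdx n) +
      ∑ k, (x (fstIdx k) • b (fstIdx k) + x (sndIdx k) • b (sndIdx k)) := by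
    conv_lhs => rw [← b.sum_repr v, sum_idx]
  have hJv : J v = ∑ k, (x (fstIdx k) • b (sndIdx k) - x (sndIdx k) • b (fstIdx k)) := by
    conv_lhs => rw [hv]
    simp only [map_add, map_smul, map_sum, h.reeb, hJ.J_xi, smul_zero, zero_add, h.J_snd hJ,
      smul_neg, ← h.snd, sub_eq_add_neg]
  rw [hJv]
  conv_lhs => rw [hv]
  simp only [map_add, map_sum, map_sub, map_smul, LinearMap.add_apply, LinearMap.sum_apply,
    LinearMap.smul_apply, h1, stdForm_reeb_left, stdForm_fst_fst, stdForm_snd_snd,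
    stdForm_fst_snd, stdForm_snd_fst, smul_eq_mul]
  simp only [mul_ite, mul_zero, add_zero, zero_add,
    Finset.sum_sub_distrib, Finset.sum_ite_eq', Finset.mem_univ, if_true]
  simp only [← Finset.sum_sub_distrib]
  refine Finset.sum_congr rfl fun k _ => ?_
  ring

/-- A continuous bilinear form as a bilinear form. -/
def bil {n : ℕ} (τ : Model n →L[ℝ] Model n →L[ℝ] ℝ) : Model n →ₗ[ℝ] Model n →ₗ[ℝ] ℝ :=
  (ContinuousLinearMap.coeLM ℝ).comp τ.toLinearMap

@[simp] lemma bil_apply {n : ℕ} (τ : Model n →L[ℝ] Model n →L[ℝ] ℝ) (v w : Model n) :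
    bil τ v w = τ v w := rfl

lemma bil_add_smul {n : ℕ} (τ τ' : Model n →L[ℝ] Model n →L[ℝ] ℝ) (s : ℝ) :
    bil (τ + s • τ') = (1 : ℝ) • bil τ + s • bil τ' := by
  ext v w; simp

/-- The standard basis of the model space. -/
def stdBasis (n : ℕ) : Module.Basis (Fin (2 * n + 1)) ℝ (Model n) :=
  (EuclideanSpace.basisFun (Fin (2 * n + 1)) ℝ).toBasis

lemma stdBasis_apply (n : ℕ) (i : Fin (2 * n + 1)) :
    stdBasis n i = EuclideanSpace.single i (1 : ℝ) := by
  simp [stdBasis]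

lemma finrank_model (n : ℕ) : Module.finrank ℝ (Model n) = 2 * n + 1 := by simp

namespace SasakianStructure

variable {n : ℕ} {M : Type*} [TopologicalSpace M] [ChartedSpace (Model n) M]
  [IsManifold (𝓡 (2 * n + 1)) ∞ M] (S : SasakianStructure n M)

/-- The deformed contact form at `x` on the model space. -/
def etaDE (φ : M → ℝ) (x : M) : Model n →L[ℝ] ℝ := S.etaE x + S.dcE φ x

/-- The transverse Kähler form `dη_φ` at `x` on the model space. -/
def kahler (φ : M → ℝ) (x : M) : Model n →L[ℝ] Model n →L[ℝ] ℝ := extDE (S.etaDef φ) x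

/-- The deformed tensor `Φ_φ` at `x` on the model space. -/
def JE (φ : M → ℝ) (x : M) : Model n →L[ℝ] Model n :=
  S.PhiE x - ((S.dcE φ x).comp (S.PhiE x)).smulRight (S.xiE x)

lemma JE_apply (φ : M → ℝ) (x : M) (v : Model n) :
    S.JE φ x v = S.PhiE x v - S.dcE φ x (S.PhiE x v) • S.xiE x := rfl

lemma almostContact (x : M) :
    AlmostContact (S.etaE x).toLinearMap (S.xiE x) (S.PhiE x).toLinearMap :=
  ⟨S.etaE_xiE x, S.PhiE_sq x⟩

lemma PhiE_xiE (x : M) : S.PhiE x (S.xiE x) = 0 := (S.almostContact x).J_xi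

lemma etaE_PhiE (x : M) (v : Model n) : S.etaE x (S.PhiE x v) = 0 := (S.almostContact x).eta_J v

lemma dcE_xiE (f : M → ℝ) (x : M) : S.dcE f x (S.xiE x) = 0 := by
  rw [dcE_apply, PhiE_xiE, map_zero, mul_zero]

-- The deformed tensor is `Φ` corrected along `ξ` so that its image lies in the kernel of `η_φ`; the
-- correction does not affect `d^c φ`, because `d^c φ(ξ) = 0`.
variable {S} in
lemma IsBasic.almostContact {φ : M → ℝ} (hφ : S.IsBasic φ) (x : M) :
    AlmostContact (S.etaDE φ x).toLinearMap (S.xiE x) (S.JE φ x).toLinearMap := by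
  refine ⟨?_, fun v => ?_⟩
  · change S.etaE x (S.xiE x) + S.dcE φ x (S.xiE x) = 1
    rw [dcE_xiE, add_zero, etaE_xiE]
  · change S.JE φ x (S.JE φ x v) = -v + (S.etaE x v + S.dcE φ x v) • S.xiE x
    have h1 : S.dcE φ x (S.PhiE x (S.PhiE x v)) = -S.dcE φ x v := by
      rw [dcE_apply, hφ.diffE_Phi_Phi, dcE_apply]; ring
    rw [JE_apply, JE_apply, map_sub, map_smul, PhiE_xiE, smul_zero, sub_zero, h1, PhiE_sq]
    module

lemma extDE_add {α β : ∀ x : M, Tan n x →L[ℝ] ℝ} (hα : Smooth1 α) (hβ : Smooth1 β) (x : M) :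
    extDE (fun z => α z + β z) x = extDE α x + extDE β x := by
  have hyt := mem_extChartAt_target (I := 𝓡 (2 * n + 1)) x
  have h : rep1 (fun z => α z + β z) x = rep1 α x + rep1 β x := rfl
  rw [extDE, extDE, extDE, h, locD, fderiv_add (hα.differentiableAt hyt) (hβ.differentiableAt hyt)]
  ext v w
  simp [locD_apply]; ring

lemma kahler_eq {φ : M → ℝ} (hφ : ContMDiff (𝓡 (2 * n + 1)) 𝓘(ℝ, ℝ) ∞ φ) (x : M) :
    S.kahler φ x = extDE S.eta x + extDE (S.dc φ) x :=
  extDE_add S.smooth1_eta (S.smooth1_dc hφ) x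

lemma extDE_xi (x : M) (v : Model n) : extDE S.eta x (S.xiE x) v = 0 := by
  rw [extDE_apply]; exact S.xi_extD x v

lemma extDE_eta_Phi (x : M) (v w : Model n) :
    extDE S.eta x v (S.PhiE x w) = S.g.inner x v w - S.etaE x v * S.etaE x w := by
  rw [extDE_apply]
  exact (S.extD_eta x v (S.PhiE x w)).trans (S.g_Phi x v w)

/-- `Φ_φ - Φ` takes values in the line of `ξ`, which `τ` annihilates. Transverse forms therefore do
not notice the deformation, and one notion of invariance serves all `φ`. -/
lemma isTransverse_of_Phi {τ : Model n →L[ℝ] Model n →L[ℝ] ℝ} (x : M)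
    (h1 : ∀ v w, τ v w = -τ w v) (h2 : ∀ v, τ (S.xiE x) v = 0)
    (h3 : ∀ v w, τ (S.PhiE x v) (S.PhiE x w) = τ v w) (φ : M → ℝ) :
    IsTransverse (S.xiE x) (S.JE φ x).toLinearMap (bil τ) := by
  refine ⟨h1, h2, fun v w => ?_⟩
  change τ (S.JE φ x v) (S.JE φ x w) = τ v w
  have h4 : ∀ v, τ v (S.xiE x) = 0 := fun v => by rw [h1, h2, neg_zero]
  rw [JE_apply, JE_apply, map_sub, map_sub, map_smul, map_smul]
  simp [h2, h4, h3]

lemma isTransverse_extDE_eta (x : M) (φ : M → ℝ) :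
    IsTransverse (S.xiE x) (S.JE φ x).toLinearMap (bil (extDE S.eta x)) := by
  refine S.isTransverse_of_Phi x (extDE_skew _ _) (S.extDE_xi x) (fun v w => ?_) φ
  rw [extDE_eta_Phi, etaE_PhiE, zero_mul, sub_zero]
  have := S.extD_eta x v w
  rw [extDE_apply, this]; rfl

variable {S} in
lemma IsBasic.extDE_xi [T2Space M] {f : M → ℝ} (hf : S.IsBasic f) (x : M) (v : Model n) :
    extDE (S.dc f) x (S.xiE x) v = 0 := by
  rw [← hf.extDE_Phi_Phi, PhiE_xiE, map_zero]; rfl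

variable {S} in
lemma IsBasic.isTransverse [T2Space M] {f : M → ℝ} (hf : S.IsBasic f) (x : M) (φ : M → ℝ) :
    IsTransverse (S.xiE x) (S.JE φ x).toLinearMap (bil (extDE (S.dc f) x)) :=
  S.isTransverse_of_Phi x (extDE_skew _ _) (hf.extDE_xi x) (hf.extDE_Phi_Phi x) φ

variable {S} in
lemma IsBasic.isTransverse_kahler [T2Space M] {f : M → ℝ} (hf : S.IsBasic f) (x : M) (φ : M → ℝ) :
    IsTransverse (S.xiE x) (S.JE φ x).toLinearMap (bil (S.kahler f x)) := by
  rw [S.kahler_eq hf.1]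
  refine S.isTransverse_of_Phi x (fun v w => ?_) (fun v => ?_) (fun v w => ?_) φ
  · rw [add_apply, add_apply, add_apply, add_apply, extDE_skew S.eta, extDE_skew (S.dc f), neg_add]
  · rw [add_apply, add_apply, S.extDE_xi, hf.extDE_xi, add_zero]
  · rw [add_apply, add_apply, add_apply, add_apply, hf.extDE_Phi_Phi]
    congr 1
    rw [extDE_eta_Phi, etaE_PhiE, zero_mul, sub_zero]
    have := S.extD_eta x v w
    rw [extDE_apply, this]; rfl

/-- Positivity of the transverse metric `dη_φ(·, Φ ·)` at `x`. -/
def PosAt (φ : M → ℝ) (x : M) : Prop :=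
  ∀ v : Model n, S.PhiE x v ≠ 0 → 0 < S.kahler φ x v (S.PhiE x v)

/-- The deformed metric at `x` on the model space. -/
def metricE (φ : M → ℝ) (x : M) : Model n →ₗ[ℝ] Model n →ₗ[ℝ] ℝ :=
  contactMetric (S.etaDE φ x).toLinearMap (S.JE φ x).toLinearMap (bil (S.kahler φ x))

lemma gDef_eq (φ : M → ℝ) (x : M) (v w : Model n) : S.gDef φ x v w = S.metricE φ x v w := by
  rw [metricE, contactMetric_apply, bil_apply, kahler, ContinuousLinearMap.coe_coe, extDE_apply]
  rfl

variable {S} in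
lemma IsBasic.kahler_JE [T2Space M] {f : M → ℝ} (hf : S.IsBasic f) (x : M) (v w : Model n)
    (φ : M → ℝ) : S.kahler f x v (S.JE φ x w) = S.kahler f x v (S.PhiE x w) := by
  have h := (hf.isTransverse_kahler x φ).xi_right v
  rw [bil_apply] at h
  rw [JE_apply, map_sub, map_smul, h, smul_zero, sub_zero]

-- The transverse part degenerates exactly on the line of `ξ`, where the term `η_φ ⊗ η_φ` takes
-- over.
variable {S} in
lemma PosAt.metric_pos [T2Space M] {φ : M → ℝ} {x : M} (h : S.PosAt φ x) (hφ : S.IsBasic φ)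
    (v : Model n) (hv : v ≠ 0) : 0 < S.metricE φ x v v := by
  rw [metricE, contactMetric_apply, bil_apply]
  change 0 < S.kahler φ x v (S.JE φ x v) + S.etaDE φ x v * S.etaDE φ x v
  rw [hφ.kahler_JE]
  by_cases h0 : S.PhiE x v = 0
  · have h1 := S.PhiE_sq x v
    rw [h0, map_zero] at h1
    have h2 : v = S.etaE x v • S.xiE x := by rw [← sub_eq_zero, ← neg_eq_zero, h1]; abel
    have h3 : S.etaE x v ≠ 0 := by
      intro h4; rw [h4, zero_smul] at h2; exact hv h2
    have h5 : S.etaDE φ x v = S.etaE x v := by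
      change S.etaE x v + S.dcE φ x v = _
      rw [dcE_apply, h0, map_zero, mul_zero, add_zero]
    rw [h0, map_zero, zero_add, h5]
    exact mul_self_pos.2 h3
  · have := h v h0
    nlinarith [mul_self_nonneg (S.etaDE φ x v)]

lemma isBasic_zero : S.IsBasic (fun _ : M => (0 : ℝ)) :=
  ⟨contMDiff_const, fun x => by
    have h : diff n (fun _ : M => (0 : ℝ)) x = 0 := by
      rw [diff, mfderiv_const]; rfl
    rw [h]; rfl⟩

lemma diffE_zero (x : M) : diffE n (fun _ : M => (0 : ℝ)) x = 0 := by
  rw [diffE, diff, mfderiv_const]; rfl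

lemma dc_zero : S.dc (fun _ : M => (0 : ℝ)) = fun _ => 0 := by
  funext x
  have : diff n (fun _ : M => (0 : ℝ)) x = 0 := diffE_zero x
  rw [dc, this, ContinuousLinearMap.zero_comp, smul_zero]

lemma etaDef_zero : S.etaDef (fun _ : M => (0 : ℝ)) = S.eta := by
  funext x; rw [etaDef, dc_zero, add_zero]

lemma kahler_zero (x : M) : S.kahler (fun _ : M => (0 : ℝ)) x = extDE S.eta x := by
  rw [kahler, etaDef_zero]

/-- By invariance `dη(v, Φv) = dη(Φv, Φ²v)`, which is `g(Φv, Φv)`. -/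
lemma posAt_zero (x : M) : S.PosAt (fun _ : M => (0 : ℝ)) x := by
  intro v hv
  have h2 := S.extDE_eta_Phi x (S.PhiE x v) (S.PhiE x v)
  rw [etaE_PhiE, zero_mul, sub_zero] at h2
  have h3 : extDE S.eta x (S.PhiE x v) (S.PhiE x (S.PhiE x v)) = extDE S.eta x v (S.PhiE x v) := by
    have := (S.isTransverse_extDE_eta x (fun _ => 0)).inv v (S.PhiE x v)
    have hJ : ∀ u, S.JE (fun _ => 0) x u = S.PhiE x u := fun u => by
      have h0 : S.dcE (fun _ => 0) x (S.PhiE x u) = 0 := by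
        rw [dcE_apply, diffE_zero]; simp
      rw [JE_apply, h0, zero_smul, sub_zero]
    change extDE S.eta x (S.JE (fun _ => 0) x v) (S.JE (fun _ => 0) x (S.PhiE x v)) = _ at this
    rw [hJ, hJ] at this
    exact this
  rw [kahler_zero, ← h3, h2]
  exact S.g.pos x (S.PhiE x v) hv

variable {S} in
lemma PosAt.exists_adapted [T2Space M] {φ ψ : M → ℝ} {x : M} (h : S.PosAt φ x) (hφ : S.IsBasic φ)
    (hψ : S.IsBasic ψ) : ∃ (b : Module.Basis (Fin (2 * n + 1)) ℝ (Model n)) (c : Fin n → ℝ),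
    IsAdapted b (S.etaDE φ x).toLinearMap (S.xiE x) (S.JE φ x).toLinearMap (bil (S.kahler φ x))
      (bil (extDE (S.dc ψ) x)) c :=
  exists_adapted_basis (finrank_model n) (hφ.almostContact x) (hφ.isTransverse_kahler x φ)
    (hψ.isTransverse x φ) (h.metric_pos hφ)

end SasakianStructure
end Sasaki

end

section

namespace Sasaki

/-! ### Leibniz rules and dependence of the differential forms on the potential. -/

section Linear

variable {n : ℕ} {M : Type*} [TopologicalSpace M] [ChartedSpace (Model n) M]
  [IsManifold (𝓡 (2 * n + 1)) ∞ M]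

lemma diffE_add_smul {f h : M → ℝ} (hf : ContMDiff (𝓡 (2 * n + 1)) 𝓘(ℝ, ℝ) ∞ f)
    (hh : ContMDiff (𝓡 (2 * n + 1)) 𝓘(ℝ, ℝ) ∞ h) (s : ℝ) (x : M) :
    diffE n (fun z => f z + s * h z) x = diffE n f x + s • diffE n h x := by
  have hf' := (hf.mdifferentiableAt (x := x) (by simp)).hasMFDerivAt
  have hh' := (hh.mdifferentiableAt (x := x) (by simp)).hasMFDerivAt
  exact (hf'.add (hh'.const_smul s)).mfderiv

lemma diffE_mul {f h : M → ℝ} (hf : ContMDiff (𝓡 (2 * n + 1)) 𝓘(ℝ, ℝ) ∞ f)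
    (hh : ContMDiff (𝓡 (2 * n + 1)) 𝓘(ℝ, ℝ) ∞ h) (x : M) :
    diffE n (fun z => f z * h z) x = f x • diffE n h x + h x • diffE n f x := by
  have hf' := (hf.mdifferentiableAt (x := x) (by simp)).hasMFDerivAt
  have hh' := (hh.mdifferentiableAt (x := x) (by simp)).hasMFDerivAt
  exact (hf'.mul hh').mfderiv

lemma rep1_self (α : ∀ x : M, Tan n x →L[ℝ] ℝ) (x : M) (v : Model n) :
    rep1 α x (extChartAt (𝓡 (2 * n + 1)) x x) v = (α x : Model n →L[ℝ] ℝ) v := by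
  rw [rep1_apply]
  have h : (extChartAt (𝓡 (2 * n + 1)) x).symm (extChartAt (𝓡 (2 * n + 1)) x x) = x :=
    extChartAt_to_inv x
  have h2 := chartInv_chartFwd' (mem_extChartAt_source (I := 𝓡 (2 * n + 1)) x) v
  rw [chartFwd_self] at h2
  rw [h2]
  exact congrArg (fun z => (α z : Model n →L[ℝ] ℝ) v) h

lemma rep1_smul (f : M → ℝ) (α : ∀ x : M, Tan n x →L[ℝ] ℝ) (c : M) :
    rep1 (fun z => f z • α z) c = rep0 n f c • rep1 α c := rfl

lemma extDE_smul {f : M → ℝ} (hf : ContMDiff (𝓡 (2 * n + 1)) 𝓘(ℝ, ℝ) ∞ f)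
    {α : ∀ x : M, Tan n x →L[ℝ] ℝ} (hα : Smooth1 α) (x : M) (v w : Model n) :
    extDE (fun z => f z • α z) x v w = f x * extDE α x v w +
      (diffE n f x v * (α x : Model n →L[ℝ] ℝ) w - diffE n f x w * (α x : Model n →L[ℝ] ℝ) v) := by
  have hyt := mem_extChartAt_target (I := 𝓡 (2 * n + 1)) x
  have h1 := ((SasakianStructure.contDiffAt_rep0 hf hyt).differentiableAt (by simp)).hasFDerivAt
  have h2 := (hα.differentiableAt hyt).hasFDerivAt
  have h3 : rep0 n f x (extChartAt (𝓡 (2 * n + 1)) x x) = f x :=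
    congrArg f (extChartAt_to_inv x)
  rw [extDE, rep1_smul, locD_apply, (h1.smul h2).fderiv]
  simp only [add_apply, smul_apply, ContinuousLinearMap.smulRight_apply, smul_eq_mul,
    rep1_self, h3, SasakianStructure.fderiv_rep0_self hf]
  rw [extDE, locD_apply]
  ring

lemma extDE_const_smul {α : ∀ x : M, Tan n x →L[ℝ] ℝ} (hα : Smooth1 α) (s : ℝ) (x : M) :
    extDE (fun z => s • α z) x = s • extDE α x := by
  ext v w
  have h := extDE_smul (f := fun _ : M => s) contMDiff_const hα x v w
  have h0 : diffE n (fun _ : M => s) x = 0 := by rw [diffE, diff, mfderiv_const]; rfl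
  rw [h0] at h
  simpa using h

lemma Smooth1.const_smul {α : ∀ x : M, Tan n x →L[ℝ] ℝ} (hα : Smooth1 α) (s : ℝ) :
    Smooth1 (fun z => s • α z) := fun c => (hα c).const_smul s

lemma Smooth1.smul {f : M → ℝ} (hf : ContMDiff (𝓡 (2 * n + 1)) 𝓘(ℝ, ℝ) ∞ f)
    {α : ∀ x : M, Tan n x →L[ℝ] ℝ} (hα : Smooth1 α) :
    Smooth1 (fun z => f z • α z) := fun c => (contDiffOn_rep0 hf c).smul (hα c)

lemma Smooth1.add {α β : ∀ x : M, Tan n x →L[ℝ] ℝ} (hα : Smooth1 α) (hβ : Smooth1 β) :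
    Smooth1 (fun z => α z + β z) := fun c => (hα c).add (hβ c)

end Linear

/-! ### The volume density and the pointwise formulas in an adapted basis. -/

namespace SasakianStructure

variable {n : ℕ} {M : Type*} [TopologicalSpace M] [ChartedSpace (Model n) M]
  [IsManifold (𝓡 (2 * n + 1)) ∞ M] (S : SasakianStructure n M)

lemma dc_add_smul {f h : M → ℝ} (hf : ContMDiff (𝓡 (2 * n + 1)) 𝓘(ℝ, ℝ) ∞ f)
    (hh : ContMDiff (𝓡 (2 * n + 1)) 𝓘(ℝ, ℝ) ∞ h) (s : ℝ) :
    S.dc (fun z => f z + s * h z) = fun z => S.dc f z + s • S.dc h z := by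
  funext x
  have h1 : S.dcE (fun z => f z + s * h z) x = S.dcE f x + s • S.dcE h x := by
    ext v
    simp only [dcE_apply, diffE_add_smul hf hh, add_apply, smul_apply, smul_eq_mul]
    ring
  exact h1

lemma dc_mul {f h : M → ℝ} (hf : ContMDiff (𝓡 (2 * n + 1)) 𝓘(ℝ, ℝ) ∞ f)
    (hh : ContMDiff (𝓡 (2 * n + 1)) 𝓘(ℝ, ℝ) ∞ h) :
    S.dc (fun z => f z * h z) = fun z => f z • S.dc h z + h z • S.dc f z := by
  funext x
  have h1 : S.dcE (fun z => f z * h z) x = f x • S.dcE h x + h x • S.dcE f x := by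
    ext v
    simp only [dcE_apply, diffE_mul hf hh, add_apply, smul_apply, smul_eq_mul]
    ring
  exact h1

lemma dcE_add_smul {f h : M → ℝ} (hf : ContMDiff (𝓡 (2 * n + 1)) 𝓘(ℝ, ℝ) ∞ f)
    (hh : ContMDiff (𝓡 (2 * n + 1)) 𝓘(ℝ, ℝ) ∞ h) (s : ℝ) (x : M) :
    S.dcE (fun z => f z + s * h z) x = S.dcE f x + s • S.dcE h x :=
  congrFun (S.dc_add_smul hf hh s) x

lemma extDE_dc_mul_self {f : M → ℝ} (hf : ContMDiff (𝓡 (2 * n + 1)) 𝓘(ℝ, ℝ) ∞ f) (x : M)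
    (v w : Model n) : extDE (S.dc fun z => f z * f z) x v w = 2 * (f x * extDE (S.dc f) x v w) +
      2 * (-(1 / 2 : ℝ) * (diffE n f x v * diffE n f x (S.PhiE x w) -
        diffE n f x w * diffE n f x (S.PhiE x v))) := by
  have h := S.smooth1_dc hf
  rw [S.dc_mul hf hf, extDE_add (h.smul hf) (h.smul hf), add_apply, add_apply, extDE_smul hf h]
  have h2 : ∀ u : Model n, (S.dc f x : Model n →L[ℝ] ℝ) u = -(1 / 2 : ℝ) * diffE n f x (S.PhiE x u) :=
    S.dcE_apply f x
  rw [h2, h2]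
  ring

variable {S} in
lemma IsBasic.add_smul {f h : M → ℝ} (hf : S.IsBasic f) (hh : S.IsBasic h) (s : ℝ) :
    S.IsBasic (fun z => f z + s * h z) :=
  ⟨hf.1.add (contMDiff_const.mul hh.1), fun x => by
    change diffE n _ x (S.xiE x) = 0
    rw [diffE_add_smul hf.1 hh.1, add_apply, smul_apply, hf.diffE_xiE, hh.diffE_xiE, smul_zero,
      add_zero]⟩

variable {S} in
lemma IsBasic.mul {f h : M → ℝ} (hf : S.IsBasic f) (hh : S.IsBasic h) :
    S.IsBasic (fun z => f z * h z) :=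
  ⟨hf.1.mul hh.1, fun x => by
    change diffE n _ x (S.xiE x) = 0
    rw [diffE_mul hf.1 hh.1, add_apply, smul_apply, smul_apply, hf.diffE_xiE, hh.diffE_xiE,
      smul_zero, smul_zero, add_zero]⟩

lemma kahler_add_smul {f h : M → ℝ} (hf : ContMDiff (𝓡 (2 * n + 1)) 𝓘(ℝ, ℝ) ∞ f)
    (hh : ContMDiff (𝓡 (2 * n + 1)) 𝓘(ℝ, ℝ) ∞ h) (s : ℝ) (x : M) :
    S.kahler (fun z => f z + s * h z) x = S.kahler f x + s • extDE (S.dc h) x := by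
  have h0 : ContMDiff (𝓡 (2 * n + 1)) 𝓘(ℝ, ℝ) ∞ (fun z => f z + s * h z) :=
    hf.add (contMDiff_const.mul hh)
  rw [S.kahler_eq h0, S.kahler_eq hf, S.dc_add_smul hf hh,
    extDE_add (S.smooth1_dc hf) ((S.smooth1_dc hh).const_smul s),
    extDE_const_smul (S.smooth1_dc hh)]
  exact (add_assoc (extDE S.eta x) (extDE (S.dc f) x) (s • extDE (S.dc h) x)).symm

/-- The volume form `η_φ ∧ (dη_φ)ⁿ` on the model space. -/
def topForm (φ : M → ℝ) (x : M) (v : Fin (2 * n + 1) → Model n) : ℝ :=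
  wedge (fun u => S.etaDE φ x u) (fun u w => S.kahler φ x u w) v

lemma wedgeTop_eq (φ : M → ℝ) (x : M) (v : Fin (2 * n + 1) → Model n) :
    wedgeTop (x := x) (S.etaDef φ x) (S.dEtaDef φ x) v = S.topForm φ x v := by
  have h : (fun u w => S.kahler φ x u w) = fun u w : Model n => S.dEtaDef φ x u w := by
    funext u w; rw [kahler, extDE_apply]; rfl
  rw [topForm, h]; rfl

lemma topForm_eq_det_mul (b : Module.Basis (Fin (2 * n + 1)) ℝ (Model n)) (φ : M → ℝ) (x : M)
    (v : Fin (2 * n + 1) → Model n) : S.topForm φ x v = b.det v * S.topForm φ x b :=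
  wedge_eq_det_mul b (S.etaDE φ x).toLinearMap (bil (S.kahler φ x)) v

lemma topForm_zero_ne (x : M) : S.topForm (fun _ => 0) x (stdBasis n) ≠ 0 := by
  obtain ⟨v, hv⟩ := S.contact x
  intro h
  apply hv
  have h1 := S.wedgeTop_eq (fun _ => 0) x v
  have h3 := S.topForm_eq_det_mul (stdBasis n) (fun _ => 0) x v
  rw [h, mul_zero] at h3
  have h2 : S.dEtaDef (fun _ => 0) x = extD S.eta x := by
    funext u w; rw [dEtaDef, etaDef_zero]
  rw [etaDef_zero, h2] at h1
  exact h1.trans h3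

/-- The density of the volume form of `φ` with respect to the one of `0`. -/
def rho (φ : M → ℝ) (x : M) : ℝ :=
  S.topForm φ x (stdBasis n) / S.topForm (fun _ => 0) x (stdBasis n)

lemma topForm_eq_rho (φ : M → ℝ) (x : M) (v : Fin (2 * n + 1) → Model n) :
    S.topForm φ x v = S.rho φ x * S.topForm (fun _ => 0) x v := by
  rw [S.topForm_eq_det_mul (stdBasis n) φ, S.topForm_eq_det_mul (stdBasis n) (fun _ => 0), rho]
  field_simp [S.topForm_zero_ne x]

lemma rho_zero (x : M) : S.rho (fun _ => 0) x = 1 := div_self (S.topForm_zero_ne x)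

lemma etaDE_add_smul {f h : M → ℝ} (hf : ContMDiff (𝓡 (2 * n + 1)) 𝓘(ℝ, ℝ) ∞ f)
    (hh : ContMDiff (𝓡 (2 * n + 1)) 𝓘(ℝ, ℝ) ∞ h) (s : ℝ) (x : M) (v : Model n) :
    S.etaDE (fun z => f z + s * h z) x v = S.etaDE f x v + s * S.dcE h x v := by
  rw [etaDE, dcE_add_smul S hf hh, etaDE]
  simp; ring

variable [T2Space M] {S}

/-- Replacing `η_φ` by `η_φ + s d^c ψ` adds a term all of whose factors are annihilated by `ξ`,
which vanishes in degree `2n + 1`. Only the change of the transverse form is left, and it is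
diagonal. -/
lemma IsBasic.topForm_add_smul {φ ψ : M → ℝ} {x : M} (hφ : S.IsBasic φ) (hψ : S.IsBasic ψ)
    {b : Module.Basis (Fin (2 * n + 1)) ℝ (Model n)} {c : Fin n → ℝ}
    (h : IsAdapted b (S.etaDE φ x).toLinearMap (S.xiE x) (S.JE φ x).toLinearMap
      (bil (S.kahler φ x)) (bil (extDE (S.dc ψ) x)) c) (s : ℝ) (v : Fin (2 * n + 1) → Model n) :
    S.topForm (fun z => φ z + s * ψ z) x v =
      b.det v * (wedgeConst n * ∏ k, (1 + s * c k)) := by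
  have h0 := (hφ.add_smul hψ s).isTransverse_kahler x φ
  have h1 : wedge (fun u => s * S.dcE ψ x u)
      (fun u w => S.kahler (fun z => φ z + s * ψ z) x u w) v = 0 := by
    refine wedge_eq_zero_of_kernel b (s • S.dcE ψ x).toLinearMap
      (bil (S.kahler (fun z => φ z + s * ψ z) x)) (i := reebIdx n) ?_ ?_ ?_ v
    · rw [h.reeb]
      change s * S.dcE ψ x (S.xiE x) = 0
      rw [dcE_xiE, mul_zero]
    · rw [h.reeb]; exact h0.xi_left
    · rw [h.reeb]; exact h0.xi_right
  rw [← h.wedge_eq 1 s v, topForm]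
  simp only [S.etaDE_add_smul hφ.1 hψ.1]
  rw [wedge_add_left, h1, add_zero, ← bil_add_smul, ← S.kahler_add_smul hφ.1 hψ.1]
  rfl

lemma IsBasic.topForm_self {φ ψ : M → ℝ} {x : M} (hφ : S.IsBasic φ) (hψ : S.IsBasic ψ)
    {b : Module.Basis (Fin (2 * n + 1)) ℝ (Model n)} {c : Fin n → ℝ}
    (h : IsAdapted b (S.etaDE φ x).toLinearMap (S.xiE x) (S.JE φ x).toLinearMap
      (bil (S.kahler φ x)) (bil (extDE (S.dc ψ) x)) c) (v : Fin (2 * n + 1) → Model n) :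
    S.topForm φ x v = b.det v * wedgeConst n := by
  have := hφ.topForm_add_smul hψ h 0 v
  simpa using this

lemma IsBasic.rho_add_smul {φ ψ : M → ℝ} {x : M} (hφ : S.IsBasic φ) (hψ : S.IsBasic ψ)
    {b : Module.Basis (Fin (2 * n + 1)) ℝ (Model n)} {c : Fin n → ℝ}
    (h : IsAdapted b (S.etaDE φ x).toLinearMap (S.xiE x) (S.JE φ x).toLinearMap
      (bil (S.kahler φ x)) (bil (extDE (S.dc ψ) x)) c) (s : ℝ) :
    S.rho (fun z => φ z + s * ψ z) x = S.rho φ x * ∏ k, (1 + s * c k) := by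
  rw [rho, rho, hφ.topForm_add_smul hψ h, hφ.topForm_self hψ h]
  ring

lemma IsBasic.kahler_quadratic {φ ψ : M → ℝ} {x : M} (hφ : S.IsBasic φ) (hψ : S.IsBasic ψ)
    {b : Module.Basis (Fin (2 * n + 1)) ℝ (Model n)} {c : Fin n → ℝ}
    (h : IsAdapted b (S.etaDE φ x).toLinearMap (S.xiE x) (S.JE φ x).toLinearMap
      (bil (S.kahler φ x)) (bil (extDE (S.dc ψ) x)) c) (s : ℝ) (v : Model n) :
    S.kahler (fun z => φ z + s * ψ z) x v (S.PhiE x v) =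
      ∑ k, (1 + s * c k) * (b.repr v (fstIdx k) ^ 2 + b.repr v (sndIdx k) ^ 2) := by
  have h1 := h.quadratic (hφ.almostContact x) 1 s v
  rw [← bil_add_smul, ← S.kahler_add_smul hφ.1 hψ.1] at h1
  rw [← h1, ← (hφ.add_smul hψ s).kahler_JE x v v φ]
  rfl

lemma PhiE_eq_zero_of_repr {x : M} {b : Module.Basis (Fin (2 * n + 1)) ℝ (Model n)}
    (hb : b (reebIdx n) = S.xiE x) {v : Model n}
    (h : ∀ k, b.repr v (fstIdx k) ^ 2 + b.repr v (sndIdx k) ^ 2 = 0) : S.PhiE x v = 0 := by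
  have h1 : ∀ k, b.repr v (fstIdx k) = 0 := fun k => by nlinarith [h k, sq_nonneg (b.repr v (fstIdx k)), sq_nonneg (b.repr v (sndIdx k))]
  have h2 : ∀ k, b.repr v (sndIdx k) = 0 := fun k => by nlinarith [h k, sq_nonneg (b.repr v (fstIdx k)), sq_nonneg (b.repr v (sndIdx k))]
  have h3 : v = b.repr v (reebIdx n) • S.xiE x := by
    conv_lhs => rw [← b.sum_repr v, sum_idx]
    simp [h1, h2, hb]
  rw [h3, map_smul, PhiE_xiE, smul_zero]

/-- The transverse metric of `φ` is positive semidefinite at `x`. -/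
def SemiposAt (S : SasakianStructure n M) (φ : M → ℝ) (x : M) : Prop :=
  ∀ v : Model n, 0 ≤ S.kahler φ x v (S.PhiE x v)

lemma PosAt.semiposAt {φ : M → ℝ} {x : M} (h : S.PosAt φ x) : S.SemiposAt φ x := fun v => by
  by_cases hv : S.PhiE x v = 0
  · rw [hv, map_zero]
  · exact (h v hv).le

/-- These are the eigenvalues of `dη_φ` relative to `dη`, read off in a basis adapted to the zero
potential. Since `rho φ` is their product, a determinant can control positivity. -/
lemma IsBasic.exists_eigenvalues {φ : M → ℝ} (hφ : S.IsBasic φ) (x : M) :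
    ∃ c : Fin n → ℝ, S.rho φ x = ∏ k, c k ∧ (S.SemiposAt φ x → ∀ k, 0 ≤ c k) ∧
      (S.PosAt φ x → ∀ k, 0 < c k) ∧ ((∀ k, 0 < c k) → S.PosAt φ x) := by
  obtain ⟨b, c, h⟩ := (S.posAt_zero x).exists_adapted S.isBasic_zero hφ
  have h1 := S.isBasic_zero.rho_add_smul hφ h 1
  have h2 := S.isBasic_zero.kahler_quadratic hφ h 1
  simp only [zero_add, one_mul, rho_zero] at h1 h2
  have h3 : ∀ k, S.kahler φ x (b (fstIdx k)) (S.PhiE x (b (fstIdx k))) = 1 + c k := fun k => by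
    rw [h2, Finset.sum_eq_single k]
    · simp
    · intro l _ hl
      simp [hl.symm]
    · simp
  refine ⟨fun k => 1 + c k, h1, fun hs k => (hs _).trans_eq (h3 k),
    fun hp k => (hp _ ?_).trans_eq (h3 k),
    fun hc v hv => ?_⟩
  · intro h0
    have h4 := h.snd k
    have h5 : (S.JE (fun _ => 0) x).toLinearMap (b (fstIdx k)) = 0 := by
      change S.JE (fun _ => 0) x (b (fstIdx k)) = 0
      rw [JE_apply, h0, map_zero, zero_smul, sub_zero]
    rw [h5] at h4
    exact b.ne_zero _ h4
  · rw [h2]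
    have h4 : ∀ k, 0 ≤ (1 + c k) * (b.repr v (fstIdx k) ^ 2 + b.repr v (sndIdx k) ^ 2) :=
      fun k => mul_nonneg (hc k).le (by positivity)
    refine lt_of_le_of_ne (Finset.sum_nonneg fun k _ => h4 k) fun h5 => hv ?_
    refine PhiE_eq_zero_of_repr h.reeb fun k => ?_
    have := (Finset.sum_eq_zero_iff_of_nonneg fun k _ => h4 k).1 h5.symm k (Finset.mem_univ k)
    exact (mul_eq_zero.1 this).resolve_left (hc k).ne'

lemma PosAt.rho_pos {φ : M → ℝ} {x : M} (h : S.PosAt φ x) (hφ : S.IsBasic φ) : 0 < S.rho φ x := by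
  obtain ⟨c, h1, -, h2, -⟩ := hφ.exists_eigenvalues x
  rw [h1]; exact Finset.prod_pos fun k _ => h2 h k

/-- Nonnegative eigenvalues with nonzero product are positive. -/
lemma SemiposAt.posAt {φ : M → ℝ} {x : M} (h : S.SemiposAt φ x) (hφ : S.IsBasic φ)
    (h0 : S.rho φ x ≠ 0) : S.PosAt φ x := by
  obtain ⟨c, h1, h2, -, h3⟩ := hφ.exists_eigenvalues x
  refine h3 fun k => lt_of_le_of_ne (h2 h k) fun hk => h0 ?_
  rw [h1]; exact Finset.prod_eq_zero (Finset.mem_univ k) hk.symm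

lemma PosAt.add_smul {φ ψ : M → ℝ} {x : M} (hφ : S.IsBasic φ) (hψ : S.IsBasic ψ)
    (h : S.PosAt φ x) (h1 : S.PosAt (fun z => φ z + 1 * ψ z) x) {s : ℝ} (hs : s ∈ Set.Icc (0 : ℝ) 1) :
    S.PosAt (fun z => φ z + s * ψ z) x := by
  intro v hv
  have a := h v hv
  have b := h1 v hv
  rw [S.kahler_add_smul hφ.1 hψ.1] at b ⊢
  simp only [add_apply, smul_apply, smul_eq_mul, one_mul] at b ⊢
  rcases eq_or_lt_of_le hs.2 with h2 | h2
  · rw [h2]; linarith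
  · nlinarith [hs.1, mul_nonneg hs.1 b.le, mul_pos (sub_pos.2 h2) a]

/-- The squared norm of `dψ` for the metric of `φ`. -/
def gradSq (S : SasakianStructure n M) (φ ψ : M → ℝ) (x : M) : ℝ :=
  inner1 (S.gDef φ) (diff n ψ) (diff n ψ) x

lemma gram_gDef (φ : M → ℝ) (x : M) : gram (S.gDef φ) x = Matrix.of fun i j =>
    contactMetric (S.etaDE φ x).toLinearMap (S.JE φ x).toLinearMap (bil (S.kahler φ x))
      (stdBasis n i) (stdBasis n j) := by
  ext i j
  rw [gram, Matrix.of_apply, Matrix.of_apply, stdBasis_apply, stdBasis_apply]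
  exact S.gDef_eq φ x _ _

section Adapted

variable {φ ψ : M → ℝ} {x : M} {b : Module.Basis (Fin (2 * n + 1)) ℝ (Model n)} {c : Fin n → ℝ}

lemma IsBasic.laplacian_eq (h : IsAdapted b (S.etaDE φ x).toLinearMap (S.xiE x)
      (S.JE φ x).toLinearMap (bil (S.kahler φ x)) (bil (extDE (S.dc ψ) x)) c) :
    S.laplacian φ ψ x = ∑ k, c k := by
  have h1 := h.contract_forms (stdBasis n)
  rw [← S.gram_gDef] at h1
  have h2 : inner2 (S.gDef φ) (S.ddc ψ) (S.dEtaDef φ) x = 2 * ∑ k, c k := by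
    rw [← h1, inner2]
    simp only [bil_apply, stdBasis_apply, kahler, extDE_apply]
    rfl
  rw [laplacian, h2]; ring

lemma IsBasic.gradSq_eq (hψ : S.IsBasic ψ) (h : IsAdapted b (S.etaDE φ x).toLinearMap (S.xiE x)
      (S.JE φ x).toLinearMap (bil (S.kahler φ x)) (bil (extDE (S.dc ψ) x)) c) :
    S.gradSq φ ψ x = ∑ k, (diffE n ψ x (b (fstIdx k)) ^ 2 + diffE n ψ x (b (sndIdx k)) ^ 2) := by
  have h1 := h.contract_covector (stdBasis n) (diffE n ψ x).toLinearMap (hψ.diffE_xiE x)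
  rw [← S.gram_gDef] at h1
  refine Eq.trans ?_ h1
  rw [gradSq, inner1]
  simp only [stdBasis_apply]
  rfl

lemma diffE_JE (hψ : S.IsBasic ψ) (v : Model n) :
    diffE n ψ x (S.JE φ x v) = diffE n ψ x (S.PhiE x v) := by
  rw [JE_apply, map_sub, map_smul, hψ.diffE_xiE, smul_zero, sub_zero]

/-- Expresses the squared gradient through Laplacians, so that Stokes' theorem for `dd^c(ψ²)` yields
Green's formula. -/
lemma IsBasic.laplacian_mul_self (hφ : S.IsBasic φ) (hψ : S.IsBasic ψ)
    (h : IsAdapted b (S.etaDE φ x).toLinearMap (S.xiE x)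
      (S.JE φ x).toLinearMap (bil (S.kahler φ x)) (bil (extDE (S.dc ψ) x)) c) :
    S.laplacian φ (fun z => ψ z * ψ z) x = 2 * ψ x * S.laplacian φ ψ x + S.gradSq φ ψ x := by
  set d := (diffE n ψ x).toLinearMap
  set J := (S.JE φ x).toLinearMap with hJ
  let τ : Model n →ₗ[ℝ] Model n →ₗ[ℝ] ℝ :=
    (-(1 / 2 : ℝ)) • ((d.smulRight (d.comp J)) - (d.comp J).smulRight d)
  have hτ : ∀ v w, τ v w = -(1 / 2 : ℝ) * (d v * d (J w) - d w * d (J v)) := fun v w => by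
    simp [τ]; ring
  have h1 := h.contract_wedge (hφ.almostContact x) (stdBasis n) d (hψ.diffE_xiE x) τ hτ
  have h2 := h.contract_forms (stdBasis n)
  rw [← S.gram_gDef] at h1 h2
  have h3 : inner2 (S.gDef φ) (S.ddc fun z => ψ z * ψ z) (S.dEtaDef φ) x =
      2 * ψ x * (2 * ∑ k, c k) + 2 * S.gradSq φ ψ x := by
    rw [hψ.gradSq_eq h, ← h2]
    refine Eq.trans ?_ (congrArg (fun r => _ + 2 * r) h1)
    rw [inner2]
    simp only [Finset.mul_sum, ← Finset.sum_add_distrib]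
    refine Finset.sum_congr rfl fun i _ => Finset.sum_congr rfl fun j _ =>
      Finset.sum_congr rfl fun k _ => Finset.sum_congr rfl fun l _ => ?_
    have h4 : S.ddc (fun z => ψ z * ψ z) x (tanBasis n x i) (tanBasis n x j) =
        2 * (ψ x * extDE (S.dc ψ) x (stdBasis n i) (stdBasis n j)) +
          2 * τ (stdBasis n i) (stdBasis n j) := by
      rw [hτ, stdBasis_apply, stdBasis_apply]
      refine (extDE_apply _ x _ _).symm.trans ((S.extDE_dc_mul_self hψ.1 x
        (EuclideanSpace.single i 1 : Model n) (EuclideanSpace.single j 1 : Model n)).trans ?_)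
      have h5 := fun v => (diffE_JE (x := x) (φ := φ) hψ v).symm
      rw [h5, h5]
      rfl
    have h6 : S.dEtaDef φ x (tanBasis n x k) (tanBasis n x l) =
        bil (S.kahler φ x) (stdBasis n k) (stdBasis n l) := by
      rw [stdBasis_apply, stdBasis_apply]
      exact (extDE_apply _ x _ _).symm
    rw [h4, h6, bil_apply (extDE (S.dc ψ) x)]
    ring
  rw [laplacian, h3, IsBasic.laplacian_eq h]
  ring

lemma IsBasic.inner2_velocity (hφ : S.IsBasic φ) (hψ : S.IsBasic ψ)
    (h : IsAdapted b (S.etaDE φ x).toLinearMap (S.xiE x)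
      (S.JE φ x).toLinearMap (bil (S.kahler φ x)) (bil (extDE (S.dc ψ) x)) c)
    (a : ∀ x : M, Tan n x → Tan n x → ℝ)
    (ha : ∀ v w : Model n, a x v w = extDE (S.dc ψ) x v (S.PhiE x w) +
      (S.etaDE φ x v * S.dcE ψ x w + S.dcE ψ x v * S.etaDE φ x w)) :
    inner2 (S.gDef φ) a a x = 2 * ∑ k, c k ^ 2 + 1 / 2 * S.gradSq φ ψ x := by
  set d := (diffE n ψ x).toLinearMap with hd
  set J := (S.JE φ x).toLinearMap with hJ
  set η := (S.etaDE φ x).toLinearMap with hη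
  let A : Model n →ₗ[ℝ] Model n →ₗ[ℝ] ℝ := (bil (extDE (S.dc ψ) x)).compl₂ J -
    (1 / 2 : ℝ) • (η.smulRight (d.comp J) + (d.comp J).smulRight η)
  have hA : ∀ v w, A v w = bil (extDE (S.dc ψ) x) v (J w) -
      (1 / 2 : ℝ) * (η v * d (J w) + d (J v) * η w) := fun v w => by
    simp [A]; ring
  have haA : ∀ v w : Model n, a x v w = A v w := fun v w => by
    rw [ha, hA, bil_apply]
    have h5 := fun v => (diffE_JE (x := x) (φ := φ) hψ v)
    have h6 := (hψ.isTransverse x φ).xi_right v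
    rw [bil_apply] at h6
    -- The given tensor uses `Φ` while the adapted basis belongs to `Φ_φ`; the difference lies along
    -- `ξ` and is invisible to `dd^c ψ`.
    have h7 : extDE (S.dc ψ) x v (S.JE φ x w) = extDE (S.dc ψ) x v (S.PhiE x w) := by
      rw [JE_apply, map_sub, map_smul, h6, smul_zero, sub_zero]
    simp only [hJ, hd, hη, ContinuousLinearMap.coe_coe, h5, h7, dcE_apply]
    ring
  have h1 := h.contract_velocity (hφ.almostContact x) (stdBasis n) d A hA
  rw [← S.gram_gDef] at h1
  rw [hψ.gradSq_eq h]
  refine Eq.trans ?_ h1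
  rw [inner2]
  simp only [← haA, stdBasis_apply]
  rfl

end Adapted

lemma PosAt.gradSq_nonneg {φ ψ : M → ℝ} {x : M} (h : S.PosAt φ x) (hφ : S.IsBasic φ)
    (hψ : S.IsBasic ψ) : 0 ≤ S.gradSq φ ψ x := by
  obtain ⟨b, c, h⟩ := h.exists_adapted hφ hψ
  rw [hψ.gradSq_eq h]; positivity

lemma PosAt.diffE_eq_zero {φ ψ : M → ℝ} {x : M} (h : S.PosAt φ x) (hφ : S.IsBasic φ)
    (hψ : S.IsBasic ψ) (h0 : S.gradSq φ ψ x = 0) : diffE n ψ x = 0 := by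
  obtain ⟨b, c, h⟩ := h.exists_adapted hφ hψ
  rw [hψ.gradSq_eq h] at h0
  have := h.covector_eq_zero (diffE n ψ x).toLinearMap (hψ.diffE_xiE x) h0
  ext v; exact congrArg (fun f => f v) this

lemma wedgeConst_ne_zero (S : SasakianStructure n M) (x : M) : wedgeConst n ≠ 0 := by
  obtain ⟨b, c, h⟩ := (S.posAt_zero x).exists_adapted S.isBasic_zero S.isBasic_zero
  intro h0
  apply S.topForm_zero_ne x
  rw [S.isBasic_zero.topForm_self S.isBasic_zero h, h0, mul_zero]

/-- In an adapted basis the Riemannian volume is `|det|` and the contact form is `wedgeConst n`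
times `det`, so the two densities differ by a constant. -/
lemma PosAt.sqrt_det {φ : M → ℝ} {x : M} (h : S.PosAt φ x) (hφ : S.IsBasic φ)
    (v : Fin (2 * n + 1) → Model n) :
    |wedgeConst n| * √(Matrix.det (Matrix.of fun i j => S.gDef φ x (v i) (v j))) =
      |S.topForm φ x v| := by
  obtain ⟨b, c, h⟩ := h.exists_adapted hφ S.isBasic_zero
  have h1 := sqrt_det_gram _ b h.orthonormal v
  have h2 : (Matrix.of fun i j => S.gDef φ x (v i) (v j)) = Matrix.of fun i j =>
      contactMetric (S.etaDE φ x).toLinearMap (S.JE φ x).toLinearMap (bil (S.kahler φ x))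
        (v i) (v j) := by
    ext i j; exact S.gDef_eq φ x _ _
  rw [h2, h1, hφ.topForm_self S.isBasic_zero h, abs_mul, mul_comm]

end SasakianStructure
end Sasaki

end

section

namespace Sasaki

/-! ### Measures defined by densities on the manifold. -/

section Measure

open MeasureTheory

variable {n : ℕ} {M : Type*} [TopologicalSpace M] [ChartedSpace (Model n) M]

/-- The coordinate expression of a density in the preferred chart at `c`. -/
def locDens (δ : ∀ x : M, (Fin (2 * n + 1) → Tan n x) → ℝ) (c : M) (y : Model n) : ℝ :=
  δ ((extChartAt (𝓡 (2 * n + 1)) c).symm y)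
    (fun i => (chartInv c y (EuclideanSpace.single i (1 : ℝ)) : Model n))

/-- Continuous fields which transform by the absolute value of the determinant. -/
structure IsDensity (δ : ∀ x : M, (Fin (2 * n + 1) → Tan n x) → ℝ) : Prop where
  map : ∀ (x : M) (A : Model n →L[ℝ] Model n) (v : Fin (2 * n + 1) → Model n),
    |δ x (fun i => (A (v i) : Model n))| = |A.det| * |δ x v|
  cont : ∀ c, ContinuousOn (locDens δ c) (extChartAt (𝓡 (2 * n + 1)) c).target

lemma chartMeasure_eq [MeasurableSpace M] (δ : ∀ x : M, (Fin (2 * n + 1) → Tan n x) → ℝ) (c : M) :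
    chartMeasure δ c =
      (((volume : Measure (Model n)).restrict (extChartAt (𝓡 (2 * n + 1)) c).target).withDensity
        (fun y => ENNReal.ofReal |locDens δ c y|)).map (extChartAt (𝓡 (2 * n + 1)) c).symm := rfl

variable [MeasurableSpace M] [BorelSpace M]

lemma measurableSet_target (c : M) : MeasurableSet (extChartAt (𝓡 (2 * n + 1)) c).target :=
  (isOpen_target c).measurableSet

lemma measurableSet_source (c : M) : MeasurableSet (extChartAt (𝓡 (2 * n + 1)) c).source :=
  (isOpen_extChartAt_source c).measurableSet

lemma aemeasurable_symm (c : M) : AEMeasurable (extChartAt (𝓡 (2 * n + 1)) c).symm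
    ((volume : Measure (Model n)).restrict (extChartAt (𝓡 (2 * n + 1)) c).target) :=
  (continuousOn_extChartAt_symm c).aemeasurable (measurableSet_target c)

lemma aemeasurable_symm_withDensity (c : M) (f : Model n → ℝ≥0∞) :
    AEMeasurable (extChartAt (𝓡 (2 * n + 1)) c).symm
      (((volume : Measure (Model n)).restrict (extChartAt (𝓡 (2 * n + 1)) c).target).withDensity f) :=
  (aemeasurable_symm c).mono_ac (withDensity_absolutelyContinuous _ _)

lemma measurableSet_chart_image (c : M) {A : Set M} (hA : MeasurableSet A) :
    MeasurableSet ((extChartAt (𝓡 (2 * n + 1)) c).target ∩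
      (extChartAt (𝓡 (2 * n + 1)) c).symm ⁻¹' A) := by
  have h := (continuousOn_iff_continuous_domRestrict.1
    (continuousOn_extChartAt_symm (I := 𝓡 (2 * n + 1)) c)).measurable hA
  have := (measurableSet_target c).subtype_image h
  convert this using 1
  ext y; simp [Set.domRestrict, and_comm]

lemma chartMeasure_apply (δ : ∀ x : M, (Fin (2 * n + 1) → Tan n x) → ℝ) (c : M) {A : Set M}
    (hA : MeasurableSet A) : chartMeasure δ c A =
      ∫⁻ y in (extChartAt (𝓡 (2 * n + 1)) c).target ∩ (extChartAt (𝓡 (2 * n + 1)) c).symm ⁻¹' A,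
        ENNReal.ofReal |locDens δ c y| := by
  rw [chartMeasure_eq, Measure.map_apply_of_aemeasurable (aemeasurable_symm_withDensity c _) hA,
    withDensity_apply', Measure.restrict_restrict' (measurableSet_target c), Set.inter_comm]

lemma lintegral_chartMeasure {δ : ∀ x : M, (Fin (2 * n + 1) → Tan n x) → ℝ} (hδ : IsDensity δ)
    (c : M) {f : M → ℝ≥0∞} (hf : Measurable f) : ∫⁻ x, f x ∂(chartMeasure δ c) =
      ∫⁻ y in (extChartAt (𝓡 (2 * n + 1)) c).target,
        ENNReal.ofReal |locDens δ c y| * f ((extChartAt (𝓡 (2 * n + 1)) c).symm y) := by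
  have h1 : AEMeasurable (fun y => ENNReal.ofReal |locDens δ c y|)
      ((volume : Measure (Model n)).restrict (extChartAt (𝓡 (2 * n + 1)) c).target) :=
    ((hδ.cont c).abs.aemeasurable (measurableSet_target c)).ennreal_ofReal
  rw [chartMeasure_eq, lintegral_map' hf.aemeasurable (aemeasurable_symm_withDensity c _)]
  exact lintegral_withDensity_eq_lintegral_mul₀ h1 (hf.comp_aemeasurable (aemeasurable_symm c))

lemma integral_chartMeasure {δ : ∀ x : M, (Fin (2 * n + 1) → Tan n x) → ℝ} (hδ : IsDensity δ)
    (c : M) {f : M → ℝ} (hf : Measurable f) : ∫ x, f x ∂(chartMeasure δ c) =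
      ∫ y in (extChartAt (𝓡 (2 * n + 1)) c).target,
        |locDens δ c y| * f ((extChartAt (𝓡 (2 * n + 1)) c).symm y) := by
  have h1 : AEMeasurable (fun y => Real.toNNReal |locDens δ c y|)
      ((volume : Measure (Model n)).restrict (extChartAt (𝓡 (2 * n + 1)) c).target) :=
    ((hδ.cont c).abs.aemeasurable (measurableSet_target c)).real_toNNReal
  rw [chartMeasure_eq, integral_map (aemeasurable_symm_withDensity c _)
    hf.aestronglyMeasurable]
  have h2 := integral_withDensity_eq_integral_smul₀ h1
    (fun y => f ((extChartAt (𝓡 (2 * n + 1)) c).symm y))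
  refine h2.trans (integral_congr_ae (ae_of_all _ fun y => ?_))
  simp [NNReal.smul_def]

lemma chartMeasure_compl_source (δ : ∀ x : M, (Fin (2 * n + 1) → Tan n x) → ℝ) (c : M) :
    chartMeasure δ c (extChartAt (𝓡 (2 * n + 1)) c).sourceᶜ = 0 := by
  rw [chartMeasure_apply δ c (measurableSet_source c).compl]
  have : (extChartAt (𝓡 (2 * n + 1)) c).target ∩ (extChartAt (𝓡 (2 * n + 1)) c).symm ⁻¹'
      (extChartAt (𝓡 (2 * n + 1)) c).sourceᶜ = ∅ := by
    ext y
    simp only [Set.mem_inter_iff, Set.mem_preimage, Set.mem_compl_iff, Set.mem_empty_iff_false,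
      iff_false, not_and, not_not]
    exact fun hy => (extChartAt (𝓡 (2 * n + 1)) c).map_target hy
  rw [this]; simp

variable [IsManifold (𝓡 (2 * n + 1)) ∞ M]

lemma abs_locDens_transition {δ : ∀ x : M, (Fin (2 * n + 1) → Tan n x) → ℝ} (hδ : IsDensity δ)
    {c c' : M} {y : Model n} (hy : y ∈ overlap c c') :
    |locDens δ c y| = |(fderiv ℝ (transition c c') y).det| * |locDens δ c' (transition c c' y)| := by
  have h1 : (extChartAt (𝓡 (2 * n + 1)) c').symm (transition c c' y) =
      (extChartAt (𝓡 (2 * n + 1)) c).symm y := (extChartAt (𝓡 (2 * n + 1)) c').left_inv hy.2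
  have h2 : ∀ v, chartInv c y v = chartInv c' (transition c c' y)
      (fderiv ℝ (transition c c') y v) := fun v => by
    rw [fderiv_transition hy, transition, chartInv_chartFwd' hy.2]
  let x := (extChartAt (𝓡 (2 * n + 1)) c).symm y
  let e : Fin (2 * n + 1) → Model n := fun i => EuclideanSpace.single i 1
  have h3 : locDens δ c' (transition c c' y) =
      δ x (fun i => (chartInv c' (transition c c' y) (e i) : Model n)) :=
    congrArg (fun z => δ z (fun i => (chartInv c' (transition c c' y) (e i) : Model n))) h1
  have h4 : locDens δ c y = δ x (fun i => ((chartInv c' (transition c c' y)).comp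
      (fderiv ℝ (transition c c') y) (e i) : Model n)) :=
    congrArg (fun v : Fin (2 * n + 1) → Model n => δ x v) (funext fun i => h2 (e i))
  rw [h3, h4, hδ.map x _ e, hδ.map x _ e]
  have h5 : ((chartInv c' (transition c c' y)).comp (fderiv ℝ (transition c c') y)).det =
      (chartInv c' (transition c c' y)).det * (fderiv ℝ (transition c c') y).det :=
    LinearMap.det_comp _ _
  rw [h5, abs_mul]; ring

/-- The change of variables formula for the transition map, whose Jacobian is the factor by which
the densities transform. -/
lemma chartMeasure_congr {δ : ∀ x : M, (Fin (2 * n + 1) → Tan n x) → ℝ} (hδ : IsDensity δ)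
    (c c' : M) {A : Set M} (hA : MeasurableSet A)
    (h1 : A ⊆ (extChartAt (𝓡 (2 * n + 1)) c).source)
    (h2 : A ⊆ (extChartAt (𝓡 (2 * n + 1)) c').source) :
    chartMeasure δ c A = chartMeasure δ c' A := by
  rw [chartMeasure_apply δ c hA, chartMeasure_apply δ c' hA]
  set s := (extChartAt (𝓡 (2 * n + 1)) c).target ∩ (extChartAt (𝓡 (2 * n + 1)) c).symm ⁻¹' A
  have hs : s ⊆ overlap c c' := fun y hy => ⟨hy.1, h2 hy.2⟩
  have himg : (extChartAt (𝓡 (2 * n + 1)) c').target ∩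
      (extChartAt (𝓡 (2 * n + 1)) c').symm ⁻¹' A = transition c c' '' s := by
    ext z
    constructor
    · rintro ⟨hz, hzA⟩
      refine ⟨extChartAt (𝓡 (2 * n + 1)) c ((extChartAt (𝓡 (2 * n + 1)) c').symm z),
        ⟨(extChartAt (𝓡 (2 * n + 1)) c).map_source (h1 hzA), ?_⟩, ?_⟩
      · rw [Set.mem_preimage, (extChartAt (𝓡 (2 * n + 1)) c).left_inv (h1 hzA)]; exact hzA
      · rw [transition, (extChartAt (𝓡 (2 * n + 1)) c).left_inv (h1 hzA),
          (extChartAt (𝓡 (2 * n + 1)) c').right_inv hz]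
    · rintro ⟨y, hy, rfl⟩
      refine ⟨(extChartAt (𝓡 (2 * n + 1)) c').map_source (h2 hy.2), ?_⟩
      rw [Set.mem_preimage, transition, (extChartAt (𝓡 (2 * n + 1)) c').left_inv (h2 hy.2)]
      exact hy.2
  have hinj : Set.InjOn (transition (n := n) c c') s := by
    intro y hy z hz hyz
    have := (extChartAt (𝓡 (2 * n + 1)) c').injOn (h2 hy.2) (h2 hz.2) hyz
    exact (extChartAt (𝓡 (2 * n + 1)) c).symm.injOn hy.1 hz.1 this
  have hd : ∀ y ∈ s, HasFDerivWithinAt (transition c c') (fderiv ℝ (transition c c') y) s y :=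
    fun y hy => (((contDiffOn_transition c c').contDiffAt
      ((isOpen_overlap c c').mem_nhds (hs hy))).differentiableAt
        (by simp)).hasFDerivAt.hasFDerivWithinAt
  rw [himg, lintegral_image_eq_lintegral_abs_det_fderiv_mul _ (measurableSet_chart_image c hA) hd
    hinj]
  refine setLIntegral_congr_fun (measurableSet_chart_image c hA) fun y hy => ?_
  rw [abs_locDens_transition hδ (hs hy), ENNReal.ofReal_mul (abs_nonneg _)]

variable [T2Space M] [CompactSpace M]

variable (n M) in
/-- The finite set of the charts that occur in the partition of unity. -/
def partSupport : Finset M :=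
  ((chartPartition n M).locallyFinite.finite_nonempty_of_compact).toFinset

lemma chartPartition_eq_zero {c : M} (hc : c ∉ partSupport n M) (x : M) :
    chartPartition n M c x = 0 := by
  by_contra h
  exact hc (by
    simp only [partSupport, Set.Finite.mem_toFinset]
    exact ⟨x, h⟩)

lemma tsupport_chartPartition (c : M) :
    tsupport (chartPartition n M c) ⊆ (extChartAt (𝓡 (2 * n + 1)) c).source := by
  rw [extChartAt_source]
  exact Classical.choose_spec
    (SmoothPartitionOfUnity.exists_isSubordinate_chartAt_source (I := 𝓡 (2 * n + 1)) M) c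

lemma chartPartition_nonneg (c x : M) : 0 ≤ chartPartition n M c x :=
  (chartPartition n M).nonneg c x

lemma sum_chartPartition (x : M) : ∑ c ∈ partSupport n M, chartPartition n M c x = 1 := by
  rw [← (chartPartition n M).sum_eq_one (Set.mem_univ x)]
  refine (finsum_eq_sum_of_support_subset _ fun c hc => ?_).symm
  by_contra h
  exact hc (chartPartition_eq_zero h x)

lemma measurable_chartPartition (c : M) :
    Measurable fun x => ENNReal.ofReal (chartPartition n M c x) :=
  ((chartPartition n M c).contMDiff.continuous.measurable).ennreal_ofReal

lemma lintegral_densityMeasure (δ : ∀ x : M, (Fin (2 * n + 1) → Tan n x) → ℝ) {f : M → ℝ≥0∞}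
    (hf : Measurable f) : ∫⁻ x, f x ∂(densityMeasure δ) = ∑ c ∈ partSupport n M,
      ∫⁻ x, ENNReal.ofReal (chartPartition n M c x) * f x ∂(chartMeasure δ c) := by
  rw [densityMeasure, lintegral_sum_measure, tsum_eq_sum (s := partSupport n M)]
  · exact Finset.sum_congr rfl fun c _ =>
      lintegral_withDensity_eq_lintegral_mul _ (measurable_chartPartition c) hf
  · intro c hc
    rw [lintegral_withDensity_eq_lintegral_mul _ (measurable_chartPartition c) hf]
    simp [chartPartition_eq_zero hc]

/-- On the domain of a chart the measure of a density is given by its coordinate expression. -/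
lemma restrict_densityMeasure {δ : ∀ x : M, (Fin (2 * n + 1) → Tan n x) → ℝ} (hδ : IsDensity δ)
    (c : M) : (densityMeasure δ).restrict (extChartAt (𝓡 (2 * n + 1)) c).source =
      chartMeasure δ c := by
  ext A hA
  set s := (extChartAt (𝓡 (2 * n + 1)) c).source with hs
  have hAs : MeasurableSet (A ∩ s) := hA.inter (measurableSet_source c)
  rw [Measure.restrict_apply hA, ← lintegral_indicator_one hAs,
    lintegral_densityMeasure δ (measurable_one.indicator hAs)]
  -- The piece of the partition at `c'` lives in the domain of that chart, where both chart measures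
  -- agree. All pieces can thus be moved to the chart `c`, where they sum to one.
  have key : ∀ c', ∫⁻ x, ENNReal.ofReal (chartPartition n M c' x) * (A ∩ s).indicator 1 x
      ∂(chartMeasure δ c') = ∫⁻ x in A ∩ s, ENNReal.ofReal (chartPartition n M c' x)
        ∂(chartMeasure δ c) := fun c' => by
    set B := A ∩ s ∩ (extChartAt (𝓡 (2 * n + 1)) c').source
    have hB : MeasurableSet B := hAs.inter (measurableSet_source c')
    have hr : (chartMeasure δ c').restrict B = (chartMeasure δ c).restrict B := by
      ext C hC
      rw [Measure.restrict_apply hC, Measure.restrict_apply hC]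
      exact chartMeasure_congr hδ _ _ (hC.inter hB) (fun x hx => hx.2.2) (fun x hx => hx.2.1.2)
    have hz : ∀ x, x ∉ (extChartAt (𝓡 (2 * n + 1)) c').source → chartPartition n M c' x = 0 :=
      fun x hx => image_eq_zero_of_notMem_tsupport fun h => hx (tsupport_chartPartition c' h)
    have h1 : ∀ x, ENNReal.ofReal (chartPartition n M c' x) * (A ∩ s).indicator 1 x =
        B.indicator (fun x => ENNReal.ofReal (chartPartition n M c' x)) x := fun x => by
      by_cases h2 : x ∈ (extChartAt (𝓡 (2 * n + 1)) c').source
      · by_cases h3 : x ∈ A ∩ s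
        · have h4 : x ∈ B := ⟨h3, h2⟩
          simp only [Set.indicator_of_mem h3, Set.indicator_of_mem h4, Pi.one_apply, mul_one]
        · have h4 : x ∉ B := fun h => h3 h.1
          simp only [Set.indicator_of_notMem h3, Set.indicator_of_notMem h4, mul_zero]
      · have h4 : x ∉ B := fun h => h2 h.2
        rw [Set.indicator_of_notMem h4, hz x h2, ENNReal.ofReal_zero, zero_mul]
    have h5 : ∀ x, (A ∩ s).indicator (fun x => ENNReal.ofReal (chartPartition n M c' x)) x =
        B.indicator (fun x => ENNReal.ofReal (chartPartition n M c' x)) x := fun x => by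
      rw [← h1]
      by_cases h3 : x ∈ A ∩ s
      · simp only [Set.indicator_of_mem h3, Pi.one_apply, mul_one]
      · simp only [Set.indicator_of_notMem h3, mul_zero]
    rw [lintegral_congr h1, lintegral_indicator hB, hr, ← lintegral_indicator hB,
      ← lintegral_indicator hAs, lintegral_congr h5]
  simp only [key]
  rw [← lintegral_finsetSum _ fun c' _ => measurable_chartPartition c']
  have h6 : ∀ x, ∑ c' ∈ partSupport n M, ENNReal.ofReal (chartPartition n M c' x) = 1 := fun x => by
    rw [← ENNReal.ofReal_sum_of_nonneg fun c' _ => chartPartition_nonneg c' x, sum_chartPartition,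
      ENNReal.ofReal_one]
  simp only [h6, lintegral_one, Measure.restrict_apply_univ]
  refine le_antisymm (measure_mono Set.inter_subset_left) ?_
  calc chartMeasure δ c A ≤ chartMeasure δ c (A ∩ s) + chartMeasure δ c sᶜ := by
        refine (measure_mono fun x hx => ?_).trans (measure_union_le _ _)
        by_cases h : x ∈ s
        · exact Or.inl ⟨hx, h⟩
        · exact Or.inr h
    _ = _ := by rw [chartMeasure_compl_source, add_zero]

lemma integral_densityMeasure_of_support {δ : ∀ x : M, (Fin (2 * n + 1) → Tan n x) → ℝ}
    (hδ : IsDensity δ) (c : M) {f : M → ℝ} (hf : Measurable f)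
    (hs : ∀ x, x ∉ (extChartAt (𝓡 (2 * n + 1)) c).source → f x = 0) :
    ∫ x, f x ∂(densityMeasure δ) = ∫ y in (extChartAt (𝓡 (2 * n + 1)) c).target,
        |locDens δ c y| * f ((extChartAt (𝓡 (2 * n + 1)) c).symm y) := by
  rw [← integral_chartMeasure hδ c hf, ← restrict_densityMeasure hδ c]
  exact (setIntegral_eq_integral_of_forall_compl_eq_zero hs).symm

/-- Only finitely many pieces occur, and each density is continuous, hence bounded, on the compact
image of the support of its cutoff. -/
lemma isFiniteMeasure_densityMeasure {δ : ∀ x : M, (Fin (2 * n + 1) → Tan n x) → ℝ}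
    (hδ : IsDensity δ) : IsFiniteMeasure (densityMeasure δ) := by
  constructor
  rw [← lintegral_one, lintegral_densityMeasure δ measurable_const]
  refine ENNReal.sum_lt_top.2 fun c _ => ?_
  simp only [mul_one]
  rw [lintegral_chartMeasure hδ c (measurable_chartPartition c)]
  set T := (extChartAt (𝓡 (2 * n + 1)) c).target
  set K := extChartAt (𝓡 (2 * n + 1)) c '' tsupport (chartPartition n M c)
  have hK : IsCompact K := (isClosed_tsupport _).isCompact.image_of_continuousOn
    ((continuousOn_extChartAt c).mono (tsupport_chartPartition c))
  have hKT : K ⊆ T := by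
    rintro _ ⟨x, hx, rfl⟩
    exact (extChartAt (𝓡 (2 * n + 1)) c).map_source (tsupport_chartPartition c hx)
  obtain ⟨C, hC⟩ := (hK.image_of_continuousOn ((hδ.cont c).mono hKT).abs).bddAbove
  calc _ ≤ ∫⁻ y in T, K.indicator (fun _ => ENNReal.ofReal C) y := by
        refine setLIntegral_mono ((measurable_const).indicator hK.measurableSet) fun y hy => ?_
        by_cases hyK : y ∈ K
        · rw [Set.indicator_of_mem hyK]
          calc _ ≤ ENNReal.ofReal C * 1 := by
                refine mul_le_mul' (ENNReal.ofReal_le_ofReal (hC ⟨y, hyK, rfl⟩)) ?_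
                rw [ENNReal.ofReal_le_one]
                exact (chartPartition n M).le_one c _
            _ = _ := mul_one _
        · have : chartPartition n M c ((extChartAt (𝓡 (2 * n + 1)) c).symm y) = 0 := by
            refine image_eq_zero_of_notMem_tsupport fun h => hyK ⟨_, h, ?_⟩
            exact (extChartAt (𝓡 (2 * n + 1)) c).right_inv hy
          rw [this, ENNReal.ofReal_zero, mul_zero]; exact zero_le
    _ ≤ ∫⁻ y, K.indicator (fun _ => ENNReal.ofReal C) y := setLIntegral_le_lintegral _ _
    _ = ENNReal.ofReal C * volume K := lintegral_indicator_const hK.measurableSet _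
    _ < ⊤ := ENNReal.mul_lt_top ENNReal.ofReal_lt_top hK.measure_lt_top

lemma isOpenPosMeasure_densityMeasure {δ : ∀ x : M, (Fin (2 * n + 1) → Tan n x) → ℝ}
    (hδ : IsDensity δ) (h0 : ∀ c, ∀ y ∈ (extChartAt (𝓡 (2 * n + 1)) c).target, locDens δ c y ≠ 0) :
    (densityMeasure δ).IsOpenPosMeasure := by
  constructor
  rintro U hU ⟨x, hx⟩ h
  have h1 : chartMeasure δ x U = 0 := by
    rw [← restrict_densityMeasure hδ x]
    exact le_antisymm ((Measure.restrict_apply_le _ _).trans_eq h) zero_le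
  rw [chartMeasure_apply δ x hU.measurableSet] at h1
  set s := (extChartAt (𝓡 (2 * n + 1)) x).target ∩ (extChartAt (𝓡 (2 * n + 1)) x).symm ⁻¹' U
  have hs : IsOpen s :=
    (continuousOn_extChartAt_symm x).isOpen_inter_preimage (isOpen_target x) hU
  have hne : s.Nonempty := ⟨extChartAt (𝓡 (2 * n + 1)) x x, mem_extChartAt_target x, by
    rw [Set.mem_preimage, extChartAt_to_inv]; exact hx⟩
  have hm : AEMeasurable (fun y => ENNReal.ofReal |locDens δ x y|)
      ((volume : Measure (Model n)).restrict s) :=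
    (((hδ.cont x).mono Set.inter_subset_left).abs.aemeasurable hs.measurableSet).ennreal_ofReal
  rw [lintegral_eq_zero_iff' hm, Filter.EventuallyEq, ae_restrict_iff' hs.measurableSet] at h1
  have h2 : ∀ᵐ y : Model n, y ∉ s := h1.mono fun y hy hys => by
    have := hy hys
    simp only [Pi.zero_apply, ENNReal.ofReal_eq_zero, abs_nonpos_iff] at this
    exact h0 x y hys.1 this
  exact (hs.measure_pos volume hne).ne' (by simpa [ae_iff] using h2)

/-- Refers all volume measures of the problem, contact or Riemannian, to the single measure of the
zero potential. -/
lemma densityMeasure_mul {δ δ' : ∀ x : M, (Fin (2 * n + 1) → Tan n x) → ℝ} (hδ : IsDensity δ)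
    {r : M → ℝ} (hr : Measurable r) (h : ∀ x v, |δ' x v| = r x * |δ x v|) (hr0 : ∀ x, 0 ≤ r x) :
    densityMeasure δ' = (densityMeasure δ).withDensity fun x => ENNReal.ofReal (r x) := by
  have hc : ∀ c, chartMeasure δ' c = (chartMeasure δ c).withDensity fun x => ENNReal.ofReal (r x) := by
    intro c
    ext A hA
    rw [withDensity_apply _ hA, ← lintegral_indicator hA,
      lintegral_chartMeasure hδ c (hr.ennreal_ofReal.indicator hA), chartMeasure_apply _ c hA]
    have hs := measurableSet_chart_image (n := n) c hA
    set T := (extChartAt (𝓡 (2 * n + 1)) c).target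
    set s := T ∩ (extChartAt (𝓡 (2 * n + 1)) c).symm ⁻¹' A
    have h1 : ∫⁻ y in T, ENNReal.ofReal |locDens δ c y| * A.indicator
        (fun x => ENNReal.ofReal (r x)) ((extChartAt (𝓡 (2 * n + 1)) c).symm y) =
        ∫⁻ y in T, s.indicator (fun y => ENNReal.ofReal |locDens δ' c y|) y := by
      refine setLIntegral_congr_fun (measurableSet_target c) fun y hy => ?_
      by_cases hyA : (extChartAt (𝓡 (2 * n + 1)) c).symm y ∈ A
      · have hys : y ∈ s := ⟨hy, hyA⟩
        simp only [Set.indicator_of_mem hys, Set.indicator_of_mem hyA]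
        have h2 : |locDens δ' c y| = r _ * |locDens δ c y| := h _ _
        rw [h2, ENNReal.ofReal_mul (hr0 _), mul_comm]
      · have hys : y ∉ s := fun h => hyA h.2
        simp only [Set.indicator_of_notMem hys, Set.indicator_of_notMem hyA, mul_zero]
    rw [h1, lintegral_indicator hs, Measure.restrict_restrict hs,
      Set.inter_eq_left.2 Set.inter_subset_left]
  ext A hA
  rw [withDensity_apply _ hA, ← lintegral_indicator hA,
    lintegral_densityMeasure δ (hr.ennreal_ofReal.indicator hA), ← lintegral_indicator_one hA,
    lintegral_densityMeasure δ' (measurable_one.indicator hA)]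
  refine Finset.sum_congr rfl fun c _ => ?_
  rw [hc c]
  refine (lintegral_withDensity_eq_lintegral_mul _ hr.ennreal_ofReal
    ((measurable_chartPartition c).mul (measurable_one.indicator hA))).trans
      (lintegral_congr fun x => ?_)
  by_cases hx : x ∈ A
  · simp [hx, mul_comm]
  · simp [hx]

end Measure
end Sasaki

end

section

namespace Sasaki

/-! ### The linearization of `α ∧ τⁿ`. -/

section LinWedge

variable {n : ℕ} {V : Type*}

/-- The linearization `n α ∧ θ ∧ τ ∧ ... ∧ τ` of `α ∧ τ ∧ ... ∧ τ` in the direction of `θ`. -/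
def linWedge (α : V → ℝ) (τ θ : V → V → ℝ) (v : Fin (2 * n + 1) → V) : ℝ :=
  (1 / 2 ^ n : ℝ) * ∑ σ : Equiv.Perm (Fin (2 * n + 1)),
    ((Equiv.Perm.sign σ : ℤ) : ℝ) * α (v (σ (reebIdx n))) *
      ∑ j : Fin n, θ (v (σ (fstIdx j))) (v (σ (sndIdx j))) *
        ∏ k ∈ Finset.univ.erase j, τ (v (σ (fstIdx k))) (v (σ (sndIdx k)))

lemma hasDerivAt_wedge {α : ℝ → V → ℝ} {τ : ℝ → V → V → ℝ} {α' : V → ℝ} {θ : V → V → ℝ} {t : ℝ}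
    (hα : ∀ v, HasDerivAt (fun s => α s v) (α' v) t)
    (hτ : ∀ v w, HasDerivAt (fun s => τ s v w) (θ v w) t) (v : Fin (2 * n + 1) → V) :
    HasDerivAt (fun s => wedge (α s) (τ s) v)
      (wedge α' (τ t) v + linWedge (α t) (τ t) θ v) t := by
  unfold wedge linWedge
  rw [← mul_add, ← Finset.sum_add_distrib]
  refine HasDerivAt.const_mul _ (HasDerivAt.fun_sum fun σ _ => ?_)
  have h1 := (hα (v (σ (reebIdx n)))).const_mul ((Equiv.Perm.sign σ : ℤ) : ℝ)
  have h2 := HasDerivAt.fun_finsetProd (u := Finset.univ) fun (k : Fin n) _ =>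
    hτ (v (σ (fstIdx k))) (v (σ (sndIdx k)))
  refine (h1.mul h2).congr_deriv ?_
  congr 2
  exact Finset.sum_congr rfl fun j _ => by rw [smul_eq_mul, mul_comm]

lemma linWedge_add (α : V → ℝ) (τ θ θ' : V → V → ℝ) (v : Fin (2 * n + 1) → V) :
    linWedge α τ (fun x y => θ x y + θ' x y) v = linWedge α τ θ v + linWedge α τ θ' v := by
  simp only [linWedge, ← mul_add, ← Finset.sum_add_distrib]
  congr 1
  refine Finset.sum_congr rfl fun σ _ => ?_
  congr 1
  exact Finset.sum_congr rfl fun j _ => by ring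

lemma linWedge_smul (α : V → ℝ) (τ θ : V → V → ℝ) (r : ℝ) (v : Fin (2 * n + 1) → V) :
    linWedge α τ (fun x y => r * θ x y) v = r * linWedge α τ θ v := by
  simp only [linWedge, Finset.mul_sum]
  refine Finset.sum_congr rfl fun σ _ => Finset.sum_congr rfl fun j _ => ?_
  ring

lemma linWedge_zero (α : V → ℝ) (τ : V → V → ℝ) (v : Fin (2 * n + 1) → V) :
    linWedge α τ (fun _ _ => 0) v = 0 := by simp [linWedge]

/-- Obtained by differentiating `wedge_eq_det_mul` for `τ + s θ` at `s = 0`. -/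
lemma linWedge_eq_det_mul [AddCommGroup V] [Module ℝ V] (b : Module.Basis (Fin (2 * n + 1)) ℝ V)
    (α : V →ₗ[ℝ] ℝ) (τ θ : V →ₗ[ℝ] V →ₗ[ℝ] ℝ) (v : Fin (2 * n + 1) → V) :
    linWedge (fun x => α x) (fun x y => τ x y) (fun x y => θ x y) v =
      b.det v * linWedge (fun x => α x) (fun x y => τ x y) (fun x y => θ x y) b := by
  have key : ∀ v : Fin (2 * n + 1) → V, HasDerivAt (fun s : ℝ => wedge (fun x => α x) (fun x y => (τ + s • θ) x y) v)
      (linWedge (fun x => α x) (fun x y => τ x y) (fun x y => θ x y) v) 0 := fun v => by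
    have h := hasDerivAt_wedge (α := fun _ x => α x) (τ := fun s x y => (τ + s • θ) x y)
      (α' := fun _ => 0) (θ := fun x y => θ x y) (t := 0) (fun x => hasDerivAt_const _ _)
      (fun x y => by
        have := ((hasDerivAt_id (0 : ℝ)).mul_const (θ x y)).const_add (τ x y)
        simpa using this) v
    refine h.congr_deriv ?_
    simp [wedge]
  have h1 := (key b).const_mul (b.det v)
  simp only [← wedge_eq_det_mul b] at h1
  exact (key v).unique h1

end LinWedge

/-! ### Signed sums over permutations. -/

section Permutations

variable {n : ℕ} {ι : Type*} [Fintype ι] [DecidableEq ι]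

lemma sum_sign_swap (F : Equiv.Perm ι → ℝ) {i j : ι} (hij : i ≠ j) :
    ∑ σ : Equiv.Perm ι, ((Equiv.Perm.sign σ : ℤ) : ℝ) * F (σ * Equiv.swap i j) =
      -∑ σ : Equiv.Perm ι, ((Equiv.Perm.sign σ : ℤ) : ℝ) * F σ := by
  rw [← Finset.sum_neg_distrib,
    ← Equiv.sum_comp (Equiv.mulRight (Equiv.swap i j)) fun σ => -(((Equiv.Perm.sign σ : ℤ) : ℝ) * F σ)]
  refine Finset.sum_congr rfl fun σ _ => ?_
  simp [Equiv.Perm.sign_mul, Equiv.Perm.sign_swap hij]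

lemma sum_sign_eq_zero (F : Equiv.Perm ι → ℝ) {i j : ι} (hij : i ≠ j)
    (hF : ∀ σ, F (σ * Equiv.swap i j) = F σ) :
    ∑ σ : Equiv.Perm ι, ((Equiv.Perm.sign σ : ℤ) : ℝ) * F σ = 0 := by
  have := sum_sign_swap F hij
  simp only [hF] at this
  linarith

/-- Exchanging the two indices of a pair changes the sign, so antisymmetrizing one factor doubles
the signed sum. The induction antisymmetrizes one factor at a time. -/
lemma sum_sign_skew (F : Fin (2 * n + 1) → ℝ)
    (A : Fin n → Fin (2 * n + 1) → Fin (2 * n + 1) → ℝ) :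
    ∑ σ : Equiv.Perm (Fin (2 * n + 1)), ((Equiv.Perm.sign σ : ℤ) : ℝ) * F (σ (reebIdx n)) *
      ∏ k, (A k (σ (fstIdx k)) (σ (sndIdx k)) - A k (σ (sndIdx k)) (σ (fstIdx k))) =
    2 ^ n * ∑ σ : Equiv.Perm (Fin (2 * n + 1)), ((Equiv.Perm.sign σ : ℤ) : ℝ) *
      F (σ (reebIdx n)) * ∏ k, A k (σ (fstIdx k)) (σ (sndIdx k)) := by
  suffices h : ∀ s : Finset (Fin n),
      ∑ σ : Equiv.Perm (Fin (2 * n + 1)), ((Equiv.Perm.sign σ : ℤ) : ℝ) * F (σ (reebIdx n)) *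
        ∏ k, (A k (σ (fstIdx k)) (σ (sndIdx k)) -
          if k ∈ s then A k (σ (sndIdx k)) (σ (fstIdx k)) else 0) =
      2 ^ s.card * ∑ σ : Equiv.Perm (Fin (2 * n + 1)), ((Equiv.Perm.sign σ : ℤ) : ℝ) *
        F (σ (reebIdx n)) * ∏ k, A k (σ (fstIdx k)) (σ (sndIdx k)) by
    simpa using h Finset.univ
  intro s
  induction s using Finset.induction_on with
  | empty => simp
  | insert j s hj ih =>
    rw [Finset.card_insert_of_notMem hj, pow_succ', mul_assoc, ← ih]
    set X : Equiv.Perm (Fin (2 * n + 1)) → ℝ := fun σ => F (σ (reebIdx n)) *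
      ∏ k, (A k (σ (fstIdx k)) (σ (sndIdx k)) -
        if k ∈ s then A k (σ (sndIdx k)) (σ (fstIdx k)) else 0) with hX
    have h1 : ∀ σ : Equiv.Perm (Fin (2 * n + 1)), F (σ (reebIdx n)) *
        ∏ k, (A k (σ (fstIdx k)) (σ (sndIdx k)) -
          if k ∈ insert j s then A k (σ (sndIdx k)) (σ (fstIdx k)) else 0) =
        X σ - X (σ * Equiv.swap (fstIdx j) (sndIdx j)) := fun σ => by
      have e0 : (σ * Equiv.swap (fstIdx j) (sndIdx j)) (reebIdx n) = σ (reebIdx n) := by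
        rw [Equiv.Perm.mul_apply, Equiv.swap_apply_of_ne_of_ne (fstIdx_ne_reebIdx _).symm
          (sndIdx_ne_reebIdx _).symm]
      have e1 : (σ * Equiv.swap (fstIdx j) (sndIdx j)) (fstIdx j) = σ (sndIdx j) := by simp
      have e2 : (σ * Equiv.swap (fstIdx j) (sndIdx j)) (sndIdx j) = σ (fstIdx j) := by simp
      have e3 : ∀ k ≠ j, (σ * Equiv.swap (fstIdx j) (sndIdx j)) (fstIdx k) = σ (fstIdx k) :=
        fun k hk => by
          rw [Equiv.Perm.mul_apply, Equiv.swap_apply_of_ne_of_ne (by simpa using hk)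
            (by simp)]
      have e4 : ∀ k ≠ j, (σ * Equiv.swap (fstIdx j) (sndIdx j)) (sndIdx k) = σ (sndIdx k) :=
        fun k hk => by
          rw [Equiv.Perm.mul_apply, Equiv.swap_apply_of_ne_of_ne (by simp)
            (by simpa using hk)]
      simp only [hX, e0]
      rw [← mul_sub]
      congr 1
      rw [← Finset.mul_prod_erase _ _ (Finset.mem_univ j),
        ← Finset.mul_prod_erase _ _ (Finset.mem_univ j),
        ← Finset.mul_prod_erase _ _ (Finset.mem_univ j), e1, e2]
      have p1 : ∏ k ∈ Finset.univ.erase j, (A k (σ (fstIdx k)) (σ (sndIdx k)) -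
          if k ∈ insert j s then A k (σ (sndIdx k)) (σ (fstIdx k)) else 0) =
          ∏ k ∈ Finset.univ.erase j, (A k (σ (fstIdx k)) (σ (sndIdx k)) -
          if k ∈ s then A k (σ (sndIdx k)) (σ (fstIdx k)) else 0) :=
        Finset.prod_congr rfl fun k hk => by simp [Finset.ne_of_mem_erase hk]
      have p2 : ∏ k ∈ Finset.univ.erase j, (A k ((σ * Equiv.swap (fstIdx j) (sndIdx j)) (fstIdx k))
          ((σ * Equiv.swap (fstIdx j) (sndIdx j)) (sndIdx k)) -
          if k ∈ s then A k ((σ * Equiv.swap (fstIdx j) (sndIdx j)) (sndIdx k))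
            ((σ * Equiv.swap (fstIdx j) (sndIdx j)) (fstIdx k)) else 0) =
          ∏ k ∈ Finset.univ.erase j, (A k (σ (fstIdx k)) (σ (sndIdx k)) -
          if k ∈ s then A k (σ (sndIdx k)) (σ (fstIdx k)) else 0) :=
        Finset.prod_congr rfl fun k hk => by
          rw [e3 k (Finset.ne_of_mem_erase hk), e4 k (Finset.ne_of_mem_erase hk)]
      rw [p1, p2]
      simp [hj]
      ring
    simp only [mul_assoc, h1]
    simp only [mul_sub, Finset.sum_sub_distrib]
    rw [sum_sign_swap X (by simp)]
    simp only [hX]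
    ring

/-- For `τ = da` the antisymmetrized derivative can be replaced by the plain derivative, at the
price of `2ⁿ`, which cancels the normalization. -/
lemma wedge_skew {V : Type*} (α : V → ℝ) (τ A : V → V → ℝ) (hτ : ∀ v w, τ v w = A v w - A w v)
    (e : Fin (2 * n + 1) → V) : wedge α τ e =
      ∑ σ : Equiv.Perm (Fin (2 * n + 1)), ((Equiv.Perm.sign σ : ℤ) : ℝ) *
        (α (e (σ (reebIdx n))) * ∏ k, A (e (σ (fstIdx k))) (e (σ (sndIdx k)))) := by
  simp only [wedge, hτ]
  rw [sum_sign_skew (fun i => α (e i)) fun _ i j => A (e i) (e j)]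
  simp only [mul_assoc]
  field_simp

lemma linWedge_skew {V : Type*} (α : V → ℝ) (τ θ A B : V → V → ℝ)
    (hτ : ∀ v w, τ v w = A v w - A w v) (hθ : ∀ v w, θ v w = B v w - B w v)
    (e : Fin (2 * n + 1) → V) : linWedge α τ θ e =
      ∑ j, ∑ σ : Equiv.Perm (Fin (2 * n + 1)), ((Equiv.Perm.sign σ : ℤ) : ℝ) *
        (B (e (σ (fstIdx j))) (e (σ (sndIdx j))) * α (e (σ (reebIdx n))) *
          ∏ k ∈ Finset.univ.erase j, A (e (σ (fstIdx k))) (e (σ (sndIdx k)))) := by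
  simp only [linWedge, Finset.mul_sum]
  rw [Finset.sum_comm]
  refine Finset.sum_congr rfl fun j _ => ?_
  -- The `j`-th factor is the one linearized; the family of forms indexed by the factors lets
  -- `sum_sign_skew` treat it together with the others.
  let C : Fin n → Fin (2 * n + 1) → Fin (2 * n + 1) → ℝ := fun k i l =>
    if k = j then B (e i) (e l) else A (e i) (e l)
  have h := sum_sign_skew (fun i => α (e i)) C
  have h1 : ∀ σ : Equiv.Perm (Fin (2 * n + 1)), ∏ k, (C k (σ (fstIdx k)) (σ (sndIdx k)) -
      C k (σ (sndIdx k)) (σ (fstIdx k))) = θ (e (σ (fstIdx j))) (e (σ (sndIdx j))) *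
        ∏ k ∈ Finset.univ.erase j, τ (e (σ (fstIdx k))) (e (σ (sndIdx k))) := fun σ => by
    rw [← Finset.mul_prod_erase _ _ (Finset.mem_univ j)]
    congr 1
    · simp [C, hθ]
    · exact Finset.prod_congr rfl fun k hk => by simp [C, hτ, Finset.ne_of_mem_erase hk]
  have h2 : ∀ σ : Equiv.Perm (Fin (2 * n + 1)), ∏ k, C k (σ (fstIdx k)) (σ (sndIdx k)) =
      B (e (σ (fstIdx j))) (e (σ (sndIdx j))) *
        ∏ k ∈ Finset.univ.erase j, A (e (σ (fstIdx k))) (e (σ (sndIdx k))) := fun σ => by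
    rw [← Finset.mul_prod_erase _ _ (Finset.mem_univ j)]
    congr 1
    · simp [C]
    · exact Finset.prod_congr rfl fun k hk => by simp [C, Finset.ne_of_mem_erase hk]
  simp only [h1, h2] at h
  rw [← Finset.mul_sum, h, ← mul_assoc]
  have : (1 / 2 ^ n : ℝ) * 2 ^ n = 1 := by field_simp
  rw [this, one_mul]
  exact Finset.sum_congr rfl fun σ _ => by ring

end Permutations

/-! ### Stokes' theorem for the linearized volume form in a chart. -/

section Stokes

open MeasureTheory

variable {n : ℕ}

/-- Integration by parts against the constant function one. -/
lemma integral_fderiv_eq_zero {f : Model n → ℝ} (hf : ContDiff ℝ 1 f) (hs : HasCompactSupport f)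
    (v : Model n) : ∫ y, fderiv ℝ f y v = 0 := by
  have hc : Continuous fun y => fderiv ℝ f y v :=
    (hf.continuous_fderiv (by simp)).clm_apply continuous_const
  have hi : Integrable fun y => fderiv ℝ f y v :=
    hc.integrable_of_hasCompactSupport (hs.fderiv_apply ℝ v)
  have h := integral_mul_fderiv_eq_neg_fderiv_mul_of_integrable (μ := volume)
    (f := fun _ : Model n => (1 : ℝ)) (g := f) (v := v) (by simp) (by simpa using hi)
    (by simpa using hf.continuous.integrable_of_hasCompactSupport hs)
    (fun x _ => differentiableAt_const _) (fun x _ => hf.differentiable (by simp) x)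
  simpa using h

variable {T : Set (Model n)} {a b : Model n → (Model n →L[ℝ] ℝ)}

/-- The function whose derivatives sum up to the linearized volume form. -/
def stokesTerm (a b : Model n → (Model n →L[ℝ] ℝ)) (j : Fin n)
    (σ : Equiv.Perm (Fin (2 * n + 1))) (y : Model n) : ℝ :=
  b y (stdBasis n (σ (sndIdx j))) * a y (stdBasis n (σ (reebIdx n))) *
    ∏ k ∈ Finset.univ.erase j,
      fderiv ℝ a y (stdBasis n (σ (fstIdx k))) (stdBasis n (σ (sndIdx k)))

lemma stokesTerm_zero (j : Fin n) (σ : Equiv.Perm (Fin (2 * n + 1))) {y : Model n} (h : b y = 0) :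
    stokesTerm a b j σ y = 0 := by simp [stokesTerm, h]

lemma contDiff_stokesTerm (hT : IsOpen T) (ha : ContDiffOn ℝ ∞ a T) (hb : ContDiff ℝ ∞ b)
    (hbT : tsupport b ⊆ T) (j : Fin n) (σ : Equiv.Perm (Fin (2 * n + 1))) :
    ContDiff ℝ 1 (stokesTerm a b j σ) := by
  rw [contDiff_iff_contDiffAt]
  intro y
  by_cases hy : y ∈ tsupport b
  · have hT' := hT.mem_nhds (hbT hy)
    have h1 : ContDiffAt ℝ 1 a y := (ha.contDiffAt hT').of_le (by simp)
    have h2 : ContDiffAt ℝ 1 (fderiv ℝ a) y :=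
      (ha.contDiffAt hT').fderiv_right (m := 1) two_le_infty
    refine ((hb.of_le (by simp)).contDiffAt.clm_apply contDiffAt_const).mul
      (h1.clm_apply contDiffAt_const) |>.mul ?_
    exact contDiffAt_prod fun k _ =>
      (h2.clm_apply contDiffAt_const).clm_apply contDiffAt_const
  · refine (contDiffAt_const (c := (0 : ℝ))).congr_of_eventuallyEq ?_
    filter_upwards [(isClosed_tsupport b).isOpen_compl.mem_nhds hy] with z hz
    exact stokesTerm_zero j σ (image_eq_zero_of_notMem_tsupport hz)

lemma hasCompactSupport_stokesTerm (hb : HasCompactSupport b) (j : Fin n)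
    (σ : Equiv.Perm (Fin (2 * n + 1))) : HasCompactSupport (stokesTerm a b j σ) :=
  hb.mono' fun y hy => by
    by_contra h
    exact hy (stokesTerm_zero j σ (image_eq_zero_of_notMem_tsupport h))

/-- The coordinate form of `d(a ∧ b ∧ (da)ⁿ⁻¹)`. The product rule gives the wanted term, a term
equal to `b ∧ (da)ⁿ` up to sign, which vanishes by `h0`, and terms with second derivatives of `a`,
which cancel because `d² = 0`. -/
lemma sum_fderiv_stokesTerm (hT : IsOpen T) (ha : ContDiffOn ℝ ∞ a T) (hb : ContDiff ℝ ∞ b)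
    (j : Fin n) {y : Model n} (hy : y ∈ T)
    (h0 : wedge (fun u => b y u) (fun u w => locD a y u w) (stdBasis n) = 0) :
    ∑ σ : Equiv.Perm (Fin (2 * n + 1)), ((Equiv.Perm.sign σ : ℤ) : ℝ) *
      fderiv ℝ (stokesTerm a b j σ) y (stdBasis n (σ (fstIdx j))) =
    ∑ σ : Equiv.Perm (Fin (2 * n + 1)), ((Equiv.Perm.sign σ : ℤ) : ℝ) *
        (fderiv ℝ b y (stdBasis n (σ (fstIdx j))) (stdBasis n (σ (sndIdx j))) *
          a y (stdBasis n (σ (reebIdx n))) *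
          ∏ k ∈ Finset.univ.erase j, fderiv ℝ a y (stdBasis n (σ (fstIdx k)))
            (stdBasis n (σ (sndIdx k)))) := by
  set e := stdBasis n
  have hT' := hT.mem_nhds hy
  have ha1 : HasFDerivAt a (fderiv ℝ a y) y :=
    ((ha.contDiffAt hT').differentiableAt (by simp)).hasFDerivAt
  have ha2 : HasFDerivAt (fderiv ℝ a) (fderiv ℝ (fderiv ℝ a) y) y :=
    (((ha.contDiffAt hT').fderiv_right (m := 1) two_le_infty).differentiableAt
      (by simp)).hasFDerivAt
  have hb1 : HasFDerivAt b (fderiv ℝ b y) y := (hb.differentiable (by simp) y).hasFDerivAt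
  have hsymm : ∀ u w, fderiv ℝ (fderiv ℝ a) y u w = fderiv ℝ (fderiv ℝ a) y w u :=
    fun u w => ((ha.contDiffAt hT').isSymmSndFDerivAt
      (by rw [minSmoothness_of_isRCLikeNormedField, ← one_add_one_eq_two]; exact two_le_infty)).eq u w
  let P : Equiv.Perm (Fin (2 * n + 1)) → ℝ := fun σ => ∏ k ∈ Finset.univ.erase j,
    fderiv ℝ a y (e (σ (fstIdx k))) (e (σ (sndIdx k)))
  have key : ∀ σ : Equiv.Perm (Fin (2 * n + 1)),
      fderiv ℝ (stokesTerm a b j σ) y (e (σ (fstIdx j))) =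
      fderiv ℝ b y (e (σ (fstIdx j))) (e (σ (sndIdx j))) * a y (e (σ (reebIdx n))) * P σ +
      b y (e (σ (sndIdx j))) * fderiv ℝ a y (e (σ (fstIdx j))) (e (σ (reebIdx n))) * P σ +
      ∑ l ∈ Finset.univ.erase j, b y (e (σ (sndIdx j))) * a y (e (σ (reebIdx n))) *
        ((∏ k ∈ (Finset.univ.erase j).erase l,
          fderiv ℝ a y (e (σ (fstIdx k))) (e (σ (sndIdx k)))) *
          fderiv ℝ (fderiv ℝ a) y (e (σ (fstIdx j))) (e (σ (fstIdx l))) (e (σ (sndIdx l)))) :=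
    fun σ => by
    have hp := HasFDerivAt.finsetProd (u := Finset.univ.erase j) fun (k : Fin n) _ =>
      (ha2.clm_apply (hasFDerivAt_const (e (σ (fstIdx k))) y)).clm_apply
        (hasFDerivAt_const (e (σ (sndIdx k))) y)
    have h := ((hb1.clm_apply (hasFDerivAt_const (e (σ (sndIdx j))) y)).mul
      (ha1.clm_apply (hasFDerivAt_const (e (σ (reebIdx n))) y))).mul hp
    have h' : HasFDerivAt (stokesTerm a b j σ) _ y := h
    rw [h'.fderiv]
    simp [P]
    rw [← Finset.mul_sum]
    ring
  simp only [key, mul_add, Finset.sum_add_distrib]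
  have h2 : ∑ σ : Equiv.Perm (Fin (2 * n + 1)), ((Equiv.Perm.sign σ : ℤ) : ℝ) *
      (b y (e (σ (sndIdx j))) * fderiv ℝ a y (e (σ (fstIdx j))) (e (σ (reebIdx n))) * P σ) = 0 := by
    have hw := wedge_skew (fun u => b y u) (fun u w => locD a y u w)
      (fun u w => fderiv ℝ a y u w) (fun u w => locD_apply a y u w) e
    rw [h0] at hw
    -- Exchanging the second index of the pair `j` with the Reeb index turns the sum into `b ∧
    -- (da)ⁿ`.
    have hs := sum_sign_swap (fun σ => b y (e (σ (sndIdx j))) *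
      fderiv ℝ a y (e (σ (fstIdx j))) (e (σ (reebIdx n))) * P σ)
      (sndIdx_ne_reebIdx j)
    rw [← neg_eq_zero, ← hs, hw]
    refine Finset.sum_congr rfl fun σ _ => ?_
    have e3 : ∀ k, (σ * Equiv.swap (sndIdx j) (reebIdx n)) (fstIdx k) = σ (fstIdx k) := fun k => by
      rw [Equiv.Perm.mul_apply, Equiv.swap_apply_of_ne_of_ne (by simp) (fstIdx_ne_reebIdx k)]
    have e4 : ∀ k ≠ j, (σ * Equiv.swap (sndIdx j) (reebIdx n)) (sndIdx k) = σ (sndIdx k) :=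
      fun k hk => by
        rw [Equiv.Perm.mul_apply, Equiv.swap_apply_of_ne_of_ne (by simpa using hk)
          (sndIdx_ne_reebIdx k)]
    have e5 : P (σ * Equiv.swap (sndIdx j) (reebIdx n)) = P σ :=
      Finset.prod_congr rfl fun k hk => by rw [e3, e4 k (Finset.ne_of_mem_erase hk)]
    rw [e3, e5, Equiv.Perm.mul_apply, Equiv.Perm.mul_apply, Equiv.swap_apply_left,
      Equiv.swap_apply_right, ← Finset.mul_prod_erase _ _ (Finset.mem_univ j), mul_assoc]
  have h3 : ∀ l ∈ Finset.univ.erase j, ∑ σ : Equiv.Perm (Fin (2 * n + 1)),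
      ((Equiv.Perm.sign σ : ℤ) : ℝ) * (b y (e (σ (sndIdx j))) * a y (e (σ (reebIdx n))) *
        ((∏ k ∈ (Finset.univ.erase j).erase l,
          fderiv ℝ a y (e (σ (fstIdx k))) (e (σ (sndIdx k)))) *
          fderiv ℝ (fderiv ℝ a) y (e (σ (fstIdx j))) (e (σ (fstIdx l))) (e (σ (sndIdx l))))) = 0 := by
    intro l hl
    have hlj := Finset.ne_of_mem_erase hl
    -- The summand is unchanged when the first indices of the pairs `j` and `l` are exchanged, by
    -- symmetry of the second derivative, while the sign flips.
    refine sum_sign_eq_zero _ (i := fstIdx j) (j := fstIdx l) (by simpa using hlj.symm) fun σ => ?_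
    have e3 : ∀ k, (σ * Equiv.swap (fstIdx j) (fstIdx l)) (sndIdx k) = σ (sndIdx k) := fun k => by
      rw [Equiv.Perm.mul_apply, Equiv.swap_apply_of_ne_of_ne (by simp) (by simp)]
    have e4 : ∀ k ≠ j, k ≠ l → (σ * Equiv.swap (fstIdx j) (fstIdx l)) (fstIdx k) = σ (fstIdx k) :=
      fun k hk hk' => by
        rw [Equiv.Perm.mul_apply, Equiv.swap_apply_of_ne_of_ne (by simpa using hk)
          (by simpa using hk')]
    have e0 : (σ * Equiv.swap (fstIdx j) (fstIdx l)) (reebIdx n) = σ (reebIdx n) := by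
      rw [Equiv.Perm.mul_apply, Equiv.swap_apply_of_ne_of_ne (fstIdx_ne_reebIdx _).symm
        (fstIdx_ne_reebIdx _).symm]
    have e5 : ∏ k ∈ (Finset.univ.erase j).erase l,
        fderiv ℝ a y (e ((σ * Equiv.swap (fstIdx j) (fstIdx l)) (fstIdx k)))
          (e ((σ * Equiv.swap (fstIdx j) (fstIdx l)) (sndIdx k))) =
        ∏ k ∈ (Finset.univ.erase j).erase l,
          fderiv ℝ a y (e (σ (fstIdx k))) (e (σ (sndIdx k))) :=
      Finset.prod_congr rfl fun k hk => by
        rw [e3, e4 k (Finset.ne_of_mem_erase (Finset.mem_of_mem_erase hk))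
          (Finset.ne_of_mem_erase hk)]
    rw [e5, e3, e3, e0, Equiv.Perm.mul_apply, Equiv.Perm.mul_apply, Equiv.swap_apply_left,
      Equiv.swap_apply_right, hsymm]
  have h4 : ∑ σ : Equiv.Perm (Fin (2 * n + 1)), ((Equiv.Perm.sign σ : ℤ) : ℝ) *
      ∑ l ∈ Finset.univ.erase j, b y (e (σ (sndIdx j))) * a y (e (σ (reebIdx n))) *
        ((∏ k ∈ (Finset.univ.erase j).erase l,
          fderiv ℝ a y (e (σ (fstIdx k))) (e (σ (sndIdx k)))) *
          fderiv ℝ (fderiv ℝ a) y (e (σ (fstIdx j))) (e (σ (fstIdx l))) (e (σ (sndIdx l)))) = 0 := by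
    simp only [Finset.mul_sum (Finset.univ.erase j)]
    rw [Finset.sum_comm]
    exact Finset.sum_eq_zero h3
  rw [h2, h4, add_zero, add_zero]

/-- Stokes' theorem for the linearized volume form. -/
lemma integral_linWedge_eq_zero (hT : IsOpen T) (ha : ContDiffOn ℝ ∞ a T) (hb : ContDiff ℝ ∞ b)
    (hbc : HasCompactSupport b) (hbT : tsupport b ⊆ T)
    (h0 : ∀ y ∈ T, wedge (fun u => b y u) (fun u w => locD a y u w) (stdBasis n) = 0) :
    ∫ y, linWedge (fun u => a y u) (fun u w => locD a y u w) (fun u w => locD b y u w)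
      (stdBasis n) = 0 := by
  have h1 : ∀ y, linWedge (fun u => a y u) (fun u w => locD a y u w) (fun u w => locD b y u w)
      (stdBasis n) = ∑ j, ∑ σ : Equiv.Perm (Fin (2 * n + 1)), ((Equiv.Perm.sign σ : ℤ) : ℝ) *
        fderiv ℝ (stokesTerm a b j σ) y (stdBasis n (σ (fstIdx j))) := fun y => by
    by_cases hy : y ∈ tsupport b
    · rw [linWedge_skew _ _ _ (fun u w => fderiv ℝ a y u w) (fun u w => fderiv ℝ b y u w)
        (fun u w => locD_apply a y u w) (fun u w => locD_apply b y u w)]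
      exact Finset.sum_congr rfl fun j _ =>
        (sum_fderiv_stokesTerm hT ha hb j (hbT hy) (h0 y (hbT hy))).symm
    · have hev : ∀ᶠ z in 𝓝 y, b z = 0 := by
        filter_upwards [(isClosed_tsupport b).isOpen_compl.mem_nhds hy] with z hz
        exact image_eq_zero_of_notMem_tsupport hz
      have hb0 : fderiv ℝ b y = 0 := by
        have : b =ᶠ[𝓝 y] fun _ => 0 := hev
        rw [this.fderiv_eq]; simp
      have hs0 : ∀ j σ, fderiv ℝ (stokesTerm a b j σ) y = 0 := fun j σ => by
        have : stokesTerm a b j σ =ᶠ[𝓝 y] fun _ => 0 :=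
          hev.mono fun z hz => stokesTerm_zero j σ hz
        rw [this.fderiv_eq]; simp
      simp [hs0, locD_apply, hb0, linWedge_zero]
  simp only [h1]
  have hi : ∀ j (σ : Equiv.Perm (Fin (2 * n + 1))), Integrable fun y =>
      ((Equiv.Perm.sign σ : ℤ) : ℝ) *
        fderiv ℝ (stokesTerm a b j σ) y (stdBasis n (σ (fstIdx j))) := fun j σ => by
    have hc := contDiff_stokesTerm hT ha hb hbT j σ
    exact Integrable.const_mul (((hc.continuous_fderiv (by simp)).clm_apply
      continuous_const).integrable_of_hasCompactSupport
        ((hasCompactSupport_stokesTerm hbc j σ).fderiv_apply ℝ _)) _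
  rw [integral_finsetSum _ fun j _ => integrable_finsetSum _ fun σ _ => hi j σ]
  refine Finset.sum_eq_zero fun j _ => ?_
  rw [integral_finsetSum _ fun σ _ => hi j σ]
  refine Finset.sum_eq_zero fun σ _ => ?_
  rw [integral_const_mul, integral_fderiv_eq_zero (contDiff_stokesTerm hT ha hb hbT j σ)
    (hasCompactSupport_stokesTerm hbc j σ), mul_zero]

end Stokes
end Sasaki

end

section

namespace Sasaki

lemma infty_add_one_le : (∞ : ℕ∞ω) + 1 ≤ (∞ : ℕ∞ω) := by
  exact_mod_cast le_rfl

/-! ### Smooth dependence on a real parameter. -/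

section Parametric

variable {E G : Type*} [NormedAddCommGroup E] [NormedSpace ℝ E] [NormedAddCommGroup G]
  [NormedSpace ℝ G]

/-- Families of functions on `T` which depend smoothly on the point and on a real parameter. -/
def ParSmooth (T : Set E) (f : ℝ → E → G) : Prop :=
  ContDiffOn ℝ ∞ (fun p : ℝ × E => f p.1 p.2) (Set.univ ×ˢ T)

namespace ParSmooth

variable {T : Set E} {f : ℝ → E → G}

lemma contDiffAt (hT : IsOpen T) (hf : ParSmooth T f) (t : ℝ) {y : E}
    (hy : y ∈ T) :
    ContDiffAt ℝ ∞ (fun p : ℝ × E => f p.1 p.2) (t, y) :=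
  ContDiffOn.contDiffAt hf ((isOpen_univ.prod hT).mem_nhds ⟨trivial, hy⟩)

lemma hasFDerivAt (hT : IsOpen T) (hf : ParSmooth T f) (t : ℝ) {y : E}
    (hy : y ∈ T) : HasFDerivAt (fun p : ℝ × E => f p.1 p.2)
    (fderiv ℝ (fun p : ℝ × E => f p.1 p.2) (t, y)) (t, y) :=
  ((hf.contDiffAt hT t hy).differentiableAt (by simp)).hasFDerivAt

lemma contDiffOn_fderiv (hT : IsOpen T) (hf : ParSmooth T f) : ContDiffOn ℝ ∞ (fderiv ℝ (fun p : ℝ × E => f p.1 p.2))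
    (Set.univ ×ˢ T) :=
  ContDiffOn.fderiv_of_isOpen hf (isOpen_univ.prod hT) infty_add_one_le

lemma fderiv_slice (hT : IsOpen T) (hf : ParSmooth T f) (t : ℝ) {y : E}
    (hy : y ∈ T) : fderiv ℝ (f t) y =
    (fderiv ℝ (fun p : ℝ × E => f p.1 p.2) (t, y)).comp (ContinuousLinearMap.inr ℝ ℝ E) :=
  ((hf.hasFDerivAt hT t hy).comp y (hasFDerivAt_prodMk_right t y)).fderiv

lemma hasDerivAt_slice (hT : IsOpen T) (hf : ParSmooth T f) (t : ℝ) {y : E}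
    (hy : y ∈ T) : HasDerivAt (fun s => f s y)
    (fderiv ℝ (fun p : ℝ × E => f p.1 p.2) (t, y) (1, 0)) t := by
  have h := (hf.hasFDerivAt hT t hy).comp_hasDerivAt t
    ((hasDerivAt_id t).prodMk (hasDerivAt_const t y))
  exact h

lemma hasDerivAt (hT : IsOpen T) (hf : ParSmooth T f) (t : ℝ) {y : E}
    (hy : y ∈ T) :
    HasDerivAt (fun s => f s y) (deriv (fun s => f s y) t) t :=
  (hf.hasDerivAt_slice hT t hy).differentiableAt.hasDerivAt

lemma fderiv (hT : IsOpen T) (hf : ParSmooth T f) : ParSmooth T fun t y => fderiv ℝ (f t) y := by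
  have h : ContDiffOn ℝ ∞ (fun p : ℝ × E => (_root_.fderiv ℝ (fun p : ℝ × E => f p.1 p.2) p).comp
      (ContinuousLinearMap.inr ℝ ℝ E)) (Set.univ ×ˢ T) :=
    (hf.contDiffOn_fderiv hT).clm_comp contDiffOn_const
  exact h.congr fun p hp => hf.fderiv_slice hT p.1 hp.2

lemma deriv (hT : IsOpen T) (hf : ParSmooth T f) : ParSmooth T fun t y => deriv (fun s => f s y) t := by
  have h : ContDiffOn ℝ ∞ (fun p : ℝ × E => _root_.fderiv ℝ (fun p : ℝ × E => f p.1 p.2) p (1, 0))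
      (Set.univ ×ˢ T) := (hf.contDiffOn_fderiv hT).clm_apply contDiffOn_const
  exact h.congr fun p hp => (hf.hasDerivAt_slice hT p.1 hp.2).deriv

/-- The derivatives in the parameter and in the point commute. -/
lemma hasDerivAt_fderiv (hT : IsOpen T) (hf : ParSmooth T f) (t : ℝ) {y : E}
    (hy : y ∈ T) :
    HasDerivAt (fun s => _root_.fderiv ℝ (f s) y)
      (_root_.fderiv ℝ (fun z => _root_.deriv (fun s => f s z) t) y) t := by
  set F := fun p : ℝ × E => f p.1 p.2 with hF
  have h2 : HasFDerivAt (_root_.fderiv ℝ F) (_root_.fderiv ℝ (_root_.fderiv ℝ F) (t, y)) (t, y) :=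
    (((hf.contDiffAt hT t hy).fderiv_right (m := 1) two_le_infty).differentiableAt
      (by simp)).hasFDerivAt
  have hsymm : ∀ u w, _root_.fderiv ℝ (_root_.fderiv ℝ F) (t, y) u w =
      _root_.fderiv ℝ (_root_.fderiv ℝ F) (t, y) w u :=
    fun u w => ((hf.contDiffAt hT t hy).isSymmSndFDerivAt
      (by rw [minSmoothness_of_isRCLikeNormedField, ← one_add_one_eq_two]; exact two_le_infty)).eq u w
  have h3 : HasDerivAt (fun s => _root_.fderiv ℝ F (s, y))
      (_root_.fderiv ℝ (_root_.fderiv ℝ F) (t, y) (1, 0)) t :=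
    h2.comp_hasDerivAt t ((hasDerivAt_id t).prodMk (hasDerivAt_const t y))
  have h4 : HasFDerivAt (fun z => _root_.fderiv ℝ F (t, z))
      ((_root_.fderiv ℝ (_root_.fderiv ℝ F) (t, y)).comp (ContinuousLinearMap.inr ℝ ℝ E)) y :=
    h2.comp y (hasFDerivAt_prodMk_right t y)
  have h5 : (fun s => _root_.fderiv ℝ (f s) y) = fun s =>
      (_root_.fderiv ℝ F (s, y)).comp (ContinuousLinearMap.inr ℝ ℝ E) :=
    funext fun s => hf.fderiv_slice hT s hy
  have h6 : (fun z => _root_.deriv (fun s => f s z) t) =ᶠ[𝓝 y] fun z =>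
      _root_.fderiv ℝ F (t, z) (1, 0) := by
    filter_upwards [hT.mem_nhds hy] with z hz
    exact (hf.hasDerivAt_slice hT t hz).deriv
  rw [h5, h6.fderiv_eq, (h4.clm_apply (hasFDerivAt_const ((1, 0) : ℝ × E) y)).fderiv]
  refine (h3.clm_comp (hasDerivAt_const t (ContinuousLinearMap.inr ℝ ℝ E))).congr_deriv ?_
  ext w
  simp [hsymm (1, 0)]

end ParSmooth

lemma ParSmooth.mono_param {T : Set E} {f : ℝ → E → G} (hf : ParSmooth T f) {u : ℝ → ℝ}
    (hu : ContDiff ℝ ∞ u) : ParSmooth T fun t y => f (u t) y :=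
  ContDiffOn.comp (g := fun p : ℝ × E => f p.1 p.2) hf
    (f := fun p : ℝ × E => (u p.1, p.2))
    ((hu.comp contDiff_fst).prodMk contDiff_snd).contDiffOn fun _ hp => ⟨trivial, hp.2⟩

lemma parSmooth_const {T : Set E} {f : E → G} (hf : ContDiffOn ℝ ∞ f T) :
    ParSmooth T fun _ y => f y :=
  hf.comp contDiff_snd.contDiffOn fun _ hp => hp.2

end Parametric

/-! ### Smooth families of functions on the manifold. -/

section LocSmooth

variable {n : ℕ} {M : Type*} [TopologicalSpace M] [ChartedSpace (Model n) M]

variable (n) in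
/-- Families of functions on `M` which depend smoothly on the point and on a real parameter. -/
def LocSmooth (R : ℝ → M → ℝ) : Prop :=
  ∀ c : M, ParSmooth (extChartAt (𝓡 (2 * n + 1)) c).target fun t => rep0 n (R t) c

variable (n) in
lemma continuous_of_charts {X : Type*} [TopologicalSpace X] {f : M → X}
    (hf : ∀ c : M, ContinuousOn (fun y => f ((extChartAt (𝓡 (2 * n + 1)) c).symm y))
      (extChartAt (𝓡 (2 * n + 1)) c).target) : Continuous f := by
  rw [continuous_iff_continuousAt]
  intro x
  have h1 : ContinuousAt (fun y => f ((extChartAt (𝓡 (2 * n + 1)) x).symm y))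
      (extChartAt (𝓡 (2 * n + 1)) x x) :=
    (hf x).continuousAt ((isOpen_target x).mem_nhds (mem_extChartAt_target x))
  have h2 := h1.comp (continuousAt_extChartAt (I := 𝓡 (2 * n + 1)) x)
  refine h2.congr ?_
  filter_upwards [extChartAt_source_mem_nhds (I := 𝓡 (2 * n + 1)) x] with z hz
  simp only [Function.comp]
  rw [(extChartAt (𝓡 (2 * n + 1)) x).left_inv hz]

namespace LocSmooth

variable {R R' : ℝ → M → ℝ}

lemma continuous (hR : LocSmooth n R) : Continuous fun p : ℝ × M => R p.1 p.2 := by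
  rw [continuous_iff_continuousAt]
  rintro ⟨t, x⟩
  have h1 := ((hR x).contDiffAt (isOpen_target x) t (mem_extChartAt_target x)).continuousAt
  have h2 : ContinuousAt (fun p : ℝ × M => (p.1, extChartAt (𝓡 (2 * n + 1)) x p.2)) (t, x) :=
    continuousAt_fst.prodMk ((continuousAt_extChartAt (I := 𝓡 (2 * n + 1)) x).comp
      (f := fun p : ℝ × M => p.2) (x := (t, x)) continuousAt_snd)
  have h3 := ContinuousAt.comp (f := fun p : ℝ × M => (p.1, extChartAt (𝓡 (2 * n + 1)) x p.2))
    (x := (t, x)) h1 h2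
  refine h3.congr ?_
  filter_upwards [(continuousAt_snd (p := (t, x))).preimage_mem_nhds
    (extChartAt_source_mem_nhds (I := 𝓡 (2 * n + 1)) x)] with z hz
  simp only [Function.comp, rep0]
  rw [(extChartAt (𝓡 (2 * n + 1)) x).left_inv hz]

lemma hasDerivAt (hR : LocSmooth n R) (t : ℝ) (x : M) :
    HasDerivAt (fun s => R s x) (_root_.deriv (fun s => R s x) t) t := by
  have h := (hR x).hasDerivAt (isOpen_target x) t (mem_extChartAt_target x)
  simpa only [rep0, extChartAt_to_inv] using h

lemma deriv (hR : LocSmooth n R) : LocSmooth n fun t x => deriv (fun s => R s x) t :=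
  fun c => (hR c).deriv (isOpen_target c)

lemma add (hR : LocSmooth n R) (hR' : LocSmooth n R') : LocSmooth n fun t x => R t x + R' t x :=
  fun c => ContDiffOn.add (hR c) (hR' c)

lemma mul (hR : LocSmooth n R) (hR' : LocSmooth n R') : LocSmooth n fun t x => R t x * R' t x :=
  fun c => ContDiffOn.mul (hR c) (hR' c)

lemma neg (hR : LocSmooth n R) : LocSmooth n fun t x => -R t x :=
  fun c => ContDiffOn.neg (hR c)

lemma comp_param (hR : LocSmooth n R) {u : ℝ → ℝ} (hu : ContDiff ℝ ∞ u) :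
    LocSmooth n fun t x => R (u t) x :=
  fun c => (hR c).mono_param hu

lemma of_param {u : ℝ → ℝ} (hu : ContDiff ℝ ∞ u) : LocSmooth n fun t (_ : M) => u t :=
  fun _ => (hu.comp contDiff_fst).contDiffOn

variable [IsManifold (𝓡 (2 * n + 1)) ∞ M]

lemma of_contMDiff {f : M → ℝ} (hf : ContMDiff (𝓡 (2 * n + 1)) 𝓘(ℝ, ℝ) ∞ f) :
    LocSmooth n fun _ x => f x :=
  fun c => parSmooth_const (contDiffOn_rep0 hf c)

lemma of_contMDiff_prod (hR : ContMDiff (𝓘(ℝ, ℝ).prod (𝓡 (2 * n + 1))) 𝓘(ℝ, ℝ) ∞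
    fun z : ℝ × M => R z.1 z.2) : LocSmooth n R := by
  intro c
  rw [ParSmooth, ← contMDiffOn_iff_contDiffOn]
  have h1 : ContMDiffOn 𝓘(ℝ, ℝ × Model n) 𝓘(ℝ, ℝ) ∞ (fun p : ℝ × Model n => p.1)
      (Set.univ ×ˢ (extChartAt (𝓡 (2 * n + 1)) c).target) :=
    contDiff_fst.contMDiff.contMDiffOn
  have h2 : ContMDiffOn 𝓘(ℝ, ℝ × Model n) 𝓘(ℝ, Model n) ∞ (fun p : ℝ × Model n => p.2)
      (Set.univ ×ˢ (extChartAt (𝓡 (2 * n + 1)) c).target) :=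
    contDiff_snd.contMDiff.contMDiffOn
  have h3 := (contMDiffOn_extChartAt_symm (I := 𝓡 (2 * n + 1)) (n := ∞) c).comp h2 fun p hp => hp.2
  exact hR.comp_contMDiffOn (h1.prodMk h3)

lemma to_contMDiff_prod (hR : LocSmooth n R) :
    ContMDiff (𝓘(ℝ, ℝ).prod (𝓡 (2 * n + 1))) 𝓘(ℝ, ℝ) ∞ fun z : ℝ × M => R z.1 z.2 := by
  rintro ⟨t, x⟩
  have h1 := ((hR x).contDiffAt (isOpen_target x) t (mem_extChartAt_target x)).contMDiffAt
  have h2 : ContMDiffAt (𝓘(ℝ, ℝ).prod (𝓡 (2 * n + 1))) 𝓘(ℝ, Model n) ∞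
      (fun p : ℝ × M => extChartAt (𝓡 (2 * n + 1)) x p.2) (t, x) :=
    (contMDiffAt_extChartAt (I := 𝓡 (2 * n + 1)) (n := ∞) (x := x)).comp (t, x) contMDiffAt_snd
  have h3 : ContMDiffAt (𝓘(ℝ, ℝ).prod (𝓡 (2 * n + 1))) 𝓘(ℝ, ℝ × Model n) ∞
      (fun p : ℝ × M => (p.1, extChartAt (𝓡 (2 * n + 1)) x p.2)) (t, x) :=
    contMDiffAt_fst.prodMk_space h2
  have h4 := ContMDiffAt.comp (t, x) (g := fun p : ℝ × Model n => rep0 n (R p.1) x p.2)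
    (f := fun p : ℝ × M => (p.1, extChartAt (𝓡 (2 * n + 1)) x p.2)) h1 h3
  refine h4.congr_of_eventuallyEq ?_
  filter_upwards [(continuousAt_snd (p := (t, x))).preimage_mem_nhds
    (extChartAt_source_mem_nhds (I := 𝓡 (2 * n + 1)) x)] with z hz
  simp only [Function.comp, rep0]
  rw [(extChartAt (𝓡 (2 * n + 1)) x).left_inv hz]

lemma slice (hR : LocSmooth n R) (t : ℝ) : ContMDiff (𝓡 (2 * n + 1)) 𝓘(ℝ, ℝ) ∞ (R t) :=
  hR.to_contMDiff_prod.comp (contMDiff_const.prodMk contMDiff_id)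

end LocSmooth

/-- The differentials of a smooth family depend differentiably on the parameter. -/
lemma LocSmooth.hasDerivAt_diffE [IsManifold (𝓡 (2 * n + 1)) ∞ M] {R : ℝ → M → ℝ}
    (hR : LocSmooth n R) (t : ℝ) (x : M) :
    HasDerivAt (fun s => diffE n (R s) x)
      (diffE n (fun z => _root_.deriv (fun s => R s z) t) x) t := by
  have h := (hR x).hasDerivAt_fderiv (isOpen_target x) t (mem_extChartAt_target x)
  have h1 : ∀ {f : M → ℝ}, ContMDiff (𝓡 (2 * n + 1)) 𝓘(ℝ, ℝ) ∞ f →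
      _root_.fderiv ℝ (rep0 n f x) (extChartAt (𝓡 (2 * n + 1)) x x) = diffE n f x := fun hf => by
    ext v; exact SasakianStructure.fderiv_rep0_self hf x v
  have h2 : (fun s => diffE n (R s) x) =
      fun s => _root_.fderiv ℝ (rep0 n (R s) x) (extChartAt (𝓡 (2 * n + 1)) x x) :=
    funext fun s => (h1 (hR.slice s)).symm
  rw [h2, ← h1 (hR.deriv.slice t)]
  exact h

end LocSmooth
end Sasaki

end

section

/-! ### Derivatives of the deformed forms and of the volume density along families. -/

namespace Sasaki

lemma contDiffOn_wedge {n : ℕ} {X : Type*} [NormedAddCommGroup X] [NormedSpace ℝ X] {s : Set X}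
    {α : X → (Model n →L[ℝ] ℝ)} {τ : X → (Model n →L[ℝ] Model n →L[ℝ] ℝ)}
    (hα : ContDiffOn ℝ ∞ α s) (hτ : ContDiffOn ℝ ∞ τ s) (v : Fin (2 * n + 1) → Model n) :
    ContDiffOn ℝ ∞ (fun p => wedge (fun u => α p u) (fun u w => τ p u w) v) s := by
  unfold wedge
  refine contDiffOn_const.mul (ContDiffOn.sum fun σ _ => ?_)
  refine (contDiffOn_const.mul (hα.clm_apply contDiffOn_const)).mul (contDiffOn_prod fun k _ => ?_)
  exact (hτ.clm_apply contDiffOn_const).clm_apply contDiffOn_const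

lemma contDiffOn_linWedge {n : ℕ} {X : Type*} [NormedAddCommGroup X] [NormedSpace ℝ X] {s : Set X}
    {α : X → (Model n →L[ℝ] ℝ)} {τ θ : X → (Model n →L[ℝ] Model n →L[ℝ] ℝ)}
    (hα : ContDiffOn ℝ ∞ α s) (hτ : ContDiffOn ℝ ∞ τ s) (hθ : ContDiffOn ℝ ∞ θ s)
    (v : Fin (2 * n + 1) → Model n) :
    ContDiffOn ℝ ∞ (fun p => linWedge (fun u => α p u) (fun u w => τ p u w)
      (fun u w => θ p u w) v) s := by
  unfold linWedge
  refine contDiffOn_const.mul (ContDiffOn.sum fun σ _ => ?_)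
  refine (contDiffOn_const.mul (hα.clm_apply contDiffOn_const)).mul (ContDiffOn.sum fun j _ => ?_)
  refine ((hθ.clm_apply contDiffOn_const).clm_apply contDiffOn_const).mul
    (contDiffOn_prod fun k _ => ?_)
  exact (hτ.clm_apply contDiffOn_const).clm_apply contDiffOn_const

lemma ParSmooth.locD {n : ℕ} {T : Set (Model n)} {a : ℝ → Model n → (Model n →L[ℝ] ℝ)}
    (hT : IsOpen T) (ha : ParSmooth T a) : ParSmooth T fun t y => locD (a t) y := by
  have h := ha.fderiv hT
  have h2 : ContDiffOn ℝ ∞ (fun p : ℝ × Model n => (_root_.fderiv ℝ (a p.1) p.2).flip)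
      (Set.univ ×ˢ T) :=
    contDiffOn_clm_apply.2 fun v => contDiffOn_clm_apply.2 fun w =>
      (ContDiffOn.clm_apply h (contDiffOn_const (c := w))).clm_apply (contDiffOn_const (c := v))
  exact ContDiffOn.sub h h2

namespace SasakianStructure

variable {n : ℕ} {M : Type*} [TopologicalSpace M] [ChartedSpace (Model n) M]
  [IsManifold (𝓡 (2 * n + 1)) ∞ M] (S : SasakianStructure n M)

lemma smooth1_etaDef {φ : M → ℝ} (hφ : ContMDiff (𝓡 (2 * n + 1)) 𝓘(ℝ, ℝ) ∞ φ) :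
    Smooth1 (S.etaDef φ) := S.smooth1_eta.add (S.smooth1_dc hφ)

lemma rep1_etaDef {φ : M → ℝ} (hφ : ContMDiff (𝓡 (2 * n + 1)) 𝓘(ℝ, ℝ) ∞ φ) {c : M} {y : Model n}
    (hy : y ∈ (extChartAt (𝓡 (2 * n + 1)) c).target) : rep1 (S.etaDef φ) c y =
      rep1 S.eta c y + (-(1 / 2 : ℝ)) • (fderiv ℝ (rep0 n φ c) y).comp (repEnd S.Phi c y) := by
  rw [← S.rep1_dc hφ hy]; rfl

/-- The volume form in a chart. -/
def topLoc (φ : M → ℝ) (c : M) (y : Model n) : ℝ :=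
  wedge (fun u => rep1 (S.etaDef φ) c y u) (fun u w => locD (rep1 (S.etaDef φ) c) y u w)
    (stdBasis n)

/-- The coordinate frame of a chart. -/
def chartFrame (c : M) (y : Model n) (i : Fin (2 * n + 1)) : Model n := chartInv c y (stdBasis n i)

lemma topForm_chartFrame {φ : M → ℝ} (hφ : ContMDiff (𝓡 (2 * n + 1)) 𝓘(ℝ, ℝ) ∞ φ) {c : M}
    {y : Model n} (hy : y ∈ (extChartAt (𝓡 (2 * n + 1)) c).target) :
    S.topForm φ ((extChartAt (𝓡 (2 * n + 1)) c).symm y) (chartFrame c y) = S.topLoc φ c y := by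
  have h : ∀ v w, locD (rep1 (S.etaDef φ) c) y v w =
      S.kahler φ ((extChartAt (𝓡 (2 * n + 1)) c).symm y) (chartInv c y v) (chartInv c y w) :=
    fun v w => by
      rw [← (S.smooth1_etaDef hφ).extD_eq hy, kahler, extDE_apply]
  rw [topForm, topLoc]
  simp only [h]
  rfl

/-- The frame is a basis because the derivative of the inverse chart has a left inverse, hence
nonzero determinant. -/
lemma topForm_zero_chartFrame_ne {c : M} {y : Model n}
    (hy : y ∈ (extChartAt (𝓡 (2 * n + 1)) c).target) :
    S.topForm (fun _ => 0) ((extChartAt (𝓡 (2 * n + 1)) c).symm y) (chartFrame c y) ≠ 0 := by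
  rw [S.topForm_eq_det_mul (stdBasis n)]
  refine mul_ne_zero ?_ (S.topForm_zero_ne _)
  have h1 : (stdBasis n).det (chartFrame c y) = (chartInv c y).det := by
    have := (stdBasis n).det_comp_basis (stdBasis n) (chartInv c y).toLinearMap
    rw [← show (chartInv c y).toLinearMap ∘ (stdBasis n) = chartFrame c y from rfl, this]
    rfl
  rw [h1]
  intro h0
  have h2 : (chartFwd c ((extChartAt (𝓡 (2 * n + 1)) c).symm y)).comp (chartInv c y) =
      ContinuousLinearMap.id ℝ _ := by
    ext v; exact congrFun (congrArg _ (chartFwd_chartInv hy v)) _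
  have h3 : ((chartFwd c ((extChartAt (𝓡 (2 * n + 1)) c).symm y)).comp (chartInv c y)).det =
      (chartFwd c ((extChartAt (𝓡 (2 * n + 1)) c).symm y)).det * (chartInv c y).det :=
    LinearMap.det_comp _ _
  rw [h2, h0, mul_zero] at h3
  have h4 : (ContinuousLinearMap.id ℝ (Model n)).det = 1 := LinearMap.det_id
  exact one_ne_zero (h4.symm.trans h3)

lemma topLoc_zero_ne {c : M} {y : Model n} (hy : y ∈ (extChartAt (𝓡 (2 * n + 1)) c).target) :
    S.topLoc (fun _ => 0) c y ≠ 0 := by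
  rw [← S.topForm_chartFrame contMDiff_const hy]
  exact S.topForm_zero_chartFrame_ne hy

lemma rho_chart {φ : M → ℝ} (hφ : ContMDiff (𝓡 (2 * n + 1)) 𝓘(ℝ, ℝ) ∞ φ) {c : M}
    {y : Model n} (hy : y ∈ (extChartAt (𝓡 (2 * n + 1)) c).target) :
    rep0 n (S.rho φ) c y = S.topLoc φ c y / S.topLoc (fun _ => 0) c y := by
  rw [← S.topForm_chartFrame hφ hy, ← S.topForm_chartFrame contMDiff_const hy,
    S.topForm_eq_rho φ, mul_div_cancel_right₀ _ (S.topForm_zero_chartFrame_ne hy)]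
  rfl

lemma parSmooth_etaDef {F : ℝ → M → ℝ} (hF : LocSmooth n F) (c : M) :
    ParSmooth (extChartAt (𝓡 (2 * n + 1)) c).target fun t => rep1 (S.etaDef (F t)) c := by
  have h1 := (hF c).fderiv (isOpen_target c)
  have h2 := parSmooth_const (contDiffOn_repEnd S.Phi_smooth c)
  have h3 := parSmooth_const (S.smooth1_eta c)
  have h4 := ContDiffOn.add h3 ((ContDiffOn.clm_comp h1 h2).const_smul (-(1 / 2 : ℝ)))
  exact h4.congr fun p hp => S.rep1_etaDef (hF.slice p.1) hp.2

lemma parSmooth_topLoc {F : ℝ → M → ℝ} (hF : LocSmooth n F) (c : M) :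
    ParSmooth (extChartAt (𝓡 (2 * n + 1)) c).target fun t => S.topLoc (F t) c :=
  contDiffOn_wedge (S.parSmooth_etaDef hF c) ((S.parSmooth_etaDef hF c).locD (isOpen_target c)) _

lemma _root_.Sasaki.LocSmooth.rho {F : ℝ → M → ℝ} (hF : LocSmooth n F) :
    LocSmooth n fun t => S.rho (F t) := by
  intro c
  have h0 : LocSmooth n fun (_ : ℝ) (_ : M) => (0 : ℝ) := LocSmooth.of_param contDiff_const
  refine ContDiffOn.congr (ContDiffOn.div (S.parSmooth_topLoc hF c) (S.parSmooth_topLoc h0 c)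
    fun p hp => S.topLoc_zero_ne hp.2) fun p hp => ?_
  exact S.rho_chart (hF.slice p.1) hp.2

lemma contMDiff_rho {φ : M → ℝ} (hφ : ContMDiff (𝓡 (2 * n + 1)) 𝓘(ℝ, ℝ) ∞ φ) :
    ContMDiff (𝓡 (2 * n + 1)) 𝓘(ℝ, ℝ) ∞ (S.rho φ) :=
  ((LocSmooth.of_contMDiff hφ).rho S).slice 0

lemma continuous_rho {φ : M → ℝ} (hφ : ContMDiff (𝓡 (2 * n + 1)) 𝓘(ℝ, ℝ) ∞ φ) :
    Continuous (S.rho φ) := (S.contMDiff_rho hφ).continuous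

lemma hasDerivAt_dcE {F : ℝ → M → ℝ} (hF : LocSmooth n F) (t : ℝ) (x : M) (v : Model n) :
    HasDerivAt (fun s => S.dcE (F s) x v) (S.dcE (fun z => deriv (fun s => F s z) t) x v) t := by
  simp only [dcE_apply]
  have h := (hF.hasDerivAt_diffE t x).clm_apply (hasDerivAt_const t (S.PhiE x v))
  exact (h.const_mul _).congr_deriv (by simp)

lemma hasDerivAt_etaDE {F : ℝ → M → ℝ} (hF : LocSmooth n F) (t : ℝ) (x : M) (v : Model n) :
    HasDerivAt (fun s => S.etaDE (F s) x v) (S.dcE (fun z => deriv (fun s => F s z) t) x v) t :=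
  (S.hasDerivAt_dcE hF t x v).const_add _

/-- `dd^c F` is linear in the first two derivatives of `F` in the chart, and these commute with the
derivative in the parameter. -/
lemma hasDerivAt_extDE_dc {F : ℝ → M → ℝ} (hF : LocSmooth n F) (t : ℝ) (x : M) (v w : Model n) :
    HasDerivAt (fun s => extDE (S.dc (F s)) x v w)
      (extDE (S.dc fun z => deriv (fun s => F s z) t) x v w) t := by
  set y := extChartAt (𝓡 (2 * n + 1)) x x with hy
  have hyt : y ∈ (extChartAt (𝓡 (2 * n + 1)) x).target := mem_extChartAt_target x
  have hT := isOpen_target (n := n) x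
  have e1 : (fun s => extDE (S.dc (F s)) x v w) = fun s => _ :=
    funext fun s => S.extDE_dc (hF.slice s) x v w
  rw [e1, S.extDE_dc (hF.deriv.slice t)]
  have h1 : ∀ u, HasDerivAt (fun s => diffE n (F s) x u)
      (diffE n (fun z => deriv (fun s => F s z) t) x u) t := fun u =>
    ((hF.hasDerivAt_diffE t x).clm_apply (hasDerivAt_const t u)).congr_deriv (by simp)
  have h2 : ∀ u u', HasDerivAt (fun s => fderiv ℝ (fderiv ℝ (rep0 n (F s) x)) y u u')
      (fderiv ℝ (fderiv ℝ (rep0 n (fun z => deriv (fun s => F s z) t) x)) y u u') t := fun u u' => by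
    have h3 := ((hF x).fderiv hT).hasDerivAt_fderiv hT t hyt
    have h4 : (fun z => deriv (fun s => fderiv ℝ (rep0 n (F s) x) z) t) =ᶠ[𝓝 y]
        fderiv ℝ (rep0 n (fun z => deriv (fun s => F s z) t) x) := by
      filter_upwards [hT.mem_nhds hyt] with z hz
      exact ((hF x).hasDerivAt_fderiv hT t hz).deriv
    rw [h4.fderiv_eq] at h3
    exact ((h3.clm_apply (hasDerivAt_const t u)).clm_apply (hasDerivAt_const t u')).congr_deriv
      (by simp)
  exact (((h2 _ _).add (h1 _)).sub ((h2 _ _).add (h1 _))).const_mul _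

lemma hasDerivAt_kahler {F : ℝ → M → ℝ} (hF : LocSmooth n F) (t : ℝ) (x : M) (v w : Model n) :
    HasDerivAt (fun s => S.kahler (F s) x v w)
      (extDE (S.dc fun z => deriv (fun s => F s z) t) x v w) t := by
  have e1 : (fun s => S.kahler (F s) x v w) =
      fun s => extDE S.eta x v w + extDE (S.dc (F s)) x v w :=
    funext fun s => by rw [S.kahler_eq (hF.slice s)]; rfl
  rw [e1]
  exact (S.hasDerivAt_extDE_dc hF t x v w).const_add _

/-- The derivative of the volume density along a transverse exact `2`-form `dβ`. -/
def linForm (φ : M → ℝ) (β : ∀ x : M, Tan n x →L[ℝ] ℝ) (x : M) : ℝ :=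
  linWedge (fun u => S.etaDE φ x u) (fun u w => S.kahler φ x u w) (fun u w => extDE β x u w)
    (stdBasis n) / S.topForm (fun _ => 0) x (stdBasis n)

variable [T2Space M]

/-- All factors descend to the `2n`-dimensional quotient by `ξ`, which carries no form of degree `2n
+ 1`. -/
lemma wedge_eq_zero {φ : M → ℝ} (hφ : S.IsBasic φ) (x : M) (α : Model n →L[ℝ] ℝ)
    (hα : α (S.xiE x) = 0) (v : Fin (2 * n + 1) → Model n) :
    wedge (fun u => α u) (fun u w => S.kahler φ x u w) v = 0 := by
  obtain ⟨b, c, h⟩ := (S.posAt_zero x).exists_adapted S.isBasic_zero S.isBasic_zero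
  have h0 := hφ.isTransverse_kahler x φ
  refine wedge_eq_zero_of_kernel b α.toLinearMap (bil (S.kahler φ x)) (i := reebIdx n) ?_ ?_ ?_ v
  · rw [h.reeb]; exact hα
  · rw [h.reeb]; exact h0.xi_left
  · rw [h.reeb]; exact h0.xi_right

/-- The derivative of the volume densities along a smooth family. -/
lemma hasDerivAt_rho {F : ℝ → M → ℝ} (hF : LocSmooth n F) {t : ℝ} (ht : S.IsBasic (F t)) (x : M) :
    HasDerivAt (fun s => S.rho (F s) x)
      (S.linForm (F t) (S.dc fun z => deriv (fun s => F s z) t) x) t := by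
  have h := hasDerivAt_wedge (α := fun s u => S.etaDE (F s) x u)
    (τ := fun s u w => S.kahler (F s) x u w) (S.hasDerivAt_etaDE hF t x)
    (S.hasDerivAt_kahler hF t x) (stdBasis n)
  -- The variation `d^c` of `η_F` is annihilated by `ξ`, so only the variation of the transverse
  -- form contributes.
  rw [S.wedge_eq_zero ht x _ (S.dcE_xiE _ x), zero_add] at h
  exact h.div_const _

end SasakianStructure
end Sasaki

end

section

/-! ### The contact and Riemannian volume measures. -/

namespace Sasaki
namespace SasakianStructure

open MeasureTheory

variable {n : ℕ} {M : Type*} [TopologicalSpace M] [ChartedSpace (Model n) M]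
  [IsManifold (𝓡 (2 * n + 1)) ∞ M] (S : SasakianStructure n M)

/-- The volume form `(1/n!) η_φ ∧ (dη_φ)ⁿ`, as a density. -/
def volDens (φ : M → ℝ) (x : M) (v : Fin (2 * n + 1) → Tan n x) : ℝ :=
  (1 / (n.factorial : ℝ)) * S.topForm φ x v

lemma locDens_volDens {φ : M → ℝ} (hφ : ContMDiff (𝓡 (2 * n + 1)) 𝓘(ℝ, ℝ) ∞ φ) {c : M}
    {y : Model n} (hy : y ∈ (extChartAt (𝓡 (2 * n + 1)) c).target) :
    locDens (S.volDens φ) c y = (1 / (n.factorial : ℝ)) * S.topLoc φ c y := by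
  rw [← S.topForm_chartFrame hφ hy]
  have : (chartFrame c y : Fin (2 * n + 1) → Model n) =
      fun i => chartInv c y (EuclideanSpace.single i (1 : ℝ)) :=
    funext fun i => by rw [chartFrame, stdBasis_apply]
  exact congrArg (fun f => (1 / (n.factorial : ℝ)) * S.topForm φ _ f) this.symm

lemma continuousOn_topLoc {φ : M → ℝ} (hφ : ContMDiff (𝓡 (2 * n + 1)) 𝓘(ℝ, ℝ) ∞ φ) (c : M) :
    ContinuousOn (S.topLoc φ c) (extChartAt (𝓡 (2 * n + 1)) c).target := by
  have h := (S.parSmooth_topLoc (LocSmooth.of_contMDiff hφ) c).continuousOn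
  exact h.comp (f := fun y : Model n => ((0 : ℝ), y)) (by fun_prop) fun y hy => ⟨trivial, hy⟩

lemma isDensity_volDens {φ : M → ℝ} (hφ : ContMDiff (𝓡 (2 * n + 1)) 𝓘(ℝ, ℝ) ∞ φ) :
    IsDensity (S.volDens φ) := by
  refine ⟨fun x A v => ?_, fun c => ?_⟩
  · change |(1 / (n.factorial : ℝ)) * S.topForm φ x (fun i => A (v i))| =
      |A.det| * |(1 / (n.factorial : ℝ)) * S.topForm φ x v|
    have h1 := S.topForm_eq_det_mul (stdBasis n) φ x (fun i => A (v i))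
    have h2 := S.topForm_eq_det_mul (stdBasis n) φ x v
    have h3 : (stdBasis n).det (fun i => A (v i)) = A.det * (stdBasis n).det v :=
      (stdBasis n).det_comp A.toLinearMap v
    rw [h1, h2, h3, ← abs_mul]
    congr 1
    ring
  · exact (continuousOn_const.mul (S.continuousOn_topLoc hφ c)).congr fun y hy =>
      S.locDens_volDens hφ hy

variable [T2Space M] [CompactSpace M] [MeasurableSpace M] [BorelSpace M]

lemma vol_eq (φ : M → ℝ) : S.vol φ = densityMeasure (S.volDens φ) := by
  have h : (fun (x : M) (v : Fin (2 * n + 1) → Tan n x) => (1 / (n.factorial : ℝ)) *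
      wedgeTop (S.etaDef φ x) (S.dEtaDef φ x) v) = S.volDens φ := by
    funext x v
    rw [volDens]
    exact congrArg _ (S.wedgeTop_eq φ x v)
  rw [vol, h]

/-- The reference measure. -/
abbrev baseVol : Measure M := S.vol fun _ => 0

instance isFiniteMeasure_baseVol : IsFiniteMeasure S.baseVol := by
  rw [baseVol, vol_eq]
  exact isFiniteMeasure_densityMeasure (S.isDensity_volDens contMDiff_const)

instance isOpenPosMeasure_baseVol : S.baseVol.IsOpenPosMeasure := by
  rw [baseVol, vol_eq]
  refine isOpenPosMeasure_densityMeasure (S.isDensity_volDens contMDiff_const) fun c y hy => ?_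
  rw [S.locDens_volDens contMDiff_const hy]
  exact mul_ne_zero (by positivity) (S.topLoc_zero_ne hy)

lemma vol_eq_withDensity {φ : M → ℝ} (hφ : ContMDiff (𝓡 (2 * n + 1)) 𝓘(ℝ, ℝ) ∞ φ)
    (hpos : ∀ x, 0 ≤ S.rho φ x) :
    S.vol φ = S.baseVol.withDensity fun x => ENNReal.ofReal (S.rho φ x) := by
  rw [baseVol, S.vol_eq φ, S.vol_eq fun _ => 0]
  refine densityMeasure_mul (S.isDensity_volDens contMDiff_const) (S.continuous_rho hφ).measurable
    (fun x v => ?_) hpos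
  rw [volDens, volDens, S.topForm_eq_rho φ x v, abs_mul, abs_mul, abs_mul, abs_of_nonneg (hpos x)]
  ring

lemma integral_vol {φ : M → ℝ} (hφ : ContMDiff (𝓡 (2 * n + 1)) 𝓘(ℝ, ℝ) ∞ φ)
    (hpos : ∀ x, 0 ≤ S.rho φ x) (f : M → ℝ) :
    ∫ x, f x ∂(S.vol φ) = ∫ x, S.rho φ x * f x ∂S.baseVol := by
  rw [S.vol_eq_withDensity hφ hpos]
  refine (integral_withDensity_eq_integral_smul
    (S.continuous_rho hφ).measurable.real_toNNReal f).trans ?_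
  refine integral_congr_ae (ae_of_all _ fun x => ?_)
  simp [NNReal.smul_def, Real.coe_toNNReal _ (hpos x)]

/-- The normalization constant between the two volume forms. -/
def volRatio (n : ℕ) : ℝ := |wedgeConst n| / n.factorial

lemma volRatio_pos (S : SasakianStructure n M) (x : M) : 0 < volRatio n :=
  div_pos (abs_pos.2 (S.wedgeConst_ne_zero x)) (by positivity)

lemma volRatio_le_one : volRatio n ≤ 1 :=
  div_le_one_of_le₀ (abs_wedgeConst_le n) (by positivity)

/-- The ratio of the Riemannian to the contact volume is the constant `n! / |wedgeConst n|`, the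
same for all potentials. -/
lemma riemannianVolume_gDef [Nonempty M] {φ : M → ℝ} (hφ : S.IsBasic φ)
    (hpos : ∀ x, S.PosAt φ x) : riemannianVolume (S.gDef φ) =
      S.baseVol.withDensity fun x => ENNReal.ofReal ((volRatio n)⁻¹ * S.rho φ x) := by
  obtain ⟨x0⟩ := ‹Nonempty M›
  rw [baseVol, riemannianVolume, S.vol_eq fun _ => 0]
  refine densityMeasure_mul (S.isDensity_volDens contMDiff_const)
    ((S.continuous_rho hφ.1).measurable.const_mul _) (fun x v => ?_)
    fun x => mul_nonneg (inv_nonneg.2 (S.volRatio_pos x0).le) ((hpos x).rho_pos hφ).le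
  have h := (hpos x).sqrt_det hφ v
  have h2 : √(Matrix.det (Matrix.of fun i j => S.gDef φ x (v i) (v j))) =
      |wedgeConst n|⁻¹ * |S.topForm φ x v| := by
    rw [← h, inv_mul_cancel_left₀ (abs_ne_zero.2 (S.wedgeConst_ne_zero x))]
  rw [abs_of_nonneg (Real.sqrt_nonneg _), h2, volDens, S.topForm_eq_rho φ x v, abs_mul,
    abs_of_pos ((hpos x).rho_pos hφ), abs_mul, volRatio, inv_div,
    abs_of_nonneg (show (0 : ℝ) ≤ 1 / (n.factorial : ℝ) by positivity)]
  have : (n.factorial : ℝ) ≠ 0 := by positivity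
  field_simp

lemma integral_riemannianVolume [Nonempty M] {φ : M → ℝ} (hφ : S.IsBasic φ)
    (hpos : ∀ x, S.PosAt φ x) (f : M → ℝ) : ∫ x, f x ∂(riemannianVolume (S.gDef φ)) =
      (volRatio n)⁻¹ * ∫ x, S.rho φ x * f x ∂S.baseVol := by
  have h0 : ∀ x, 0 ≤ (volRatio n)⁻¹ * S.rho φ x := fun x =>
    mul_nonneg (inv_nonneg.2 (S.volRatio_pos x).le) ((hpos x).rho_pos hφ).le
  rw [S.riemannianVolume_gDef hφ hpos, ← integral_const_mul]
  refine (integral_withDensity_eq_integral_smul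
    ((S.continuous_rho hφ.1).measurable.const_mul _).real_toNNReal f).trans ?_
  refine integral_congr_ae (ae_of_all _ fun x => ?_)
  simp [NNReal.smul_def, Real.coe_toNNReal _ (h0 x), mul_assoc]

lemma linForm_chart {φ : M → ℝ} (hφ : ContMDiff (𝓡 (2 * n + 1)) 𝓘(ℝ, ℝ) ∞ φ)
    {β : ∀ x : M, Tan n x →L[ℝ] ℝ} (hβ : Smooth1 β) {c : M} {y : Model n}
    (hy : y ∈ (extChartAt (𝓡 (2 * n + 1)) c).target) :
    S.linForm φ β ((extChartAt (𝓡 (2 * n + 1)) c).symm y) =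
      linWedge (fun u => rep1 (S.etaDef φ) c y u) (fun u w => locD (rep1 (S.etaDef φ) c) y u w)
        (fun u w => locD (rep1 β c) y u w) (stdBasis n) / S.topLoc (fun _ => 0) c y := by
  set x := (extChartAt (𝓡 (2 * n + 1)) c).symm y
  have h1 : ∀ v w, locD (rep1 (S.etaDef φ) c) y v w =
      S.kahler φ x (chartInv c y v) (chartInv c y w) :=
    fun v w => by rw [← (S.smooth1_etaDef hφ).extD_eq hy, kahler, extDE_apply]
  have h2 : ∀ v w, locD (rep1 β c) y v w = extDE β x (chartInv c y v) (chartInv c y w) :=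
    fun v w => by rw [← hβ.extD_eq hy, extDE_apply]
  have h3 : linWedge (fun u => rep1 (S.etaDef φ) c y u)
      (fun u w => locD (rep1 (S.etaDef φ) c) y u w) (fun u w => locD (rep1 β c) y u w) (stdBasis n) =
      linWedge (fun u => S.etaDE φ x u) (fun u w => S.kahler φ x u w) (fun u w => extDE β x u w)
        (chartFrame c y) := by
    simp only [h1, h2]; rfl
  have h4 := S.topForm_zero_chartFrame_ne hy
  have h6 := linWedge_eq_det_mul (stdBasis n) (S.etaDE φ x).toLinearMap (bil (S.kahler φ x))
    (bil (extDE β x)) (chartFrame c y)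
  simp only [bil_apply, ContinuousLinearMap.coe_coe] at h6
  rw [h3, ← S.topForm_chartFrame contMDiff_const hy, h6, linForm]
  rw [S.topForm_eq_det_mul (stdBasis n) _ _ (chartFrame c y)] at h4 ⊢
  exact (mul_div_mul_left _ _ (left_ne_zero_of_mul h4)).symm

lemma continuous_linForm {φ : M → ℝ} (hφ : ContMDiff (𝓡 (2 * n + 1)) 𝓘(ℝ, ℝ) ∞ φ)
    {β : ∀ x : M, Tan n x →L[ℝ] ℝ} (hβ : Smooth1 β) : Continuous (S.linForm φ β) := by
  refine continuous_of_charts n fun c => ?_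
  have hT := isOpen_target (n := n) c
  have h1 : ContDiffOn ℝ ∞ (locD (rep1 (S.etaDef φ) c)) (extChartAt (𝓡 (2 * n + 1)) c).target :=
    ContDiffOn.comp (g := fun p : ℝ × Model n => locD (rep1 (S.etaDef φ) c) p.2)
      (ParSmooth.locD hT (parSmooth_const (S.smooth1_etaDef hφ c)))
      (contDiff_prodMk_right (0 : ℝ)).contDiffOn fun y hy => ⟨trivial, hy⟩
  have h2 : ContDiffOn ℝ ∞ (locD (rep1 β c)) (extChartAt (𝓡 (2 * n + 1)) c).target :=
    ContDiffOn.comp (g := fun p : ℝ × Model n => locD (rep1 β c) p.2)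
      (ParSmooth.locD hT (parSmooth_const (hβ c)))
      (contDiff_prodMk_right (0 : ℝ)).contDiffOn fun y hy => ⟨trivial, hy⟩
  exact ((contDiffOn_linWedge (S.smooth1_etaDef hφ c) h1 h2 _).continuousOn.div
    (S.continuousOn_topLoc contMDiff_const c) fun y hy => S.topLoc_zero_ne hy).congr
      fun y hy => S.linForm_chart hφ hβ hy

end SasakianStructure
end Sasaki

end

section

/-! ### Stokes' theorem on the manifold. -/

namespace Sasaki

lemma locD_const_smul {n : ℕ} {b : Model n → (Model n →L[ℝ] ℝ)} {y : Model n} (r : ℝ)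
    (hb : DifferentiableAt ℝ b y) : locD (fun z => r • b z) y = r • locD b y := by
  ext v w
  have h : fderiv ℝ (fun z => r • b z) y = r • fderiv ℝ b y := fderiv_const_smul hb r
  simp [locD_apply, h, mul_sub]

section Sum

variable {n : ℕ} {M : Type*} [TopologicalSpace M] [ChartedSpace (Model n) M]
  [IsManifold (𝓡 (2 * n + 1)) ∞ M]

lemma extDE_sum {ι : Type*} (s : Finset ι) {α : ι → ∀ x : M, Tan n x →L[ℝ] ℝ}
    (hα : ∀ i, Smooth1 (α i)) (x : M) :
    Smooth1 (fun z => ∑ i ∈ s, α i z) ∧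
      extDE (fun z => ∑ i ∈ s, α i z) x = ∑ i ∈ s, extDE (α i) x := by
  classical
  induction s using Finset.induction_on with
  | empty =>
    have h0 : ∀ c : M, rep1 (fun z : M => ∑ i ∈ (∅ : Finset ι), α i z) c = fun _ => 0 := fun c => by
      funext y; ext v; rw [rep1_apply, Finset.sum_empty]; rfl
    refine ⟨fun c => by rw [h0]; exact contDiffOn_const, ?_⟩
    rw [extDE, h0, Finset.sum_empty]
    ext v w
    simp [locD_apply]
  | insert i s hi ih =>
    have h1 : (fun z => ∑ j ∈ insert i s, α j z) = fun z => α i z + ∑ j ∈ s, α j z :=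
      funext fun z => Finset.sum_insert hi
    rw [h1, Finset.sum_insert hi, ← ih.2]
    exact ⟨(hα i).add ih.1, SasakianStructure.extDE_add (hα i) ih.1 x⟩

end Sum

namespace SasakianStructure

open MeasureTheory

variable {n : ℕ} {M : Type*} [TopologicalSpace M] [ChartedSpace (Model n) M]
  [IsManifold (𝓡 (2 * n + 1)) ∞ M] (S : SasakianStructure n M)
  [T2Space M] [CompactSpace M] [MeasurableSpace M] [BorelSpace M]

/-- Stokes' theorem for a transverse `1`-form supported in a chart. -/
lemma integral_linForm_of_support {φ : M → ℝ} (hφ : S.IsBasic φ) {β : ∀ x : M, Tan n x →L[ℝ] ℝ}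
    (hβ : Smooth1 β) (hξ : ∀ x, β x (S.xi x) = 0) (c : M) {K : Set M} (hK : IsClosed K)
    (hKc : K ⊆ (extChartAt (𝓡 (2 * n + 1)) c).source) (hβK : ∀ x, x ∉ K → β x = 0) :
    ∫ x, S.linForm φ β x ∂S.baseVol = 0 := by
  set T := (extChartAt (𝓡 (2 * n + 1)) c).target with hTdef
  have hT : IsOpen T := isOpen_target c
  have hβ0 : ∀ x, x ∉ K → extDE β x = 0 := fun x hx => by
    have hev : rep1 β x =ᶠ[𝓝 (extChartAt (𝓡 (2 * n + 1)) x x)] fun _ => 0 := by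
      have h1 : (extChartAt (𝓡 (2 * n + 1)) x).symm ⁻¹' Kᶜ ∈
          𝓝 (extChartAt (𝓡 (2 * n + 1)) x x) :=
        (continuousAt_extChartAt_symm x).preimage_mem_nhds
          (by rw [extChartAt_to_inv]; exact hK.isOpen_compl.mem_nhds hx)
      filter_upwards [h1] with z hz
      ext v
      rw [rep1_apply, hβK _ hz]; rfl
    rw [extDE, locD, hev.fderiv_eq]
    ext v w; simp
  have hf : Measurable (S.linForm φ β) := (S.continuous_linForm hφ.1 hβ).measurable
  have hs : ∀ x, x ∉ (extChartAt (𝓡 (2 * n + 1)) c).source → S.linForm φ β x = 0 := fun x hx => by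
    rw [linForm, hβ0 x fun h => hx (hKc h)]
    simp only [zero_apply, linWedge_zero, zero_div]
  rw [baseVol, vol_eq, integral_densityMeasure_of_support (S.isDensity_volDens contMDiff_const) c hf hs]
  set a := rep1 (S.etaDef φ) c
  set W := S.topLoc (fun _ => 0) c
  -- The base measure has density proportional to `|W|` while `linForm` divides by `W`. The sign is
  -- locally constant, so it can be absorbed into the `1`-form without disturbing its exterior
  -- derivative.
  let ε : Model n → ℝ := fun y => SignType.sign (W y)
  have hε : ∀ y ∈ T, ∀ᶠ z in 𝓝 y, ε z = ε y := fun y hy => by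
    have hc : ContinuousAt W y :=
      (S.continuousOn_topLoc contMDiff_const c).continuousAt (hT.mem_nhds hy)
    have hne : W y ≠ 0 := S.topLoc_zero_ne hy
    rcases lt_or_gt_of_ne hne with h | h
    · filter_upwards [hc.eventually_lt_const h] with z hz
      simp only [ε, sign_neg hz, sign_neg h]
    · filter_upwards [hc.eventually_const_lt h] with z hz
      simp only [ε, sign_pos hz, sign_pos h]
  -- Extension by zero off the chart stays smooth because the form is supported in the compact set
  -- `K'` inside `T`.
  let b : Model n → (Model n →L[ℝ] ℝ) := T.indicator fun y => ε y • rep1 β c y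
  have hbT : ∀ y ∈ T, b y = ε y • rep1 β c y := fun y hy => Set.indicator_of_mem hy _
  have hbev : ∀ y ∈ T, b =ᶠ[𝓝 y] fun z => ε y • rep1 β c z := fun y hy => by
    filter_upwards [hε y hy, hT.mem_nhds hy] with z hz hzT
    rw [hbT z hzT, hz]
  set K' := extChartAt (𝓡 (2 * n + 1)) c '' K
  have hK' : IsCompact K' := hK.isCompact.image_of_continuousOn ((continuousOn_extChartAt c).mono hKc)
  have hK'T : K' ⊆ T := by
    rintro _ ⟨x, hx, rfl⟩
    exact (extChartAt (𝓡 (2 * n + 1)) c).map_source (hKc hx)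
  have hbK : Function.support b ⊆ K' := fun y hy => by
    by_contra hyK
    apply hy
    by_cases hyT : y ∈ T
    · rw [hbT y hyT]
      have : rep1 β c y = 0 := by
        ext v
        rw [rep1_apply, hβK _ fun h => hyK ⟨_, h, (extChartAt (𝓡 (2 * n + 1)) c).right_inv hyT⟩]
        rfl
      rw [this, smul_zero]
    · exact Set.indicator_of_notMem hyT _
  have htb : tsupport b ⊆ K' := closure_minimal hbK hK'.isClosed
  have hb : ContDiff ℝ ∞ b := by
    rw [contDiff_iff_contDiffAt]
    intro y
    by_cases hy : y ∈ T
    · exact (((hβ c).contDiffAt (hT.mem_nhds hy)).const_smul (ε y)).congr_of_eventuallyEq (hbev y hy)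
    · refine (contDiffAt_const (c := (0 : Model n →L[ℝ] ℝ))).congr_of_eventuallyEq ?_
      filter_upwards [hK'.isClosed.isOpen_compl.mem_nhds fun h => hy (hK'T h)] with z hz
      exact Function.notMem_support.1 fun h => hz (hbK h)
  have h0 : ∀ y ∈ T, wedge (fun u => b y u) (fun u w => locD a y u w) (stdBasis n) = 0 := by
    intro y hy
    set x := (extChartAt (𝓡 (2 * n + 1)) c).symm y
    have h1 : ∀ v w, locD a y v w = S.kahler φ x (chartInv c y v) (chartInv c y w) :=
      fun v w => by rw [← (S.smooth1_etaDef hφ.1).extD_eq hy, kahler, extDE_apply]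
    have h2 := S.wedge_eq_zero hφ x (ε y • (β x : Model n →L[ℝ] ℝ)) (by
      have : (β x : Model n →L[ℝ] ℝ) (S.xiE x) = 0 := hξ x
      change ε y * (β x : Model n →L[ℝ] ℝ) (S.xiE x) = 0
      rw [this, mul_zero]) (chartFrame c y)
    rw [← h2, hbT y hy]
    simp only [h1]
    rfl
  have hmain := integral_linWedge_eq_zero hT (S.smooth1_etaDef hφ.1 c) hb
    (hK'.of_isClosed_subset (isClosed_tsupport b) htb) (htb.trans hK'T) h0
  have hl : ∀ y ∈ T, |locDens (S.volDens fun _ => 0) c y| *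
      S.linForm φ β ((extChartAt (𝓡 (2 * n + 1)) c).symm y) = (1 / (n.factorial : ℝ)) *
      linWedge (fun u => a y u) (fun u w => locD a y u w) (fun u w => locD b y u w)
        (stdBasis n) := fun y hy => by
    have hW : W y ≠ 0 := S.topLoc_zero_ne hy
    have h1 : locD b y = ε y • locD (rep1 β c) y := by
      rw [← locD_const_smul _ (hβ.differentiableAt hy), locD, locD, (hbev y hy).fderiv_eq]
    rw [S.locDens_volDens contMDiff_const hy, S.linForm_chart hφ.1 hβ hy, h1]
    simp only [smul_apply, smul_eq_mul]
    rw [linWedge_smul, abs_mul, abs_of_nonneg (show (0 : ℝ) ≤ 1 / (n.factorial : ℝ) by positivity),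
      mul_assoc]
    congr 1
    change |W y| * (_ / W y) = _
    have h2 : |W y| = ε y * W y := (sign_mul_self (W y)).symm
    rw [h2]
    field_simp
    rfl
  have hz : ∀ y, y ∉ T → linWedge (fun u => a y u) (fun u w => locD a y u w)
      (fun u w => locD b y u w) (stdBasis n) = 0 := fun y hy => by
    have h1 : b =ᶠ[𝓝 y] fun _ => 0 := by
      filter_upwards [hK'.isClosed.isOpen_compl.mem_nhds fun h => hy (hK'T h)] with z hz
      exact Function.notMem_support.1 fun h => hz (hbK h)
    have h2 : locD b y = 0 := by
      rw [locD, h1.fderiv_eq]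
      ext v w; simp
    simp only [h2, zero_apply, linWedge_zero]
  rw [setIntegral_congr_fun hT.measurableSet hl, integral_const_mul,
    setIntegral_eq_integral_of_forall_compl_eq_zero hz, hmain, mul_zero]

/-- Stokes' theorem on `M` for the linearized volume form. -/
lemma integral_linForm {φ ψ : M → ℝ} (hφ : S.IsBasic φ)
    (hψ : ContMDiff (𝓡 (2 * n + 1)) 𝓘(ℝ, ℝ) ∞ ψ) :
    ∫ x, S.linForm φ (S.dc ψ) x ∂S.baseVol = 0 := by
  -- A partition of unity reduces to forms supported in one chart. The pieces are no longer of the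
  -- form `d^c` of a function, which is why the local statement allows any `1`-form annihilated by
  -- `ξ`.
  let β : M → ∀ x : M, Tan n x →L[ℝ] ℝ := fun c z => chartPartition n M c z • S.dc ψ z
  have hβ : ∀ c, Smooth1 (β c) := fun c =>
    (S.smooth1_dc hψ).smul (chartPartition n M c).contMDiff
  have hsum : S.dc ψ = fun z => ∑ c ∈ partSupport n M, β c z := by
    funext z
    rw [← Finset.sum_smul, sum_chartPartition, one_smul]
  have h1 : ∀ x, S.linForm φ (S.dc ψ) x = ∑ c ∈ partSupport n M, S.linForm φ (β c) x := fun x => by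
    conv_lhs => rw [linForm, hsum, (extDE_sum (partSupport n M) hβ x).2]
    simp only [linForm, ← Finset.sum_div]
    congr 1
    generalize partSupport n M = s
    classical
    induction s using Finset.induction_on with
    | empty => simp [linWedge_zero]
    | insert c s hc ih =>
      rw [Finset.sum_insert hc, Finset.sum_insert hc, ← ih]
      exact linWedge_add _ _ (fun u w => extDE (β c) x u w)
        (fun u w => (∑ i ∈ s, extDE (β i) x) u w) _
  simp only [h1]
  rw [integral_finsetSum _ fun c _ => (S.continuous_linForm hφ.1 (hβ c)).integrable_of_hasCompactSupport
    (HasCompactSupport.of_compactSpace _)]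
  refine Finset.sum_eq_zero fun c _ => S.integral_linForm_of_support hφ (hβ c) (fun x => ?_) c
    (isClosed_tsupport (chartPartition n M c)) (tsupport_chartPartition c) fun x hx => ?_
  · have h2 : S.dc ψ x (S.xi x) = 0 := S.dcE_xiE ψ x
    change chartPartition n M c x * S.dc ψ x (S.xi x) = 0
    rw [h2, mul_zero]
  · change chartPartition n M c x • S.dc ψ x = 0
    rw [image_eq_zero_of_notMem_tsupport hx, zero_smul]

end SasakianStructure
end Sasaki

end

section

namespace Sasaki

/-! ### Differentiation under the integral sign, and derivatives of `∏ (1 + s c_k)`. -/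

section

open MeasureTheory

variable {n : ℕ} {M : Type*} [TopologicalSpace M] [ChartedSpace (Model n) M] [CompactSpace M]
  [MeasurableSpace M] [BorelSpace M] {μ : Measure M} [IsFiniteMeasure μ]

lemma integrable_of_continuous {f : M → ℝ} (hf : Continuous f) : Integrable f μ :=
  hf.integrable_of_hasCompactSupport (HasCompactSupport.of_compactSpace _)

lemma LocSmooth.continuous_slice {R : ℝ → M → ℝ} (hR : LocSmooth n R) (t : ℝ) : Continuous (R t) :=
  hR.continuous.comp (Continuous.prodMk_right t)

lemma LocSmooth.exists_bound {R : ℝ → M → ℝ} (hR : LocSmooth n R) (a b : ℝ) :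
    ∃ C, 0 ≤ C ∧ ∀ t ∈ Set.Icc a b, ∀ x, |R t x| ≤ C := by
  obtain ⟨C, hC⟩ := ((isCompact_Icc (a := a) (b := b)).prod isCompact_univ).bddAbove_image
    (f := fun p : ℝ × M => |R p.1 p.2|) hR.continuous.abs.continuousOn
  refine ⟨max C 0, le_max_right _ _, fun t ht x => (hC ⟨(t, x), ⟨ht, trivial⟩, rfl⟩).trans
    (le_max_left _ _)⟩

/-- Differentiation under the integral sign. -/
lemma LocSmooth.hasDerivAt_integral {R : ℝ → M → ℝ} (hR : LocSmooth n R) (t : ℝ) :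
    HasDerivAt (fun s => ∫ x, R s x ∂μ) (∫ x, _root_.deriv (fun s => R s x) t ∂μ) t := by
  obtain ⟨C, -, hC⟩ := hR.deriv.exists_bound (t - 1) (t + 1)
  refine (hasDerivAt_integral_of_dominated_loc_of_deriv_le (Metric.ball_mem_nhds t one_pos)
    (Filter.Eventually.of_forall fun s => (hR.continuous_slice s).aestronglyMeasurable)
    (integrable_of_continuous (hR.continuous_slice t))
    (hR.deriv.continuous_slice t).aestronglyMeasurable (bound := fun _ => C)
    (ae_of_all _ fun x s hs => ?_) (integrable_const C)
    (ae_of_all _ fun x s _ => hR.hasDerivAt s x)).2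
  rw [Real.ball_eq_Ioo] at hs
  exact hC s ⟨hs.1.le, hs.2.le⟩ x

lemma LocSmooth.continuous_integral {R : ℝ → M → ℝ} (hR : LocSmooth n R) :
    Continuous fun s => ∫ x, R s x ∂μ :=
  continuous_iff_continuousAt.2 fun t => (hR.hasDerivAt_integral t).continuousAt

end

lemma hasDerivAt_prod_one_add {ι : Type*} [Fintype ι] [DecidableEq ι] (c : ι → ℝ) (s : ℝ) :
    HasDerivAt (fun s => ∏ k, (1 + s * c k)) (∑ j, c j * ∏ k ∈ Finset.univ.erase j, (1 + s * c k)) s := by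
  have h := HasDerivAt.fun_finsetProd (u := Finset.univ) fun (k : ι) _ =>
    ((hasDerivAt_id s).mul_const (c k)).const_add 1
  refine h.congr_deriv (Finset.sum_congr rfl fun j _ => ?_)
  simp [mul_comm]

/-- Twice the second elementary symmetric function of the `c_k`. -/
lemma hasDerivAt_prod_one_add_snd {ι : Type*} [Fintype ι] [DecidableEq ι] (c : ι → ℝ) :
    HasDerivAt (fun s => ∑ j, c j * ∏ k ∈ Finset.univ.erase j, (1 + s * c k))
      ((∑ k, c k) ^ 2 - ∑ k, c k ^ 2) 0 := by
  have h : ∀ j, HasDerivAt (fun s => c j * ∏ k ∈ Finset.univ.erase j, (1 + s * c k))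
      (c j * ∑ l ∈ Finset.univ.erase j, c l) 0 := fun j => by
    have h := HasDerivAt.fun_finsetProd (u := Finset.univ.erase j) fun (k : ι) _ =>
      ((hasDerivAt_id (0 : ℝ)).mul_const (c k)).const_add 1
    refine (h.const_mul (c j)).congr_deriv ?_
    simp
  refine (HasDerivAt.fun_sum fun j (_ : j ∈ Finset.univ) => h j).congr_deriv ?_
  have h2 : ∀ j, c j * ∑ l ∈ Finset.univ.erase j, c l = c j * (∑ k, c k) - c j ^ 2 := fun j => by
    rw [← Finset.add_sum_erase _ _ (Finset.mem_univ j)]; ring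
  simp only [h2]
  rw [Finset.sum_sub_distrib, ← Finset.sum_mul, sq]

/-! ### Positivity of the transverse metric of a potential. -/

namespace SasakianStructure

variable {n : ℕ} {M : Type*} [TopologicalSpace M] [ChartedSpace (Model n) M]
  [IsManifold (𝓡 (2 * n + 1)) ∞ M] {S : SasakianStructure n M} [T2Space M]

/-- Adding `η_φ²` removes the degenerate direction `ξ`, so that positivity is a condition on all
nonzero vectors and compactness of a sphere applies. -/
lemma posAt_iff {φ : M → ℝ} (hφ : S.IsBasic φ) (x : M) : S.PosAt φ x ↔
    ∀ v : Model n, v ≠ 0 → 0 < S.kahler φ x v (S.PhiE x v) + S.etaDE φ x v ^ 2 := by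
  constructor
  · intro h v hv
    have := h.metric_pos hφ v hv
    rw [metricE, contactMetric_apply, bil_apply] at this
    change 0 < S.kahler φ x v (S.JE φ x v) + S.etaDE φ x v * S.etaDE φ x v at this
    rwa [hφ.kahler_JE, ← sq] at this
  · intro h v hv
    set w := v - S.etaDE φ x v • S.xiE x with hw
    have hη : S.etaDE φ x (S.xiE x) = 1 := (hφ.almostContact x).eta_xi
    have h1 : S.PhiE x w = S.PhiE x v := by
      rw [hw, map_sub, map_smul, PhiE_xiE, smul_zero, sub_zero]
    have h2 : S.etaDE φ x w = 0 := by
      rw [hw, map_sub, map_smul, hη, smul_eq_mul, mul_one, sub_self]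
    have h3 : S.kahler φ x w (S.PhiE x v) = S.kahler φ x v (S.PhiE x v) := by
      have := (hφ.isTransverse_kahler x φ).xi_left (S.PhiE x v)
      rw [bil_apply] at this
      rw [hw, map_sub, map_smul, sub_apply, smul_apply, this, smul_zero, sub_zero]
    have h4 : w ≠ 0 := fun h0 => hv (by rw [← h1, h0, map_zero])
    have h5 := h w h4
    rw [h1, h2, h3] at h5
    simpa using h5

lemma kahler_chart {φ : M → ℝ} (hφ : S.IsBasic φ) {c : M} {y : Model n}
    (hy : y ∈ (extChartAt (𝓡 (2 * n + 1)) c).target) (v : Model n) :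
    S.kahler φ ((extChartAt (𝓡 (2 * n + 1)) c).symm y) (chartInv c y v)
      (S.PhiE ((extChartAt (𝓡 (2 * n + 1)) c).symm y) (chartInv c y v)) =
    locD (rep1 (S.etaDef φ) c) y v (repEnd S.Phi c y v) := by
  have h : S.PhiE ((extChartAt (𝓡 (2 * n + 1)) c).symm y) (chartInv c y v) =
      chartInv c y (repEnd S.Phi c y v) := (chartInv_chartFwd hy _).symm
  rw [h, kahler, extDE_apply]
  exact (S.smooth1_etaDef hφ.1).extD_eq hy _ _

lemma continuousOn_kahler_chart {φ : M → ℝ} (hφ : S.IsBasic φ) (c : M) :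
    ContinuousOn (fun p : Model n × Model n => locD (rep1 (S.etaDef φ) c) p.1 p.2
      (repEnd S.Phi c p.1 p.2)) ((extChartAt (𝓡 (2 * n + 1)) c).target ×ˢ Set.univ) := by
  have hT := isOpen_target (n := n) c
  have h1 : ContinuousOn (locD (rep1 (S.etaDef φ) c)) (extChartAt (𝓡 (2 * n + 1)) c).target :=
    (ParSmooth.locD hT (parSmooth_const (S.smooth1_etaDef hφ.1 c))).continuousOn.comp
      (f := fun y : Model n => ((0 : ℝ), y)) (by fun_prop) fun y hy => ⟨trivial, hy⟩
  have h2 := (contDiffOn_repEnd S.Phi_smooth c).continuousOn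
  have h3 : ContinuousOn (fun p : Model n × Model n => locD (rep1 (S.etaDef φ) c) p.1)
      ((extChartAt (𝓡 (2 * n + 1)) c).target ×ˢ Set.univ) :=
    h1.comp continuousOn_fst fun p hp => hp.1
  have h4 : ContinuousOn (fun p : Model n × Model n => repEnd S.Phi c p.1)
      ((extChartAt (𝓡 (2 * n + 1)) c).target ×ˢ Set.univ) :=
    h2.comp continuousOn_fst fun p hp => hp.1
  exact (h3.clm_apply continuousOn_snd).clm_apply (h4.clm_apply continuousOn_snd)

lemma chartInv_self (x : M) (v : Model n) :
    chartInv x (extChartAt (𝓡 (2 * n + 1)) x x) v = v := by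
  have h := chartInv_chartFwd' (mem_extChartAt_source (I := 𝓡 (2 * n + 1)) x) v
  rwa [chartFwd_self] at h

/-- In a chart, a continuous quadratic form that is positive on the unit sphere at one point stays
so nearby; homogeneity extends this to all nonzero vectors. -/
lemma isOpen_posAt {φ : M → ℝ} (hφ : S.IsBasic φ) : IsOpen {x | S.PosAt φ x} := by
  rw [isOpen_iff_mem_nhds]
  intro x hx
  set a := rep1 (S.etaDef φ) x
  set y0 := extChartAt (𝓡 (2 * n + 1)) x x with hy0
  have hy0T : y0 ∈ (extChartAt (𝓡 (2 * n + 1)) x).target := mem_extChartAt_target x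
  let G : Model n × Model n → ℝ := fun p => locD a p.1 p.2 (repEnd S.Phi x p.1 p.2) + a p.1 p.2 ^ 2
  have hG : ContinuousOn G ((extChartAt (𝓡 (2 * n + 1)) x).target ×ˢ Set.univ) := by
    refine (continuousOn_kahler_chart hφ x).add (ContinuousOn.pow ?_ 2)
    exact ((S.smooth1_etaDef hφ.1 x).continuousOn.comp continuousOn_fst
      fun p hp => hp.1).clm_apply continuousOn_snd
  have hGx : ∀ y ∈ (extChartAt (𝓡 (2 * n + 1)) x).target, ∀ v, G (y, v) =
      S.kahler φ ((extChartAt (𝓡 (2 * n + 1)) x).symm y) (chartInv x y v)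
        (S.PhiE ((extChartAt (𝓡 (2 * n + 1)) x).symm y) (chartInv x y v)) +
      S.etaDE φ ((extChartAt (𝓡 (2 * n + 1)) x).symm y) (chartInv x y v) ^ 2 := fun y hy v => by
    rw [kahler_chart hφ hy]; rfl
  have hev : ∀ᶠ y in 𝓝 y0, ∀ v ∈ Metric.sphere (0 : Model n) 1, 0 < G (y, v) := by
    refine (isCompact_sphere (0 : Model n) 1).eventually_forall_of_forall_eventually fun v hv => ?_
    have hc : ContinuousAt G (y0, v) :=
      hG.continuousAt (((isOpen_target x).prod isOpen_univ).mem_nhds ⟨hy0T, trivial⟩)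
    refine hc.eventually_const_lt ?_
    rw [hGx y0 hy0T, hy0, chartInv_self, extChartAt_to_inv]
    exact (posAt_iff hφ x).1 hx v fun h => by simp [h] at hv
  have hev2 : ∀ᶠ z in 𝓝 x, ∀ v ∈ Metric.sphere (0 : Model n) 1,
      0 < G (extChartAt (𝓡 (2 * n + 1)) x z, v) := (continuousAt_extChartAt x).eventually hev
  filter_upwards [hev2, extChartAt_source_mem_nhds (I := 𝓡 (2 * n + 1)) x] with z hz hzs
  set y := extChartAt (𝓡 (2 * n + 1)) x z with hy
  have hyT : y ∈ (extChartAt (𝓡 (2 * n + 1)) x).target :=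
    (extChartAt (𝓡 (2 * n + 1)) x).map_source hzs
  have hyz : (extChartAt (𝓡 (2 * n + 1)) x).symm y = z :=
    (extChartAt (𝓡 (2 * n + 1)) x).left_inv hzs
  change S.PosAt φ z
  rw [posAt_iff hφ]
  intro v hv
  set w := chartFwd x z v with hw
  have hwv : chartInv x y w = v := chartInv_chartFwd' hzs v
  have hw0 : w ≠ 0 := fun h => hv (by rw [← hwv, h, map_zero])
  have h1 := hz (‖w‖⁻¹ • w) (by simp [norm_smul, hw0])
  rw [hGx y hyT, hyz, map_smul, hwv, map_smul, map_smul, map_smul, map_smul, smul_apply] at h1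
  simp only [smul_eq_mul] at h1
  have h2 : 0 < ‖w‖⁻¹ := inv_pos.2 (norm_pos_iff.2 hw0)
  have h3 : ‖w‖⁻¹ * (‖w‖⁻¹ * S.kahler φ z v (S.PhiE z v)) + (‖w‖⁻¹ * S.etaDE φ z v) ^ 2 =
      ‖w‖⁻¹ ^ 2 * (S.kahler φ z v (S.PhiE z v) + S.etaDE φ z v ^ 2) := by ring
  rw [h3] at h1
  exact (mul_pos_iff_of_pos_left (by positivity)).1 h1

lemma isClosed_semiposAt {φ : M → ℝ} (hφ : S.IsBasic φ) : IsClosed {x | S.SemiposAt φ x} := by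
  rw [← isOpen_compl_iff, isOpen_iff_mem_nhds]
  intro x hx
  have hx' : ∃ v : Model n, S.kahler φ x v (S.PhiE x v) < 0 := by
    simpa [SemiposAt] using hx
  obtain ⟨v, hv⟩ := hx'
  set y0 := extChartAt (𝓡 (2 * n + 1)) x x with hy0
  have hy0T : y0 ∈ (extChartAt (𝓡 (2 * n + 1)) x).target := mem_extChartAt_target x
  have hc : ContinuousAt (fun y : Model n => locD (rep1 (S.etaDef φ) x) y v (repEnd S.Phi x y v))
      y0 := ContinuousAt.comp (f := fun y : Model n => (y, v))
        ((continuousOn_kahler_chart hφ x).continuousAt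
          (((isOpen_target x).prod isOpen_univ).mem_nhds ⟨hy0T, trivial⟩)) (by fun_prop)
  have h1 : locD (rep1 (S.etaDef φ) x) y0 v (repEnd S.Phi x y0 v) < 0 := by
    rw [← kahler_chart hφ hy0T, hy0, chartInv_self, extChartAt_to_inv]; exact hv
  have h2 := (continuousAt_extChartAt (I := 𝓡 (2 * n + 1)) x).eventually (hc.eventually_lt_const h1)
  filter_upwards [h2, extChartAt_source_mem_nhds (I := 𝓡 (2 * n + 1)) x] with z hz hzs
  rw [← kahler_chart hφ ((extChartAt (𝓡 (2 * n + 1)) x).map_source hzs),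
    (extChartAt (𝓡 (2 * n + 1)) x).left_inv hzs] at hz
  exact fun h => absurd (h _) (not_le.2 hz)

lemma IsPotential.rho_ne_zero {φ : M → ℝ} (hφ : S.IsPotential φ) (x : M) : S.rho φ x ≠ 0 := by
  obtain ⟨v, hv⟩ := hφ.2 x
  intro h
  apply hv
  have h1 := S.wedgeTop_eq φ x v
  have h2 := S.topForm_eq_rho φ x v
  rw [h, zero_mul] at h2
  exact h1.trans h2

lemma isPotential_of_posAt {φ : M → ℝ} (hφ : S.IsBasic φ) (h : ∀ x, S.PosAt φ x) :
    S.IsPotential φ := by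
  refine ⟨hφ, fun x => ⟨(stdBasis n : Fin (2 * n + 1) → Model n), fun h0 => ?_⟩⟩
  have h1 := (S.wedgeTop_eq φ x (stdBasis n)).symm.trans h0
  rw [S.topForm_eq_rho] at h1
  exact (mul_ne_zero ((h x).rho_pos hφ).ne' (S.topForm_zero_ne x)) h1

/-- The deformed metrics of all potentials are positive definite. -/
lemma IsPotential.posAt [CompactSpace M] [ConnectedSpace M] {φ : M → ℝ} (hφ : S.IsPotential φ)
    (x : M) : S.PosAt φ x := by
  -- The volume density never vanishes, so the open condition coincides with the closed one.
  have h1 : {x | S.PosAt φ x} = {x | S.SemiposAt φ x} := by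
    ext z
    exact ⟨fun h => PosAt.semiposAt h, fun h => SemiposAt.posAt h hφ.1 (hφ.rho_ne_zero z)⟩
  have h2 : IsClopen {x | S.PosAt φ x} :=
    ⟨by rw [h1]; exact isClosed_semiposAt hφ.1, isOpen_posAt hφ.1⟩
  -- At a minimum point of `φ` the form `dd^c φ` is nonnegative and adds to the positive `dη`, so
  -- the clopen set is nonempty.
  obtain ⟨z, hz⟩ := (isCompact_univ (X := M)).exists_isMinOn Set.univ_nonempty
    hφ.1.1.continuous.continuousOn
  have h3 : S.SemiposAt φ z := fun v => by
    rw [S.kahler_eq hφ.1.1, add_apply, add_apply]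
    refine add_nonneg ?_ (hφ.1.extDE_dc_nonneg (fun w => hz.2 (Set.mem_univ w)) v)
    rw [← S.kahler_zero]
    exact (S.posAt_zero z).semiposAt v
  have h4 := h2.eq_univ ⟨z, h3.posAt hφ.1 (hφ.rho_ne_zero z)⟩
  exact h4.symm.subset (Set.mem_univ x)

end SasakianStructure
end Sasaki

end

section

/-! ### Comparison of the Ebin, Calabi and gradient metrics. -/

namespace Sasaki
namespace SasakianStructure

open MeasureTheory

variable {n : ℕ} {M : Type*} [TopologicalSpace M] [ChartedSpace (Model n) M]
  [IsManifold (𝓡 (2 * n + 1)) ∞ M] {S : SasakianStructure n M} [T2Space M]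

section Pointwise

variable {φ ψ : M → ℝ}

lemma locSmooth_line (hφ : S.IsBasic φ) (hψ : S.IsBasic ψ) :
    LocSmooth n fun s x => φ x + s * ψ x :=
  (LocSmooth.of_contMDiff hφ.1).add ((LocSmooth.of_param contDiff_id).mul (LocSmooth.of_contMDiff hψ.1))

lemma deriv_line (s : ℝ) (x : M) : deriv (fun s => φ x + s * ψ x) s = ψ x := by
  simp

lemma hasDerivAt_rho_line (hφ : S.IsBasic φ) (hψ : S.IsBasic ψ) (s : ℝ) (x : M) :
    HasDerivAt (fun s => S.rho (fun z => φ z + s * ψ z) x)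
      (S.linForm (fun z => φ z + s * ψ z) (S.dc ψ) x) s := by
  have h := S.hasDerivAt_rho (locSmooth_line hφ hψ) (t := s) (hφ.add_smul hψ s) x
  simpa only [deriv_line] using h

/-- Both sides are the derivative of the density along `φ + sψ`: once by linearization, once from
the product over the eigenvalues. -/
lemma PosAt.linForm_eq {x : M} (h : S.PosAt φ x) (hφ : S.IsBasic φ) (hψ : S.IsBasic ψ) :
    S.linForm φ (S.dc ψ) x = S.rho φ x * S.laplacian φ ψ x := by
  obtain ⟨b, c, hb⟩ := h.exists_adapted hφ hψ
  have h1 := hasDerivAt_rho_line hφ hψ 0 x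
  simp only [zero_mul, add_zero] at h1
  have h2 := (hasDerivAt_prod_one_add c 0).const_mul (S.rho φ x)
  simp only [← hφ.rho_add_smul hψ hb] at h2
  rw [h1.unique h2, IsBasic.laplacian_eq hb]
  simp

/-- Uses `∑ c_k² = (∑ c_k)² - ((∑ c_k)² - ∑ c_k²)`, where the bracket is the second derivative of
the density divided by `rho φ x`. It will integrate to zero. -/
lemma PosAt.deriv_rho_snd {x : M} (h : S.PosAt φ x) (hφ : S.IsBasic φ) (hψ : S.IsBasic ψ)
    (a : ∀ x : M, Tan n x → Tan n x → ℝ)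
    (ha : ∀ v w : Model n, a x v w = extDE (S.dc ψ) x v (S.PhiE x w) +
      (S.etaDE φ x v * S.dcE ψ x w + S.dcE ψ x v * S.etaDE φ x w)) :
    S.rho φ x * inner2 (S.gDef φ) a a x = 2 * (S.rho φ x * S.laplacian φ ψ x ^ 2) +
      1 / 2 * (S.rho φ x * S.gradSq φ ψ x) -
      2 * deriv (fun s => deriv (fun s => S.rho (fun z => φ z + s * ψ z) x) s) 0 := by
  obtain ⟨b, c, hb⟩ := h.exists_adapted hφ hψ
  have h1 : (fun s => deriv (fun s => S.rho (fun z => φ z + s * ψ z) x) s) = fun s =>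
      S.rho φ x * ∑ j, c j * ∏ k ∈ Finset.univ.erase j, (1 + s * c k) := funext fun s => by
    simp only [hφ.rho_add_smul hψ hb]
    exact ((hasDerivAt_prod_one_add c s).const_mul (S.rho φ x)).deriv
  rw [h1, ((hasDerivAt_prod_one_add_snd c).const_mul (S.rho φ x)).deriv,
    hφ.inner2_velocity hψ hb a ha, IsBasic.laplacian_eq hb]
  ring

lemma PosAt.gradSq_eq_linForm {x : M} (h : S.PosAt φ x) (hφ : S.IsBasic φ) (hψ : S.IsBasic ψ) :
    S.rho φ x * S.gradSq φ ψ x = S.linForm φ (S.dc fun z => ψ z * ψ z) x -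
      2 * (ψ x * S.linForm φ (S.dc ψ) x) := by
  rw [h.linForm_eq hφ hψ, h.linForm_eq hφ (hψ.mul hψ)]
  obtain ⟨b, c, hb⟩ := h.exists_adapted hφ hψ
  rw [IsBasic.laplacian_mul_self hφ hψ hb]
  ring

lemma PosAt.laplacian_eq_linForm {x : M} (h : S.PosAt φ x) (hφ : S.IsBasic φ) (hψ : S.IsBasic ψ) :
    S.rho φ x * S.laplacian φ ψ x ^ 2 = S.linForm φ (S.dc ψ) x ^ 2 / S.rho φ x := by
  rw [h.linForm_eq hφ hψ]
  have := (h.rho_pos hφ).ne'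
  field_simp

end Pointwise

section Integrals

variable [CompactSpace M] [MeasurableSpace M] [BorelSpace M] {φ ψ : M → ℝ}

lemma continuous_linForm_dc (hφ : S.IsBasic φ) (hψ : S.IsBasic ψ) :
    Continuous (S.linForm φ (S.dc ψ)) := S.continuous_linForm hφ.1 (S.smooth1_dc hψ.1)

lemma calabi_eq (hφ : S.IsBasic φ) (hpos : ∀ x, S.PosAt φ x) :
    S.calabiMetric φ ψ ψ = ∫ x, S.rho φ x * S.laplacian φ ψ x ^ 2 ∂S.baseVol := by
  rw [calabiMetric, S.integral_vol hφ.1 fun x => ((hpos x).rho_pos hφ).le]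
  simp only [sq]

lemma calabi_eq_linForm (hφ : S.IsBasic φ) (hψ : S.IsBasic ψ) (hpos : ∀ x, S.PosAt φ x) :
    S.calabiMetric φ ψ ψ = ∫ x, S.linForm φ (S.dc ψ) x ^ 2 / S.rho φ x ∂S.baseVol := by
  rw [calabi_eq hφ hpos]
  exact integral_congr_ae (ae_of_all _ fun x => (hpos x).laplacian_eq_linForm hφ hψ)

lemma gradient_eq (hφ : S.IsBasic φ) (hpos : ∀ x, S.PosAt φ x) :
    S.gradientMetric φ ψ ψ = ∫ x, S.rho φ x * S.gradSq φ ψ x ∂S.baseVol := by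
  rw [gradientMetric, S.integral_vol hφ.1 fun x => ((hpos x).rho_pos hφ).le]
  rfl

lemma integrable_laplacian_sq (hφ : S.IsBasic φ) (hψ : S.IsBasic ψ) (hpos : ∀ x, S.PosAt φ x) :
    Integrable (fun x => S.rho φ x * S.laplacian φ ψ x ^ 2) S.baseVol := by
  have h : (fun x => S.rho φ x * S.laplacian φ ψ x ^ 2) =
      fun x => S.linForm φ (S.dc ψ) x ^ 2 / S.rho φ x :=
    funext fun x => (hpos x).laplacian_eq_linForm hφ hψ
  rw [h]
  exact integrable_of_continuous (((continuous_linForm_dc hφ hψ).pow 2).div (S.continuous_rho hφ.1)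
    fun x => ((hpos x).rho_pos hφ).ne')

lemma continuous_gradSq (hφ : S.IsBasic φ) (hψ : S.IsBasic ψ) (hpos : ∀ x, S.PosAt φ x) :
    Continuous fun x => S.rho φ x * S.gradSq φ ψ x := by
  have h : (fun x => S.rho φ x * S.gradSq φ ψ x) = fun x =>
      S.linForm φ (S.dc fun z => ψ z * ψ z) x - 2 * (ψ x * S.linForm φ (S.dc ψ) x) :=
    funext fun x => (hpos x).gradSq_eq_linForm hφ hψ
  rw [h]
  exact (continuous_linForm_dc hφ (hψ.mul hψ)).sub
    (continuous_const.mul (hψ.1.continuous.mul (continuous_linForm_dc hφ hψ)))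

/-- Green's formula for the basic Laplacian. -/
lemma gradient_eq_linForm (hφ : S.IsBasic φ) (hψ : S.IsBasic ψ) (hpos : ∀ x, S.PosAt φ x) :
    S.gradientMetric φ ψ ψ = -2 * ∫ x, ψ x * S.linForm φ (S.dc ψ) x ∂S.baseVol := by
  rw [gradient_eq hφ hpos]
  have h : (fun x => S.rho φ x * S.gradSq φ ψ x) = fun x =>
      S.linForm φ (S.dc fun z => ψ z * ψ z) x - 2 * (ψ x * S.linForm φ (S.dc ψ) x) :=
    funext fun x => (hpos x).gradSq_eq_linForm hφ hψ
  have h1 : Integrable (fun x => ψ x * S.linForm φ (S.dc ψ) x) S.baseVol :=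
    integrable_of_continuous (hψ.1.continuous.mul (continuous_linForm_dc hφ hψ))
  rw [h, integral_sub (integrable_of_continuous (continuous_linForm_dc hφ (hψ.mul hψ)))
    (h1.const_mul 2), S.integral_linForm hφ (hψ.mul hψ).1, integral_const_mul]
  ring

/-- Stokes makes the first derivative of the total volume vanish at every `s`, not only where `φ +
sψ` is a potential; so its derivative in `s` is zero too. -/
lemma integral_deriv_rho_snd (hφ : S.IsBasic φ) (hψ : S.IsBasic ψ) :
    ∫ x, deriv (fun s => deriv (fun s => S.rho (fun z => φ z + s * ψ z) x) s) 0 ∂S.baseVol = 0 := by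
  have h := (((locSmooth_line hφ hψ).rho S).deriv.hasDerivAt_integral (μ := S.baseVol) 0)
  have h0 : (fun s => ∫ x, deriv (fun s => S.rho (fun z => φ z + s * ψ z) x) s ∂S.baseVol) =
      fun _ => 0 := funext fun s => by
    rw [← S.integral_linForm (hφ.add_smul hψ s) hψ.1]
    exact integral_congr_ae (ae_of_all _ fun x => (hasDerivAt_rho_line hφ hψ s x).deriv)
  rw [h0] at h
  exact h.unique (hasDerivAt_const _ _)

lemma integral_lin_comb {X : Type*} [MeasurableSpace X] {μ : Measure X} {f g h : X → ℝ}
    (hf : Integrable f μ) (hg : Integrable g μ) (hh : Integrable h μ) :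
    ∫ x, (2 * f x + 1 / 2 * g x - 2 * h x) ∂μ =
      2 * ∫ x, f x ∂μ + 1 / 2 * ∫ x, g x ∂μ - 2 * ∫ x, h x ∂μ := by
  rw [integral_sub (f := fun x => 2 * f x + 1 / 2 * g x)
    ((hf.const_mul 2).add (hg.const_mul (1 / 2))) (hh.const_mul 2),
    integral_add (hf.const_mul 2) (hg.const_mul (1 / 2)), integral_const_mul, integral_const_mul,
    integral_const_mul]

/-- The integrated form of `PosAt.deriv_rho_snd`: the second derivative of the density disappears
and the Ebin metric becomes a combination of the other two. -/
lemma ebin_eq [Nonempty M] (hφ : S.IsBasic φ) (hψ : S.IsBasic ψ) (hpos : ∀ x, S.PosAt φ x)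
    (a : ∀ x : M, Tan n x → Tan n x → ℝ)
    (ha : ∀ (x : M) (v w : Model n), a x v w = extDE (S.dc ψ) x v (S.PhiE x w) +
      (S.etaDE φ x v * S.dcE ψ x w + S.dcE ψ x v * S.etaDE φ x w)) :
    ebinMetric (S.gDef φ) a a = (volRatio n)⁻¹ *
      (2 * S.calabiMetric φ ψ ψ + 1 / 2 * S.gradientMetric φ ψ ψ) := by
  rw [ebinMetric, S.integral_riemannianVolume hφ hpos, calabi_eq hφ hpos, gradient_eq hφ hpos]
  have h1 := integrable_laplacian_sq hφ hψ hpos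
  have h2 := integrable_of_continuous (μ := S.baseVol) (continuous_gradSq hφ hψ hpos)
  have h3 := integrable_of_continuous (μ := S.baseVol)
    (((locSmooth_line hφ hψ).rho S).deriv.deriv.continuous_slice 0)
  have h4 := integral_lin_comb h1 h2 h3
  rw [integral_deriv_rho_snd hφ hψ, mul_zero, sub_zero] at h4
  rw [← h4]
  exact congrArg _ (integral_congr_ae (ae_of_all _ fun x => (hpos x).deriv_rho_snd hφ hψ a (ha x)))

lemma calabi_nonneg (hφ : S.IsBasic φ) (hpos : ∀ x, S.PosAt φ x) :
    0 ≤ S.calabiMetric φ ψ ψ := by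
  rw [calabi_eq hφ hpos]
  exact integral_nonneg fun x => mul_nonneg ((hpos x).rho_pos hφ).le (sq_nonneg _)

lemma gradient_nonneg (hφ : S.IsBasic φ) (hψ : S.IsBasic ψ) (hpos : ∀ x, S.PosAt φ x) :
    0 ≤ S.gradientMetric φ ψ ψ := by
  rw [gradient_eq hφ hpos]
  exact integral_nonneg fun x => mul_nonneg ((hpos x).rho_pos hφ).le ((hpos x).gradSq_nonneg hφ hψ)

lemma sqrt_calabi_add_le [Nonempty M] (hφ : S.IsBasic φ) (hψ : S.IsBasic ψ)
    (hpos : ∀ x, S.PosAt φ x) (a : ∀ x : M, Tan n x → Tan n x → ℝ)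
    (ha : ∀ (x : M) (v w : Model n), a x v w = extDE (S.dc ψ) x v (S.PhiE x w) +
      (S.etaDE φ x v * S.dcE ψ x w + S.dcE ψ x v * S.etaDE φ x w)) :
    √(S.calabiMetric φ ψ ψ) + √(S.gradientMetric φ ψ ψ) / 2 ≤ √(ebinMetric (S.gDef φ) a a) := by
  obtain ⟨x0⟩ := ‹Nonempty M›
  have : Nonempty M := ⟨x0⟩
  have hC := calabi_nonneg (ψ := ψ) hφ hpos
  have hG := gradient_nonneg hφ hψ hpos
  rw [ebin_eq hφ hψ hpos a ha]
  refine Real.le_sqrt_of_sq_le ?_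
  set C := S.calabiMetric φ ψ ψ
  set G := S.gradientMetric φ ψ ψ
  -- The inequality `(a + b)² ≤ 2a² + 2b²` with `b = √G / 2`, for which `2b² = G / 2`.
  have h1 : (√C + √G / 2) ^ 2 ≤ 2 * C + 1 / 2 * G := by
    nlinarith [Real.sq_sqrt hC, Real.sq_sqrt hG, sq_nonneg (√C - √G / 2)]
  have h2 : 1 ≤ (volRatio n)⁻¹ := (one_le_inv₀ (S.volRatio_pos x0)).2 volRatio_le_one
  exact h1.trans (le_mul_of_one_le_left (by positivity) h2)

end Integrals

/-! ### Velocities and lengths of curves of potentials. -/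

section Curves

variable [CompactSpace M] [MeasurableSpace M] [BorelSpace M] {p q : S.Potential} (γ : S.Curve p q)

lemma Curve.locSmooth : LocSmooth n γ.toFun := LocSmooth.of_contMDiff_prod γ.smooth

lemma Curve.isBasic {t : ℝ} (ht : t ∈ Set.Icc (0 : ℝ) 1) : S.IsBasic (γ.toFun t) := (γ.mem t ht).1.1

lemma Curve.posAt [ConnectedSpace M] {t : ℝ} (ht : t ∈ Set.Icc (0 : ℝ) 1) (x : M) :
    S.PosAt (γ.toFun t) x := (γ.mem t ht).1.posAt x

lemma Curve.locSmooth_velocity : LocSmooth n γ.velocity := γ.locSmooth.deriv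

/-- The open interval is needed because the curve consists of basic functions only for parameters in
`[0, 1]`, while the two-sided derivative uses a neighbourhood. -/
lemma Curve.isBasic_velocity {t : ℝ} (ht : t ∈ Set.Ioo (0 : ℝ) 1) : S.IsBasic (γ.velocity t) := by
  refine ⟨γ.locSmooth_velocity.slice t, fun x => ?_⟩
  have h := (γ.locSmooth.hasDerivAt_diffE t x).clm_apply (hasDerivAt_const t (S.xiE x))
  have h0 : (fun s => diffE n (γ.toFun s) x (S.xiE x)) =ᶠ[𝓝 t] fun _ => 0 := by
    filter_upwards [Icc_mem_nhds ht.1 ht.2] with s hs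
    exact (γ.isBasic hs).diffE_xiE x
  have h1 := h.unique ((hasDerivAt_const t (0 : ℝ)).congr_of_eventuallyEq h0)
  simp only [map_zero, add_zero] at h1
  exact h1

/-- Since the transverse form ignores `ξ`, the tensor `Φ_φ` in `g_φ` can be replaced by the fixed
`Φ` before differentiating. -/
lemma Curve.metricVelocity_eq {t : ℝ} (ht : t ∈ Set.Ioo (0 : ℝ) 1) (x : M) (v w : Model n) :
    γ.metricVelocity t x v w = extDE (S.dc (γ.velocity t)) x v (S.PhiE x w) +
      (S.etaDE (γ.toFun t) x v * S.dcE (γ.velocity t) x w +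
        S.dcE (γ.velocity t) x v * S.etaDE (γ.toFun t) x w) := by
  have h1 := S.hasDerivAt_kahler γ.locSmooth t x v (S.PhiE x w)
  have h2 := (S.hasDerivAt_etaDE γ.locSmooth t x v).mul (S.hasDerivAt_etaDE γ.locSmooth t x w)
  have h0 : (fun s => S.gDef (γ.toFun s) x v w) =ᶠ[𝓝 t] fun s =>
      S.kahler (γ.toFun s) x v (S.PhiE x w) +
        S.etaDE (γ.toFun s) x v * S.etaDE (γ.toFun s) x w := by
    filter_upwards [Icc_mem_nhds ht.1 ht.2] with s hs
    refine (S.gDef_eq _ x v w).trans ?_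
    rw [metricE, contactMetric_apply, bil_apply]
    change S.kahler _ x v (S.JE _ x w) + _ = _
    rw [(γ.isBasic hs).kahler_JE]
    rfl
  refine (((h1.add h2).congr_of_eventuallyEq h0).deriv).trans ?_
  rw [add_comm (S.etaDE (γ.toFun t) x v * _)]
  rfl

lemma setLIntegral_Icc_eq_Ioo (f : ℝ → ℝ≥0∞) :
    ∫⁻ t in Set.Icc (0 : ℝ) 1, f t = ∫⁻ t in Set.Ioo (0 : ℝ) 1, f t :=
  setLIntegral_congr Ioo_ae_eq_Icc.symm

lemma Curve.calabiLength_add_le [ConnectedSpace M] :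
    γ.calabiLength + γ.gradientLength / 2 ≤ γ.ebinLength := by
  rw [calabiLength, gradientLength, ebinLength, setLIntegral_Icc_eq_Ioo, setLIntegral_Icc_eq_Ioo,
    setLIntegral_Icc_eq_Ioo, ENNReal.div_eq_inv_mul, ← lintegral_const_mul' _ _ (by simp)]
  refine (le_lintegral_add _ _).trans (setLIntegral_mono_ae' measurableSet_Ioo (ae_of_all _ ?_))
  intro t ht
  have hI := Set.Ioo_subset_Icc_self ht
  have h := sqrt_calabi_add_le (γ.isBasic hI) (γ.isBasic_velocity ht) (γ.posAt hI)
    (γ.metricVelocity t) (γ.metricVelocity_eq ht)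
  refine le_trans (le_of_eq ?_) (ENNReal.ofReal_le_ofReal h)
  rw [ENNReal.ofReal_add (Real.sqrt_nonneg _) (by positivity), div_eq_inv_mul,
    ENNReal.ofReal_mul (by norm_num), ENNReal.ofReal_inv_of_pos (by norm_num)]
  simp

lemma calabiDist_add_le [ConnectedSpace M] (p q : S.Potential) :
    calabiDist p q + gradientDist p q / 2 ≤ ebinDist p q :=
  le_iInf fun γ => (add_le_add (iInf_le _ γ) (ENNReal.div_le_div_right (iInf_le _ γ) 2)).trans
    γ.calabiLength_add_le

end Curves
end SasakianStructure
end Sasaki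

end

section

/-! ### Finite length, reversal and concatenation of curves: the distance is a pseudometric. -/

namespace Sasaki
namespace SasakianStructure

open MeasureTheory

variable {n : ℕ} {M : Type*} [TopologicalSpace M] [ChartedSpace (Model n) M]
  [IsManifold (𝓡 (2 * n + 1)) ∞ M] {S : SasakianStructure n M} [T2Space M] [CompactSpace M]
  [MeasurableSpace M] [BorelSpace M]

variable (S) in
/-- The square of the Ebin speed of a family of potentials, written with the densities of the
volume forms. -/
def energy (F : ℝ → M → ℝ) (t : ℝ) : ℝ :=
  (volRatio n)⁻¹ * (2 * ∫ x, deriv (fun s => S.rho (F s) x) t ^ 2 / S.rho (F t) x ∂S.baseVol -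
    ∫ x, deriv (fun s => F s x) t * deriv (fun s => S.rho (F s) x) t ∂S.baseVol)

variable (S) in
/-- The length of a family of potentials over a set of parameters. -/
def lengthOn (F : ℝ → M → ℝ) (s : Set ℝ) : ℝ≥0∞ := ∫⁻ t in s, ENNReal.ofReal √(S.energy F t)

lemma energy_congr {F G : ℝ → M → ℝ} {t : ℝ} (h : F =ᶠ[𝓝 t] G) : S.energy F t = S.energy G t := by
  have h1 : ∀ x, deriv (fun s => S.rho (F s) x) t = deriv (fun s => S.rho (G s) x) t := fun x =>
    Filter.EventuallyEq.deriv_eq (h.mono fun s hs => by simp only [hs])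
  have h2 : ∀ x, deriv (fun s => F s x) t = deriv (fun s => G s x) t := fun x =>
    Filter.EventuallyEq.deriv_eq (h.mono fun s hs => by simp only [hs])
  simp only [energy, h1, h2, h.self_of_nhds]

lemma energy_const (φ : M → ℝ) (t : ℝ) : S.energy (fun _ => φ) t = 0 := by
  simp [energy]

lemma energy_comp {F : ℝ → M → ℝ} (hF : LocSmooth n F) {u : ℝ → ℝ} {u' t : ℝ}
    (hu : HasDerivAt u u' t) : S.energy (fun s => F (u s)) t = u' ^ 2 * S.energy F (u t) := by
  have h1 : ∀ x, deriv (fun s => S.rho (F (u s)) x) t = u' * deriv (fun s => S.rho (F s) x) (u t) :=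
    fun x => by
      rw [mul_comm]
      exact (((hF.rho S).hasDerivAt (u t) x).comp t hu).deriv
  have h2 : ∀ x, deriv (fun s => F (u s) x) t = u' * deriv (fun s => F s x) (u t) := fun x => by
    rw [mul_comm]
    exact ((hF.hasDerivAt (u t) x).comp t hu).deriv
  have h3 : ∀ a b : ℝ, (u' * a) ^ 2 / b = u' ^ 2 * (a ^ 2 / b) := fun a b => by ring
  have h4 : ∀ a b : ℝ, u' * a * (u' * b) = u' ^ 2 * (a * b) := fun a b => by ring
  simp only [energy, h1, h2, h3, h4, integral_const_mul]
  ring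

/-- The change of variables formula for monotone maps, which need not be injective; only an
inequality results because `u` may miss part of `T`. -/
lemma lengthOn_comp_le_of_monotoneOn {F : ℝ → M → ℝ} (hF : LocSmooth n F) {u u' : ℝ → ℝ}
    (hu : ∀ t, HasDerivAt u (u' t) t) (hu' : ∀ t, 0 ≤ u' t) {s T : Set ℝ} (hs : MeasurableSet s)
    (hm : MonotoneOn u s) (hT : Set.MapsTo u s T) :
    S.lengthOn (fun t => F (u t)) s ≤ S.lengthOn F T := by
  have h := lintegral_image_eq_lintegral_deriv_mul_of_monotoneOn hs
    (fun x _ => (hu x).hasDerivWithinAt) hm fun t => ENNReal.ofReal √(S.energy F t)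
  rw [lengthOn, lengthOn]
  refine le_trans (le_of_eq ?_) (lintegral_mono_set (Set.image_subset_iff.2 hT))
  rw [h]
  refine lintegral_congr fun t => ?_
  rw [energy_comp hF (hu t), Real.sqrt_mul (sq_nonneg _), Real.sqrt_sq (hu' t),
    ENNReal.ofReal_mul (hu' t)]

lemma lengthOn_comp_le_of_antitoneOn {F : ℝ → M → ℝ} (hF : LocSmooth n F) {u u' : ℝ → ℝ}
    (hu : ∀ t, HasDerivAt u (u' t) t) (hu' : ∀ t, u' t ≤ 0) {s T : Set ℝ} (hs : MeasurableSet s)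
    (hm : AntitoneOn u s) (hT : Set.MapsTo u s T) :
    S.lengthOn (fun t => F (u t)) s ≤ S.lengthOn F T := by
  have h := lintegral_image_eq_lintegral_deriv_mul_of_antitoneOn hs
    (fun x _ => (hu x).hasDerivWithinAt) hm fun t => ENNReal.ofReal √(S.energy F t)
  rw [lengthOn, lengthOn]
  refine le_trans (le_of_eq ?_) (lintegral_mono_set (Set.image_subset_iff.2 hT))
  rw [h]
  refine lintegral_congr fun t => ?_
  rw [energy_comp hF (hu t), Real.sqrt_mul (sq_nonneg _), Real.sqrt_sq_eq_abs, abs_of_nonpos (hu' t),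
    ENNReal.ofReal_mul (neg_nonneg.2 (hu' t))]

lemma integral_sq_div_sub_le {X : Type*} [MeasurableSpace X] {μ : Measure X} [IsFiniteMeasure μ]
    {f g h : X → ℝ} {A B δ : ℝ} (hδ : 0 < δ) (hB : 0 ≤ B) (hf : ∀ x, |f x| ≤ A)
    (hg : ∀ x, |g x| ≤ B) (hh : ∀ x, δ ≤ h x) :
    2 * ∫ x, f x ^ 2 / h x ∂μ - ∫ x, g x * f x ∂μ ≤
      2 * (A ^ 2 / δ * μ.real Set.univ) + B * A * μ.real Set.univ := by
  have h4 := norm_integral_le_of_norm_le_const (μ := μ) (f := fun x => f x ^ 2 / h x)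
    (C := A ^ 2 / δ) (ae_of_all _ fun x => by
      rw [Real.norm_eq_abs, abs_div, abs_pow, abs_of_pos (hδ.trans_le (hh x))]
      gcongr
      exacts [hf x, hh x])
  have h5 := norm_integral_le_of_norm_le_const (μ := μ) (f := fun x => g x * f x) (C := B * A)
    (ae_of_all _ fun x => by
      rw [Real.norm_eq_abs, abs_mul]
      exact mul_le_mul (hg x) (hf x) (abs_nonneg _) hB)
  rw [Real.norm_eq_abs] at h4 h5
  linarith [le_abs_self (∫ x, f x ^ 2 / h x ∂μ), neg_abs_le (∫ x, g x * f x ∂μ)]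

lemma exists_pos_le_of_locSmooth [Nonempty M] {R : ℝ → M → ℝ} (hR : LocSmooth n R)
    (hpos : ∀ t ∈ Set.Icc (0 : ℝ) 1, ∀ x, 0 < R t x) :
    ∃ δ, 0 < δ ∧ ∀ t ∈ Set.Icc (0 : ℝ) 1, ∀ x, δ ≤ R t x := by
  obtain ⟨x0⟩ := ‹Nonempty M›
  obtain ⟨⟨t0, z0⟩, hz0, hmin⟩ := ((isCompact_Icc (a := (0 : ℝ)) (b := 1)).prod
    (isCompact_univ (X := M))).exists_isMinOn ⟨(0, x0), by simp⟩ hR.continuous.continuousOn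
  exact ⟨R t0 z0, hpos t0 hz0.1 z0, fun t ht x => hmin (Set.mk_mem_prod ht (Set.mem_univ x))⟩

lemma exists_energy_le {F : ℝ → M → ℝ} (hF : LocSmooth n F)
    (hpos : ∀ t ∈ Set.Icc (0 : ℝ) 1, ∀ x, 0 < S.rho (F t) x) [Nonempty M] :
    ∃ C, ∀ t ∈ Set.Icc (0 : ℝ) 1, S.energy F t ≤ C := by
  obtain ⟨C1, -, h1⟩ := (hF.rho S).deriv.exists_bound 0 1
  obtain ⟨C2, hC2, h2⟩ := hF.deriv.exists_bound 0 1
  obtain ⟨δ, hδ, h3⟩ := exists_pos_le_of_locSmooth (hF.rho S) hpos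
  obtain ⟨x0⟩ := ‹Nonempty M›
  exact ⟨_, fun t ht => mul_le_mul_of_nonneg_left
    (integral_sq_div_sub_le hδ hC2 (h1 t ht) (h2 t ht) (h3 t ht)) (inv_nonneg.2 (S.volRatio_pos x0).le)⟩

variable [ConnectedSpace M] {p q r : S.Potential}

lemma Curve.deriv_rho (γ : S.Curve p q) {t : ℝ} (ht : t ∈ Set.Icc (0 : ℝ) 1) (x : M) :
    deriv (fun s => S.rho (γ.toFun s) x) t = S.linForm (γ.toFun t) (S.dc (γ.velocity t)) x :=
  (S.hasDerivAt_rho γ.locSmooth (γ.isBasic ht) x).deriv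

/-- The energy involves only parameter derivatives of the functions and of their volume densities,
so it is transparent under reparametrization and bounded by compactness. -/
lemma Curve.ebinLength_eq (γ : S.Curve p q) : γ.ebinLength = S.lengthOn γ.toFun (Set.Icc 0 1) := by
  rw [ebinLength, lengthOn, setLIntegral_Icc_eq_Ioo, setLIntegral_Icc_eq_Ioo]
  refine setLIntegral_congr_fun measurableSet_Ioo fun t ht => ?_
  have hI := Set.Ioo_subset_Icc_self ht
  rw [ebin_eq (γ.isBasic hI) (γ.isBasic_velocity ht) (γ.posAt hI) (γ.metricVelocity t)
    (γ.metricVelocity_eq ht), calabi_eq_linForm (γ.isBasic hI) (γ.isBasic_velocity ht) (γ.posAt hI),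
    gradient_eq_linForm (γ.isBasic hI) (γ.isBasic_velocity ht) (γ.posAt hI), energy]
  simp only [γ.deriv_rho hI]
  congr 3
  change _ = _ - ∫ x, γ.velocity t x * _ ∂_
  ring

lemma Curve.ebinLength_ne_top (γ : S.Curve p q) : γ.ebinLength ≠ ⊤ := by
  obtain ⟨C, hC⟩ := exists_energy_le (S := S) γ.locSmooth fun t ht x =>
    (γ.posAt ht x).rho_pos (γ.isBasic ht)
  rw [γ.ebinLength_eq, lengthOn]
  refine ((setLIntegral_mono_ae' measurableSet_Icc (g := fun _ => ENNReal.ofReal √C)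
    (ae_of_all _ fun t ht => ENNReal.ofReal_le_ofReal (Real.sqrt_le_sqrt (hC t ht)))).trans_lt ?_).ne
  simp

variable (p) in
/-- The constant curve. -/
def Curve.refl : S.Curve p p where
  toFun _ := p.1
  smooth := (LocSmooth.of_contMDiff p.2.1.1.1).to_contMDiff_prod
  mem _ _ := p.2
  start := rfl
  finish := rfl

/-- The reversed curve. -/
def Curve.symm (γ : S.Curve p q) : S.Curve q p where
  toFun t := γ.toFun (1 - t)
  smooth := (γ.locSmooth.comp_param (contDiff_const.sub contDiff_id)).to_contMDiff_prod
  mem t ht := γ.mem (1 - t) ⟨by linarith [ht.2], by linarith [ht.1]⟩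
  start := by rw [sub_zero, γ.finish]
  finish := by rw [sub_self, γ.start]

lemma ebinDist_self (p : S.Potential) : ebinDist p p = 0 := by
  refine le_antisymm ((iInf_le _ (Curve.refl p)).trans (le_of_eq ?_)) (zero_le)
  rw [Curve.ebinLength_eq, lengthOn]
  simp [Curve.refl, energy_const]

lemma ebinDist_comm_le (p q : S.Potential) : ebinDist p q ≤ ebinDist q p := by
  refine le_iInf fun γ => (iInf_le _ γ.symm).trans ?_
  rw [γ.ebinLength_eq, γ.symm.ebinLength_eq]
  refine lengthOn_comp_le_of_antitoneOn γ.locSmooth (u := fun t => 1 - t) (u' := fun _ => -1)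
    (fun t => (hasDerivAt_id t).const_sub 1) (fun _ => by norm_num) measurableSet_Icc
    (fun a _ b _ hab => sub_le_sub_left hab 1) fun t ht => ⟨by linarith [ht.2], by linarith [ht.1]⟩

lemma hasDerivAt_smoothTransition (t : ℝ) :
    HasDerivAt Real.smoothTransition (deriv Real.smoothTransition t) t :=
  ((Real.smoothTransition.contDiff (n := 1)).differentiable (by simp) t).hasDerivAt

lemma deriv_smoothTransition_nonneg (t : ℝ) : 0 ≤ deriv Real.smoothTransition t :=
  Real.smoothTransition.monotone.deriv_nonneg

/-- The concatenation of two curves, smoothed at the common end point. -/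
def transFun (γ : S.Curve p q) (γ' : S.Curve q r) (t : ℝ) (x : M) : ℝ :=
  -- For `t ≤ 2/3` the second term equals `q`, for `t ≥ 1/3` the first one does. Subtracting `q`
  -- leaves a single smooth formula that needs no gluing.
  γ.toFun (Real.smoothTransition (3 * t)) x + γ'.toFun (Real.smoothTransition (3 * t - 2)) x +
    -q.1 x

lemma transFun_left (γ : S.Curve p q) (γ' : S.Curve q r) {t : ℝ} (ht : t ≤ 2 / 3) :
    transFun γ γ' t = γ.toFun (Real.smoothTransition (3 * t)) := by
  funext x
  rw [transFun, Real.smoothTransition.zero_of_nonpos (x := 3 * t - 2) (by linarith), γ'.start]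
  ring

lemma transFun_right (γ : S.Curve p q) (γ' : S.Curve q r) {t : ℝ} (ht : 1 / 3 ≤ t) :
    transFun γ γ' t = γ'.toFun (Real.smoothTransition (3 * t - 2)) := by
  funext x
  rw [transFun, Real.smoothTransition.one_of_one_le (x := 3 * t) (by linarith), γ.finish]
  ring

/-- The concatenation of two curves. -/
def Curve.trans (γ : S.Curve p q) (γ' : S.Curve q r) : S.Curve p r where
  toFun := transFun γ γ'
  smooth := (((γ.locSmooth.comp_param (Real.smoothTransition.contDiff.comp
    (contDiff_const.mul contDiff_id))).add (γ'.locSmooth.comp_param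
      (Real.smoothTransition.contDiff.comp ((contDiff_const.mul contDiff_id).sub
        contDiff_const)))).add (LocSmooth.of_contMDiff q.2.1.1.1).neg).to_contMDiff_prod
  mem t _ := by
    rcases le_total t (2 / 3) with h | h
    · rw [transFun_left γ γ' h]
      exact γ.mem _ ⟨Real.smoothTransition.nonneg _, Real.smoothTransition.le_one _⟩
    · rw [transFun_right γ γ' (by linarith)]
      exact γ'.mem _ ⟨Real.smoothTransition.nonneg _, Real.smoothTransition.le_one _⟩
  start := by
    rw [transFun_left γ γ' (by norm_num), Real.smoothTransition.zero_of_nonpos (by norm_num), γ.start]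
  finish := by
    rw [transFun_right γ γ' (by norm_num), Real.smoothTransition.one_of_one_le (by norm_num),
      γ'.finish]

lemma Curve.ebinLength_trans_le (γ : S.Curve p q) (γ' : S.Curve q r) :
    (γ.trans γ').ebinLength ≤ γ.ebinLength + γ'.ebinLength := by
  rw [ebinLength_eq, ebinLength_eq, ebinLength_eq]
  -- Two overlapping open sets, because the energy depends on the germ of the family in the
  -- parameter; on the overlap the curve rests at `q`.
  have h : Set.Icc (0 : ℝ) 1 ⊆ Set.Iio (2 / 3) ∪ Set.Ioi (1 / 3) := fun t _ => by
    rcases lt_or_ge t (2 / 3) with h | h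
    · exact Or.inl h
    · exact Or.inr (show 1 / 3 < t by linarith)
  refine (lintegral_mono_set h).trans ((lintegral_union_le _ _ _).trans (add_le_add ?_ ?_))
  · refine (le_of_eq ?_).trans (lengthOn_comp_le_of_monotoneOn (S := S) γ.locSmooth
      (u := fun t => Real.smoothTransition (3 * t)) (s := Set.Iio (2 / 3))
      (u' := fun t => deriv Real.smoothTransition (3 * t) * 3)
      (fun t => (hasDerivAt_smoothTransition (3 * t)).comp t
        (by simpa using (hasDerivAt_id t).const_mul 3))
      (fun t => mul_nonneg (deriv_smoothTransition_nonneg _) (by norm_num)) measurableSet_Iio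
      (fun a _ b _ hab => Real.smoothTransition.monotone (by linarith))
      fun t _ => ⟨Real.smoothTransition.nonneg _, Real.smoothTransition.le_one _⟩)
    refine setLIntegral_congr_fun measurableSet_Iio fun t ht => ?_
    have : (γ.trans γ').toFun =ᶠ[𝓝 t] fun t => γ.toFun (Real.smoothTransition (3 * t)) := by
      filter_upwards [Iio_mem_nhds ht] with s hs
      exact transFun_left γ γ' (le_of_lt hs)
    simp only [energy_congr this]
  · refine (le_of_eq ?_).trans (lengthOn_comp_le_of_monotoneOn (S := S) γ'.locSmooth
      (u := fun t => Real.smoothTransition (3 * t - 2)) (s := Set.Ioi (1 / 3))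
      (u' := fun t => deriv Real.smoothTransition (3 * t - 2) * 3)
      (fun t => HasDerivAt.comp (h := fun t => 3 * t - 2) t (hasDerivAt_smoothTransition (3 * t - 2))
        (by simpa using ((hasDerivAt_id t).const_mul 3).sub_const 2))
      (fun t => mul_nonneg (deriv_smoothTransition_nonneg _) (by norm_num)) measurableSet_Ioi
      (fun a _ b _ hab => Real.smoothTransition.monotone (by linarith))
      fun t _ => ⟨Real.smoothTransition.nonneg _, Real.smoothTransition.le_one _⟩)
    refine setLIntegral_congr_fun measurableSet_Ioi fun t ht => ?_
    have : (γ.trans γ').toFun =ᶠ[𝓝 t] fun t => γ'.toFun (Real.smoothTransition (3 * t - 2)) := by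
      filter_upwards [Ioi_mem_nhds ht] with s hs
      exact transFun_right γ γ' (le_of_lt hs)
    simp only [energy_congr this]

lemma ebinDist_triangle (p q r : S.Potential) : ebinDist p r ≤ ebinDist p q + ebinDist q r :=
  ENNReal.le_iInf_add_iInf fun γ γ' => (iInf_le _ (γ.trans γ')).trans (γ.ebinLength_trans_le γ')

end SasakianStructure
end Sasaki

end

section

/-! ### The normalized segment and finiteness of the distance. -/

namespace Sasaki
namespace SasakianStructure

open MeasureTheory

variable {n : ℕ} {M : Type*} [TopologicalSpace M] [ChartedSpace (Model n) M]
  [IsManifold (𝓡 (2 * n + 1)) ∞ M] {S : SasakianStructure n M} {φ ψ : M → ℝ}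

section Constants

lemma diffE_add_const (hφ : ContMDiff (𝓡 (2 * n + 1)) 𝓘(ℝ, ℝ) ∞ φ) (c : ℝ) (x : M) :
    diffE n (fun z => φ z + c) x = diffE n φ x := by
  have h := diffE_add_smul hφ (contMDiff_const (c := (1 : ℝ))) c x
  have h0 : diffE n (fun _ : M => (1 : ℝ)) x = 0 := mfderiv_const
  rw [h0, smul_zero, add_zero] at h
  simpa using h

lemma dc_add_const (hφ : ContMDiff (𝓡 (2 * n + 1)) 𝓘(ℝ, ℝ) ∞ φ) (c : ℝ) :
    S.dc (fun z => φ z + c) = S.dc φ :=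
  funext fun x => congrArg (fun u : Model n →L[ℝ] ℝ => (-(1 / 2 : ℝ)) • u.comp (S.PhiE x))
    (diffE_add_const hφ c x)

lemma kahler_add_const (hφ : ContMDiff (𝓡 (2 * n + 1)) 𝓘(ℝ, ℝ) ∞ φ) (c : ℝ) (x : M) :
    S.kahler (fun z => φ z + c) x = S.kahler φ x := by
  have h : S.etaDef (fun z => φ z + c) = S.etaDef φ := funext fun x => by
    rw [etaDef, etaDef, dc_add_const hφ]
  rw [kahler, kahler, h]

lemma rho_add_const (hφ : ContMDiff (𝓡 (2 * n + 1)) 𝓘(ℝ, ℝ) ∞ φ) (c : ℝ) (x : M) :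
    S.rho (fun z => φ z + c) x = S.rho φ x := by
  have h : S.etaDE (fun z => φ z + c) x = S.etaDE φ x := by
    rw [etaDE, etaDE, dcE, dcE, dc_add_const hφ]
  simp only [rho, topForm, h, kahler_add_const hφ c]

lemma PosAt.add_const {x : M} (h : S.PosAt φ x) (hφ : S.IsBasic φ) (c : ℝ) :
    S.PosAt (fun z => φ z + c) x :=
  fun v hv => by rw [kahler_add_const hφ.1]; exact h v hv

lemma IsBasic.add_const (hφ : S.IsBasic φ) (c : ℝ) : S.IsBasic (fun z => φ z + c) :=
  ⟨hφ.1.add contMDiff_const, fun x =>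
    (congrArg (fun u : Model n →L[ℝ] ℝ => u (S.xiE x)) (diffE_add_const hφ.1 c x)).trans (hφ.2 x)⟩

lemma IsBasic.const_mul (hφ : S.IsBasic φ) (c : ℝ) : S.IsBasic (fun z => c * φ z) := by
  simpa using S.isBasic_zero.add_smul hφ c

end Constants

variable [T2Space M]

lemma PosAt.const_mul {x : M} (h : S.PosAt φ x) (hφ : S.IsBasic φ) {t : ℝ}
    (ht : t ∈ Set.Icc (0 : ℝ) 1) : S.PosAt (fun z => t * φ z) x := by
  have := PosAt.add_smul S.isBasic_zero hφ (S.posAt_zero x) (by simpa using h) ht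
  simpa using this

lemma locSmooth_const_mul (hφ : S.IsBasic φ) : LocSmooth n fun t x => t * φ x :=
  (LocSmooth.of_param contDiff_id).mul (LocSmooth.of_contMDiff hφ.1)

variable [CompactSpace M] [MeasurableSpace M] [BorelSpace M]

/-- The derivative of the total volume along `s φ` vanishes by Stokes for all `s`, so the value at
`s = 1` is that at `s = 0`. -/
lemma integral_rho (hφ : S.IsBasic φ) : ∫ x, S.rho φ x ∂S.baseVol = S.baseVol.real Set.univ := by
  have h1 := fun s => (((locSmooth_line S.isBasic_zero hφ).rho S).hasDerivAt_integral
    (μ := S.baseVol) s)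
  have h2 : ∀ s, ∫ x, deriv (fun s => S.rho (fun z => 0 + s * φ z) x) s ∂S.baseVol = 0 := fun s => by
    refine (integral_congr_ae (ae_of_all _ fun x => ?_)).trans
      (S.integral_linForm (S.isBasic_zero.add_smul hφ s) hφ.1)
    exact (hasDerivAt_rho_line S.isBasic_zero hφ s x).deriv
  have h3 := is_const_of_deriv_eq_zero (fun s => (h1 s).differentiableAt)
    (fun s => (h1 s).deriv.trans (h2 s)) 1 0
  simpa [S.rho_zero] using h3

lemma functionalI_eq (hφ : S.IsBasic φ) (hpos : ∀ x, S.PosAt φ x) : S.functionalI φ =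
    ∫ t in (0 : ℝ)..1, ∫ x, S.rho (fun z => t * φ z) x * φ x ∂S.baseVol := by
  refine intervalIntegral.integral_congr fun t ht => ?_
  rw [Set.uIcc_of_le zero_le_one] at ht
  exact S.integral_vol (hφ.const_mul t).1
    (fun x => (((hpos x).const_mul hφ ht).rho_pos (hφ.const_mul t)).le) φ

lemma locSmooth_rho_mul (hφ : S.IsBasic φ) :
    LocSmooth n fun t x => S.rho (fun z => t * φ z) x * φ x :=
  ((locSmooth_const_mul hφ).rho S).mul (LocSmooth.of_contMDiff hφ.1)

/-- Densities do not see constants and have constant total mass, so `I` is shifted by the constant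
times the volume. Hence every potential can be normalized by a constant, and by only one. -/
lemma functionalI_add_const (hφ : S.IsBasic φ) (hpos : ∀ x, S.PosAt φ x) (c : ℝ) :
    S.functionalI (fun z => φ z + c) = S.functionalI φ + c * S.baseVol.real Set.univ := by
  rw [functionalI_eq (hφ.add_const c) fun x => (hpos x).add_const hφ c, functionalI_eq hφ hpos]
  have h : ∀ t : ℝ, ∫ x, S.rho (fun z => t * (φ z + c)) x * (φ x + c) ∂S.baseVol =
      (∫ x, S.rho (fun z => t * φ z) x * φ x ∂S.baseVol) + c * S.baseVol.real Set.univ := fun t => by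
    simp only [mul_add, rho_add_const (hφ.const_mul t).1]
    have h1 : Integrable (fun x => S.rho (fun z => t * φ z) x * φ x) S.baseVol :=
      integrable_of_continuous ((locSmooth_rho_mul hφ).continuous_slice t)
    have h2 : Integrable (fun x => S.rho (fun z => t * φ z) x * c) S.baseVol :=
      integrable_of_continuous ((S.continuous_rho (hφ.const_mul t).1).mul continuous_const)
    rw [integral_add h1 h2, integral_mul_const, integral_rho (hφ.const_mul t), mul_comm c]
  simp only [h]
  rw [intervalIntegral.integral_add
    ((locSmooth_rho_mul hφ).continuous_integral.intervalIntegrable 0 1) (by simp)]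
  simp

section Segment

/-- The functional `I` along the line through `φ` in the direction `ψ`. -/
def segmentI (S : SasakianStructure n M) (φ ψ : M → ℝ) (σ : ℝ) : ℝ :=
  ∫ t in (0 : ℝ)..1, ∫ x, S.rho (fun z => t * (φ z + σ * ψ z)) x * (φ x + σ * ψ x) ∂S.baseVol

open Polynomial in
lemma eval_eq_sum_basis (P : ℝ[X]) {m : ℕ} (hP : P.degree < m) (σ : ℝ) : P.eval σ =
    ∑ i ∈ Finset.range m, P.eval (i : ℝ) *
      (Lagrange.basis (Finset.range m) (fun i : ℕ => (i : ℝ)) i).eval σ := by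
  have h := Lagrange.eq_interpolate (s := Finset.range m) (v := fun i : ℕ => (i : ℝ)) (f := P)
    (fun a _ b _ hab => Nat.cast_injective hab) (by simpa using hP)
  conv_lhs => rw [h, Lagrange.interpolate_apply]
  simp [eval_finsetSum]

open Polynomial in
lemma exists_polynomial_rho_mul (hφ : S.IsBasic φ) (hψ : S.IsBasic ψ) {x : M} (h : S.PosAt φ x)
    {t : ℝ} (ht : t ∈ Set.Icc (0 : ℝ) 1) : ∃ P : ℝ[X], P.degree < (n + 2 : ℕ) ∧
      ∀ σ : ℝ, S.rho (fun z => t * (φ z + σ * ψ z)) x * (φ x + σ * ψ x) = P.eval σ := by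
  obtain ⟨b, c, hb⟩ := (h.const_mul hφ ht).exists_adapted (hφ.const_mul t) hψ
  refine ⟨C (S.rho (fun z => t * φ z) x) * (∏ k, (C (t * c k) * X + C 1)) *
    (C (ψ x) * X + C (φ x)), ?_, fun σ => ?_⟩
  · refine degree_le_natDegree.trans_lt ?_
    -- The density contributes degree `n`, one for each eigenvalue, and the affine factor `φ + σψ`
    -- one more.
    refine Nat.cast_lt.2 (Nat.lt_succ_of_le ?_)
    refine natDegree_mul_le.trans (add_le_add (natDegree_C_mul_le _ _ |>.trans
      ((natDegree_prod_le _ _).trans ?_)) natDegree_linear_le)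
    refine (Finset.sum_le_sum fun k _ => natDegree_linear_le).trans (by simp)
  · have h1 : (fun z => t * (φ z + σ * ψ z)) = fun z => t * φ z + (t * σ) * ψ z :=
      funext fun z => by ring
    rw [h1, (hφ.const_mul t).rho_add_smul hψ hb]
    simp only [eval_mul, eval_C, eval_prod, eval_add, eval_X]
    congr 1
    · congr 1
      exact Finset.prod_congr rfl fun k _ => by ring
    · ring

/-- For fixed `t` and `x` the integrand is a polynomial in `σ` of degree at most `n + 1`.
Interpolation at the nodes `0, ..., n + 1` expresses it by values at fixed `σ`, which integrate
linearly; smoothness in `σ` then needs no control of the coefficients. -/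
lemma segmentI_eq (hφ : S.IsBasic φ) (hψ : S.IsBasic ψ) (hpos : ∀ x, S.PosAt φ x) (σ : ℝ) :
    S.segmentI φ ψ σ = ∑ i ∈ Finset.range (n + 2), S.segmentI φ ψ (i : ℝ) *
      (Lagrange.basis (Finset.range (n + 2)) (fun i : ℕ => (i : ℝ)) i).eval σ := by
  set L := fun i : ℕ => (Lagrange.basis (Finset.range (n + 2)) (fun i : ℕ => (i : ℝ)) i).eval σ
  have h0 : ∀ i : ℕ, LocSmooth n fun t x => S.rho (fun z => t * (φ z + i * ψ z)) x *
      (φ x + i * ψ x) := fun i => locSmooth_rho_mul (hφ.add_smul hψ i)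
  have h1 : ∀ t ∈ Set.Icc (0 : ℝ) 1, ∫ x, S.rho (fun z => t * (φ z + σ * ψ z)) x *
      (φ x + σ * ψ x) ∂S.baseVol = ∑ i ∈ Finset.range (n + 2),
        (∫ x, S.rho (fun z => t * (φ z + i * ψ z)) x * (φ x + i * ψ x) ∂S.baseVol) * L i := by
    intro t ht
    simp only [← integral_mul_const]
    rw [← integral_finsetSum]
    · refine integral_congr_ae (ae_of_all _ fun x => ?_)
      obtain ⟨P, hP, hP'⟩ := exists_polynomial_rho_mul hφ hψ (hpos x) ht
      simp only [hP']
      exact eval_eq_sum_basis P hP σ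
    · exact fun i _ => (integrable_of_continuous ((h0 i).continuous_slice t)).mul_const _
  have h2 : S.segmentI φ ψ σ = ∫ t in (0 : ℝ)..1, ∑ i ∈ Finset.range (n + 2),
        (∫ x, S.rho (fun z => t * (φ z + i * ψ z)) x * (φ x + i * ψ x) ∂S.baseVol) * L i :=
    intervalIntegral.integral_congr fun t ht => h1 t (by rwa [Set.uIcc_of_le zero_le_one] at ht)
  rw [h2, intervalIntegral.integral_finsetSum fun i _ =>
    (((h0 i).continuous_integral).intervalIntegrable 0 1).mul_const _]
  simp only [intervalIntegral.integral_mul_const]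
  rfl

lemma contDiff_segmentI (hφ : S.IsBasic φ) (hψ : S.IsBasic ψ) (hpos : ∀ x, S.PosAt φ x) :
    ContDiff ℝ ∞ (S.segmentI φ ψ) := by
  have h : S.segmentI φ ψ = fun σ => ∑ i ∈ Finset.range (n + 2), S.segmentI φ ψ (i : ℝ) *
      (Lagrange.basis (Finset.range (n + 2)) (fun i : ℕ => (i : ℝ)) i).eval σ :=
    funext (segmentI_eq hφ hψ hpos)
  rw [h]
  exact ContDiff.sum fun i _ => contDiff_const.mul (Polynomial.contDiff_aeval _ _)

end Segment

section Existence

variable [ConnectedSpace M] (p q : S.Potential)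

lemma Potential.isBasic : S.IsBasic p.1 := p.2.1.1

lemma Potential.posAt (x : M) : S.PosAt p.1 x := p.2.1.posAt x

lemma baseVol_real_pos : 0 < S.baseVol.real Set.univ := measureReal_univ_pos

lemma Potential.isBasic_sub : S.IsBasic fun z => q.1 z - p.1 z := by
  simpa [sub_eq_add_neg] using (q.isBasic.add_smul p.isBasic (-1))

variable {p q} in
lemma Potential.posAt_segment {σ : ℝ} (hσ : σ ∈ Set.Icc (0 : ℝ) 1) (x : M) :
    S.PosAt (fun z => p.1 z + σ * (q.1 z - p.1 z)) x :=
  PosAt.add_smul p.isBasic (p.isBasic_sub q) (p.posAt x) (by simpa using q.posAt x) hσ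

/-- The normalized segment between two potentials. -/
def Curve.segment : S.Curve p q where
  toFun σ x := p.1 x + σ * (q.1 x - p.1 x) +
    -S.segmentI p.1 (fun z => q.1 z - p.1 z) σ / S.baseVol.real Set.univ
  smooth := ((locSmooth_line p.isBasic (p.isBasic_sub q)).add (LocSmooth.of_param
    ((contDiff_segmentI p.isBasic (p.isBasic_sub q) p.posAt).neg.div_const _))).to_contMDiff_prod
  mem σ hσ := by
    have hb := p.isBasic.add_smul (p.isBasic_sub q) σ
    refine ⟨isPotential_of_posAt (hb.add_const _)
      fun x => (Potential.posAt_segment hσ x).add_const hb _, ?_⟩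
    rw [functionalI_add_const hb (Potential.posAt_segment hσ),
      functionalI_eq hb (Potential.posAt_segment hσ),
      div_mul_cancel₀ _ (baseVol_real_pos (S := S)).ne']
    exact add_neg_cancel _
  start := by
    have h := functionalI_eq p.isBasic p.posAt
    rw [p.2.2] at h
    funext x
    simp [segmentI, ← h]
  finish := by
    have h := functionalI_eq q.isBasic q.posAt
    rw [q.2.2] at h
    funext x
    simp [segmentI, ← h]

lemma ebinDist_ne_top : ebinDist p q ≠ ⊤ :=
  ne_top_of_le_ne_top (Curve.segment p q).ebinLength_ne_top (iInf_le _ _)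

end Existence

end SasakianStructure
end Sasaki

end

section

/-! ### Separation: points at distance zero coincide. -/

namespace Sasaki

open MeasureTheory

variable {n : ℕ} {M : Type*} [TopologicalSpace M] [ChartedSpace (Model n) M]
  [IsManifold (𝓡 (2 * n + 1)) ∞ M]

/-- A weighted Cauchy-Schwarz inequality. -/
lemma sq_integral_mul_le {X : Type*} [MeasurableSpace X] {μ : Measure X} {f h w : X → ℝ}
    (hw : ∀ x, 0 < w x) (h1 : Integrable (fun x => f x ^ 2 / w x) μ)
    (h2 : Integrable (fun x => f x * h x) μ) (h3 : Integrable (fun x => w x * h x ^ 2) μ) :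
    (∫ x, f x * h x ∂μ) ^ 2 ≤ (∫ x, f x ^ 2 / w x ∂μ) * ∫ x, w x * h x ^ 2 ∂μ := by
  have h : ∀ s : ℝ, 0 ≤ (∫ x, f x ^ 2 / w x ∂μ) * (s * s) + (2 * ∫ x, f x * h x ∂μ) * s +
      ∫ x, w x * h x ^ 2 ∂μ := fun s => by
    have h4 : ∫ x, (f x ^ 2 / w x * (s * s) + f x * h x * (2 * s) + w x * h x ^ 2) ∂μ =
        (∫ x, f x ^ 2 / w x ∂μ) * (s * s) + (∫ x, f x * h x ∂μ) * (2 * s) +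
          ∫ x, w x * h x ^ 2 ∂μ := by
      rw [integral_add (f := fun x => f x ^ 2 / w x * (s * s) + f x * h x * (2 * s))
        ((h1.mul_const _).add (h2.mul_const _)) h3, integral_add (h1.mul_const _) (h2.mul_const _),
        integral_mul_const, integral_mul_const]
    have h5 : 0 ≤ ∫ x, (f x ^ 2 / w x * (s * s) + f x * h x * (2 * s) + w x * h x ^ 2) ∂μ := by
      refine integral_nonneg fun x => ?_
      have : f x ^ 2 / w x * (s * s) + f x * h x * (2 * s) + w x * h x ^ 2 =
          (s * f x + w x * h x) ^ 2 / w x := by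
        have := (hw x).ne'
        field_simp
        ring
      change 0 ≤ f x ^ 2 / w x * (s * s) + f x * h x * (2 * s) + w x * h x ^ 2
      rw [this]
      exact div_nonneg (sq_nonneg _) (hw x).le
    rw [h4] at h5
    linarith
  have := discrim_le_zero h
  rw [discrim] at this
  linarith

lemma LocSmooth.contDiff_integral_one [CompactSpace M] [MeasurableSpace M] [BorelSpace M]
    {μ : Measure M} [IsFiniteMeasure μ] {R : ℝ → M → ℝ} (hR : LocSmooth n R) :
    ContDiff ℝ 1 fun s => ∫ x, R s x ∂μ := by
  rw [contDiff_one_iff_deriv]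
  refine ⟨fun t => (hR.hasDerivAt_integral t).differentiableAt, ?_⟩
  have : _root_.deriv (fun s => ∫ x, R s x ∂μ) = fun t => ∫ x, _root_.deriv (fun s => R s x) t ∂μ :=
    funext fun t => (hR.hasDerivAt_integral t).deriv
  rw [this]
  exact hR.deriv.continuous_integral

/-- On a connected manifold, a function with vanishing differential is constant. -/
lemma exists_eq_const_of_diffE_eq_zero [ConnectedSpace M] {f : M → ℝ}
    (hf : ContMDiff (𝓡 (2 * n + 1)) 𝓘(ℝ, ℝ) ∞ f) (h : ∀ x, diffE n f x = 0) :
    ∃ c, ∀ x, f x = c := by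
  have hl : IsLocallyConstant f := by
    rw [IsLocallyConstant.iff_eventually_eq]
    intro x
    have hT := isOpen_target (n := n) x
    obtain ⟨ε, hε, hb⟩ := Metric.isOpen_iff.1 hT _ (mem_extChartAt_target (I := 𝓡 (2 * n + 1)) x)
    have h1 : ∀ y ∈ Metric.ball (extChartAt (𝓡 (2 * n + 1)) x x) ε,
        fderiv ℝ (rep0 n f x) y = 0 := fun y hy => by
      rw [← rep1_diff hf (hb hy)]
      refine ContinuousLinearMap.ext fun v => ?_
      exact congrArg (fun u : Model n →L[ℝ] ℝ => u (chartInv x y v))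
        (h ((extChartAt (𝓡 (2 * n + 1)) x).symm y))
    have h2 : ∀ {y}, y ∈ Metric.ball (extChartAt (𝓡 (2 * n + 1)) x x) ε →
        rep0 n f x y = rep0 n f x (extChartAt (𝓡 (2 * n + 1)) x x) := fun hy =>
      Metric.isOpen_ball.is_const_of_fderiv_eq_zero (𝕜 := ℝ) (convex_ball _ _).isPreconnected
        (((contDiffOn_rep0 hf x).mono hb).differentiableOn (by simp)) h1 hy
        (Metric.mem_ball_self hε)
    filter_upwards [(continuousAt_extChartAt (I := 𝓡 (2 * n + 1)) x).preimage_mem_nhds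
      (Metric.ball_mem_nhds _ hε), extChartAt_source_mem_nhds (I := 𝓡 (2 * n + 1)) x] with z hz hz'
    have h3 := h2 hz
    rw [rep0, rep0, (extChartAt (𝓡 (2 * n + 1)) x).left_inv hz', extChartAt_to_inv] at h3
    exact h3
  obtain ⟨x0⟩ := (inferInstance : Nonempty M)
  exact ⟨f x0, fun x => hl.apply_eq_of_isPreconnected isPreconnected_univ trivial trivial⟩

namespace SasakianStructure

variable {S : SasakianStructure n M} [T2Space M] [CompactSpace M] [MeasurableSpace M] [BorelSpace M]
  [ConnectedSpace M] {p q : S.Potential}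

lemma abs_le_mul_sqrt {a A B C V : ℝ} (h : a ^ 2 ≤ A * B) (hB : B ≤ C ^ 2 * V) (hA : 0 ≤ A)
    (hC : 0 ≤ C) (hV : 0 ≤ V) : |a| ≤ C * √V * √A := by
  refine abs_le_of_sq_le_sq (h.trans ((mul_le_mul_of_nonneg_left hB hA).trans (le_of_eq ?_)))
    (by positivity)
  rw [mul_pow, mul_pow, Real.sq_sqrt hA, Real.sq_sqrt hV]
  ring

/-- Cauchy-Schwarz with weight `rho φ`, whose total mass does not depend on `φ`: the constant is
therefore uniform along curves. -/
lemma abs_integral_linForm_mul_le {φ ψ h : M → ℝ} (hφ : S.IsBasic φ) (hψ : S.IsBasic ψ)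
    (hpos : ∀ x, S.PosAt φ x) (hh : Continuous h) {C : ℝ} (hC : ∀ x, |h x| ≤ C) :
    |∫ x, S.linForm φ (S.dc ψ) x * h x ∂S.baseVol| ≤
      C * √(S.baseVol.real Set.univ) * √(S.calabiMetric φ ψ ψ) := by
  have hp := fun x => (hpos x).rho_pos hφ
  have hc := continuous_linForm_dc hφ hψ
  have hr := S.continuous_rho hφ.1
  obtain ⟨x0⟩ := (inferInstance : Nonempty M)
  have h1 : Integrable (fun x => S.rho φ x * h x ^ 2) S.baseVol :=
    integrable_of_continuous (hr.mul (hh.pow 2))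
  have hcs := sq_integral_mul_le (μ := S.baseVol) hp (integrable_of_continuous
    ((hc.pow 2).div hr fun x => (hp x).ne')) (integrable_of_continuous (hc.mul hh)) h1
  rw [← calabi_eq_linForm hφ hψ hpos] at hcs
  refine abs_le_mul_sqrt hcs ?_ (calabi_nonneg hφ hpos) ((abs_nonneg _).trans (hC x0))
    measureReal_nonneg
  rw [← integral_rho hφ, ← integral_const_mul]
  refine integral_mono h1 ((integrable_of_continuous hr).const_mul _) fun x => ?_
  change _ ≤ C ^ 2 * S.rho φ x
  rw [mul_comm (C ^ 2)]
  exact mul_le_mul_of_nonneg_left (sq_le_sq' (abs_le.1 (hC x)).1 (abs_le.1 (hC x)).2) (hp x).le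

/-- The volume densities vary by at most the Calabi length. -/
lemma Curve.enorm_integral_rho_sub_le (γ : S.Curve p q) {h : M → ℝ}
    (hh : ContMDiff (𝓡 (2 * n + 1)) 𝓘(ℝ, ℝ) ∞ h) {C : ℝ} (hC : ∀ x, |h x| ≤ C) :
    ‖∫ x, S.rho q.1 x * h x ∂S.baseVol - ∫ x, S.rho p.1 x * h x ∂S.baseVol‖ₑ ≤
      ENNReal.ofReal (C * √(S.baseVol.real Set.univ)) * γ.calabiLength := by
  have hR := (γ.locSmooth.rho S).mul (LocSmooth.of_contMDiff hh)
  have h0 := enorm_sub_le_lintegral_deriv_of_contDiffOn_Icc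
    (hR.contDiff_integral_one (μ := S.baseVol)).contDiffOn (zero_le_one' ℝ)
  simp only [γ.start, γ.finish] at h0
  refine h0.trans ?_
  rw [calabiLength, ← lintegral_const_mul' _ _ ENNReal.ofReal_ne_top, setLIntegral_Icc_eq_Ioo,
    setLIntegral_Icc_eq_Ioo]
  refine setLIntegral_mono_ae' measurableSet_Ioo (ae_of_all _ fun t ht => ?_)
  have hI := Set.Ioo_subset_Icc_self ht
  obtain ⟨x0⟩ := (inferInstance : Nonempty M)
  have hd : deriv (fun s => ∫ x, S.rho (γ.toFun s) x * h x ∂S.baseVol) t =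
      ∫ x, S.linForm (γ.toFun t) (S.dc (γ.velocity t)) x * h x ∂S.baseVol := by
    rw [(hR.hasDerivAt_integral t).deriv]
    refine integral_congr_ae (ae_of_all _ fun x => ?_)
    exact ((S.hasDerivAt_rho γ.locSmooth (γ.isBasic hI) x).mul_const (h x)).deriv
  rw [hd, ← ENNReal.ofReal_mul (mul_nonneg ((abs_nonneg _).trans (hC x0)) (Real.sqrt_nonneg _)),
    Real.enorm_eq_ofReal_abs]
  exact ENNReal.ofReal_le_ofReal (abs_integral_linForm_mul_le (γ.isBasic hI) (γ.isBasic_velocity ht)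
    (γ.posAt hI) hh.continuous hC)

lemma rho_eq_of_calabiDist_eq_zero (h : calabiDist p q = 0) : S.rho p.1 = S.rho q.1 := by
  have hp := S.contMDiff_rho p.isBasic.1
  have hq := S.contMDiff_rho q.isBasic.1
  -- The difference of the densities serves as its own test function.
  have hd : ContMDiff (𝓡 (2 * n + 1)) 𝓘(ℝ, ℝ) ∞ fun x => S.rho q.1 x - S.rho p.1 x := hq.sub hp
  obtain ⟨C, -, hC⟩ := (LocSmooth.of_contMDiff hd).exists_bound 0 1
  have h1 : ‖∫ x, S.rho q.1 x * (S.rho q.1 x - S.rho p.1 x) ∂S.baseVol -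
      ∫ x, S.rho p.1 x * (S.rho q.1 x - S.rho p.1 x) ∂S.baseVol‖ₑ ≤
        ENNReal.ofReal (C * √(S.baseVol.real Set.univ)) * calabiDist p q := by
    have : Nonempty (S.Curve p q) := ⟨Curve.segment p q⟩
    rw [calabiDist, ENNReal.mul_iInf (by simp)]
    exact le_iInf fun γ => γ.enorm_integral_rho_sub_le hd (hC 0 (by simp))
  have i1 : Integrable (fun x => S.rho q.1 x * (S.rho q.1 x - S.rho p.1 x)) S.baseVol :=
    integrable_of_continuous (hq.continuous.mul hd.continuous)
  have i2 : Integrable (fun x => S.rho p.1 x * (S.rho q.1 x - S.rho p.1 x)) S.baseVol :=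
    integrable_of_continuous (hp.continuous.mul hd.continuous)
  rw [h, mul_zero, nonpos_iff_eq_zero, enorm_eq_zero, ← integral_sub i1 i2] at h1
  have h2 : ∫ x, (S.rho q.1 x - S.rho p.1 x) ^ 2 ∂S.baseVol = 0 := by
    refine Eq.trans (integral_congr_ae (ae_of_all _ fun x => ?_)) h1
    ring
  have hc : Continuous fun x => (S.rho q.1 x - S.rho p.1 x) ^ 2 := hd.continuous.pow 2
  rw [integral_eq_zero_iff_of_nonneg (fun x => sq_nonneg _) (integrable_of_continuous hc)] at h2
  have h3 := (hc.ae_eq_iff_eq S.baseVol continuous_const).1 h2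
  funext x
  have h4 : (S.rho q.1 x - S.rho p.1 x) ^ 2 = 0 := congrFun h3 x
  exact (sub_eq_zero.1 (pow_eq_zero_iff two_ne_zero |>.1 h4)).symm

/-- A potential is determined by its volume density up to a constant. -/
lemma diffE_sub_eq_zero_of_rho_eq (h : S.rho p.1 = S.rho q.1) (x : M) :
    diffE n (fun z => q.1 z - p.1 z) x = 0 := by
  have hu := p.isBasic_sub q
  set u := fun z => q.1 z - p.1 z with hu0
  have hl := (locSmooth_line p.isBasic hu).rho S
  have hd : ∀ s, HasDerivAt (fun s => ∫ x, S.rho (fun z => p.1 z + s * u z) x * u x ∂S.baseVol)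
      (∫ x, u x * S.linForm (fun z => p.1 z + s * u z) (S.dc u) x ∂S.baseVol) s := fun s => by
    refine ((hl.mul (LocSmooth.of_contMDiff hu.1)).hasDerivAt_integral s).congr_deriv ?_
    refine integral_congr_ae (ae_of_all _ fun x => ?_)
    change deriv (fun s => S.rho (fun z => p.1 z + s * u z) x * u x) s = _
    rw [((hasDerivAt_rho_line p.isBasic hu s x).mul_const (u x)).deriv, mul_comm]
  have h01 : ∫ x, S.rho (fun z => p.1 z + 0 * u z) x * u x ∂S.baseVol =
      ∫ x, S.rho (fun z => p.1 z + 1 * u z) x * u x ∂S.baseVol := by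
    simp only [hu0, zero_mul, add_zero, one_mul, add_sub_cancel]
    simp only [h]
  -- Rolle's theorem: the integral of `u` against the density agrees at both ends of the segment, so
  -- its derivative vanishes at some interior `s`. By Green's formula that derivative is minus half
  -- the gradient metric of `u` at that `s`.
  obtain ⟨s, hs, hs0⟩ := exists_hasDerivAt_eq_zero one_pos
    (fun s _ => (hd s).continuousAt.continuousWithinAt) h01 fun s _ => hd s
  have hI := Set.Ioo_subset_Icc_self hs
  have hb := p.isBasic.add_smul hu s
  have hpos : ∀ x, S.PosAt (fun z => p.1 z + s * u z) x := Potential.posAt_segment hI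
  have hg := gradient_eq_linForm hb hu hpos
  have hc := continuous_gradSq hb hu hpos
  rw [hs0, mul_zero, gradient_eq hb hpos, integral_eq_zero_iff_of_nonneg
    (fun x => mul_nonneg ((hpos x).rho_pos hb).le ((hpos x).gradSq_nonneg hb hu))
    (integrable_of_continuous hc)] at hg
  have h3 := (hc.ae_eq_iff_eq S.baseVol continuous_const).1 hg
  refine (hpos x).diffE_eq_zero hb hu ?_
  exact (mul_eq_zero.1 (congrFun h3 x)).resolve_left ((hpos x).rho_pos hb).ne'

/-- Equal densities make `q - p` constant, and the normalization `I = 0` forces this constant to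
vanish. -/
lemma eq_of_calabiDist_eq_zero (h : calabiDist p q = 0) : p = q := by
  obtain ⟨c, hc⟩ := exists_eq_const_of_diffE_eq_zero (p.isBasic_sub q).1
    (diffE_sub_eq_zero_of_rho_eq (rho_eq_of_calabiDist_eq_zero h))
  have h1 : q.1 = fun z => p.1 z + c := funext fun z => by linarith [hc z]
  have h2 := functionalI_add_const p.isBasic p.posAt c
  rw [← h1, q.2.2, p.2.2, zero_add] at h2
  have h3 := (mul_eq_zero.1 h2.symm).resolve_right (baseVol_real_pos (S := S)).ne'
  exact Subtype.ext (by rw [h1, h3]; simp)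

/-- The Ebin distance makes the space of normalized potentials a metric space. -/
abbrev ebinMetricSpace (S : SasakianStructure n M) : MetricSpace S.Potential :=
  let m : EMetricSpace S.Potential :=
    { edist := ebinDist
      edist_self := ebinDist_self
      edist_comm := fun p q => le_antisymm (ebinDist_comm_le p q) (ebinDist_comm_le q p)
      edist_triangle := ebinDist_triangle
      eq_of_edist_eq_zero := fun {p q} h => eq_of_calabiDist_eq_zero
        (nonpos_iff_eq_zero.1 ((le_self_add.trans (calabiDist_add_le p q)).trans_eq h)) }
  EMetricSpace.toMetricSpace ebinDist_ne_top

end SasakianStructure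
end Sasaki

end

end

open scoped Manifold ContDiff in
open Sasaki SasakianStructure in
theorem mainTheorem12 {n : ℕ} {M : Type*} [TopologicalSpace M] [ChartedSpace (Model n) M]
    [IsManifold (𝓡 (2 * n + 1)) ∞ M] [T2Space M] [CompactSpace M] [ConnectedSpace M]
    [MeasurableSpace M] [BorelSpace M] (S : SasakianStructure n M) :
    (∃ m : MetricSpace S.Potential, ∀ p q : S.Potential, m.edist p q = ebinDist p q) ∧
    (∀ p q : S.Potential, calabiDist p q ≤ ebinDist p q) ∧
    (∀ p q : S.Potential,
      calabiDist p q ≤ calabiDist p q + gradientDist p q / 2 ∧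
      calabiDist p q + gradientDist p q / 2 ≤ ebinDist p q) :=
  ⟨⟨ebinMetricSpace S, fun _ _ => rfl⟩, fun p q => le_self_add.trans (calabiDist_add_le p q),
    fun p q => ⟨le_self_add, calabiDist_add_le p q⟩⟩
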